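/- Let $\varphi:(\mathbb C^2,0)\to(\mathbb C^2,0)$ be a germ of birational transformation, i.e. a germ of holomorphic map with $\varphi(0)=0$ that is injective off a proper analytic subset near $0$ (as is every holomorphic germ induced by a birational transformation fixing the point). Let $\mathrm{Crit}(\varphi)=\{\det D\varphi=0\}$ be its critical set, and assume $0\in \mathrm{Crit}(\varphi)$. Let $\mathcal F$ be a germ at $0$ of holomorphic foliation, defined by $\omega=a\,dx+b\,dy$ with $a,b$ holomorphic germs without common factor vanishing at $0$, and assume that $\mathcal F$ is $\varphi$-invariant, i.e. $\varphi^*\omega\wedge\omega=0$. Then: (i) the critical set of $\varphi$ is tangent to $\mathcal F$, i.e. $\omega$ vanishes identically along it; (ii) $\mathcal F$ is either smooth at $0$ (that is, $(a(0),b(0))\neq(0,0)$) or has a reduced non-degenerate singularity at $0$, i.e. $a(0)=b(0)=0$ and the linear part at $0$ of the vector field $b\,\partial_x-a\,\partial_y$ has two nonzero eigenvalues whose ratio is not a positive rational number. In the latter case $\mathcal F$ has exactly two separatrices at $0$ (irreducible germs of analytic curves through $0$ tangent to $\mathcal F$), and, as germs at $0$, their union coincides with $\mathrm{Crit}(\varphi\circ\varphi)$.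 In particular, if $\mathrm{Crit}(\varphi)=\mathrm{Crit}(\varphi\circ\varphi)$ as germs at $0$ (equivalently, if $\varphi$ and all its iterates have the same critical set, which can always be achieved by replacing $\varphi$ by $\varphi\circ\varphi$), then the union of the two separatrices of $\mathcal F$ is $\mathrm{Crit}(\varphi)$. -/

import Mathlib

open Filter Topology

noncomputable section

/-- Two subsets of `ℂ²` define the same germ of set at the origin. -/
def SameGerm (S T : Set (ℂ × ℂ)) : Prop :=
  ∀ᶠ p in 𝓝 (0 : ℂ × ℂ), (p ∈ S ↔ p ∈ T)

/-- A holomorphic germ `φ : (ℂ², 0) → (ℂ², 0)` is a germ of birational transformation if it is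
bimeromorphic onto its image: near `0` it is injective off a proper analytic subset `{h = 0}`.
(If `φ` is induced by a birational map with inverse `ψ`, then `ψ ∘ φ = id` off a curve, so this
holds; no algebraicity is required here, so that the notion also covers, in local holomorphic
coordinates, birational maps of arbitrary surfaces at a fixed point where they are defined.) -/
structure IsBirationalGerm (φ : ℂ × ℂ → ℂ × ℂ) : Prop where
  analyticAt : AnalyticAt ℂ φ 0
  map_zero : φ 0 = 0
  generically_injective : ∃ h : ℂ × ℂ → ℂ, AnalyticAt ℂ h 0 ∧ (¬ ∀ᶠ p in 𝓝 0, h p = 0) ∧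
    ∃ U ∈ 𝓝 (0 : ℂ × ℂ), Set.InjOn φ {p | p ∈ U ∧ h p ≠ 0}

/-- The critical set of `φ`: the points where the Jacobian determinant vanishes. -/
def criticalSet (φ : ℂ × ℂ → ℂ × ℂ) : Set (ℂ × ℂ) :=
  {p | (fderiv ℂ φ p).det = 0}

/-- A germ at `0 ∈ ℂ²` of (possibly singular) holomorphic foliation, given by a holomorphic
1-form `ω = a dx + b dy` whose coefficients have no common factor vanishing at the origin, that
is, the curves `a = 0` and `b = 0` have no common component through the origin. -/
structure FoliationGerm where
  a : ℂ × ℂ → ℂ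
  b : ℂ × ℂ → ℂ
  analyticAt_a : AnalyticAt ℂ a 0
  analyticAt_b : AnalyticAt ℂ b 0
  no_common_component : ∀ h a' b' : ℂ × ℂ → ℂ,
    AnalyticAt ℂ h 0 → AnalyticAt ℂ a' 0 → AnalyticAt ℂ b' 0 →
    (∀ᶠ p in 𝓝 0, a p = h p * a' p) → (∀ᶠ p in 𝓝 0, b p = h p * b' p) → h 0 ≠ 0

namespace FoliationGerm

/-- The value at the point `p` of the 1-form `ω = a dx + b dy` on the tangent vector `v`. -/
def form (F : FoliationGerm) (p v : ℂ × ℂ) : ℂ :=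
  F.a p * v.1 + F.b p * v.2

/-- `F` is `φ`-invariant: `φ^* F = F`, that is, `(φ^* ω) ∧ ω = 0` near the origin, where
`(φ^* ω)_p (v) = ω_{φ p} (Dφ_p v)`. -/
def IsInvariant (F : FoliationGerm) (φ : ℂ × ℂ → ℂ × ℂ) : Prop :=
  ∀ᶠ p in 𝓝 (0 : ℂ × ℂ), ∀ v w : ℂ × ℂ,
    F.form (φ p) (fderiv ℂ φ p v) * F.form p w - F.form (φ p) (fderiv ℂ φ p w) * F.form p v = 0

/-- The germ at `0` of the analytic set `S` is tangent to `F`: at all points of `S` close to the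
origin, `ω` vanishes identically along every holomorphic arc contained in `S`. -/
def IsTangent (F : FoliationGerm) (S : Set (ℂ × ℂ)) : Prop :=
  ∀ᶠ p in 𝓝 (0 : ℂ × ℂ), p ∈ S → ∀ γ : ℂ → ℂ × ℂ,
    AnalyticAt ℂ γ 0 → γ 0 = p → (∀ᶠ t in 𝓝 0, γ t ∈ S) →
      ∀ᶠ t in 𝓝 0, F.form (γ t) (deriv γ t) = 0

/-- `F` is smooth at the origin. -/
def IsSmooth (F : FoliationGerm) : Prop :=
  F.a 0 ≠ 0 ∨ F.b 0 ≠ 0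

/-- The linear part at the origin of the vector field `b ∂/∂x - a ∂/∂y`, which spans the kernel
of `ω = a dx + b dy`. -/
def linearPart (F : FoliationGerm) : ℂ × ℂ →L[ℂ] ℂ × ℂ :=
  fderiv ℂ (fun p => (F.b p, -F.a p)) 0

/-- `F` has a reduced non-degenerate singularity at the origin: `F` is singular there, and the
linear part has two nonzero eigenvalues (counted with multiplicity) whose ratio is not a positive
rational number. -/
def IsReducedNondegenerate (F : FoliationGerm) : Prop :=
  F.a 0 = 0 ∧ F.b 0 = 0 ∧ ∃ l₁ l₂ : ℂ,
    (F.linearPart : ℂ × ℂ →ₗ[ℂ] ℂ × ℂ).charpoly.roots = {l₁, l₂} ∧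
    l₁ ≠ 0 ∧ l₂ ≠ 0 ∧ ∀ q : ℚ, 0 < q → l₁ / l₂ ≠ (q : ℂ)

end FoliationGerm

/-- `S` represents an irreducible germ of analytic curve through the origin of `ℂ²`: the germ of
the image of a nonconstant holomorphic arc `γ : (ℂ, 0) → (ℂ², 0)`. -/
def IsIrreducibleCurveGerm (S : Set (ℂ × ℂ)) : Prop :=
  ∃ γ : ℂ → ℂ × ℂ, AnalyticAt ℂ γ 0 ∧ γ 0 = 0 ∧ (¬ ∀ᶠ t in 𝓝 0, γ t = 0) ∧
    ∀ᶠ r in 𝓝[>] (0 : ℝ), SameGerm (γ '' Metric.ball 0 r) S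

/-- A separatrix of `F` at the origin: an irreducible germ of analytic curve tangent to `F`. -/
def FoliationGerm.IsSeparatrix (F : FoliationGerm) (S : Set (ℂ × ℂ)) : Prop :=
  IsIrreducibleCurveGerm S ∧ F.IsTangent S

end

/-! A generically injective germ φ = (f, g) with a critical point at 0 factors through blow-up
charts. Write f = hf', g = hg' with f', g' coprime, and suppose that both are nonunits. For generic
c the curve g' = cf' is mapped injectively into the line of slope c, and inverting φ along it gives
an arc γ with φ(γ(s)) = (s, cs). Two slopes make Dφ(0) invertible, which is excluded. So one
component divides the other (`GermMap.GenInj.dvd_or_dvd`), φ factors through (x, x(y + c)), and the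
Jacobian loses a factor. Induction (`GermMap.GenInj.exists_isMonomial`) gives source coordinates in
which f, g and the Jacobian are monomials times units, with exponent matrix of determinant 0 or ±1,
and in which both f and g vanish on every critical curve.

Normal crossings. Suppose that both axes are critical, for φ or for φ∘φ. If the exponent matrix has
determinant ±1, its two eigenvalues are distinct and irrational, and each is the multiplier of an
eigenform α dx/x + β dy/y + dH of the pullback, H solving a functional equation that converges
because φ is superattracting. Expand ω = A₁η₁ + A₂η₂ up to the factor xy. Invariance relates A₁ and
A₂, and comparing leading monomials for an irrational weight that φ multiplies by an eigenvalue
forces A₁ or A₂ to vanish (`GermMap.isReducedLog_of_unimodular`). If the determinant is 0, φ factors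
through a power map, and exchanging the two factors reduces to the case of degree at least two
below; the foliation then has a first integral x^P y^Q times a unit
(`GermMap.GenInj.isReducedLog_of_degenerate`).

One critical curve x = 0, with f = x^a y^b times a unit. If b ≥ 1, then y = 0 is sent into x = 0, so
φ∘φ has normal crossings. If b = 0 and a ≥ 2, a Böttcher coordinate and an affine fibre coordinate
bring φ to (x^a, l x^s y + P(x)). Counting points on vertical lines excludes other invariant curves,
and then a one-variable equation for the foliation contradicts injectivity unless the foliation is
dx = 0 (`GermMap.GenInj.exists_wedge_d_eq_zero`). If b = 0 and a = 1, a foliation that is not smooth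
and tangent to x = 0 is given by A dx/x + B dy with A(0) = 0. Coordinates are chosen so that y = 0
is invariant to high order. There the foliation induces a connection on the normal bundle, and φ
acts on that bundle by a function of order N, the order of the Jacobian along x = 0. The residue of
the connection must be unchanged by the local diffeomorphism induced on the axis and also shift by N
≥ 1, a contradiction (`GermMap.IsLogInvariant.not`).

In the normal crossing cases ω becomes yα dx + xβ dy with units α, β and mα(0) + nβ(0) ≠ 0 for all
positive integers m, n. The eigenvalues are proportional to β(0) and -α(0), so the singularity is
reduced. A tangent arc lying on neither axis would satisfy such a relation, m and n being the orders
of its coordinates; hence the axes are the only separatrices.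

All this takes place in the ring of convergent germs, which is factorial by Weierstrass division. -/

noncomputable section

/-! ### Osgood's lemma for bounded separately holomorphic functions. -/

open Metric

/-- Holomorphic in each variable separately and bounded by `m` on the bidisc of radii `r`, `ρ`. -/
structure SepHolOn (r ρ m : ℝ) (f : ℂ × ℂ → ℂ) : Prop where
  diff_fst : ∀ y ∈ ball (0 : ℂ) ρ, DifferentiableOn ℂ (fun x => f (x, y)) (ball 0 r)
  diff_snd : ∀ x ∈ ball (0 : ℂ) r, DifferentiableOn ℂ (fun y => f (x, y)) (ball 0 ρ)
  bound : ∀ x ∈ ball (0 : ℂ) r, ∀ y ∈ ball (0 : ℂ) ρ, ‖f (x, y)‖ ≤ m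

/-- The constant depends only on the bound and the radius. A family bounded uniformly in a parameter
is therefore continuous for the sup norm. -/
theorem lipschitz_of_bounded_holomorphic {E : Type*} [NormedAddCommGroup E] [NormedSpace ℂ E]
    {g : ℂ → E} {ρ m : ℝ} (hρ : 0 < ρ) (hg : DifferentiableOn ℂ g (ball 0 ρ))
    (hm : ∀ z ∈ ball (0 : ℂ) ρ, ‖g z‖ ≤ m) {z w : ℂ} (hz : z ∈ ball (0 : ℂ) (ρ / 2))
    (hw : w ∈ ball (0 : ℂ) (ρ / 2)) : ‖g z - g w‖ ≤ 2 * m / (ρ / 2) * ‖z - w‖ := by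
  have hsub : ball w (ρ / 2) ⊆ ball 0 ρ := by
    apply ball_subset_ball'
    rw [mem_ball] at hw
    linarith
  have hbig : ball (0 : ℂ) (ρ / 2) ⊆ ball 0 ρ := ball_subset_ball (by linarith)
  have h2 : ∀ z ∈ ball (0 : ℂ) ρ, ‖g z - g w‖ ≤ 2 * m := fun z hz => by
    have := norm_sub_le (g z) (g w)
    have := hm z hz
    have := hm w (hbig hw)
    linarith
  -- Schwarz's lemma applies on the disc of radius ρ / 2 about w; for points farther apart the
  -- trivial bound 2m suffices.
  by_cases h : z ∈ ball w (ρ / 2)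
  · have := Complex.dist_le_div_mul_dist_of_mapsTo_ball (hg.mono hsub)
      (R₂ := 2 * m) (fun u hu => by
        rw [mem_closedBall, dist_eq_norm]; exact h2 u (hsub hu)) h
    simpa [dist_eq_norm] using this
  · have h1 := h2 z (hbig hz)
    rw [mem_ball, dist_eq_norm, not_lt] at h
    have hm0 : 0 ≤ 2 * m := (norm_nonneg _).trans h1
    calc ‖g z - g w‖ ≤ 2 * m := h1
      _ = 2 * m / (ρ / 2) * (ρ / 2) := by field_simp
      _ ≤ _ := by gcongr

/-- A bounded family of holomorphic functions gives a holomorphic map to continuous functions. -/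
theorem analyticAt_toContinuousMap {K : Type*} [TopologicalSpace K] [CompactSpace K]
    {ρ m : ℝ} (hρ : 0 < ρ) (F : ℂ → C(K, ℂ))
    (hd : ∀ k, DifferentiableOn ℂ (fun z => F z k) (ball 0 ρ))
    (hm : ∀ z ∈ ball (0 : ℂ) ρ, ∀ k, ‖F z k‖ ≤ m) : AnalyticAt ℂ F 0 := by
  by_cases hK : IsEmpty K
  · have : F = fun _ => 0 := by
      funext z; ext k; exact (hK.false k).elim
    rw [this]; exact analyticAt_const
  rw [not_isEmpty_iff] at hK
  have hcont : ContinuousOn F (ball 0 (ρ / 2)) := by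
    have : LipschitzOnWith (2 * m / (ρ / 2)).toNNReal F (ball 0 (ρ / 2)) := by
      apply LipschitzOnWith.of_dist_le_mul
      intro z hz w hw
      have hm0 : 0 ≤ m := by
        obtain ⟨k⟩ := hK
        exact (norm_nonneg _).trans (hm 0 (by simpa using hρ) k)
      have h0 : 0 ≤ 2 * m / (ρ / 2) := by positivity
      rw [Real.coe_toNNReal _ h0, ContinuousMap.dist_le (by positivity)]
      intro k
      rw [dist_eq_norm, dist_eq_norm]
      exact lipschitz_of_bounded_holomorphic hρ (hd k) (fun z hz => hm z hz k) hz hw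
    exact this.continuousOn
  obtain ⟨R, hR⟩ : ∃ R : NNReal, (R : ℝ) = ρ / 4 := ⟨⟨ρ / 4, by positivity⟩, rfl⟩
  have hR0 : 0 < R := by rw [← NNReal.coe_pos, hR]; positivity
  have hsph : closedBall (0 : ℂ) R ⊆ ball 0 (ρ / 2) := closedBall_subset_ball (by linarith)
  have hci : CircleIntegrable F 0 R :=
    (hcont.mono (sphere_subset_closedBall.trans hsph)).circleIntegrable R.2
  -- The Cauchy integral of the continuous `C(K, ℂ)`-valued map is analytic. Evaluation at k
  -- commutes with the integral, so the scalar Cauchy formula identifies it with F.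
  have hps := hasFPowerSeriesOn_cauchy_integral hci hR0
  have han := hps.analyticAt
  refine han.congr ?_
  filter_upwards [ball_mem_nhds (0 : ℂ) (show (0 : ℝ) < R by exact_mod_cast hR0)] with w hw
  ext k
  let ev : C(K, ℂ) →L[ℂ] ℂ := ContinuousMap.evalCLM ℂ k
  have hev : ∀ G : C(K, ℂ), G k = ev G := fun G => rfl
  rw [hev, map_smul]
  have hw0 : ∀ θ : ℝ, circleMap 0 R θ - w ≠ 0 := fun θ h => by
    rw [sub_eq_zero] at h
    rw [← h] at hw
    simp at hw
  have hcomm : ev (∮ z in C(0, (R : ℝ)), (z - w)⁻¹ • F z) =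
      ∮ z in C(0, (R : ℝ)), (z - w)⁻¹ • (F z k) := by
    rw [circleIntegral, ← ContinuousLinearMap.intervalIntegral_comp_comm]
    · simp only [circleIntegral, map_smul, hev]
    · apply Continuous.intervalIntegrable
      have hc : Continuous fun θ : ℝ => F (circleMap 0 R θ) :=
        hcont.comp_continuous (continuous_circleMap 0 R) fun θ =>
          hsph (sphere_subset_closedBall (circleMap_mem_sphere 0 R.2 θ))
      have hc2 : Continuous fun θ : ℝ => deriv (circleMap 0 R) θ := by
        simp only [deriv_circleMap]
        fun_prop
      exact hc2.smul (((continuous_circleMap 0 R).sub continuous_const).inv₀ hw0 |>.smul hc)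
  rw [hcomm]
  have hdc : DiffContOnCl ℂ (fun z => F z k) (ball 0 (R : ℝ)) := by
    apply DifferentiableOn.diffContOnCl
    rw [closure_ball 0 (by exact_mod_cast hR0.ne')]
    exact (hd k).mono (hsph.trans (ball_subset_ball (by linarith)))
  exact hdc.two_pi_i_inv_smul_circleIntegral_sub_inv_smul hw

/-- Osgood's lemma for bounded functions. -/
theorem SepHolOn.analyticAt {r ρ m : ℝ} {f : ℂ × ℂ → ℂ} (hr : 0 < r) (hρ : 0 < ρ)
    (hf : SepHolOn r ρ m f) : AnalyticAt ℂ f 0 := by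
  have hs : sphere (0 : ℂ) (ρ / 2) ⊆ ball 0 ρ := sphere_subset_ball (by linarith)
  -- Cauchy's formula in y over this circle reads f(x, y) as a continuous functional of the product
  -- of f(x, ·) and the kernel 1 / (w - y). Both factors are analytic maps into the Banach algebra
  -- `C(K, ℂ)`, one of x alone and the other of y alone.
  let K := sphere (0 : ℂ) (ρ / 2)
  have : CompactSpace K := isCompact_iff_compactSpace.1 (isCompact_sphere 0 (ρ / 2))
  classical
  let F : ℂ → C(K, ℂ) := fun x =>
    if hx : x ∈ ball (0 : ℂ) r then
      ⟨fun w => f (x, w), (hf.diff_snd x hx).continuousOn.comp_continuous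
        continuous_subtype_val fun w => hs w.2⟩
    else 0
  have hFval : ∀ x ∈ ball (0 : ℂ) r, ∀ w : K, F x w = f (x, w) := fun x hx w => by
    simp only [F, hx, dif_pos, ContinuousMap.coe_mk]
  have hF : AnalyticAt ℂ F 0 := by
    refine analyticAt_toContinuousMap (m := m) hr F (fun k => ?_) (fun z hz k => ?_)
    · exact (hf.diff_fst k (hs k.2)).congr fun x hx => hFval x hx k
    · rw [hFval z hz]; exact hf.bound z hz k (hs k.2)
  let id' : C(K, ℂ) := ⟨fun w => (w : ℂ), continuous_subtype_val⟩
  have hid : ∀ y : ℂ, ‖y‖ < ρ / 2 → IsUnit (id' - algebraMap ℂ C(K, ℂ) y) := fun y hy => by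
    rw [ContinuousMap.isUnit_iff_forall_ne_zero]
    intro w h
    have : (w : ℂ) = y := by simpa [id', sub_eq_zero] using h
    have h2 : ‖(w : ℂ)‖ = ρ / 2 := by simpa using w.2
    rw [this] at h2
    linarith
  let c : ℂ → C(K, ℂ) := fun y => Ring.inverse (id' - algebraMap ℂ C(K, ℂ) y)
  have hc : AnalyticAt ℂ c 0 := by
    obtain ⟨u, hu⟩ := hid 0 (by rw [norm_zero]; positivity)
    have h1 : AnalyticAt ℂ (fun y : ℂ => id' - algebraMap ℂ C(K, ℂ) y) 0 := by
      refine analyticAt_const.sub ?_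
      exact (Algebra.linearMap ℂ C(K, ℂ)).toContinuousLinearMap.analyticAt 0
    have h2 := analyticAt_inverse (𝕜 := ℂ) u
    rw [hu] at h2
    exact AnalyticAt.comp (f := fun y : ℂ => id' - algebraMap ℂ C(K, ℂ) y) h2 h1
  have hcval : ∀ y : ℂ, ‖y‖ < ρ / 2 → ∀ w : K, c y w = ((w : ℂ) - y)⁻¹ := fun y hy w => by
    have := Ring.mul_inverse_cancel _ (hid y hy)
    have := congrArg (fun g : C(K, ℂ) => g w) this
    simp only [ContinuousMap.mul_apply, ContinuousMap.one_apply] at this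
    exact eq_inv_of_mul_eq_one_right (by simpa [id', c] using this)
  -- integration over the circle as a continuous functional
  let par : ℝ → K := fun θ => ⟨circleMap 0 (ρ / 2) θ, circleMap_mem_sphere 0 (by positivity) θ⟩
  have hpar : Continuous par := (continuous_circleMap 0 (ρ / 2)).subtype_mk _
  have hint : ∀ G : C(K, ℂ), IntervalIntegrable
      (fun θ => deriv (circleMap 0 (ρ / 2)) θ * G (par θ)) MeasureTheory.volume 0 (2 * Real.pi) :=
    fun G => by
      apply Continuous.intervalIntegrable
      have hc2 : Continuous fun θ : ℝ => deriv (circleMap 0 (ρ / 2)) θ := by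
        simp only [deriv_circleMap]; fun_prop
      exact hc2.mul (G.continuous.comp hpar)
  let Il : C(K, ℂ) →ₗ[ℂ] ℂ :=
    { toFun := fun G => ∫ θ in (0 : ℝ)..(2 * Real.pi), deriv (circleMap 0 (ρ / 2)) θ * G (par θ)
      map_add' := fun G H => by
        rw [← intervalIntegral.integral_add (hint G) (hint H)]
        simp only [ContinuousMap.add_apply, mul_add]
      map_smul' := fun a G => by
        simp only [ContinuousMap.smul_apply, smul_eq_mul, RingHom.id_apply]
        rw [← intervalIntegral.integral_const_mul]
        congr 1; funext θ; ring }
  let I : C(K, ℂ) →L[ℂ] ℂ := Il.mkContinuous (ρ / 2 * |2 * Real.pi - 0|) fun G => by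
    have : ∀ θ ∈ Set.uIoc (0 : ℝ) (2 * Real.pi),
        ‖deriv (circleMap 0 (ρ / 2)) θ * G (par θ)‖ ≤ ρ / 2 * ‖G‖ := fun θ _ => by
      rw [norm_mul]
      have h1 : ‖deriv (circleMap 0 (ρ / 2)) θ‖ = ρ / 2 := by
        simp [deriv_circleMap, circleMap, abs_of_pos hρ]
      rw [h1]
      gcongr
      exact G.norm_coe_le_norm _
    have := intervalIntegral.norm_integral_le_of_norm_le_const this
    calc _ ≤ _ := this
      _ = _ := by ring
  have hmain : AnalyticAt ℂ (fun p : ℂ × ℂ => (2 * Real.pi * Complex.I : ℂ)⁻¹ •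
      I (c p.2 * F p.1)) 0 := by
    have h1 : AnalyticAt ℂ (fun p : ℂ × ℂ => c p.2) 0 :=
      AnalyticAt.comp (f := fun p : ℂ × ℂ => p.2) (g := c) hc analyticAt_snd
    have h2 : AnalyticAt ℂ (fun p : ℂ × ℂ => F p.1) 0 :=
      AnalyticAt.comp (f := fun p : ℂ × ℂ => p.1) (g := F) hF analyticAt_fst
    have h3 : AnalyticAt ℂ (fun p : ℂ × ℂ => I (c p.2 * F p.1)) 0 :=
      AnalyticAt.comp (g := I) (I.analyticAt _) (h1.mul h2)
    exact (analyticAt_const (v := (2 * Real.pi * Complex.I : ℂ)⁻¹)).smul h3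
  refine hmain.congr ?_
  have hn : (ball (0 : ℂ) r) ×ˢ (ball (0 : ℂ) (ρ / 2)) ∈ 𝓝 (0 : ℂ × ℂ) :=
    prod_mem_nhds (ball_mem_nhds _ hr) (ball_mem_nhds _ (by positivity))
  filter_upwards [hn] with p hp
  obtain ⟨x, y⟩ := p
  have hy : ‖y‖ < ρ / 2 := by simpa using hp.2
  have hdc : DiffContOnCl ℂ (fun y => f (x, y)) (ball 0 (ρ / 2)) := by
    apply DifferentiableOn.diffContOnCl
    rw [closure_ball 0 (by positivity)]
    exact (hf.diff_snd x hp.1).mono (closedBall_subset_ball (by linarith))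
  rw [← hdc.two_pi_i_inv_smul_circleIntegral_sub_inv_smul hp.2]
  congr 1
  change Il _ = _
  simp only [Il, LinearMap.coe_mk, AddHom.coe_mk, circleIntegral, smul_eq_mul]
  congr 1
  funext θ
  rw [ContinuousMap.mul_apply, hcval y hy, hFval x hp.1]

theorem AnalyticAt.exists_sepHolOn {f : ℂ × ℂ → ℂ} (hf : AnalyticAt ℂ f 0) {U : Set (ℂ × ℂ)}
    (hU : U ∈ 𝓝 (0 : ℂ × ℂ)) :
    ∃ r > 0, ball (0 : ℂ) r ×ˢ ball (0 : ℂ) r ⊆ U ∧ ∃ m, SepHolOn r r m f := by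
  have h1 : ∀ᶠ p in 𝓝 (0 : ℂ × ℂ), AnalyticAt ℂ f p := hf.eventually_analyticAt
  have h2 : ∀ᶠ p in 𝓝 (0 : ℂ × ℂ), ‖f p‖ < ‖f 0‖ + 1 :=
    hf.continuousAt.norm.eventually_lt continuousAt_const (by linarith)
  obtain ⟨r, hr, hsub⟩ := Metric.mem_nhds_iff.1 (inter_mem (inter_mem h1 h2) hU)
  rw [show (0 : ℂ × ℂ) = (0, 0) from rfl, ← ball_prod_same] at hsub
  refine ⟨r, hr, fun p hp => (hsub hp).2, ‖f 0‖ + 1, ?_, ?_, ?_⟩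
  · intro y hy x hx
    have : AnalyticAt ℂ f (x, y) := (hsub ⟨hx, hy⟩).1.1
    exact (this.differentiableAt.comp x (by fun_prop)).differentiableWithinAt
  · intro x hx y hy
    have : AnalyticAt ℂ f (x, y) := (hsub ⟨hx, hy⟩).1.1
    exact (this.differentiableAt.comp y (by fun_prop)).differentiableWithinAt
  · intro x hx y hy
    exact le_of_lt (hsub (show (x, y) ∈ _ from ⟨hx, hy⟩)).1.2

end

/-! ### Division by a coordinate, and the ring of analytic germs. -/

noncomputable section

open Metric

theorem SepHolOn.analyticAt_of_mem {r ρ m : ℝ} {f : ℂ × ℂ → ℂ} (hf : SepHolOn r ρ m f)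
    {p : ℂ × ℂ} (hx : p.1 ∈ ball (0 : ℂ) r) (hy : p.2 ∈ ball (0 : ℂ) ρ) : AnalyticAt ℂ f p := by
  obtain ⟨x, y⟩ := p
  have hx' : ‖x‖ < r := by simpa using hx
  have hy' : ‖y‖ < ρ := by simpa using hy
  have h1 : ∀ z ∈ ball (0 : ℂ) (r - ‖x‖), z + x ∈ ball (0 : ℂ) r := fun z hz => by
    have := norm_add_le z x
    rw [mem_ball_zero_iff] at *
    linarith
  have h2 : ∀ z ∈ ball (0 : ℂ) (ρ - ‖y‖), z + y ∈ ball (0 : ℂ) ρ := fun z hz => by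
    have := norm_add_le z y
    rw [mem_ball_zero_iff] at *
    linarith
  have h : SepHolOn (r - ‖x‖) (ρ - ‖y‖) m (fun q => f (q + (x, y))) := by
    refine ⟨fun w hw => ?_, fun w hw => ?_, fun w hw z hz => ?_⟩
    · exact (hf.diff_fst _ (h2 w hw)).comp (f := fun z => z + x) (by fun_prop) h1
    · exact (hf.diff_snd _ (h1 w hw)).comp (f := fun z => z + y) (by fun_prop) h2
    · exact hf.bound _ (h1 w hw) _ (h2 z hz)
  have h3 := h.analyticAt (by linarith) (by linarith)
  have h4 : AnalyticAt ℂ (fun q : ℂ × ℂ => q - (x, y)) (x, y) := by fun_prop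
  have h5 := AnalyticAt.fun_comp (g := fun q => f (q + (x, y))) (f := fun q : ℂ × ℂ => q - (x, y))
    (x := (x, y)) (by simpa using h3) h4
  simpa using h5

/-- The difference quotient in the second variable. -/
def shiftSnd (f : ℂ × ℂ → ℂ) (p : ℂ × ℂ) : ℂ := dslope (fun y => f (p.1, y)) 0 p.2

theorem eq_add_mul_shiftSnd (f : ℂ × ℂ → ℂ) (p : ℂ × ℂ) :
    f p = f (p.1, 0) + p.2 * shiftSnd f p := by
  have := sub_smul_dslope (fun y => f (p.1, y)) 0 p.2
  simp only [sub_zero, smul_eq_mul] at this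
  rw [shiftSnd, this]; ring

/-- The bound is Schwarz's lemma for f(x, ·) - f(x, 0). The bidisc does not shrink, so the operation
can be iterated infinitely often. At y = 0 the quotient is a partial derivative of f, whose
holomorphy in x uses joint analyticity. -/
theorem SepHolOn.shiftSnd {r ρ m : ℝ} {f : ℂ × ℂ → ℂ} (hρ : 0 < ρ) (hf : SepHolOn r ρ m f) :
    SepHolOn r ρ (2 * m / ρ) (shiftSnd f) := by
  have h0 : (0 : ℂ) ∈ ball (0 : ℂ) ρ := by simpa using hρ
  refine ⟨fun y hy => ?_, fun x hx => ?_, fun x hx y hy => ?_⟩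
  · by_cases hy0 : y = 0
    · subst hy0
      have : DifferentiableOn ℂ (fun x => fderiv ℂ f (x, 0) (0, 1)) (ball 0 r) := fun x hx => by
        have h := (hf.analyticAt_of_mem (p := (x, 0)) hx h0).fderiv
        have h2 : DifferentiableAt ℂ (fun x => fderiv ℂ f (x, 0)) x :=
          h.differentiableAt.comp x (f := fun x => ((x, 0) : ℂ × ℂ)) (by fun_prop)
        exact (h2.clm_apply (differentiableAt_const _)).differentiableWithinAt
      refine this.congr fun x hx => ?_
      simp only [_root_.shiftSnd, dslope_same]
      have h1 := (hf.analyticAt_of_mem (p := (x, 0)) hx h0).differentiableAt.hasFDerivAt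
      have h2 : HasDerivAt (fun y : ℂ => (x, y)) ((0, 1) : ℂ × ℂ) 0 :=
        (hasDerivAt_const _ _).prodMk (hasDerivAt_id _)
      exact (h1.comp_hasDerivAt (0 : ℂ) h2).deriv
    · have : DifferentiableOn ℂ (fun x => y⁻¹ * (f (x, y) - f (x, 0))) (ball 0 r) :=
        ((hf.diff_fst y hy).sub (hf.diff_fst 0 h0)).const_mul _
      refine this.congr fun x hx => ?_
      simp [_root_.shiftSnd, dslope_of_ne _ hy0, slope_def_module]
  · exact (Complex.differentiableOn_dslope (ball_mem_nhds _ hρ)).2 (hf.diff_snd x hx)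
  · refine Complex.norm_dslope_le_div_of_mapsTo_ball (hf.diff_snd x hx) (fun z hz => ?_) hy
    rw [mem_closedBall, dist_eq_norm]
    have := norm_sub_le (f (x, z)) (f (x, 0))
    have := hf.bound x hx z hz
    have := hf.bound x hx 0 h0
    linarith

theorem AnalyticAt.shiftSnd {f : ℂ × ℂ → ℂ} (hf : AnalyticAt ℂ f 0) :
    AnalyticAt ℂ (shiftSnd f) 0 := by
  obtain ⟨r, hr, -, m, h⟩ := hf.exists_sepHolOn univ_mem
  exact (h.shiftSnd hr).analyticAt hr hr

variable {E E' : Type*} [NormedAddCommGroup E] [NormedSpace ℂ E]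
  [NormedAddCommGroup E'] [NormedSpace ℂ E']

/-- The subring of germs at the origin of analytic functions. -/
def analyticGerms (E : Type*) [NormedAddCommGroup E] [NormedSpace ℂ E] :
    Subring (Germ (𝓝 (0 : E)) ℂ) where
  carrier := {a | ∃ f : E → ℂ, AnalyticAt ℂ f 0 ∧ a = (f : Germ (𝓝 (0 : E)) ℂ)}
  mul_mem' := by
    rintro _ _ ⟨f, hf, rfl⟩ ⟨g, hg, rfl⟩
    exact ⟨f * g, hf.mul hg, rfl⟩
  one_mem' := ⟨1, analyticAt_const, rfl⟩
  add_mem' := by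
    rintro _ _ ⟨f, hf, rfl⟩ ⟨g, hg, rfl⟩
    exact ⟨f + g, hf.add hg, rfl⟩
  zero_mem' := ⟨0, analyticAt_const, rfl⟩
  neg_mem' := by
    rintro _ ⟨f, hf, rfl⟩
    exact ⟨-f, hf.neg, rfl⟩

/-- Germs at the origin of analytic functions. -/
abbrev AnalyticGerm (E : Type*) [NormedAddCommGroup E] [NormedSpace ℂ E] : Type _ :=
  analyticGerms E

namespace AnalyticGerm

/-- A representative of an analytic germ. -/
def rep (a : AnalyticGerm E) : E → ℂ := Classical.choose a.2

instance : CoeFun (AnalyticGerm E) fun _ => E → ℂ := ⟨rep⟩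

theorem analyticAt (a : AnalyticGerm E) : AnalyticAt ℂ a 0 := (Classical.choose_spec a.2).1

theorem coe_rep (a : AnalyticGerm E) : ((a : E → ℂ) : Germ (𝓝 (0 : E)) ℂ) = a.1 :=
  (Classical.choose_spec a.2).2.symm

/-- The germ of an analytic function. -/
def mk (f : E → ℂ) (hf : AnalyticAt ℂ f 0) : AnalyticGerm E := ⟨f, f, hf, rfl⟩

theorem mk_apply (f : E → ℂ) (hf : AnalyticAt ℂ f 0) : ∀ᶠ p in 𝓝 0, mk f hf p = f p :=
  Germ.coe_eq.1 (coe_rep (mk f hf))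

theorem ext {a b : AnalyticGerm E} (h : ∀ᶠ p in 𝓝 0, a p = b p) : a = b := by
  apply Subtype.ext
  rw [← coe_rep a, ← coe_rep b]
  exact Germ.coe_eq.2 h

theorem mk_eq_iff {f g : E → ℂ} {hf : AnalyticAt ℂ f 0} {hg : AnalyticAt ℂ g 0} :
    mk f hf = mk g hg ↔ ∀ᶠ p in 𝓝 0, f p = g p := by
  constructor
  · intro h
    exact Germ.coe_eq.1 (congrArg Subtype.val h)
  · intro h
    exact Subtype.ext (Germ.coe_eq.2 h)

theorem add_apply (a b : AnalyticGerm E) : ∀ᶠ p in 𝓝 0, (a + b) p = a p + b p :=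
  Germ.coe_eq.1 (by
    rw [coe_rep]; change a.1 + b.1 = _; rw [← coe_rep a, ← coe_rep b]; rfl)

theorem mul_apply (a b : AnalyticGerm E) : ∀ᶠ p in 𝓝 0, (a * b) p = a p * b p :=
  Germ.coe_eq.1 (by
    rw [coe_rep]; change a.1 * b.1 = _; rw [← coe_rep a, ← coe_rep b]; rfl)

theorem neg_apply (a : AnalyticGerm E) : ∀ᶠ p in 𝓝 0, (-a) p = -a p :=
  Germ.coe_eq.1 (by rw [coe_rep]; change -a.1 = _; rw [← coe_rep a]; rfl)

theorem sub_apply (a b : AnalyticGerm E) : ∀ᶠ p in 𝓝 0, (a - b) p = a p - b p := by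
  filter_upwards [add_apply a (-b), neg_apply b] with p h1 h2
  rw [sub_eq_add_neg, h1, h2, sub_eq_add_neg]

theorem zero_apply : ∀ᶠ p in 𝓝 0, (0 : AnalyticGerm E) p = 0 :=
  Germ.coe_eq.1 (coe_rep (0 : AnalyticGerm E))

theorem one_apply : ∀ᶠ p in 𝓝 0, (1 : AnalyticGerm E) p = 1 :=
  Germ.coe_eq.1 (coe_rep (1 : AnalyticGerm E))

theorem pow_apply (a : AnalyticGerm E) (n : ℕ) : ∀ᶠ p in 𝓝 0, (a ^ n) p = a p ^ n := by
  induction n with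
  | zero => simpa using one_apply
  | succ n ih =>
    filter_upwards [ih, mul_apply (a ^ n) a] with p h1 h2
    rw [pow_succ, h2, h1, pow_succ]

theorem sum_apply {ι : Type*} (s : Finset ι) (a : ι → AnalyticGerm E) :
    ∀ᶠ p in 𝓝 0, (∑ i ∈ s, a i) p = ∑ i ∈ s, a i p := by
  classical
  induction s using Finset.induction_on with
  | empty => simpa using zero_apply
  | insert i s hi ih =>
    filter_upwards [ih, add_apply (a i) (∑ i ∈ s, a i)] with p h1 h2
    rw [Finset.sum_insert hi, h2, h1, Finset.sum_insert hi]

theorem eq_zero_iff {a : AnalyticGerm E} : a = 0 ↔ ∀ᶠ p in 𝓝 0, a p = 0 := by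
  constructor
  · rintro rfl; exact zero_apply
  · intro h
    refine ext ?_
    filter_upwards [h, zero_apply (E := E)] with p h1 h2
    rw [h1, h2]

/-- The value at the origin. -/
def ev : AnalyticGerm E →+* ℂ where
  toFun a := a 0
  map_one' := one_apply.self_of_nhds
  map_mul' a b := (mul_apply a b).self_of_nhds
  map_zero' := zero_apply.self_of_nhds
  map_add' a b := (add_apply a b).self_of_nhds

theorem ev_def (a : AnalyticGerm E) : ev a = a 0 := rfl

theorem ev_mk (f : E → ℂ) (hf : AnalyticAt ℂ f 0) : ev (mk f hf) = f 0 :=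
  (mk_apply f hf).self_of_nhds

/-- Constant germs. -/
def C : ℂ →+* AnalyticGerm E where
  toFun c := mk (fun _ => c) analyticAt_const
  map_one' := rfl
  map_mul' _ _ := rfl
  map_zero' := rfl
  map_add' _ _ := rfl

theorem C_apply (c : ℂ) : ∀ᶠ p in 𝓝 0, (C c : AnalyticGerm E) p = c :=
  mk_apply (fun _ => c) analyticAt_const

@[simp] theorem ev_C (c : ℂ) : ev (C c : AnalyticGerm E) = c :=
  ev_mk (fun _ => c) analyticAt_const

instance : Nontrivial (AnalyticGerm E) := (ev (E := E)).domain_nontrivial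

theorem isUnit_iff {a : AnalyticGerm E} : IsUnit a ↔ ev a ≠ 0 := by
  constructor
  · intro h
    exact (h.map ev).ne_zero
  · intro h
    have hinv : AnalyticAt ℂ (fun p => (a p)⁻¹) 0 := a.analyticAt.inv h
    refine IsUnit.of_mul_eq_one (mk _ hinv) (ext ?_)
    have hne : ∀ᶠ p in 𝓝 0, a p ≠ 0 := a.analyticAt.continuousAt.eventually_ne h
    filter_upwards [mul_apply a (mk _ hinv), mk_apply _ hinv, hne, one_apply (E := E)]
      with p h1 h2 h3 h4
    rw [h1, h2, h4, mul_inv_cancel₀ h3]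

theorem not_isUnit_iff {a : AnalyticGerm E} : ¬ IsUnit a ↔ ev a = 0 := by
  rw [isUnit_iff, not_not]

theorem isUnit_C {c : ℂ} (hc : c ≠ 0) : IsUnit (C c : AnalyticGerm E) := by
  rw [isUnit_iff, ev_C]; exact hc

/-- A nonzero germ does not vanish on any open set close to the origin. -/
theorem exists_ball_dense {a : AnalyticGerm E} (ha : a ≠ 0) :
    ∃ r > 0, AnalyticOnNhd ℂ a (ball 0 r) ∧
      ∀ p ∈ ball (0 : E) r, ¬ ∀ᶠ q in 𝓝 p, a q = 0 := by
  obtain ⟨r, hr, h⟩ := Metric.eventually_nhds_iff_ball.1 a.analyticAt.eventually_analyticAt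
  refine ⟨r, hr, h, fun p hp hz => ha (eq_zero_iff.2 ?_)⟩
  have := AnalyticOnNhd.eqOn_zero_of_preconnected_of_eventuallyEq_zero (f := a) h
    (convex_ball (0 : E) r).isPreconnected hp hz
  filter_upwards [ball_mem_nhds (0 : E) hr] with q hq
  exact this hq

instance : NoZeroDivisors (AnalyticGerm E) where
  eq_zero_or_eq_zero_of_mul_eq_zero {a b} hab := by
    by_contra! h
    obtain ⟨r, hr, h1, h2⟩ := exists_ball_dense h.1
    obtain ⟨s, hs, h3, h4⟩ := exists_ball_dense h.2
    have h5 : ∀ᶠ p in 𝓝 (0 : E), a p * b p = 0 := by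
      filter_upwards [mul_apply a b, eq_zero_iff.1 hab] with p h6 h7
      rw [← h6, h7]
    obtain ⟨t, ht, h6⟩ := Metric.eventually_nhds_iff_ball.1
      (h5.and (Filter.Eventually.and (ball_mem_nhds (0 : E) hr) (ball_mem_nhds (0 : E) hs)))
    obtain ⟨p, hp, hp0⟩ : ∃ p ∈ ball (0 : E) t, a p ≠ 0 := by
      by_contra! hall
      exact h2 0 (by simpa using hr) (by
        filter_upwards [ball_mem_nhds (0 : E) ht] with p hp using hall p hp)
    have hpr := h6 p hp
    refine h4 p hpr.2.2 ?_
    filter_upwards [(h1 p hpr.2.1).continuousAt.eventually_ne hp0, isOpen_ball.mem_nhds hp]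
      with q hq hq2
    exact (mul_eq_zero.1 (h6 q hq2).1).resolve_left hq

instance : IsDomain (AnalyticGerm E) := NoZeroDivisors.to_isDomain _

theorem analyticAt_comp {φ : E → E'} (hφ : AnalyticAt ℂ φ 0) (h0 : φ 0 = 0)
    (a : AnalyticGerm E') : AnalyticAt ℂ (fun p => a (φ p)) 0 :=
  AnalyticAt.fun_comp (g := a) (f := φ) (by rw [h0]; exact a.analyticAt) hφ

/-- Pull-back of germs by an analytic map fixing the origin. -/
def pullback (φ : E → E') (hφ : AnalyticAt ℂ φ 0) (h0 : φ 0 = 0) :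
    AnalyticGerm E' →+* AnalyticGerm E := by
  have han := analyticAt_comp hφ h0
  have ht : Tendsto φ (𝓝 0) (𝓝 0) := by simpa [h0] using hφ.continuousAt.tendsto
  exact
  { toFun := fun a => mk (fun p => a (φ p)) (han a)
    map_one' := (mk_eq_iff.2 (ht.eventually one_apply) : _ = mk (fun _ => 1) analyticAt_const)
    map_mul' := fun a b => by
      refine ext ?_
      filter_upwards [mk_apply _ (han (a * b)), mk_apply _ (han a), mk_apply _ (han b),
        mul_apply (mk _ (han a)) (mk _ (han b)), ht.eventually (mul_apply a b)]
        with p h1 h2 h3 h4 h5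
      rw [h1, h4, h2, h3, h5]
    map_zero' := (mk_eq_iff.2 (ht.eventually zero_apply) : _ = mk (fun _ => 0) analyticAt_const)
    map_add' := fun a b => by
      refine ext ?_
      filter_upwards [mk_apply _ (han (a + b)), mk_apply _ (han a), mk_apply _ (han b),
        add_apply (mk _ (han a)) (mk _ (han b)), ht.eventually (add_apply a b)]
        with p h1 h2 h3 h4 h5
      rw [h1, h4, h2, h3, h5] }

theorem pullback_apply (φ : E → E') (hφ : AnalyticAt ℂ φ 0) (h0 : φ 0 = 0)
    (a : AnalyticGerm E') : ∀ᶠ p in 𝓝 0, pullback φ hφ h0 a p = a (φ p) :=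
  mk_apply _ (analyticAt_comp hφ h0 a)

@[simp] theorem pullback_C (φ : E → E') (hφ : AnalyticAt ℂ φ 0) (h0 : φ 0 = 0) (c : ℂ) :
    pullback φ hφ h0 (C c) = C c := by
  have ht : Tendsto φ (𝓝 0) (𝓝 0) := by simpa [h0] using hφ.continuousAt.tendsto
  refine ext ?_
  filter_upwards [pullback_apply φ hφ h0 (C c), ht.eventually (C_apply c), C_apply (E := E) c]
    with p h1 h2 h3
  rw [h1, h2, h3]

@[simp] theorem ev_pullback (φ : E → E') (hφ : AnalyticAt ℂ φ 0) (h0 : φ 0 = 0)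
    (a : AnalyticGerm E') : ev (pullback φ hφ h0 a) = ev a := by
  rw [ev_def, (pullback_apply φ hφ h0 a).self_of_nhds, h0, ev_def]

theorem analyticAt_fderiv_apply (v : E) (a : AnalyticGerm E) :
    AnalyticAt ℂ (fun p => fderiv ℂ a p v) 0 :=
  AnalyticAt.fun_comp (g := ContinuousLinearMap.apply ℂ ℂ v) (f := fderiv ℂ a)
    (ContinuousLinearMap.analyticAt _ _) a.analyticAt.fderiv

/-- The derivative of a germ in the direction `v`. -/
def dirDeriv (v : E) : Derivation ℤ (AnalyticGerm E) (AnalyticGerm E) := by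
  have han := analyticAt_fderiv_apply v
  have hd : ∀ a : AnalyticGerm E, ∀ᶠ p in 𝓝 0, DifferentiableAt ℂ a p := fun a =>
    a.analyticAt.eventually_analyticAt.mono fun p hp => hp.differentiableAt
  exact Derivation.mk'
    { toFun := fun a => mk _ (han a)
      map_add' := fun a b => by
        refine ext ?_
        filter_upwards [mk_apply _ (han (a + b)), mk_apply _ (han a), mk_apply _ (han b),
          add_apply (mk _ (han a)) (mk _ (han b)), (add_apply a b).eventually_nhds, hd a, hd b]
          with p h1 h2 h3 h4 h5 h6 h7
        have h8 : (a + b : AnalyticGerm E).rep =ᶠ[𝓝 p] fun q => a q + b q := h5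
        rw [h1, h4, h2, h3, h8.fderiv_eq, fderiv_fun_add h6 h7]
        rfl
      map_smul' := fun n a => by
        have hn : ∀ᶠ p in 𝓝 0, (n • a) p = n * a p := by
          have hc : (n • a) = C (n : ℂ) * a := by rw [map_intCast]; simp
          rw [hc]
          filter_upwards [mul_apply (C (n : ℂ)) a, C_apply (E := E) (n : ℂ)] with p h1 h2
          rw [h1, h2]
        have hn' : ∀ᶠ p in 𝓝 0, (n • mk _ (han a)) p = n * mk _ (han a) p := by
          have hc : (n • mk _ (han a)) = C (n : ℂ) * mk _ (han a) := by rw [map_intCast]; simp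
          rw [hc]
          filter_upwards [mul_apply (C (n : ℂ)) (mk _ (han a)), C_apply (E := E) (n : ℂ)]
            with p h1 h2
          rw [h1, h2]
        refine ext ?_
        filter_upwards [mk_apply _ (han (n • a)), mk_apply _ (han a), hn.eventually_nhds, hn',
          hd a] with p h1 h2 h3 h4 h5
        have h8 : (n • a : AnalyticGerm E).rep =ᶠ[𝓝 p] fun q => n * a q := h3
        simp only [eq_intCast, Int.cast_id]
        rw [h1, h4, h2, h8.fderiv_eq, fderiv_const_mul h5]
        rfl }
    fun a b => by
      refine ext ?_
      simp only [LinearMap.coe_mk, AddHom.coe_mk, smul_eq_mul]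
      filter_upwards [mk_apply _ (han (a * b)), mk_apply _ (han a), mk_apply _ (han b),
        add_apply (a * mk _ (han b)) (b * mk _ (han a)), mul_apply a (mk _ (han b)),
        mul_apply b (mk _ (han a)), (mul_apply a b).eventually_nhds, hd a, hd b]
        with p h1 h2 h3 h4 h4' h4'' h5 h6 h7
      have h8 : (a * b : AnalyticGerm E).rep =ᶠ[𝓝 p] fun q => a q * b q := h5
      rw [h1, h4, h4', h4'', h2, h3, h8.fderiv_eq, fderiv_fun_mul h6 h7]
      simp

theorem dirDeriv_apply (v : E) (a : AnalyticGerm E) :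
    ∀ᶠ p in 𝓝 0, dirDeriv v a p = fderiv ℂ a p v :=
  mk_apply _ (analyticAt_fderiv_apply v a)

@[simp] theorem dirDeriv_C (v : E) (c : ℂ) : dirDeriv v (C c) = 0 := by
  rw [eq_zero_iff]
  filter_upwards [dirDeriv_apply v (C c), (C_apply c).eventually_nhds] with p h1 h2
  have h3 : (C c : AnalyticGerm E).rep =ᶠ[𝓝 p] fun _ => c := h2
  rw [h1, h3.fderiv_eq]
  simp

end AnalyticGerm

end

/-! ### Germs in one and two variables, and germs of maps to the plane. -/

noncomputable section

open Metric

variable {E E' : Type*} [NormedAddCommGroup E] [NormedSpace ℂ E]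
  [NormedAddCommGroup E'] [NormedSpace ℂ E']

/-- Germs of analytic functions of one variable. -/
abbrev O₁ : Type := AnalyticGerm ℂ

/-- Germs of analytic functions of two variables. -/
abbrev O₂ : Type := AnalyticGerm (ℂ × ℂ)

namespace AnalyticGerm

/-- The coordinate on the line. -/
def T : O₁ := mk (fun t => t) analyticAt_id

/-- The first coordinate. -/
def X : O₂ := mk (fun p => p.1) analyticAt_fst

/-- The second coordinate. -/
def Y : O₂ := mk (fun p => p.2) analyticAt_snd

theorem T_apply : ∀ᶠ t in 𝓝 0, T t = t := mk_apply (fun t => t) analyticAt_id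
theorem X_apply : ∀ᶠ p in 𝓝 0, X p = p.1 := mk_apply (fun p : ℂ × ℂ => p.1) analyticAt_fst
theorem Y_apply : ∀ᶠ p in 𝓝 0, Y p = p.2 := mk_apply (fun p : ℂ × ℂ => p.2) analyticAt_snd

@[simp] theorem ev_T : ev T = 0 := ev_mk (fun t => t) analyticAt_id
@[simp] theorem ev_X : ev X = 0 := ev_mk (fun p : ℂ × ℂ => p.1) analyticAt_fst
@[simp] theorem ev_Y : ev Y = 0 := ev_mk (fun p : ℂ × ℂ => p.2) analyticAt_snd

theorem T_dvd_iff {a : O₁} : T ∣ a ↔ ev a = 0 := by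
  constructor
  · rintro ⟨b, rfl⟩; simp
  · intro h
    have h1 : AnalyticAt ℂ (dslope a 0) 0 := by
      obtain ⟨p, hp⟩ := a.analyticAt
      exact ⟨_, hp.has_fpower_series_dslope_fslope⟩
    refine ⟨mk _ h1, ext ?_⟩
    filter_upwards [mul_apply T (mk _ h1), mk_apply _ h1, T_apply] with t h2 h3 h4
    rw [h2, h3, h4]
    have := sub_smul_dslope a.rep 0 t
    rw [ev_def] at h
    simpa [h] using this.symm

theorem T_ne_zero : T ≠ 0 := by
  intro h
  have h1 := eq_zero_iff.1 h
  obtain ⟨r, hr, h2⟩ := Metric.eventually_nhds_iff_ball.1 (h1.and T_apply)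
  have hm : ((r / 2 : ℝ) : ℂ) ∈ ball (0 : ℂ) r := by
    rw [mem_ball_zero_iff, Complex.norm_real, Real.norm_of_nonneg (by positivity)]; linarith
  have h3 := h2 _ hm
  rw [h3.1] at h3
  have : r / 2 = 0 := by exact_mod_cast h3.2.symm
  linarith

theorem exists_eq_T_pow_mul {a : O₁} (ha : a ≠ 0) : ∃ (n : ℕ) (u : O₁), IsUnit u ∧ a = T ^ n * u := by
  have hne : analyticOrderAt a.rep 0 ≠ ⊤ := fun h => ha (eq_zero_iff.2 (analyticOrderAt_eq_top.1 h))
  obtain ⟨g, hg, hg0, h⟩ := (a.analyticAt.analyticOrderAt_ne_top).1 hne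
  refine ⟨analyticOrderNatAt a.rep 0, mk g hg, isUnit_iff.2 (by rwa [ev_mk]), ext ?_⟩
  filter_upwards [h, mul_apply (T ^ analyticOrderNatAt a.rep 0) (mk g hg), mk_apply g hg,
    pow_apply T (analyticOrderNatAt a.rep 0), T_apply] with t h1 h2 h3 h4 h5
  rw [h1, h2, h3, h4, h5]
  simp

theorem prime_T : Prime T := by
  refine ⟨T_ne_zero, not_isUnit_iff.2 ev_T, fun a b h => ?_⟩
  rw [T_dvd_iff, map_mul, mul_eq_zero] at h
  simpa only [T_dvd_iff] using h

instance : IsDiscreteValuationRing O₁ := by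
  apply IsDiscreteValuationRing.ofHasUnitMulPowIrreducibleFactorization
  refine ⟨T, prime_T.irreducible, fun {a} ha => ?_⟩
  obtain ⟨n, u, hu, rfl⟩ := exists_eq_T_pow_mul ha
  exact ⟨n, hu.unit, by simp⟩

/-- Restriction to the axis `x = 0`. -/
def resX : O₂ →+* O₁ := pullback (fun t => (0, t)) (by fun_prop) rfl

/-- Restriction to the axis `y = 0`. -/
def resY : O₂ →+* O₁ := pullback (fun t => (t, 0)) (by fun_prop) rfl

/-- Functions of the first coordinate. -/
def inclX : O₁ →+* O₂ := pullback (fun p => p.1) analyticAt_fst rfl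

/-- Functions of the second coordinate. -/
def inclY : O₁ →+* O₂ := pullback (fun p => p.2) analyticAt_snd rfl

theorem resX_apply (a : O₂) : ∀ᶠ t in 𝓝 0, resX a t = a (0, t) := pullback_apply _ _ _ _
theorem resY_apply (a : O₂) : ∀ᶠ t in 𝓝 0, resY a t = a (t, 0) := pullback_apply _ _ _ _
theorem inclX_apply (a : O₁) : ∀ᶠ p in 𝓝 0, inclX a p = a p.1 := pullback_apply _ _ _ _
theorem inclY_apply (a : O₁) : ∀ᶠ p in 𝓝 0, inclY a p = a p.2 := pullback_apply _ _ _ _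

@[simp] theorem ev_resX (a : O₂) : ev (resX a) = ev a := ev_pullback _ _ _ _
@[simp] theorem ev_resY (a : O₂) : ev (resY a) = ev a := ev_pullback _ _ _ _
@[simp] theorem ev_inclX (a : O₁) : ev (inclX a) = ev a := ev_pullback _ _ _ _
@[simp] theorem resX_C (c : ℂ) : resX (C c) = C c := pullback_C _ _ _ _
@[simp] theorem resY_C (c : ℂ) : resY (C c) = C c := pullback_C _ _ _ _

theorem tendsto_zero_right : Tendsto (fun t : ℂ => ((0, t) : ℂ × ℂ)) (𝓝 0) (𝓝 0) := by
  have : Continuous fun t : ℂ => ((0, t) : ℂ × ℂ) := by fun_prop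
  exact this.tendsto 0

theorem tendsto_zero_left : Tendsto (fun t : ℂ => ((t, 0) : ℂ × ℂ)) (𝓝 0) (𝓝 0) := by
  have : Continuous fun t : ℂ => ((t, 0) : ℂ × ℂ) := by fun_prop
  exact this.tendsto 0

theorem tendsto_fst_zero : Tendsto (fun p : ℂ × ℂ => p.1) (𝓝 0) (𝓝 0) := continuous_fst.tendsto 0
theorem tendsto_snd_zero : Tendsto (fun p : ℂ × ℂ => p.2) (𝓝 0) (𝓝 0) := continuous_snd.tendsto 0

@[simp] theorem resX_X : resX X = 0 := by
  rw [eq_zero_iff]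
  filter_upwards [resX_apply X, tendsto_zero_right.eventually X_apply] with t h1 h2
  rw [h1, h2]

@[simp] theorem resX_Y : resX Y = T := by
  refine ext ?_
  filter_upwards [resX_apply Y, tendsto_zero_right.eventually Y_apply, T_apply] with t h1 h2 h3
  rw [h1, h2, h3]

@[simp] theorem resY_Y : resY Y = 0 := by
  rw [eq_zero_iff]
  filter_upwards [resY_apply Y, tendsto_zero_left.eventually Y_apply] with t h1 h2
  rw [h1, h2]

@[simp] theorem resY_X : resY X = T := by
  refine ext ?_
  filter_upwards [resY_apply X, tendsto_zero_left.eventually X_apply, T_apply] with t h1 h2 h3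
  rw [h1, h2, h3]

@[simp] theorem inclX_T : inclX T = X := by
  refine ext ?_
  filter_upwards [inclX_apply T, tendsto_fst_zero.eventually T_apply, X_apply] with t h1 h2 h3
  rw [h1, h2, h3]

@[simp] theorem resX_inclY (a : O₁) : resX (inclY a) = a := by
  refine ext ?_
  filter_upwards [resX_apply (inclY a), tendsto_zero_right.eventually (inclY_apply a)]
    with t h1 h2
  rw [h1, h2]

@[simp] theorem resY_inclX (a : O₁) : resY (inclX a) = a := by
  refine ext ?_
  filter_upwards [resY_apply (inclX a), tendsto_zero_left.eventually (inclX_apply a)]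
    with t h1 h2
  rw [h1, h2]

@[simp] theorem resX_inclX (a : O₁) : resX (inclX a) = C (ev a) := by
  refine ext ?_
  filter_upwards [resX_apply (inclX a), tendsto_zero_right.eventually (inclX_apply a),
    C_apply (E := ℂ) (ev a)] with t h1 h2 h3
  rw [h1, h2, h3]; rfl

/-- Exchange of the two variables. -/
def swap : O₂ →+* O₂ := pullback Prod.swap (analyticAt_snd.prod analyticAt_fst) rfl

theorem swap_apply (a : O₂) : ∀ᶠ p in 𝓝 0, swap a p = a (p.2, p.1) := pullback_apply _ _ _ _

theorem tendsto_swap_zero : Tendsto (fun p : ℂ × ℂ => (p.2, p.1)) (𝓝 0) (𝓝 0) := by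
  have : Continuous fun p : ℂ × ℂ => (p.2, p.1) := by fun_prop
  exact this.tendsto 0

@[simp] theorem swap_swap (a : O₂) : swap (swap a) = a := by
  refine ext ?_
  filter_upwards [swap_apply (swap a), tendsto_swap_zero.eventually (swap_apply a)] with p h1 h2
  rw [h1, h2]

@[simp] theorem swap_X : swap X = Y := by
  refine ext ?_
  filter_upwards [swap_apply X, tendsto_swap_zero.eventually X_apply, Y_apply] with p h1 h2 h3
  rw [h1, h2, h3]

@[simp] theorem swap_Y : swap Y = X := by rw [← swap_X, swap_swap]

@[simp] theorem resY_swap (a : O₂) : resY (swap a) = resX a := by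
  refine ext ?_
  filter_upwards [resY_apply (swap a), tendsto_zero_left.eventually (swap_apply a), resX_apply a]
    with p h1 h2 h3
  rw [h1, h2, h3]

@[simp] theorem swap_inclX (a : O₁) : swap (inclX a) = inclY a := by
  refine ext ?_
  filter_upwards [swap_apply (inclX a), tendsto_swap_zero.eventually (inclX_apply a),
    inclY_apply a] with p h1 h2 h3
  rw [h1, h2, h3]

/-- The quotient of a(x, y) - a(x, 0) by y is analytic by Osgood's lemma; all later divisibility by
a coordinate rests on this. -/
theorem exists_eq_add_Y_mul (a : O₂) : ∃ b, a = inclX (resY a) + Y * b := by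
  refine ⟨mk _ a.analyticAt.shiftSnd, ext ?_⟩
  filter_upwards [add_apply (inclX (resY a)) (Y * mk _ a.analyticAt.shiftSnd),
    mul_apply Y (mk _ a.analyticAt.shiftSnd), mk_apply _ a.analyticAt.shiftSnd, Y_apply,
    inclX_apply (resY a), tendsto_fst_zero.eventually (resY_apply a)] with p h1 h2 h3 h4 h5 h6
  rw [h1, h2, h3, h4, h5, h6]
  exact eq_add_mul_shiftSnd a.rep p

theorem exists_eq_add_X_mul (a : O₂) : ∃ b, a = inclY (resX a) + X * b := by
  obtain ⟨b, hb⟩ := exists_eq_add_Y_mul (swap a)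
  refine ⟨swap b, ?_⟩
  have := congrArg swap hb
  simpa using this

theorem X_dvd_iff {a : O₂} : X ∣ a ↔ resX a = 0 := by
  constructor
  · rintro ⟨b, rfl⟩; simp
  · intro h
    obtain ⟨b, hb⟩ := exists_eq_add_X_mul a
    exact ⟨b, by rw [hb, h]; simp⟩

theorem Y_dvd_iff {a : O₂} : Y ∣ a ↔ resY a = 0 := by
  constructor
  · rintro ⟨b, rfl⟩; simp
  · intro h
    obtain ⟨b, hb⟩ := exists_eq_add_Y_mul a
    exact ⟨b, by rw [hb, h]; simp⟩

theorem X_ne_zero : X ≠ 0 := fun h => T_ne_zero (by rw [← resY_X, h, map_zero])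
theorem Y_ne_zero : Y ≠ 0 := fun h => T_ne_zero (by rw [← resX_Y, h, map_zero])

theorem prime_X : Prime X := by
  refine ⟨X_ne_zero, not_isUnit_iff.2 ev_X, fun a b h => ?_⟩
  rw [X_dvd_iff, map_mul, mul_eq_zero] at h
  simpa only [X_dvd_iff] using h

theorem prime_Y : Prime Y := by
  refine ⟨Y_ne_zero, not_isUnit_iff.2 ev_Y, fun a b h => ?_⟩
  rw [Y_dvd_iff, map_mul, mul_eq_zero] at h
  simpa only [Y_dvd_iff] using h

/-- Partial derivative in the first variable. -/
def dx : Derivation ℤ O₂ O₂ := dirDeriv (1, 0)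

/-- Partial derivative in the second variable. -/
def dy : Derivation ℤ O₂ O₂ := dirDeriv (0, 1)

/-- Derivative of a germ in one variable. -/
def der : Derivation ℤ O₁ O₁ := dirDeriv 1

theorem fderiv_apply_eq (a : O₂) :
    ∀ᶠ p in 𝓝 0, ∀ v : ℂ × ℂ, fderiv ℂ a p v = dx a p * v.1 + dy a p * v.2 := by
  filter_upwards [dirDeriv_apply (1, 0) a, dirDeriv_apply (0, 1) a] with p h1 h2 v
  rw [dx, dy, h1, h2]
  have : v = v.1 • ((1, 0) : ℂ × ℂ) + v.2 • ((0, 1) : ℂ × ℂ) := by ext <;> simp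
  conv_lhs => rw [this, map_add, map_smul, map_smul]
  simp only [smul_eq_mul]
  ring

theorem der_apply (a : O₁) : ∀ᶠ t in 𝓝 0, der a t = deriv a t := by
  filter_upwards [dirDeriv_apply 1 a] with t h
  rw [der, h]; rfl

@[simp] theorem dx_C (c : ℂ) : dx (C c) = 0 := dirDeriv_C _ _
@[simp] theorem dy_C (c : ℂ) : dy (C c) = 0 := dirDeriv_C _ _
@[simp] theorem der_C (c : ℂ) : der (C c) = 0 := dirDeriv_C _ _

theorem dirDeriv_eq_of_clm (v : E) (a : AnalyticGerm E) (L : E →L[ℂ] ℂ)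
    (h : ∀ᶠ p in 𝓝 0, a p = L p) : dirDeriv v a = C (L v) := by
  refine ext ?_
  filter_upwards [dirDeriv_apply v a, h.eventually_nhds, C_apply (E := E) (L v)] with p h1 h2 h3
  have h4 : a.rep =ᶠ[𝓝 p] L := h2
  rw [h1, h3, h4.fderiv_eq, L.fderiv]

@[simp] theorem dx_X : dx X = 1 := by
  rw [dx, dirDeriv_eq_of_clm _ X (ContinuousLinearMap.fst ℂ ℂ ℂ) X_apply]; simp
@[simp] theorem dy_X : dy X = 0 := by
  rw [dy, dirDeriv_eq_of_clm _ X (ContinuousLinearMap.fst ℂ ℂ ℂ) X_apply]; simp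
@[simp] theorem dx_Y : dx Y = 0 := by
  rw [dx, dirDeriv_eq_of_clm _ Y (ContinuousLinearMap.snd ℂ ℂ ℂ) Y_apply]; simp
@[simp] theorem dy_Y : dy Y = 1 := by
  rw [dy, dirDeriv_eq_of_clm _ Y (ContinuousLinearMap.snd ℂ ℂ ℂ) Y_apply]; simp
@[simp] theorem der_T : der T = 1 := by
  rw [der, dirDeriv_eq_of_clm _ T (ContinuousLinearMap.id ℂ ℂ) T_apply]; simp

end AnalyticGerm

open AnalyticGerm

/-- A germ of analytic map to the plane fixing the origin. -/
@[ext] structure GermMap (E : Type*) [NormedAddCommGroup E] [NormedSpace ℂ E] where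
  fst : AnalyticGerm E
  snd : AnalyticGerm E
  ev_fst : ev fst = 0
  ev_snd : ev snd = 0

namespace GermMap

attribute [simp] ev_fst ev_snd

/-- A representative of a germ of map. -/
def toFun (φ : GermMap E) (p : E) : ℂ × ℂ := (φ.fst p, φ.snd p)

instance : CoeFun (GermMap E) fun _ => E → ℂ × ℂ := ⟨toFun⟩

theorem analyticAt (φ : GermMap E) : AnalyticAt ℂ φ 0 :=
  φ.fst.analyticAt.prod φ.snd.analyticAt

theorem map_zero (φ : GermMap E) : φ 0 = 0 := Prod.ext φ.ev_fst φ.ev_snd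

theorem tendsto (φ : GermMap E) : Tendsto φ (𝓝 0) (𝓝 0) := by
  simpa [φ.map_zero] using φ.analyticAt.continuousAt.tendsto

/-- Substitution of a germ of map into germs of functions. -/
def pull (φ : GermMap E) : O₂ →+* AnalyticGerm E := pullback φ φ.analyticAt φ.map_zero

theorem pull_apply (φ : GermMap E) (a : O₂) : ∀ᶠ p in 𝓝 0, φ.pull a p = a (φ p) :=
  pullback_apply _ _ _ _

@[simp] theorem pull_C (φ : GermMap E) (c : ℂ) : φ.pull (C c) = C c := pullback_C _ _ _ _
@[simp] theorem ev_pull (φ : GermMap E) (a : O₂) : ev (φ.pull a) = ev a := ev_pullback _ _ _ _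

@[simp] theorem pull_X (φ : GermMap E) : φ.pull X = φ.fst := by
  refine AnalyticGerm.ext ?_
  filter_upwards [φ.pull_apply X, φ.tendsto.eventually X_apply] with p h1 h2
  rw [h1, h2]; rfl

@[simp] theorem pull_Y (φ : GermMap E) : φ.pull Y = φ.snd := by
  refine AnalyticGerm.ext ?_
  filter_upwards [φ.pull_apply Y, φ.tendsto.eventually Y_apply] with p h1 h2
  rw [h1, h2]; rfl

/-- Composition of germs of maps. -/
def comp (ψ : GermMap (ℂ × ℂ)) (φ : GermMap E) : GermMap E where
  fst := φ.pull ψ.fst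
  snd := φ.pull ψ.snd
  ev_fst := by simp
  ev_snd := by simp

@[simp] theorem comp_fst (ψ : GermMap (ℂ × ℂ)) (φ : GermMap E) : (ψ.comp φ).fst = φ.pull ψ.fst := rfl
@[simp] theorem comp_snd (ψ : GermMap (ℂ × ℂ)) (φ : GermMap E) : (ψ.comp φ).snd = φ.pull ψ.snd := rfl

theorem comp_apply (ψ : GermMap (ℂ × ℂ)) (φ : GermMap E) : ∀ᶠ p in 𝓝 0, ψ.comp φ p = ψ (φ p) := by
  filter_upwards [φ.pull_apply ψ.fst, φ.pull_apply ψ.snd] with p h1 h2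
  exact Prod.ext h1 h2

theorem pull_comp (ψ : GermMap (ℂ × ℂ)) (φ : GermMap E) (a : O₂) :
    (ψ.comp φ).pull a = φ.pull (ψ.pull a) := by
  refine AnalyticGerm.ext ?_
  filter_upwards [(ψ.comp φ).pull_apply a, φ.pull_apply (ψ.pull a), ψ.comp_apply φ,
    φ.tendsto.eventually (ψ.pull_apply a)] with p h1 h2 h3 h4
  rw [h1, h2, h3, h4]

/-- The identity. -/
def id : GermMap (ℂ × ℂ) := ⟨X, Y, ev_X, ev_Y⟩

@[simp] theorem id_fst : id.fst = X := rfl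
@[simp] theorem id_snd : id.snd = Y := rfl

theorem id_apply : ∀ᶠ p in 𝓝 0, id p = p := by
  filter_upwards [X_apply, Y_apply] with p h1 h2
  exact Prod.ext h1 h2

@[simp] theorem pull_id (a : O₂) : id.pull a = a := by
  refine AnalyticGerm.ext ?_
  filter_upwards [id.pull_apply a, id_apply] with p h1 h2
  rw [h1, h2]

theorem comp_id (ψ : GermMap (ℂ × ℂ)) : ψ.comp id = ψ := by
  ext1 <;> simp

theorem id_comp (ψ : GermMap E) : id.comp ψ = ψ := by
  ext1 <;> simp

theorem comp_assoc (χ ψ : GermMap (ℂ × ℂ)) (φ : GermMap E) :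
    (χ.comp ψ).comp φ = χ.comp (ψ.comp φ) := by
  ext1 <;> simp [pull_comp]

theorem dirDeriv_pull (v : E) (φ : GermMap E) (a : O₂) :
    dirDeriv v (φ.pull a) = φ.pull (dx a) * dirDeriv v φ.fst + φ.pull (dy a) * dirDeriv v φ.snd := by
  have hd : ∀ᶠ q in 𝓝 (0 : ℂ × ℂ), DifferentiableAt ℂ a q :=
    a.analyticAt.eventually_analyticAt.mono fun p hp => hp.differentiableAt
  have hd1 : ∀ᶠ q in 𝓝 (0 : E), DifferentiableAt ℂ φ.fst q :=
    φ.fst.analyticAt.eventually_analyticAt.mono fun p hp => hp.differentiableAt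
  have hd2 : ∀ᶠ q in 𝓝 (0 : E), DifferentiableAt ℂ φ.snd q :=
    φ.snd.analyticAt.eventually_analyticAt.mono fun p hp => hp.differentiableAt
  refine AnalyticGerm.ext ?_
  filter_upwards [dirDeriv_apply v (φ.pull a), (φ.pull_apply a).eventually_nhds,
    φ.tendsto.eventually (fderiv_apply_eq a), dirDeriv_apply v φ.fst, dirDeriv_apply v φ.snd,
    φ.pull_apply (dx a), φ.pull_apply (dy a), φ.tendsto.eventually hd, hd1, hd2,
    AnalyticGerm.add_apply (φ.pull (dx a) * dirDeriv v φ.fst) (φ.pull (dy a) * dirDeriv v φ.snd),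
    AnalyticGerm.mul_apply (φ.pull (dx a)) (dirDeriv v φ.fst),
    AnalyticGerm.mul_apply (φ.pull (dy a)) (dirDeriv v φ.snd)]
    with p h1 h2 h3 h4 h5 h6 h7 h8 h9 h10 h11 h12 h13
  have h14 : (φ.pull a).rep =ᶠ[𝓝 p] fun q => a (φ q) := h2
  rw [h11, h12, h13, h6, h7, h4, h5, h1, h14.fderiv_eq]
  have h15 : HasFDerivAt (fun q => φ q) ((fderiv ℂ φ.fst p).prod (fderiv ℂ φ.snd p)) p :=
    h9.hasFDerivAt.prodMk h10.hasFDerivAt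
  have h16 : HasFDerivAt (fun q => a (φ q)) _ p := h8.hasFDerivAt.comp p h15
  rw [h16.fderiv]
  simp [h3]

theorem dx_pull (φ : GermMap (ℂ × ℂ)) (a : O₂) :
    dx (φ.pull a) = φ.pull (dx a) * dx φ.fst + φ.pull (dy a) * dx φ.snd := dirDeriv_pull _ _ _

theorem dy_pull (φ : GermMap (ℂ × ℂ)) (a : O₂) :
    dy (φ.pull a) = φ.pull (dx a) * dy φ.fst + φ.pull (dy a) * dy φ.snd := dirDeriv_pull _ _ _

/-- The Jacobian determinant. -/
def jac (φ : GermMap (ℂ × ℂ)) : O₂ := dx φ.fst * dy φ.snd - dy φ.fst * dx φ.snd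

@[simp] theorem jac_id : jac id = 1 := by simp [jac]

theorem jac_comp (ψ φ : GermMap (ℂ × ℂ)) : (ψ.comp φ).jac = φ.pull ψ.jac * φ.jac := by
  simp only [jac, comp_fst, comp_snd, dx_pull, dy_pull, map_sub, map_mul]
  ring

theorem hasFDerivAt (φ : GermMap (ℂ × ℂ)) : ∀ᶠ p in 𝓝 0,
    HasFDerivAt φ ((fderiv ℂ φ.fst p).prod (fderiv ℂ φ.snd p)) p := by
  filter_upwards [φ.fst.analyticAt.eventually_analyticAt,
    φ.snd.analyticAt.eventually_analyticAt] with p h1 h2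
  exact h1.differentiableAt.hasFDerivAt.prodMk h2.differentiableAt.hasFDerivAt

theorem det_eq (L : ℂ × ℂ →L[ℂ] ℂ × ℂ) :
    L.det = (L (1, 0)).1 * (L (0, 1)).2 - (L (0, 1)).1 * (L (1, 0)).2 := by
  have : L.det = LinearMap.det (L : ℂ × ℂ →ₗ[ℂ] ℂ × ℂ) := rfl
  rw [this, ← LinearMap.det_toMatrix (Module.Basis.finTwoProd ℂ), Matrix.det_fin_two]
  simp [LinearMap.toMatrix_apply]

theorem det_fderiv (φ : GermMap (ℂ × ℂ)) : ∀ᶠ p in 𝓝 0, (fderiv ℂ φ p).det = φ.jac p := by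
  filter_upwards [φ.hasFDerivAt, fderiv_apply_eq φ.fst, fderiv_apply_eq φ.snd,
    AnalyticGerm.sub_apply (dx φ.fst * dy φ.snd) (dy φ.fst * dx φ.snd),
    AnalyticGerm.mul_apply (dx φ.fst) (dy φ.snd), AnalyticGerm.mul_apply (dy φ.fst) (dx φ.snd)]
    with p h1 h2 h3 h4 h5 h6
  rw [h1.fderiv, det_eq, jac, h4, h5, h6]
  simp [h2, h3]

end GermMap

end

/-! ### Weierstrass division. -/

noncomputable section

open Metric AnalyticGerm

theorem SepHolOn.mono {r ρ m r' ρ' m' : ℝ} {f : ℂ × ℂ → ℂ} (hf : SepHolOn r ρ m f) (hr : r' ≤ r)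
    (hρ : ρ' ≤ ρ) (hm : m ≤ m') : SepHolOn r' ρ' m' f :=
  ⟨fun y hy => (hf.diff_fst y (ball_subset_ball hρ hy)).mono (ball_subset_ball hr),
   fun x hx => (hf.diff_snd x (ball_subset_ball hr hx)).mono (ball_subset_ball hρ),
   fun x hx y hy => (hf.bound x (ball_subset_ball hr hx) y (ball_subset_ball hρ hy)).trans hm⟩

theorem SepHolOn.neg_mul {r ρ m n : ℝ} {f g : ℂ × ℂ → ℂ} (hf : SepHolOn r ρ m f)
    (hg : SepHolOn r ρ n g) (hm : 0 ≤ m) : SepHolOn r ρ (m * n) fun p => -(f p * g p) := by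
  refine ⟨fun y hy => ((hf.diff_fst y hy).mul (hg.diff_fst y hy)).neg,
    fun x hx => ((hf.diff_snd x hx).mul (hg.diff_snd x hx)).neg, fun x hx y hy => ?_⟩
  rw [norm_neg, norm_mul]
  exact mul_le_mul (hf.bound x hx y hy) (hg.bound x hx y hy) (norm_nonneg _) hm

theorem SepHolOn.iterate_shiftSnd {r ρ m : ℝ} {f : ℂ × ℂ → ℂ} (hρ : 0 < ρ) (hf : SepHolOn r ρ m f)
    (i : ℕ) : SepHolOn r ρ ((2 / ρ) ^ i * m) (_root_.shiftSnd^[i] f) := by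
  induction i with
  | zero => simpa using hf
  | succ i ih =>
    rw [Function.iterate_succ_apply']
    have := ih.shiftSnd hρ
    refine this.mono le_rfl le_rfl (le_of_eq ?_)
    rw [pow_succ]; ring

theorem eq_sum_add_pow_mul_shiftSnd (f : ℂ × ℂ → ℂ) (d : ℕ) (p : ℂ × ℂ) :
    f p = ∑ i ∈ Finset.range d, (shiftSnd^[i] f) (p.1, 0) * p.2 ^ i +
      p.2 ^ d * (shiftSnd^[d] f) p := by
  induction d with
  | zero => simp
  | succ d ih =>
    rw [Finset.sum_range_succ, Function.iterate_succ_apply', ih]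
    conv_lhs => rw [eq_add_mul_shiftSnd (shiftSnd^[d] f) p]
    rw [pow_succ]; ring

theorem SepHolOn.tsum {r ρ : ℝ} {M : ℕ → ℝ} (hM : Summable M) {f : ℕ → ℂ × ℂ → ℂ}
    (hf : ∀ n, SepHolOn r ρ (M n) (f n)) : SepHolOn r ρ (∑' n, M n) fun p => ∑' n, f n p := by
  refine ⟨fun y hy => ?_, fun x hx => ?_, fun x hx y hy => ?_⟩
  · exact Complex.differentiableOn_tsum_of_summable_norm hM (fun n => (hf n).diff_fst y hy)
      isOpen_ball fun n x hx => (hf n).bound x hx y hy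
  · exact Complex.differentiableOn_tsum_of_summable_norm hM (fun n => (hf n).diff_snd x hx)
      isOpen_ball fun n y hy => (hf n).bound x hx y hy
  · exact tsum_of_norm_bounded hM.hasSum fun n => (hf n).bound x hx y hy

/-- Weierstrass division by a germ of the form `y ^ d + O(x)`. -/
theorem weierstrass_division_aux (d : ℕ) (k g : O₂) :
    ∃ (q : O₂) (r : ℕ → O₁), g = q * (Y ^ d + X * k) + ∑ i ∈ Finset.range d, inclX (r i) * Y ^ i := by
  obtain ⟨ρ₁, hρ₁, -, m, hk⟩ := k.analyticAt.exists_sepHolOn univ_mem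
  obtain ⟨ρ₂, hρ₂, -, n, hg⟩ := g.analyticAt.exists_sepHolOn univ_mem
  set ρ := min ρ₁ ρ₂ with hρd
  have hρ : 0 < ρ := lt_min hρ₁ hρ₂
  set c := (2 / ρ) ^ d with hc
  have hc0 : 0 < c := by positivity
  have hm0 : 0 ≤ m := (norm_nonneg _).trans (hk.bound 0 (by simpa) 0 (by simpa))
  have hn0 : 0 ≤ n := (norm_nonneg _).trans (hg.bound 0 (by simpa) 0 (by simpa))
  -- Only the radius in x is shrunk: the operator h ↦ `shiftSnd^[d]` (-κh), with κ = xk, then has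
  -- norm at most 1/2.
  set r := min ρ (1 / (2 * c * (m + 1))) with hrd
  have hr : 0 < r := lt_min hρ (by positivity)
  have hrm : c * (r * m) ≤ 1 / 2 := by
    have h1 : r ≤ 1 / (2 * c * (m + 1)) := min_le_right _ _
    have h2 : r * m ≤ 1 / (2 * c * (m + 1)) * (m + 1) := by gcongr; linarith
    calc c * (r * m) ≤ c * (1 / (2 * c * (m + 1)) * (m + 1)) := by gcongr
      _ = 1 / 2 := by field_simp
  have hk' : SepHolOn r ρ m k :=
    hk.mono ((min_le_left _ _).trans (min_le_left _ _)) (min_le_left _ _) le_rfl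
  have hg' : SepHolOn r ρ n g :=
    hg.mono ((min_le_left _ _).trans (min_le_right _ _)) (min_le_right _ _) le_rfl
  let κ : ℂ × ℂ → ℂ := fun p => p.1 * k p
  have hκ : SepHolOn r ρ (r * m) κ := by
    refine ⟨fun y hy => differentiableOn_id.mul (hk'.diff_fst y hy),
      fun x hx => (hk'.diff_snd x hx).const_mul x, fun x hx y hy => ?_⟩
    rw [norm_mul]
    have : ‖x‖ < r := by simpa using hx
    exact mul_le_mul this.le (hk'.bound x hx y hy) (norm_nonneg _) hr.le
  -- The quotient q must satisfy q = `shiftSnd^[d]` (g - κq). Its Neumann series is the sum of the δ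
  -- j, and the lower shifts of g - κq give the remainder.
  let δ : ℕ → ℂ × ℂ → ℂ := fun j => Nat.rec (shiftSnd^[d] g)
    (fun _ h => shiftSnd^[d] (fun p => -(κ p * h p))) j
  have hδs : ∀ j, δ (j + 1) = shiftSnd^[d] (fun p => -(κ p * δ j p)) := fun j => rfl
  have hδ : ∀ j, SepHolOn r ρ (c * n * (1 / 2) ^ j) (δ j) := fun j => by
    induction j with
    | zero =>
      rw [pow_zero, mul_one]
      exact hg'.iterate_shiftSnd hρ d
    | succ j ih =>
      rw [hδs]
      refine ((hκ.neg_mul ih (by positivity)).iterate_shiftSnd hρ d).mono le_rfl le_rfl ?_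
      calc c * (r * m * (c * n * (1 / 2) ^ j)) = (c * (r * m)) * (c * n * (1 / 2) ^ j) := by ring
        _ ≤ (1 / 2) * (c * n * (1 / 2) ^ j) := by gcongr
        _ = c * n * (1 / 2) ^ (j + 1) := by rw [pow_succ]; ring
  have hsum : Summable fun j : ℕ => c * n * (1 / 2 : ℝ) ^ j :=
    (summable_geometric_of_lt_one (by norm_num) (by norm_num)).mul_left _
  have hq := SepHolOn.tsum hsum hδ
  let R : ℕ → ℕ → ℂ → ℂ := fun i j x => (shiftSnd^[i] (fun p => -(κ p * δ j p))) (x, 0)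
  have hRb : ∀ i j, SepHolOn r ρ ((2 / ρ) ^ i * (r * m * (c * n * (1 / 2) ^ j)))
      (shiftSnd^[i] (fun p => -(κ p * δ j p))) := fun i j =>
    (hκ.neg_mul (hδ j) (by positivity)).iterate_shiftSnd hρ i
  have hRsum : ∀ i, Summable fun j : ℕ => (2 / ρ) ^ i * (r * m * (c * n * (1 / 2 : ℝ) ^ j)) :=
    fun i => (hsum.mul_left _).mul_left _
  have h0ρ : (0 : ℂ) ∈ ball (0 : ℂ) ρ := by simpa using hρ
  have hran : ∀ i, AnalyticAt ℂ
      (fun x => (shiftSnd^[i] g) (x, 0) + ∑' j, R i j x) 0 := fun i => by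
    have h1 : DifferentiableOn ℂ (fun x => ∑' j, R i j x) (ball 0 r) :=
      Complex.differentiableOn_tsum_of_summable_norm (hRsum i)
        (fun j => (hRb i j).diff_fst 0 h0ρ) isOpen_ball
        fun j x hx => (hRb i j).bound x hx 0 h0ρ
    have h2 : DifferentiableOn ℂ (fun x => (shiftSnd^[i] g) (x, 0)) (ball 0 r) :=
      (hg'.iterate_shiftSnd hρ i).diff_fst 0 h0ρ
    exact (h2.add h1).analyticAt (ball_mem_nhds _ hr)
  have hqan := hq.analyticAt hr hρ
  refine ⟨mk _ hqan, fun i => mk _ (hran i), AnalyticGerm.ext ?_⟩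
  have hterm : ∀ᶠ p in 𝓝 (0 : ℂ × ℂ), ∀ i ∈ Finset.range d, (inclX (mk _ (hran i)) * Y ^ i) p =
      ((shiftSnd^[i] g) (p.1, 0) + ∑' j, R i j p.1) * p.2 ^ i := by
    rw [Filter.eventually_all_finset]
    intro i _
    filter_upwards [mul_apply (inclX (mk _ (hran i))) (Y ^ i), inclX_apply (mk _ (hran i)),
      tendsto_fst_zero.eventually (mk_apply _ (hran i)), pow_apply Y i, Y_apply]
      with p h1 h2 h3 h4 h5
    rw [h1, h2, h3, h4, h5]
  have hn : (ball (0 : ℂ) r) ×ˢ (ball (0 : ℂ) ρ) ∈ 𝓝 (0 : ℂ × ℂ) :=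
    prod_mem_nhds (ball_mem_nhds _ hr) (ball_mem_nhds _ hρ)
  filter_upwards [hn, hterm, mk_apply _ hqan, add_apply (mk _ hqan * (Y ^ d + X * k))
    (∑ i ∈ Finset.range d, inclX (mk _ (hran i)) * Y ^ i),
    mul_apply (mk _ hqan) (Y ^ d + X * k), add_apply (Y ^ d) (X * k), mul_apply X k, X_apply,
    pow_apply Y d, Y_apply, sum_apply (Finset.range d) fun i => inclX (mk _ (hran i)) * Y ^ i]
    with p hp h1 h2 h3 h4 h5 h6 h7 h8 h9 h10
  rw [h3, h4, h2, h5, h6, h7, h8, h9, h10, Finset.sum_congr rfl h1]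
  have hδsum : Summable fun j => δ j p :=
    Summable.of_norm_bounded hsum fun j => (hδ j).bound p.1 hp.1 p.2 hp.2
  have hRs : ∀ i, Summable fun j => R i j p.1 := fun i =>
    Summable.of_norm_bounded (hRsum i) fun j => (hRb i j).bound p.1 hp.1 0 h0ρ
  have key : ∀ j, -(κ p * δ j p) =
      ∑ i ∈ Finset.range d, R i j p.1 * p.2 ^ i + p.2 ^ d * δ (j + 1) p := fun j =>
    eq_sum_add_pow_mul_shiftSnd (fun p => -(κ p * δ j p)) d p
  have hsum1 : -(κ p * ∑' j, δ j p) = ∑ i ∈ Finset.range d, (∑' j, R i j p.1) * p.2 ^ i +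
      p.2 ^ d * (∑' j, δ j p - δ 0 p) := by
    have e1 : -(κ p * ∑' j, δ j p) = ∑' j, -(κ p * δ j p) := by
      rw [tsum_neg, tsum_mul_left]
    have hs2 : Summable fun j => δ (j + 1) p := (summable_nat_add_iff 1).2 hδsum
    rw [e1]
    simp_rw [key]
    rw [Summable.tsum_add (summable_sum fun i _ => (hRs i).mul_right _) (hs2.mul_left _),
      Summable.tsum_finsetSum fun i _ => (hRs i).mul_right _, tsum_mul_left, hδsum.tsum_eq_zero_add]
    simp_rw [tsum_mul_right]
    ring
  have hg1 := eq_sum_add_pow_mul_shiftSnd g.rep d p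
  have hδ0 : δ 0 p = (shiftSnd^[d] g.rep) p := rfl
  rw [← hδ0] at hg1
  simp only [add_mul, Finset.sum_add_distrib]
  have hκp : κ p = p.1 * k p := rfl
  rw [hκp] at hsum1
  linear_combination hg1 + hsum1

/-- Multiplying f by the inverse of u(y) turns it into y^d plus a multiple of x. -/
theorem weierstrass_division {f : O₂} {d : ℕ} {u : O₁} (hu : IsUnit u) (hf : resX f = T ^ d * u)
    (g : O₂) :
    ∃ (q : O₂) (r : ℕ → O₁), g = q * f + ∑ i ∈ Finset.range d, inclX (r i) * Y ^ i := by
  obtain ⟨v, hv⟩ := hu.exists_right_inv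
  have h1 : X ∣ f * inclY v - Y ^ d := by
    rw [X_dvd_iff]
    simp [hf, mul_assoc, hv]
  obtain ⟨k, hk⟩ := h1
  obtain ⟨q, r, h⟩ := weierstrass_division_aux d k g
  refine ⟨q * inclY v, r, ?_⟩
  rw [h]
  linear_combination (-q) * hk

end

/-! ### Unique factorization, local inverses, and intersections of coprime curves. -/

noncomputable section

open Metric AnalyticGerm

namespace AnalyticGerm

/-- Restriction to the line spanned by `v`. -/
def line (v : ℂ × ℂ) : O₂ →+* O₁ :=
  pullback (fun t => t • v) ((analyticAt_id).smul analyticAt_const) (zero_smul _ _)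

theorem line_apply (v : ℂ × ℂ) (a : O₂) : ∀ᶠ t in 𝓝 0, line v a t = a (t • v) :=
  pullback_apply _ _ _ _

@[simp] theorem ev_line (v : ℂ × ℂ) (a : O₂) : ev (line v a) = ev a := ev_pullback _ _ _ _

theorem exists_line_ne_zero {a : O₂} (ha : a ≠ 0) : ∃ v, line v a ≠ 0 := by
  obtain ⟨r, hr, h1, h2⟩ := exists_ball_dense ha
  obtain ⟨p, hp, hp0⟩ : ∃ p ∈ ball (0 : ℂ × ℂ) r, a p ≠ 0 := by
    by_contra! hall
    exact h2 0 (by simpa using hr) (by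
      filter_upwards [ball_mem_nhds (0 : ℂ × ℂ) hr] with p hp using hall p hp)
  refine ⟨p, fun h0 => hp0 ?_⟩
  let U : Set ℂ := (fun t : ℂ => t • p) ⁻¹' ball 0 r
  have hUc : Convex ℝ U :=
    (convex_ball (0 : ℂ × ℂ) r).is_linear_preimage
      (⟨fun x y => add_smul x y p, fun c x => by rw [smul_assoc]⟩ : IsLinearMap ℝ fun t : ℂ => t • p)
  have han : AnalyticOnNhd ℂ (fun t : ℂ => a (t • p)) U := fun t ht =>
    AnalyticAt.fun_comp (g := a) (f := fun t : ℂ => t • p) (h1 _ ht)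
      ((analyticAt_id).smul analyticAt_const)
  have hz : (fun t : ℂ => a (t • p)) =ᶠ[𝓝 0] 0 := by
    filter_upwards [line_apply p a, eq_zero_iff.1 h0] with t h3 h4
    rw [← h3, h4]; rfl
  have := han.eqOn_zero_of_preconnected_of_eventuallyEq_zero hUc.isPreconnected
    (show (0 : ℂ) ∈ U by simpa [U] using hr) hz (show (1 : ℂ) ∈ U by simpa [U] using hp)
  simpa using this

/-- Restricted to a line on which `a` does not vanish identically, `a` has finite order and h has
positive order. -/
theorem exists_not_pow_dvd {h a : O₂} (hh : ev h = 0) (ha : a ≠ 0) : ∃ n : ℕ, ¬ h ^ n ∣ a := by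
  obtain ⟨v, hv⟩ := exists_line_ne_zero ha
  obtain ⟨n, u, hu, hn⟩ := exists_eq_T_pow_mul hv
  refine ⟨n + 1, fun hd => ?_⟩
  have h1 : T ∣ line v h := T_dvd_iff.2 (by simpa using hh)
  have h2 : T ^ (n + 1) ∣ T ^ n * u := by
    rw [← hn]
    exact (pow_dvd_pow_of_dvd h1 _).trans (by rw [← map_pow]; exact map_dvd _ hd)
  rw [pow_succ, mul_dvd_mul_iff_left (pow_ne_zero _ T_ne_zero)] at h2
  exact prime_T.not_isUnit (isUnit_of_dvd_unit h2 hu)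

theorem eq_zero_of_forall_pow_dvd {h a : O₂} (hh : ev h = 0) (ha : ∀ n : ℕ, h ^ n ∣ a) : a = 0 := by
  by_contra hne
  obtain ⟨n, hn⟩ := exists_not_pow_dvd hh hne
  exact hn (ha n)

theorem eq_zero_of_T_pow_dvd_sum (d : ℕ) (c : ℕ → ℂ)
    (h : T ^ d ∣ ∑ i ∈ Finset.range d, C (c i) * T ^ i) : ∀ i < d, c i = 0 := by
  induction d generalizing c with
  | zero => simp
  | succ d ih =>
    rw [Finset.sum_range_succ'] at h
    have h0 : c 0 = 0 := by
      have : T ∣ _ := (dvd_pow_self T (Nat.succ_ne_zero d)).trans h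
      rw [T_dvd_iff] at this
      simpa [map_sum] using this
    have h1 : ∑ k ∈ Finset.range d, C (c (k + 1)) * T ^ (k + 1) + C (c 0) * T ^ 0 =
        T * ∑ k ∈ Finset.range d, C (c (k + 1)) * T ^ k := by
      rw [h0, Finset.mul_sum]
      simp only [map_zero, zero_mul, add_zero]
      exact Finset.sum_congr rfl fun i _ => by ring
    rw [h1, pow_succ', mul_dvd_mul_iff_left T_ne_zero] at h
    intro i hi
    cases i with
    | zero => exact h0
    | succ i => exact ih (fun k => c (k + 1)) h i (by omega)

/-- It suffices that every nonzero prime ideal contain a prime element. A prime ideal without x is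
generated by a lift f of a generator of its restriction to x = 0, because division by f leaves
remainder zero. -/
instance : UniqueFactorizationMonoid O₂ := by
  refine UniqueFactorizationMonoid.iff_exists_prime_mem_of_isPrime.2 fun P hP hprime => ?_
  by_cases hX : X ∈ P
  · exact ⟨X, hX, prime_X⟩
  have hcancel : ∀ a, X * a ∈ P → a ∈ P := fun a ha => (hprime.mem_or_mem ha).resolve_left hX
  have hsurj : Function.Surjective resX := fun a => ⟨inclY a, resX_inclY a⟩
  have hQ : P.map resX ≠ ⊥ := by
    intro hQ
    refine hP ((Submodule.eq_bot_iff _).2 fun p hp => ?_)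
    refine eq_zero_of_forall_pow_dvd ev_X fun n => ?_
    induction n generalizing p with
    | zero => simp
    | succ n ih =>
      have : resX p = 0 := by
        have := Ideal.mem_map_of_mem resX hp
        rwa [hQ, Ideal.mem_bot] at this
      obtain ⟨b, rfl⟩ := X_dvd_iff.2 this
      rw [pow_succ']
      exact mul_dvd_mul_left _ (ih b (hcancel b hp))
  obtain ⟨γ, hγ⟩ := (IsPrincipalIdealRing.principal (P.map resX)).principal
  have hγ0 : γ ≠ 0 := by
    rintro rfl
    exact hQ (by rw [hγ]; simp)
  obtain ⟨d, u, hu, hd⟩ := exists_eq_T_pow_mul hγ0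
  obtain ⟨f, hfP, hf⟩ := (Ideal.mem_map_iff_of_surjective resX hsurj).1
    (show γ ∈ P.map resX by rw [hγ]; exact Submodule.mem_span_singleton_self γ)
  -- On x = 0 the remainder has degree below d but is divisible by T^d, so all its coefficients
  -- vanish at x = 0. As x lies outside the prime ideal it can be cancelled, and the argument
  -- repeats indefinitely.
  have hrem : ∀ n : ℕ, ∀ r : ℕ → O₁, ∑ i ∈ Finset.range d, inclX (r i) * Y ^ i ∈ P →
      X ^ n ∣ ∑ i ∈ Finset.range d, inclX (r i) * Y ^ i := by
    intro n
    induction n with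
    | zero => simp
    | succ n ih =>
      intro r hr
      have h1 := Ideal.mem_map_of_mem resX hr
      rw [hγ, Ideal.submodule_span_eq, Ideal.mem_span_singleton, hd] at h1
      have h2 : T ^ d ∣ ∑ i ∈ Finset.range d, C (ev (r i)) * T ^ i := by
        have := (dvd_mul_right (T ^ d) u).trans h1
        simpa [map_sum] using this
      have h3 := eq_zero_of_T_pow_dvd_sum d _ h2
      have h4 : ∀ i, ∃ s : O₁, i < d → r i = T * s := fun i => by
        by_cases hi : i < d
        · obtain ⟨s, hs⟩ := T_dvd_iff.2 (h3 i hi)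
          exact ⟨s, fun _ => hs⟩
        · exact ⟨0, fun h => absurd h hi⟩
      choose s hs using h4
      have h5 : ∑ i ∈ Finset.range d, inclX (r i) * Y ^ i =
          X * ∑ i ∈ Finset.range d, inclX (s i) * Y ^ i := by
        rw [Finset.mul_sum]
        refine Finset.sum_congr rfl fun i hi => ?_
        rw [hs i (Finset.mem_range.1 hi), map_mul, inclX_T]; ring
      rw [h5] at hr ⊢
      rw [pow_succ']
      exact mul_dvd_mul_left _ (ih s (hcancel _ hr))
  have hPf : P = Ideal.span {f} := by
    apply le_antisymm
    · intro p hp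
      obtain ⟨q, r, h⟩ := weierstrass_division hu (hf.trans hd) p
      have h6 : ∑ i ∈ Finset.range d, inclX (r i) * Y ^ i ∈ P := by
        have : ∑ i ∈ Finset.range d, inclX (r i) * Y ^ i = p - q * f := by rw [h]; ring
        rw [this]
        exact P.sub_mem hp (P.mul_mem_left _ hfP)
      have h7 := eq_zero_of_forall_pow_dvd ev_X fun n => hrem n r h6
      rw [h7, add_zero] at h
      rw [Ideal.mem_span_singleton, h]
      exact dvd_mul_left _ _
    · rwa [Ideal.span_le, Set.singleton_subset_iff]
  have hf0 : f ≠ 0 := by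
    rintro rfl
    exact hγ0 (by rw [← hf, map_zero])
  exact ⟨f, hfP, (Ideal.span_singleton_prime hf0).1 (hPf ▸ hprime)⟩

/-- A finite extension is integral, and a nonzero ideal of an integral extension domain meets the
base ring nontrivially. -/
theorem exists_ne_zero_dvd_of_finite {R S : Type*} [CommRing R] [Nontrivial R] [CommRing S] [IsDomain S]
    (f : R →+* S) (d : ℕ) (e : ℕ → S)
    (hgen : ∀ x, ∃ r : ℕ → R, x = ∑ i ∈ Finset.range d, f (r i) * e i) {x : S} (hx : x ≠ 0) :
    ∃ r, r ≠ 0 ∧ x ∣ f r := by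
  let _ : Algebra R S := f.toAlgebra
  have hfin : Module.Finite R S := by
    classical
    refine ⟨⟨Finset.image e (Finset.range d), ?_⟩⟩
    rw [eq_top_iff]
    rintro x -
    obtain ⟨r, h⟩ := hgen x
    have : x = ∑ i ∈ Finset.range d, r i • e i := by
      rw [h]
      exact Finset.sum_congr rfl fun i _ => (Algebra.smul_def _ _).symm
    rw [this]
    refine Submodule.sum_mem _ fun i hi => Submodule.smul_mem _ _ (Submodule.subset_span ?_)
    exact Finset.mem_coe.2 (Finset.mem_image_of_mem _ hi)
  have hint : IsIntegral R x := Algebra.IsIntegral.isIntegral _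
  have hne := Ideal.comap_ne_bot_of_integral_mem hx (Ideal.mem_span_singleton_self _) hint
  obtain ⟨r, hr, hr0⟩ := Submodule.exists_mem_ne_zero_of_ne_bot hne
  rw [Ideal.mem_comap, Ideal.mem_span_singleton] at hr
  exact ⟨r, hr0, hr⟩

/-- Elimination of y: by Weierstrass division the quotient by p is finite over the germs in x.
Common zeros of p and g then lie over zeros of a nonzero germ in x, hence over x = 0. -/
theorem exists_ne_zero_mem_span {p g : O₂} (hp : Prime p) (hpX : resX p ≠ 0) (hg : ¬ p ∣ g) :
    ∃ r : O₁, r ≠ 0 ∧ ∃ a b : O₂, inclX r = a * p + b * g := by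
  obtain ⟨d, u, hu, hd⟩ := exists_eq_T_pow_mul hpX
  have : (Ideal.span {p}).IsPrime := (Ideal.span_singleton_prime hp.ne_zero).2 hp
  have hg0 : Ideal.Quotient.mk (Ideal.span {p}) g ≠ 0 := by
    rw [Ne, Ideal.Quotient.eq_zero_iff_mem, Ideal.mem_span_singleton]
    exact hg
  obtain ⟨r, hr0, b, hb⟩ := exists_ne_zero_dvd_of_finite
    ((Ideal.Quotient.mk (Ideal.span {p})).comp inclX) d
    (fun i => Ideal.Quotient.mk (Ideal.span {p}) (Y ^ i)) (fun x => by
      obtain ⟨x, rfl⟩ := Ideal.Quotient.mk_surjective x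
      obtain ⟨q, r, h⟩ := weierstrass_division hu hd x
      refine ⟨r, ?_⟩
      rw [h, map_add, map_mul, Ideal.Quotient.eq_zero_iff_mem.2 (Ideal.mem_span_singleton_self p),
        mul_zero, zero_add, map_sum]
      exact Finset.sum_congr rfl fun i _ => by rw [map_mul]; rfl) hg0
  refine ⟨r, hr0, ?_⟩
  obtain ⟨b, rfl⟩ := Ideal.Quotient.mk_surjective b
  have h1 : Ideal.Quotient.mk (Ideal.span {p}) (inclX r - b * g) = 0 := by
    rw [map_sub, map_mul, sub_eq_zero, mul_comm]; exact hb
  rw [Ideal.Quotient.eq_zero_iff_mem, Ideal.mem_span_singleton] at h1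
  obtain ⟨a, ha⟩ := h1
  exact ⟨a, b, by linear_combination ha⟩

theorem eventually_eq_zero_of_apply_eq_zero {r : O₁} (hr : r ≠ 0) : ∀ᶠ t in 𝓝 0, r t = 0 → t = 0 := by
  obtain ⟨n, u, hu, rfl⟩ := exists_eq_T_pow_mul hr
  have hu0 : ∀ᶠ t in 𝓝 0, u t ≠ 0 := u.analyticAt.continuousAt.eventually_ne (isUnit_iff.1 hu)
  filter_upwards [mul_apply (T ^ n) u, pow_apply T n, T_apply, hu0] with t h1 h2 h3 h4 h5
  rw [h1, h2, h3] at h5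
  exact eq_zero_of_pow_eq_zero ((mul_eq_zero.1 h5).resolve_right h4)

end AnalyticGerm

namespace GermMap

theorem exists_localInverse (φ : GermMap (ℂ × ℂ)) (h : ev φ.jac ≠ 0) :
    ∃ ψ : GermMap (ℂ × ℂ), φ.comp ψ = id ∧ ψ.comp φ = id := by
  have hcd : ContDiffAt ℂ ⊤ φ 0 := φ.analyticAt.contDiffAt
  have hdet : (fderiv ℂ φ 0).det ≠ 0 := by
    rw [φ.det_fderiv.self_of_nhds]; exact h
  let L := (fderiv ℂ φ 0).toContinuousLinearEquivOfDetNeZero hdet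
  have hL : HasFDerivAt φ (L : ℂ × ℂ →L[ℂ] ℂ × ℂ) 0 := by
    rw [ContinuousLinearMap.coe_toContinuousLinearEquivOfDetNeZero]
    exact φ.analyticAt.differentiableAt.hasFDerivAt
  have hst : HasStrictFDerivAt φ (L : ℂ × ℂ →L[ℂ] ℂ × ℂ) 0 := hcd.hasStrictFDerivAt' hL (by simp)
  have hcd' : ContDiffAt ℂ ⊤ (hst.localInverse φ L 0) (φ 0) :=
    hcd.to_localInverse hL (by simp)
  rw [φ.map_zero] at hcd'
  have han : AnalyticAt ℂ (hst.localInverse φ L 0) 0 := hcd'.analyticAt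
  have h0 : hst.localInverse φ L 0 0 = 0 := by
    have := hst.localInverse_apply_image
    rwa [φ.map_zero] at this
  have h1 : AnalyticAt ℂ (fun p => (hst.localInverse φ L 0 p).1) 0 :=
    AnalyticAt.fun_comp (g := Prod.fst) analyticAt_fst han
  have h2 : AnalyticAt ℂ (fun p => (hst.localInverse φ L 0 p).2) 0 :=
    AnalyticAt.fun_comp (g := Prod.snd) analyticAt_snd han
  let ψ : GermMap (ℂ × ℂ) := ⟨AnalyticGerm.mk _ h1, AnalyticGerm.mk _ h2, by rw [ev_mk, h0]; rfl, by rw [ev_mk, h0]; rfl⟩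
  have hψ : ∀ᶠ p in 𝓝 0, ψ p = hst.localInverse φ L 0 p := by
    filter_upwards [mk_apply _ h1, mk_apply _ h2] with p h3 h4
    exact Prod.ext h3 h4
  have hr : ∀ᶠ p in 𝓝 0, φ (hst.localInverse φ L 0 p) = p := by
    have := hst.eventually_right_inverse
    rwa [φ.map_zero] at this
  have hl : ∀ᶠ p in 𝓝 0, hst.localInverse φ L 0 (φ p) = p := hst.eventually_left_inverse
  have ext2 : ∀ χ : GermMap (ℂ × ℂ), (∀ᶠ p in 𝓝 0, χ p = p) → χ = id := fun χ hχ => by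
    ext1
    · refine AnalyticGerm.ext ?_
      filter_upwards [hχ, X_apply] with p h3 h4
      rw [id_fst, h4]; exact congrArg Prod.fst h3
    · refine AnalyticGerm.ext ?_
      filter_upwards [hχ, Y_apply] with p h3 h4
      rw [id_snd, h4]; exact congrArg Prod.snd h3
  refine ⟨ψ, ext2 _ ?_, ext2 _ ?_⟩
  · filter_upwards [φ.comp_apply ψ, hψ, hr] with p h3 h4 h5
    rw [h3, h4, h5]
  · filter_upwards [ψ.comp_apply φ, φ.tendsto.eventually hψ, hl] with p h3 h4 h5
    rw [h3, h4, h5]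

/-- A linear map of the plane, as a map germ. -/
def linear (a b c d : ℂ) : GermMap (ℂ × ℂ) :=
  ⟨AnalyticGerm.C a * X + AnalyticGerm.C b * Y, AnalyticGerm.C c * X + AnalyticGerm.C d * Y,
    by simp, by simp⟩

@[simp] theorem jac_linear (a b c d : ℂ) : (linear a b c d).jac = AnalyticGerm.C (a * d - b * c) := by
  simp [jac, linear, Derivation.leibniz]

theorem resX_pull_linear (a b c d : ℂ) (f : O₂) :
    resX ((linear a b c d).pull f) = line (b, d) f := by
  refine AnalyticGerm.ext ?_
  filter_upwards [resX_apply ((linear a b c d).pull f), line_apply (b, d) f,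
    tendsto_zero_right.eventually ((linear a b c d).pull_apply f),
    tendsto_zero_right.eventually (AnalyticGerm.add_apply (C a * X) (C b * Y)),
    tendsto_zero_right.eventually (AnalyticGerm.add_apply (C c * X) (C d * Y)),
    tendsto_zero_right.eventually (AnalyticGerm.mul_apply (C a) X),
    tendsto_zero_right.eventually (AnalyticGerm.mul_apply (C b) Y),
    tendsto_zero_right.eventually (AnalyticGerm.mul_apply (C c) X),
    tendsto_zero_right.eventually (AnalyticGerm.mul_apply (C d) Y),
    tendsto_zero_right.eventually X_apply, tendsto_zero_right.eventually Y_apply,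
    tendsto_zero_right.eventually (C_apply a), tendsto_zero_right.eventually (C_apply b),
    tendsto_zero_right.eventually (C_apply c), tendsto_zero_right.eventually (C_apply d)]
    with t h1 h2 h3 h4 h5 h6 h7 h8 h9 h10 h11 h12 h13 h14 h15
  rw [h1, h2, h3]
  congr 1
  refine Prod.ext ?_ ?_
  · change (C a * X + C b * Y : O₂) (0, t) = _
    rw [h4, h6, h7, h10, h11, h13]; simp [mul_comm]
  · change (C c * X + C d * Y : O₂) (0, t) = _
    rw [h5, h8, h9, h10, h11, h15]; simp [mul_comm]

/-- A linear change of coordinates making a given germ regular in the second variable. -/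
theorem exists_resX_pull_ne_zero {a : O₂} (ha : a ≠ 0) :
    ∃ L M : GermMap (ℂ × ℂ), L.comp M = id ∧ M.comp L = id ∧ resX (L.pull a) ≠ 0 := by
  obtain ⟨⟨v, w⟩, hv⟩ := exists_line_ne_zero ha
  obtain ⟨α, β, h⟩ : ∃ α β : ℂ, α * w - v * β ≠ 0 ∨ (v = 0 ∧ w = 0) := by
    by_cases hw : w = 0
    · by_cases hv : v = 0
      · exact ⟨0, 0, Or.inr ⟨hv, hw⟩⟩
      · exact ⟨0, 1, Or.inl (by simpa)⟩
    · exact ⟨1, 0, Or.inl (by simpa)⟩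
  -- The vector can be 0 only when a(0) ≠ 0, and then no change of coordinates is needed.
  rcases h with h | ⟨rfl, rfl⟩
  · obtain ⟨M, h1, h2⟩ := exists_localInverse (linear α v β w) (by simpa using h)
    exact ⟨_, M, h1, h2, by rwa [resX_pull_linear]⟩
  · refine ⟨id, id, comp_id _, comp_id _, fun h0 => hv ?_⟩
    rw [pull_id] at h0
    have h1 : ev a = 0 := by rw [← ev_resX, h0, _root_.map_zero]
    refine AnalyticGerm.eq_zero_iff.2 ?_
    filter_upwards [line_apply (0, 0) a] with t ht
    rw [ht]
    have h2 : t • ((0, 0) : ℂ × ℂ) = 0 := by ext <;> simp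
    rw [h2]; exact h1

theorem comp_eq_id_apply {L M : GermMap (ℂ × ℂ)} (h : L.comp M = id) : ∀ᶠ p in 𝓝 0, L (M p) = p := by
  filter_upwards [L.comp_apply M, id_apply] with p h1 h2
  rw [← h1, h, h2]

end GermMap

namespace AnalyticGerm

open GermMap

theorem prime_of_pull {L M : GermMap (ℂ × ℂ)} (h1 : L.comp M = GermMap.id)
    (h2 : M.comp L = GermMap.id) {p : O₂} (hp : Prime p) : Prime (L.pull p) := by
  let e : O₂ ≃+* O₂ := RingEquiv.ofRingHom L.pull M.pull
    (RingHom.ext fun a => by simp [← pull_comp, h2]) (RingHom.ext fun a => by simp [← pull_comp, h1])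
  exact (MulEquiv.prime_iff e.toMulEquiv).2 hp

/-- A prime germ and a germ not divisible by it have no common zero but the origin. -/
theorem eventually_eq_zero_of_prime {p g : O₂} (hp : Prime p) (hg : ¬ p ∣ g) :
    ∀ᶠ q in 𝓝 0, p q = 0 → g q = 0 → q = 0 := by
  have key : ∀ {p g : O₂}, Prime p → ¬ p ∣ g → resX p ≠ 0 →
      ∀ᶠ q in 𝓝 0, p q = 0 → g q = 0 → q.1 = 0 ∧ q.2 = 0 := by
    intro p g hp hg hX
    obtain ⟨r, hr, a, b, h⟩ := exists_ne_zero_mem_span hp hX hg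
    have h1 : ∀ᶠ q : ℂ × ℂ in 𝓝 0, p q = 0 → g q = 0 → q.1 = 0 := by
      have hz : ∀ᶠ q in 𝓝 0, (inclX r) q = (a * p + b * g : O₂) q := by rw [h]; simp
      filter_upwards [hz, inclX_apply r, add_apply (a * p) (b * g), mul_apply a p, mul_apply b g,
        tendsto_fst_zero.eventually (eventually_eq_zero_of_apply_eq_zero hr)] with q h1 h2 h3 h4 h5 h6 h7 h8
      apply h6
      rw [← h2, h1, h3, h4, h5, h7, h8]; simp
    filter_upwards [h1, (tendsto_snd_zero.eventually (resX_apply p)),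
      tendsto_snd_zero.eventually (eventually_eq_zero_of_apply_eq_zero hX)] with q h1 h2 h3 h4 h5
    refine ⟨h1 h4 h5, h3 ?_⟩
    rw [h2]; nth_rewrite 1 [← h1 h4 h5]; exact h4
  obtain ⟨L, M, h1, h2, h3⟩ := exists_resX_pull_ne_zero hp.ne_zero
  have h4 := key (prime_of_pull h1 h2 hp) (g := L.pull g) (fun h => hg (by
    have := map_dvd M.pull h
    rwa [← pull_comp, ← pull_comp, h1, pull_id, pull_id] at this)) h3
  filter_upwards [M.tendsto.eventually h4, M.tendsto.eventually (L.pull_apply p),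
    M.tendsto.eventually (L.pull_apply g), comp_eq_id_apply h1] with q h5 h6 h7 h8 h9 h10
  rw [h6, h7, h8] at h5
  have : M q = 0 := Prod.ext (h5 h9 h10).1 (h5 h9 h10).2
  rw [← h8, this, L.map_zero]

/-- Relatively prime germs have no common zero but the origin. -/
theorem eventually_eq_zero_of_isRelPrime {f g : O₂} (hf : f ≠ 0) (h : IsRelPrime f g) :
    ∀ᶠ q in 𝓝 0, f q = 0 → g q = 0 → q = 0 := by
  induction f using UniqueFactorizationMonoid.induction_on_prime with
  | h₁ => exact absurd rfl hf
  | h₂ u hu =>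
    filter_upwards [u.analyticAt.continuousAt.eventually_ne (isUnit_iff.1 hu)] with q h1 h2
    exact absurd h2 h1
  | h₃ a p ha hp ih =>
    have h1 := ih ha (h.of_mul_left_right)
    have h2 := eventually_eq_zero_of_prime hp fun hd =>
      hp.not_isUnit (h (dvd_mul_right p a) hd)
    filter_upwards [h1, h2, mul_apply p a] with q h3 h4 h5 h6 h7
    rw [h5, mul_eq_zero] at h6
    exact h6.elim (fun h => h4 h h7) (fun h => h3 h h7)

end AnalyticGerm

end

/-! ### Zeros of germs, and first properties of generically injective maps. -/

noncomputable section

open Metric AnalyticGerm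

namespace AnalyticGerm

variable {E : Type*} [NormedAddCommGroup E] [NormedSpace ℂ E]

theorem frequently_ne_zero {a : AnalyticGerm E} (ha : a ≠ 0) : ∃ᶠ p in 𝓝 0, a p ≠ 0 := fun h =>
  ha (eq_zero_iff.2 (by simpa using h))

theorem eventually_ne_zero_of_isUnit {a : AnalyticGerm E} (ha : IsUnit a) : ∀ᶠ p in 𝓝 0, a p ≠ 0 :=
  a.analyticAt.continuousAt.eventually_ne (isUnit_iff.1 ha)

/-- A germ nonzero at the origin of the ring is nonzero on a dense subset of a neighborhood. -/
theorem eventually_frequently_ne_zero {a : AnalyticGerm E} (ha : a ≠ 0) :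
    ∀ᶠ p in 𝓝 0, ∃ᶠ q in 𝓝 p, a q ≠ 0 := by
  obtain ⟨r, hr, -, h⟩ := exists_ball_dense ha
  filter_upwards [ball_mem_nhds 0 hr] with p hp hf
  exact h p hp (by simpa using hf)

/-- A regular germ vanishing at the origin has zeros on all nearby vertical lines. -/
theorem eventually_exists_apply_eq_zero {P : O₂} (hP : ev P = 0) (hX : resX P ≠ 0) {ε : ℝ}
    (hε : 0 < ε) : ∀ᶠ x in 𝓝 (0 : ℂ), ∃ y, ‖y‖ < ε ∧ P (x, y) = 0 := by
  obtain ⟨R, hR, hball⟩ := eventually_nhds_iff_ball.1 P.analyticAt.eventually_analyticAt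
  obtain ⟨R', hR', hball'⟩ := eventually_nhds_iff_ball.1
    ((eventually_eq_zero_of_apply_eq_zero hX).and (resX_apply P))
  obtain ⟨ρ, hρ, hρε, hρR, hρR'⟩ : ∃ ρ > 0, ρ < ε ∧ ρ < R ∧ ρ < R' :=
    ⟨min ε (min R R') / 2, by positivity,
      (half_lt_self (by positivity)).trans_le (min_le_left _ _),
      (half_lt_self (by positivity)).trans_le ((min_le_right _ _).trans (min_le_left _ _)),
      (half_lt_self (by positivity)).trans_le ((min_le_right _ _).trans (min_le_right _ _))⟩
  have hmem : ∀ x y : ℂ, ‖x‖ < R → ‖y‖ ≤ ρ → ((x, y) : ℂ × ℂ) ∈ ball (0 : ℂ × ℂ) R := fun x y hx hy => by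
    rw [mem_ball_zero_iff, Prod.norm_def]; exact max_lt hx (hy.trans_lt hρR)
  have hcont : ContinuousOn P (ball (0 : ℂ × ℂ) R) := fun p hp =>
    (hball p hp).continuousAt.continuousWithinAt
  have hsph : ∀ y ∈ sphere (0 : ℂ) ρ, P (0, y) ≠ 0 := fun y hy h0 => by
    have hy' : ‖y‖ = ρ := by simpa using hy
    have h1 := hball' y (by rw [mem_ball_zero_iff, hy']; exact hρR')
    have h2 : y = 0 := h1.1 (by rw [h1.2, h0])
    rw [h2, norm_zero] at hy'; exact hρ.ne hy'
  obtain ⟨y₀, hy₀, hmin⟩ := (isCompact_sphere (0 : ℂ) ρ).exists_isMinOn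
    (NormedSpace.sphere_nonempty.2 hρ.le) (f := fun y => ‖P (0, y)‖) (by
      refine (hcont.comp (by fun_prop) fun y hy => hmem 0 y (by simpa using hR) ?_).norm
      simpa using (mem_sphere_zero_iff_norm.1 hy).le)
  set m := ‖P (0, y₀)‖ with hm
  have hm0 : 0 < m := norm_pos_iff.2 (hsph y₀ hy₀)
  have h0 : P (0, 0) = 0 := hP
  -- for `x` small, `|P (x, y)| > m / 2` on the circle and `|P (x, 0)| < m / 8`
  have hA : ∀ᶠ x in 𝓝 (0 : ℂ), ∀ y ∈ sphere (0 : ℂ) ρ, m / 2 < ‖P (x, y)‖ := by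
    apply (isCompact_sphere (0 : ℂ) ρ).eventually_forall_of_forall_eventually
    intro y hy
    have hc : ContinuousAt P (0, y) := (hball _ (hmem 0 y (by simpa using hR)
      (mem_sphere_zero_iff_norm.1 hy).le)).continuousAt
    have : m / 2 < ‖P (0, y)‖ := (half_lt_self hm0).trans_le (hmin hy)
    exact hc.norm.eventually (lt_mem_nhds this)
  have hB : ∀ᶠ x in 𝓝 (0 : ℂ), ‖P (x, 0)‖ < m / 8 := by
    have hc : ContinuousAt (fun x : ℂ => ‖P (x, 0)‖) 0 :=
      (ContinuousAt.comp (f := fun x : ℂ => (x, (0 : ℂ))) (g := P) (x := (0 : ℂ))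
        P.analyticAt.continuousAt (by fun_prop)).norm
    refine hc.eventually (gt_mem_nhds ?_)
    simp only [h0, norm_zero]; positivity
  filter_upwards [hA, hB, ball_mem_nhds (0 : ℂ) hR] with x h1 h2 h3
  rw [mem_ball_zero_iff] at h3
  have hdiff : ∀ y, ‖y‖ ≤ ρ → AnalyticAt ℂ (fun y => P (x, y)) y := fun y hy =>
    AnalyticAt.fun_comp (g := P) (f := fun y => (x, y)) (hball _ (hmem x y h3 hy)) (by fun_prop)
  have hd : DiffContOnCl ℂ (fun y => P (x, y)) (ball 0 ρ) := by
    apply DifferentiableOn.diffContOnCl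
    rw [closure_ball _ hρ.ne']
    exact fun y hy => (hdiff y (by simpa using hy)).differentiableAt.differentiableWithinAt
  have hlow : ∀ y ∈ sphere (0 : ℂ) ρ, m / 4 ≤ ‖P (x, y) - P (x, 0)‖ := fun y hy => by
    have := h1 y hy
    have := norm_sub_norm_le (P (x, y)) (P (x, 0))
    linarith
  have hfr : ∃ᶠ y in 𝓝 (0 : ℂ), P (x, y) ≠ P (x, 0) := by
    intro hev
    have han : AnalyticOnNhd ℂ (fun y => P (x, y) - P (x, 0)) (closedBall 0 ρ) := fun y hy =>
      (hdiff y (by simpa using hy)).sub analyticAt_const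
    have := han.eqOn_zero_of_preconnected_of_eventuallyEq_zero
      (convex_closedBall _ _).isPreconnected (mem_closedBall_self hρ.le)
      (by filter_upwards [hev] with y hy; simpa [sub_eq_zero] using hy)
      (sphere_subset_closedBall hy₀)
    have h4 := hlow y₀ hy₀
    simp only [Pi.zero_apply] at this
    rw [this, norm_zero] at h4
    linarith
  -- Quantitative open mapping: on the circle P(x, ·) stays at distance at least m / 4 from P(x, 0),
  -- so its image covers the disc of radius m / 8 about P(x, 0), and this disc contains 0.
  obtain ⟨y, hy, hy0⟩ := hd.ball_subset_image_closedBall hρ hlow hfr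
    (show (0 : ℂ) ∈ ball (P (x, 0)) (m / 4 / 2) by
      rw [mem_ball, dist_comm, dist_zero_right]; linarith)
  exact ⟨y, (mem_closedBall_zero_iff.1 hy).trans_lt hρε, hy0⟩

/-- The zeros of a germ in two variables vanishing at the origin are not isolated. -/
theorem frequently_apply_eq_zero {P : O₂} (hP : ev P = 0) : ∃ᶠ p in 𝓝[≠] 0, P p = 0 := by
  by_cases h0 : P = 0
  · exact ((eq_zero_iff.1 h0).filter_mono nhdsWithin_le_nhds).frequently
  have key : ∀ {P : O₂}, ev P = 0 → resX P ≠ 0 → ∃ᶠ p in 𝓝[≠] 0, P p = 0 := by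
    intro P hP hX hev
    rw [eventually_nhdsWithin_iff, eventually_nhds_iff_ball] at hev
    obtain ⟨r, hr, hev⟩ := hev
    have h1 := eventually_exists_apply_eq_zero hP hX hr
    obtain ⟨x, ⟨y, hy, hxy⟩, hxr, hx0⟩ := ((h1.filter_mono nhdsWithin_le_nhds).and
      (((isOpen_ball.eventually_mem (mem_ball_self (x := (0 : ℂ)) hr)).filter_mono
        nhdsWithin_le_nhds).and self_mem_nhdsWithin) : ∀ᶠ x in 𝓝[≠] (0 : ℂ), _).exists
    refine hev (x, y) ?_ ?_ hxy
    · rw [mem_ball_zero_iff, Prod.norm_def]; exact max_lt (by simpa using hxr) hy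
    · intro h; exact hx0 (congrArg Prod.fst h)
  obtain ⟨L, M, h1, h2, h3⟩ := GermMap.exists_resX_pull_ne_zero h0
  intro hev
  refine key (by simpa using hP) h3 ?_
  rw [eventually_nhdsWithin_iff] at hev ⊢
  filter_upwards [L.tendsto.eventually hev, L.pull_apply P, GermMap.comp_eq_id_apply h2]
    with p h4 h5 h6 h7 h8
  rw [h5] at h8
  refine h4 (fun h9 => h7 ?_) h8
  rw [Set.mem_singleton_iff] at h9 ⊢
  rw [← h6, h9, M.map_zero]

end AnalyticGerm

namespace GermMap

/-- A map germ is generically injective if it is injective off a proper analytic subset. -/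
def GenInj (φ : GermMap (ℂ × ℂ)) : Prop :=
  ∃ h : O₂, h ≠ 0 ∧ ∃ U ∈ 𝓝 (0 : ℂ × ℂ), Set.InjOn φ {p | p ∈ U ∧ h p ≠ 0}

/-- A generically injective map germ has no first integral of its fibers. -/
theorem GenInj.eq_zero_of_tangent {φ : GermMap (ℂ × ℂ)} (hφ : φ.GenInj) {v w : O₂}
    (hf : dx φ.fst * v + dy φ.fst * w = 0) (hg : dx φ.snd * v + dy φ.snd * w = 0) :
    v = 0 ∧ w = 0 := by
  obtain ⟨h, h0, U, hU, hinj⟩ := hφ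
  by_contra hvw
  obtain ⟨D, hD0, hD⟩ : ∃ D : O₂, D ≠ 0 ∧ ∀ p, v p = 0 → w p = 0 → D p = 0 := by
    by_cases hv : v = 0
    · exact ⟨w, fun hw => hvw ⟨hv, hw⟩, fun p _ h => h⟩
    · exact ⟨v, hv, fun p h _ => h⟩
  have hzero : ∀ {a b : O₂}, a * v + b * w = 0 → ∀ᶠ p in 𝓝 0, a p * v p + b p * w p = 0 := by
    intro a b hab
    filter_upwards [AnalyticGerm.eq_zero_iff.1 hab, AnalyticGerm.add_apply (a * v) (b * w),
      AnalyticGerm.mul_apply a v, AnalyticGerm.mul_apply b w] with p h1 h2 h3 h4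
    rw [← h3, ← h4, ← h2, h1]
  have hfacts : ∀ᶠ p in 𝓝 (0 : ℂ × ℂ), p ∈ U ∧ AnalyticAt ℂ v p ∧ AnalyticAt ℂ w p ∧
      AnalyticAt ℂ φ.fst p ∧ AnalyticAt ℂ φ.snd p ∧ AnalyticAt ℂ h p ∧
      fderiv ℂ φ.fst p (v p, w p) = 0 ∧ fderiv ℂ φ.snd p (v p, w p) = 0 := by
    filter_upwards [hU, v.analyticAt.eventually_analyticAt, w.analyticAt.eventually_analyticAt,
      φ.fst.analyticAt.eventually_analyticAt, φ.snd.analyticAt.eventually_analyticAt,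
      h.analyticAt.eventually_analyticAt, fderiv_apply_eq φ.fst, fderiv_apply_eq φ.snd,
      hzero hf, hzero hg] with p h1 h2 h3 h4 h5 h6 h7 h8 h9 h10
    exact ⟨h1, h2, h3, h4, h5, h6, by rw [h7]; exact h9, by rw [h8]; exact h10⟩
  obtain ⟨p, hp, hmul, hpev⟩ := ((frequently_ne_zero (mul_ne_zero hD0 h0)).and_eventually
    ((AnalyticGerm.mul_apply D h).and hfacts.eventually_nhds)).exists
  rw [hmul] at hp
  have hDp : D p ≠ 0 := left_ne_zero_of_mul hp
  have hhp : h p ≠ 0 := right_ne_zero_of_mul hp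
  have hpf := hpev.self_of_nhds
  -- Both components of φ are constant along the real-time integral curve of this field through p.
  -- Injectivity makes the curve stationary, so the field vanishes at p, against the choice of p.
  let vf : ℂ × ℂ → ℂ × ℂ := fun q => (v q, w q)
  have hvf : ContDiffAt ℝ 1 vf p :=
    ((hpf.2.1.prod hpf.2.2.1).contDiffAt (n := 1)).restrict_scalars ℝ
  obtain ⟨r, hr, ε, hε, hα⟩ :=
    hvf.exists_forall_mem_closedBall_exists_eq_forall_mem_Ioo_hasDerivAt 0
  obtain ⟨α, hα0, hα⟩ := hα p (mem_closedBall_self hr.le)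
  have hmem0 : (0 : ℝ) ∈ Set.Ioo (0 - ε) (0 + ε) := by constructor <;> linarith
  have hcont : Tendsto α (𝓝 0) (𝓝 p) := by
    have := (hα 0 hmem0).continuousAt
    rwa [ContinuousAt, hα0] at this
  have hgood : ∀ᶠ q in 𝓝 p, h q ≠ 0 := hpf.2.2.2.2.2.1.continuousAt.eventually_ne hhp
  obtain ⟨δ, hδ, hball⟩ := eventually_nhds_iff_ball.1
    ((hcont.eventually (hpev.and hgood)).and (Ioo_mem_nhds hmem0.1 hmem0.2))
  have hconst : ∀ {a : O₂}, (∀ t ∈ ball (0 : ℝ) δ, AnalyticAt ℂ a (α t)) →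
      (∀ t ∈ ball (0 : ℝ) δ, fderiv ℂ a (α t) (v (α t), w (α t)) = 0) →
      ∀ t ∈ ball (0 : ℝ) δ, a (α t) = a (α 0) := by
    intro a ha ha0 t ht
    have hder : ∀ s ∈ ball (0 : ℝ) δ, HasDerivAt (fun s => a (α s)) 0 s := fun s hs => by
      have h1 := ((ha s hs).differentiableAt.hasFDerivAt.restrictScalars ℝ).comp_hasDerivAt s
        (hα s (hball s hs).2)
      have h2 := ha0 s hs
      simpa [vf, h2, Function.comp_def] using h1
    exact IsOpen.is_const_of_deriv_eq_zero isOpen_ball (convex_ball _ _).isPreconnected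
      (fun s hs => (hder s hs).differentiableAt.differentiableWithinAt)
      (fun s hs => (hder s hs).deriv) ht (mem_ball_self hδ)
  have hαc : ∀ t ∈ ball (0 : ℝ) δ, α t = p := fun t ht => by
    rw [← hα0]
    refine hinj ⟨(hball t ht).1.1.1, (hball t ht).1.2⟩
      ⟨(hball 0 (mem_ball_self hδ)).1.1.1, (hball 0 (mem_ball_self hδ)).1.2⟩ (Prod.ext ?_ ?_)
    · exact hconst (fun t ht => (hball t ht).1.1.2.2.2.1)
        (fun t ht => (hball t ht).1.1.2.2.2.2.2.2.1) t ht
    · exact hconst (fun t ht => (hball t ht).1.1.2.2.2.2.1)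
        (fun t ht => (hball t ht).1.1.2.2.2.2.2.2.2) t ht
  have hd0 : HasDerivAt α 0 0 := (hasDerivAt_const (0 : ℝ) p).congr_of_eventuallyEq (by
    filter_upwards [ball_mem_nhds (0 : ℝ) hδ] with t ht using hαc t ht)
  have := (hα 0 hmem0).unique hd0
  rw [hα0] at this
  exact hDp (hD p (congrArg Prod.fst this) (congrArg Prod.snd this))

/-- If the Jacobian vanishes identically, the Hamiltonian field of the first component is tangent to
the fibers, hence zero. Then so is that of the second component, and every field is tangent to the
fibers. -/
theorem GenInj.jac_ne_zero {φ : GermMap (ℂ × ℂ)} (hφ : φ.GenInj) : φ.jac ≠ 0 := by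
  intro hJ
  unfold jac at hJ
  have h1 := hφ.eq_zero_of_tangent (v := -dy φ.fst) (w := dx φ.fst) (by ring)
    (by linear_combination hJ)
  have h2 := hφ.eq_zero_of_tangent (v := 1) (w := 0) (by linear_combination h1.2)
  have h3 := hφ.eq_zero_of_tangent (v := -dy φ.snd) (w := dx φ.snd)
    (by rw [h1.2, neg_eq_zero.1 h1.1]; ring) (by ring)
  exact one_ne_zero (h2 (by rw [h3.2]; ring)).1

/-- The map is a local homeomorphism off its critical set. -/
theorem map_nhds_eq (φ : GermMap (ℂ × ℂ)) :
    ∀ᶠ p in 𝓝 0, φ.jac p ≠ 0 → map φ (𝓝 p) = 𝓝 (φ p) := by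
  filter_upwards [φ.analyticAt.eventually_analyticAt, φ.det_fderiv] with p h1 h2 h3
  rw [← h2] at h3
  refine HasStrictFDerivAt.map_nhds_eq_of_equiv
    (f' := (fderiv ℂ φ p).toContinuousLinearEquivOfDetNeZero h3) ?_
  rw [ContinuousLinearMap.coe_toContinuousLinearEquivOfDetNeZero]
  exact h1.hasStrictFDerivAt

/-- A generically injective germ is injective off its critical set. -/
theorem GenInj.injOn {φ : GermMap (ℂ × ℂ)} (hφ : φ.GenInj) :
    ∃ U ∈ 𝓝 (0 : ℂ × ℂ), Set.InjOn φ {p | p ∈ U ∧ φ.jac p ≠ 0} := by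
  obtain ⟨h, h0, U, hU, hinj⟩ := hφ
  have hfacts : ∀ᶠ p in 𝓝 (0 : ℂ × ℂ), p ∈ U ∧ AnalyticAt ℂ φ.jac p ∧ AnalyticAt ℂ φ p ∧
      AnalyticAt ℂ h p ∧ (φ.jac p ≠ 0 → map φ (𝓝 p) = 𝓝 (φ p)) ∧ ∃ᶠ q in 𝓝 p, h q ≠ 0 := by
    filter_upwards [hU, φ.jac.analyticAt.eventually_analyticAt, φ.analyticAt.eventually_analyticAt,
      h.analyticAt.eventually_analyticAt, φ.map_nhds_eq, eventually_frequently_ne_zero h0]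
      with p h1 h2 h3 h4 h5 h6 using ⟨h1, h2, h3, h4, h5, h6⟩
  obtain ⟨r, hr, hB⟩ := eventually_nhds_iff_ball.1 hfacts
  refine ⟨ball 0 r, ball_mem_nhds _ hr, ?_⟩
  rintro p ⟨hp, hpJ⟩ q ⟨hq, hqJ⟩ hpq
  by_contra hne
  obtain ⟨A, B, hA, hB', hpA, hqB, hAB⟩ := t2_separation hne
  have hnhd : ∀ {p A}, p ∈ ball (0 : ℂ × ℂ) r → φ.jac p ≠ 0 → IsOpen A → p ∈ A →
      ∀ᶠ z in 𝓝 p, z ∈ A ∧ z ∈ ball (0 : ℂ × ℂ) r ∧ φ.jac z ≠ 0 := fun hp hJ hA hpA =>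
    (hA.eventually_mem hpA).and ((isOpen_ball.eventually_mem hp).and
      ((hB _ hp).2.1.continuousAt.eventually_ne hJ))
  have hNp := hnhd hp hpJ hA hpA
  have hNq := hnhd hq hqJ hB' hqB
  -- A coincidence φ(p) = φ(q) at noncritical points persists under perturbation, since φ is open
  -- there. The first perturbation moves p off h = 0; a second one moves q off h = 0 while keeping
  -- the partner of p off it.
  have h1 : ∀ᶠ z in 𝓝 p, φ z ∈ φ '' {z | z ∈ B ∧ z ∈ ball (0 : ℂ × ℂ) r ∧ φ.jac z ≠ 0} := by
    have : φ '' {z | z ∈ B ∧ z ∈ ball (0 : ℂ × ℂ) r ∧ φ.jac z ≠ 0} ∈ 𝓝 (φ p) := by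
      rw [hpq, ← (hB q hq).2.2.2.2.1 hqJ]
      exact image_mem_map hNq
    exact (hB p hp).2.2.1.continuousAt.eventually this
  obtain ⟨p', hp'h, ⟨hp'A, hp'r, hp'J⟩, q', ⟨hq'B, hq'r, hq'J⟩, hpq'⟩ :=
    ((hB p hp).2.2.2.2.2.and_eventually (hNp.and h1)).exists
  have h2 : ∀ᶠ z in 𝓝 q', φ z ∈ φ '' {z | z ∈ A ∧ z ∈ ball (0 : ℂ × ℂ) r ∧ h z ≠ 0} := by
    have : φ '' {z | z ∈ A ∧ z ∈ ball (0 : ℂ × ℂ) r ∧ h z ≠ 0} ∈ 𝓝 (φ q') := by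
      rw [hpq', ← (hB p' hp'r).2.2.2.2.1 hp'J]
      exact image_mem_map ((hA.eventually_mem hp'A).and ((isOpen_ball.eventually_mem hp'r).and
        ((hB _ hp'r).2.2.2.1.continuousAt.eventually_ne hp'h)))
    exact (hB q' hq'r).2.2.1.continuousAt.eventually this
  obtain ⟨q'', hq''h, ⟨hq''B, hq''r, -⟩, p'', ⟨hp''A, hp''r, hp''h⟩, heq⟩ :=
    ((hB q' hq'r).2.2.2.2.2.and_eventually ((hnhd hq'r hq'J hB' hq'B).and h2)).exists
  have := hinj ⟨(hB p'' hp''r).1, hp''h⟩ ⟨(hB q'' hq''r).1, hq''h⟩ heq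
  exact Set.disjoint_left.1 hAB hp''A (this ▸ hq''B)

end GermMap

end

/-! ### Inverting the map along arcs, and divisibility between its components. -/

noncomputable section

open Metric AnalyticGerm

theorem isPreconnected_punctured_ball {δ : ℝ} (hδ : 0 < δ) :
    IsPreconnected {s : ℂ | s ≠ 0 ∧ ‖s‖ < δ} := by
  have h1 : {s : ℂ | s ≠ 0 ∧ ‖s‖ < δ} = Complex.exp '' {z : ℂ | z.re < Real.log δ} := by
    ext s
    constructor
    · rintro ⟨h0, hs⟩
      refine ⟨Complex.log s, ?_, Complex.exp_log h0⟩
      simpa [Complex.log_re] using Real.log_lt_log (norm_pos_iff.2 h0) hs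
    · rintro ⟨z, hz, rfl⟩
      refine ⟨Complex.exp_ne_zero z, ?_⟩
      rw [Complex.norm_exp]
      exact (Real.lt_log_iff_exp_lt hδ).1 hz
  rw [h1]
  exact (convex_halfSpace_re_lt _).isPreconnected.image _ Complex.continuous_exp.continuousOn

namespace GermMap

/-- Bundle a holomorphic map fixing the origin as a map germ. -/
def ofAnalytic {E : Type*} [NormedAddCommGroup E] [NormedSpace ℂ E] (γ : E → ℂ × ℂ)
    (hγ : AnalyticAt ℂ γ 0) (h0 : γ 0 = 0) : GermMap E where
  fst := AnalyticGerm.mk (fun s => (γ s).1) (AnalyticAt.fun_comp (g := Prod.fst) analyticAt_fst hγ)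
  snd := AnalyticGerm.mk (fun s => (γ s).2) (AnalyticAt.fun_comp (g := Prod.snd) analyticAt_snd hγ)
  ev_fst := by rw [ev_mk, h0]; rfl
  ev_snd := by rw [ev_mk, h0]; rfl

theorem ofAnalytic_apply {E : Type*} [NormedAddCommGroup E] [NormedSpace ℂ E] (γ : E → ℂ × ℂ)
    (hγ : AnalyticAt ℂ γ 0) (h0 : γ 0 = 0) : ∀ᶠ s in 𝓝 0, ofAnalytic γ hγ h0 s = γ s := by
  filter_upwards [mk_apply (fun s => (γ s).1)
      (AnalyticAt.fun_comp (g := Prod.fst) analyticAt_fst hγ),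
    mk_apply (fun s => (γ s).2) (AnalyticAt.fun_comp (g := Prod.snd) analyticAt_snd hγ)] with s h1 h2
  exact Prod.ext h1 h2

/-- A generically injective germ inverts along a component of the preimage of a line not
contained in the critical set. -/
theorem GenInj.exists_arc {φ : GermMap (ℂ × ℂ)} (hφ : φ.GenInj) {c : ℂ} {h k P : O₂}
    (hP : φ.snd - AnalyticGerm.C c * φ.fst = h * P) (hh : φ.fst = h * k) (hev : ev P = 0) (hP0 : P ≠ 0)
    (hcop : IsRelPrime P (φ.fst * φ.jac)) :
    ∃ γ : GermMap ℂ, γ.pull φ.fst = T ∧ γ.pull φ.snd = AnalyticGerm.C c * T := by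
  obtain ⟨U, hU, hinj⟩ := hφ.injOn
  have hfacts : ∀ᶠ p in 𝓝 (0 : ℂ × ℂ), p ∈ U ∧ (P p = 0 → φ.fst p = 0 → p = 0) ∧
      (P p = 0 → φ.jac p = 0 → p = 0) ∧ AnalyticAt ℂ φ p ∧ AnalyticAt ℂ P p ∧ AnalyticAt ℂ h p ∧
      φ.snd p - c * φ.fst p = h p * P p ∧ φ.fst p = h p * k p ∧ (fderiv ℂ φ p).det = φ.jac p := by
    have e1 : ∀ᶠ p in 𝓝 0, (φ.snd - AnalyticGerm.C c * φ.fst : O₂) p = (h * P : O₂) p := by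
      rw [hP]; simp
    have e2 : ∀ᶠ p in 𝓝 0, φ.fst p = (h * k : O₂) p := by rw [← hh]; simp
    filter_upwards [hU, eventually_eq_zero_of_isRelPrime hP0 hcop.of_mul_right_left,
      eventually_eq_zero_of_isRelPrime hP0 hcop.of_mul_right_right,
      φ.analyticAt.eventually_analyticAt, P.analyticAt.eventually_analyticAt,
      h.analyticAt.eventually_analyticAt, e1, e2, AnalyticGerm.sub_apply φ.snd (AnalyticGerm.C c * φ.fst),
      AnalyticGerm.mul_apply (AnalyticGerm.C c) φ.fst, C_apply c, AnalyticGerm.mul_apply h P,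
      AnalyticGerm.mul_apply h k, φ.det_fderiv]
      with p h1 h2 h3 h4 h5 h6 h7 h8 h9 h10 h11 h12 h13 h14
    refine ⟨h1, h2, h3, h4, h5, h6, ?_, ?_, h14⟩
    · rw [← h12, ← h7, h9, h10, h11]
    · rw [h8, h13]
  obtain ⟨R, hR, hB⟩ := eventually_nhds_iff_ball.1 hfacts
  set ρ := R / 2 with hρ
  have hρ0 : 0 < ρ := by positivity
  have hKB : closedBall (0 : ℂ × ℂ) ρ ⊆ ball 0 R := closedBall_subset_ball (half_lt_self hR)
  -- On this compact piece of the curve the second component is c times the first, and only the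
  -- origin can be critical or have first component 0.
  set Z := {p ∈ closedBall (0 : ℂ × ℂ) ρ | P p = 0} with hZ
  have hZB : Z ⊆ ball 0 R := fun p hp => hKB hp.1
  have hfc : ContinuousOn φ.fst (closedBall (0 : ℂ × ℂ) ρ) := fun p hp =>
    (continuous_fst.continuousAt.comp (hB p (hKB hp)).2.2.2.1.continuousAt).continuousWithinAt
  have hZc : IsCompact Z := by
    have : IsClosed Z := by
      have := ContinuousOn.preimage_isClosed_of_isClosed
        (f := P) (s := closedBall (0 : ℂ × ℂ) ρ) (t := {0})
        (fun p hp => (hB p (hKB hp)).2.2.2.2.1.continuousAt.continuousWithinAt)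
        isClosed_closedBall isClosed_singleton
      exact this
    exact (isCompact_closedBall 0 ρ).of_isClosed_subset this fun p hp => hp.1
  have hf0 : φ.fst 0 = 0 := φ.ev_fst
  -- The first component is bounded away from 0 on the part of Z on the boundary sphere, so Z is
  -- proper over the disc of radius δ.
  obtain ⟨δ, hδ, hδs⟩ : ∃ δ > 0, ∀ p ∈ Z, ‖φ.fst p‖ < δ → ‖p‖ < ρ := by
    have hcl : IsClosed (φ.fst '' (Z ∩ sphere 0 ρ)) :=
      ((hZc.inter_right isClosed_sphere).image_of_continuousOn
        (hfc.mono fun p hp => hp.1.1)).isClosed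
    have h0 : (0 : ℂ) ∈ (φ.fst '' (Z ∩ sphere 0 ρ))ᶜ := by
      rintro ⟨p, ⟨hp, hps⟩, hp0⟩
      have := (hB p (hZB hp)).2.1 hp.2 hp0
      rw [this, mem_sphere_zero_iff_norm, norm_zero] at hps
      exact hρ0.ne hps
    obtain ⟨δ, hδ, hsub⟩ := Metric.isOpen_iff.1 hcl.isOpen_compl 0 h0
    refine ⟨δ, hδ, fun p hp hlt => ?_⟩
    have h1 : ‖p‖ ≤ ρ := by simpa using hp.1
    refine lt_of_le_of_ne h1 fun h2 => hsub (mem_ball_zero_iff.2 hlt) ⟨p, ⟨hp, ?_⟩, rfl⟩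
    simpa using h2
  have hgZ : ∀ p ∈ Z, φ.snd p = c * φ.fst p := fun p hp => by
    have := (hB p (hZB hp)).2.2.2.2.2.2.1
    rw [hp.2, mul_zero, sub_eq_zero] at this
    exact this
  have hne0 : ∀ p ∈ Z, φ.fst p ≠ 0 → p ≠ 0 := fun p _ hp h0 => hp (h0 ▸ hf0)
  have hJZ : ∀ p ∈ Z, φ.fst p ≠ 0 → φ.jac p ≠ 0 := fun p hp hp0 hJ =>
    hne0 p hp hp0 ((hB p (hZB hp)).2.2.1 hp.2 hJ)
  have hloc : ∀ q ∈ Z, φ.fst q ≠ 0 → ‖φ.fst q‖ < δ → ∃ σ : ℂ → ℂ × ℂ,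
      DifferentiableAt ℂ σ (φ.fst q) ∧ ∀ᶠ s in 𝓝 (φ.fst q), σ s ∈ Z ∧ φ.fst (σ s) = s := by
    intro q hq hq0 hqδ
    obtain ⟨-, -, -, hφq, hPq, hhq, hgq, hfk, hdet⟩ := hB q (hZB hq)
    have hdet0 : (fderiv ℂ φ q).det ≠ 0 := by rw [hdet]; exact hJZ q hq hq0
    have hst : HasStrictFDerivAt φ
        (((fderiv ℂ φ q).toContinuousLinearEquivOfDetNeZero hdet0 :
          (ℂ × ℂ) ≃L[ℂ] (ℂ × ℂ)) : ℂ × ℂ →L[ℂ] ℂ × ℂ) q := by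
      rw [ContinuousLinearMap.coe_toContinuousLinearEquivOfDetNeZero]
      exact hφq.hasStrictFDerivAt
    set τ := hst.localInverse φ _ q with hτ
    have hφq' : φ q = (φ.fst q, c * φ.fst q) := Prod.ext rfl (hgZ q hq)
    have hτq : τ (φ q) = q := hst.localInverse_apply_image
    have hτd : DifferentiableAt ℂ τ (φ q) := hst.to_localInverse.differentiableAt
    have hline : Tendsto (fun s : ℂ => (s, c * s)) (𝓝 (φ.fst q)) (𝓝 (φ q)) := by
      rw [hφq']
      exact Continuous.tendsto (by fun_prop) _
    refine ⟨fun s => τ (s, c * s), ?_, ?_⟩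
    · rw [hφq'] at hτd
      exact DifferentiableAt.fun_comp' (f := fun s : ℂ => (s, c * s)) _ hτd (by fun_prop)
    · have hτc : Tendsto τ (𝓝 (φ q)) (𝓝 q) := by
        have := hτd.continuousAt
        rwa [ContinuousAt, hτq] at this
      have hh0 : h q ≠ 0 := fun h0 => hq0 (by rw [hfk, h0, zero_mul])
      have hin : ∀ᶠ p in 𝓝 q, p ∈ ball (0 : ℂ × ℂ) ρ ∧ h p ≠ 0 :=
        (isOpen_ball.eventually_mem (by simpa using hδs q hq hqδ)).and
          (hhq.continuousAt.eventually_ne hh0)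
      filter_upwards [hline.eventually (hτc.eventually hin),
        hline.eventually hst.eventually_right_inverse] with s h1 h2
      have h3 : φ.fst (τ (s, c * s)) = s := congrArg Prod.fst h2
      have h4 : φ.snd (τ (s, c * s)) = c * s := congrArg Prod.snd h2
      refine ⟨⟨ball_subset_closedBall h1.1, ?_⟩, h3⟩
      have h5 := (hB _ (hKB (ball_subset_closedBall h1.1))).2.2.2.2.2.2.1
      rw [h3, h4, sub_self] at h5
      exact (mul_eq_zero.1 h5.symm).resolve_left h1.2
  -- The image is closed by compactness, open over the punctured disc by the local inverses, and
  -- meets it because zeros of P are not isolated. The punctured disc is connected.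
  have hW : {s : ℂ | s ≠ 0 ∧ ‖s‖ < δ} ⊆ φ.fst '' Z := by
    have hint : ∀ s, s ≠ 0 → ‖s‖ < δ → s ∈ φ.fst '' Z → s ∈ interior (φ.fst '' Z) := by
      rintro _ h0 hs ⟨q, hq, rfl⟩
      obtain ⟨σ, -, hσ⟩ := hloc q hq h0 hs
      rw [mem_interior_iff_mem_nhds]
      filter_upwards [hσ] with s hs using ⟨σ s, hs.1, hs.2⟩
    have hcl : IsClosed (φ.fst '' Z) :=
      (hZc.image_of_continuousOn (hfc.mono fun p hp => hp.1)).isClosed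
    refine ((isPreconnected_punctured_ball hδ).subset_of_closure_inter_subset isOpen_interior ?_
      ?_).trans interior_subset
    · have hsm : ∀ᶠ p in 𝓝[≠] (0 : ℂ × ℂ), p ∈ ball (0 : ℂ × ℂ) ρ ∧ ‖φ.fst p‖ < δ ∧ p ≠ 0 := by
        refine ((isOpen_ball.eventually_mem (mem_ball_self hρ0)).filter_mono
          nhdsWithin_le_nhds).and ((Eventually.filter_mono nhdsWithin_le_nhds ?_).and
            self_mem_nhdsWithin)
        refine φ.fst.analyticAt.continuousAt.norm.eventually (gt_mem_nhds ?_)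
        simpa [hf0] using hδ
      obtain ⟨p, hpP, hpρ, hpδ, hp0⟩ := ((frequently_apply_eq_zero hev).and_eventually hsm).exists
      have hpZ : p ∈ Z := ⟨ball_subset_closedBall hpρ, hpP⟩
      have hfp : φ.fst p ≠ 0 := fun h => hp0 ((hB p (hZB hpZ)).2.1 hpP h)
      exact ⟨φ.fst p, ⟨hfp, hpδ⟩, hint _ hfp hpδ ⟨p, hpZ, rfl⟩⟩
    · rintro s ⟨hs, hs0, hsδ⟩
      exact hint s hs0 hsδ ((closure_mono interior_subset |>.trans hcl.closure_eq.le) hs)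
  have huniq : ∀ p ∈ Z, ∀ q ∈ Z, φ.fst p ≠ 0 → φ.fst p = φ.fst q → p = q := fun p hp q hq h0 he =>
    hinj ⟨(hB p (hZB hp)).1, hJZ p hp h0⟩ ⟨(hB q (hZB hq)).1, hJZ q hq (he ▸ h0)⟩
      (Prod.ext he (by
        change φ.snd p = φ.snd q
        rw [hgZ p hp, hgZ q hq, he]))
  have hex : ∀ s : ℂ, ∃ q, s ≠ 0 → ‖s‖ < δ → q ∈ Z ∧ φ.fst q = s := fun s => by
    by_cases hs : s ≠ 0 ∧ ‖s‖ < δ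
    · obtain ⟨q, hq, hqs⟩ := hW hs
      exact ⟨q, fun _ _ => ⟨hq, hqs⟩⟩
    · exact ⟨0, fun h1 h2 => absurd ⟨h1, h2⟩ hs⟩
  choose g hg using hex
  have hgd : DifferentiableOn ℂ g (ball 0 δ \ {0}) := by
    rintro s ⟨hs, hs0⟩
    rw [mem_ball_zero_iff] at hs
    obtain ⟨hgZ', hgs⟩ := hg s hs0 hs
    obtain ⟨σ, hσd, hσ⟩ := hloc (g s) hgZ' (by rw [hgs]; exact hs0) (by rwa [hgs])
    rw [hgs] at hσd hσ
    refine (hσd.congr_of_eventuallyEq ?_).differentiableWithinAt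
    filter_upwards [hσ, isOpen_ball.eventually_mem (mem_ball_zero_iff.2 hs),
      isOpen_ne.eventually_mem hs0] with z h1 h2 h3
    have h4 := hg z h3 (mem_ball_zero_iff.1 h2)
    exact huniq _ h4.1 _ h1.1 (by rw [h4.2]; exact h3) (by rw [h4.2, h1.2])
  have hbdd : BddAbove (norm ∘ g '' (ball 0 δ \ {0})) := by
    refine ⟨ρ, ?_⟩
    rintro _ ⟨s, ⟨hs, hs0⟩, rfl⟩
    simpa using (hg s hs0 (mem_ball_zero_iff.1 hs)).1.1
  -- The inverse branch is single-valued by injectivity and bounded, so the singularity at 0 is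
  -- removable.
  have hd := Complex.differentiableOn_update_limUnder_of_bddAbove (ball_mem_nhds 0 hδ) hgd hbdd
  set γ := Function.update g 0 ((𝓝[≠] 0).limUnder g) with hγ
  have hγs : ∀ s, s ≠ 0 → ‖s‖ < δ → γ s ∈ Z ∧ φ.fst (γ s) = s := fun s h0 hs => by
    rw [hγ, Function.update_of_ne h0]; exact hg s h0 hs
  have hγan : AnalyticAt ℂ γ 0 := hd.analyticAt (ball_mem_nhds 0 hδ)
  have hevn : ∀ᶠ s in 𝓝[≠] (0 : ℂ), γ s ∈ Z ∧ φ.fst (γ s) = s := by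
    rw [eventually_nhdsWithin_iff]
    filter_upwards [ball_mem_nhds (0 : ℂ) hδ] with s hs h0
    exact hγs s h0 (mem_ball_zero_iff.1 hs)
  have hlim : Tendsto γ (𝓝[≠] 0) (𝓝 (γ 0)) :=
    hγan.continuousAt.tendsto.mono_left nhdsWithin_le_nhds
  have hγ0Z : γ 0 ∈ Z := hZc.isClosed.mem_of_tendsto hlim (hevn.mono fun s h => h.1)
  have hγ0f : φ.fst (γ 0) = 0 := by
    have h1 : Tendsto (fun s => φ.fst (γ s)) (𝓝[≠] 0) (𝓝 (φ.fst (γ 0))) :=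
      (continuous_fst.continuousAt.comp (hB _ (hZB hγ0Z)).2.2.2.1.continuousAt).tendsto.comp hlim
    have h2 : Tendsto (fun s => φ.fst (γ s)) (𝓝[≠] 0) (𝓝 0) :=
      (tendsto_id.mono_left nhdsWithin_le_nhds).congr' (hevn.mono fun s h => h.2.symm)
    exact tendsto_nhds_unique h1 h2
  have hγ0 : γ 0 = 0 := (hB _ (hZB hγ0Z)).2.1 hγ0Z.2 hγ0f
  have hfin : ∀ᶠ s in 𝓝 (0 : ℂ), φ.fst (γ s) = s ∧ φ.snd (γ s) = c * s := by
    filter_upwards [ball_mem_nhds (0 : ℂ) hδ] with s hs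
    have : γ s ∈ Z ∧ φ.fst (γ s) = s := by
      by_cases h0 : s = 0
      · rw [h0]; exact ⟨hγ0Z, hγ0f⟩
      · exact hγs s h0 (mem_ball_zero_iff.1 hs)
    exact ⟨this.2, by rw [hgZ _ this.1, this.2]⟩
  refine ⟨ofAnalytic γ hγan hγ0, AnalyticGerm.ext ?_, AnalyticGerm.ext ?_⟩
  · filter_upwards [pull_apply (ofAnalytic γ hγan hγ0) φ.fst, ofAnalytic_apply γ hγan hγ0, hfin,
      T_apply] with s h1 h2 h3 h4
    rw [h1, h2, h3.1, h4]
  · filter_upwards [pull_apply (ofAnalytic γ hγan hγ0) φ.snd, ofAnalytic_apply γ hγan hγ0, hfin,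
      T_apply, AnalyticGerm.mul_apply (AnalyticGerm.C c) T, C_apply c] with s h1 h2 h3 h4 h5 h6
    rw [h1, h2, h3.2, h5, h4, h6]

/-- Differentiating φ along the arcs at 0 puts the independent vectors (1, c) and (1, c') in the
image of Dφ(0). -/
theorem ev_jac_ne_zero_of_arcs {φ : GermMap (ℂ × ℂ)} {γ γ' : GermMap ℂ} {c c' : ℂ} (hc : c ≠ c')
    (h1 : γ.pull φ.fst = T) (h2 : γ.pull φ.snd = AnalyticGerm.C c * T) (h3 : γ'.pull φ.fst = T)
    (h4 : γ'.pull φ.snd = AnalyticGerm.C c' * T) : ev φ.jac ≠ 0 := by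
  have key : ∀ (γ : GermMap ℂ) (a : O₂), ev (der (γ.pull a)) =
      ev (dx a) * ev (der γ.fst) + ev (dy a) * ev (der γ.snd) := fun γ a => by
    unfold der
    rw [dirDeriv_pull]; simp
  have e1 := key γ φ.fst
  have e2 := key γ φ.snd
  have e3 := key γ' φ.fst
  have e4 := key γ' φ.snd
  rw [h1, der_T, map_one] at e1
  rw [h3, der_T, map_one] at e3
  rw [h2, Derivation.leibniz, der_T, der_C] at e2
  rw [h4, Derivation.leibniz, der_T, der_C] at e4
  simp only [smul_eq_mul, mul_one, mul_zero, add_zero, ev_C] at e2 e4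
  intro h
  apply hc
  have hJ : ev (dx φ.fst) * ev (dy φ.snd) - ev (dy φ.fst) * ev (dx φ.snd) = 0 := by
    rw [← h]; simp [jac]
  rw [e2, e4]
  linear_combination
    (ev (dx φ.snd) * ev (der γ.fst) + ev (dy φ.snd) * ev (der γ.snd)) * e3
    - (ev (dx φ.snd) * ev (der γ'.fst) + ev (dy φ.snd) * ev (der γ'.snd)) * e1
    - (ev (der γ.fst) * ev (der γ'.snd) - ev (der γ'.fst) * ev (der γ.snd)) * hJ

/-- The two components of a critical generically injective germ divide one another. -/
theorem GenInj.dvd_or_dvd {φ : GermMap (ℂ × ℂ)} (hφ : φ.GenInj) (hJ : ev φ.jac = 0) :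
    φ.fst ∣ φ.snd ∨ φ.snd ∣ φ.fst := by
  have hJ0 := hφ.jac_ne_zero
  have hf0 : φ.fst ≠ 0 := fun h => hJ0 (by simp [jac, h])
  obtain ⟨f', g', h, hcop, hf, hg⟩ := UniqueFactorizationMonoid.exists_reduced_factors _ hf0 φ.snd
  by_cases hfu : IsUnit f'
  · left
    rw [← hf, ← hg]
    exact mul_dvd_mul_left _ hfu.dvd
  by_cases hgu : IsUnit g'
  · right
    rw [← hf, ← hg]
    exact mul_dvd_mul_left _ hgu.dvd
  exfalso
  set q := φ.fst * φ.jac with hq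
  have hq0 : q ≠ 0 := mul_ne_zero hf0 hJ0
  have hqu : ¬ IsUnit q := by rw [not_isUnit_iff, hq, map_mul, φ.ev_fst, zero_mul]
  let P : ℂ → O₂ := fun c => g' - AnalyticGerm.C c * f'
  -- The bad slopes are finitely many: each picks a prime factor of q dividing P c. A prime dividing
  -- two different P c would divide both f' and g'.
  let S : Set ℂ := {c | ¬ IsRelPrime (P c) q}
  have hS : S.Finite := by
    have hex : ∀ c ∈ S, ∃ p ∈ UniqueFactorizationMonoid.factors q, p ∣ P c := by
      intro c hc
      by_contra hall
      push Not at hall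
      refine hc (WfDvdMonoid.isRelPrime_of_no_irreducible_factors (fun h => hq0 h.2) ?_)
      intro z hz hzP hzq
      obtain ⟨p, hp, hpz⟩ := UniqueFactorizationMonoid.exists_mem_factors_of_dvd hq0 hz hzq
      exact hall p hp (hpz.symm.dvd.trans hzP)
    choose! p hp hpd using hex
    classical
    refine Set.Finite.of_injOn (f := p)
      (t := ((UniqueFactorizationMonoid.factors q).toFinset : Set O₂)) (fun c hc => ?_)
      (fun c hc c' hc' he => ?_) (Finset.finite_toSet _)
    · exact Finset.mem_coe.2 (Multiset.mem_toFinset.2 (hp c hc))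
    · by_contra hne
      have hprime := UniqueFactorizationMonoid.prime_of_factor _ (hp c hc)
      have h1 := hpd c hc
      have h2 := hpd c' hc'
      rw [← he] at h2
      have h3 : p c ∣ f' := by
        have h4 := dvd_sub h1 h2
        have h5 : P c - P c' = AnalyticGerm.C (c' - c) * f' := by simp only [P, map_sub]; ring
        rw [h5] at h4
        exact (isUnit_C (sub_ne_zero.2 (Ne.symm hne))).dvd_mul_left.1 h4
      have h4 : p c ∣ g' := by
        have : g' = P c + AnalyticGerm.C c * f' := by simp only [P]; ring
        rw [this]
        exact dvd_add h1 (h3.mul_left _)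
      exact hprime.not_isUnit (hcop h3 h4)
  have harc : ∀ c ∉ S, ∃ γ : GermMap ℂ, γ.pull φ.fst = T ∧
      γ.pull φ.snd = AnalyticGerm.C c * T := fun c hc => by
    have hc' : IsRelPrime (P c) q := not_not.1 hc
    refine hφ.exists_arc (h := h) (k := f') (P := P c) ?_ hf.symm ?_ ?_ hc'
    · simp only [P]; rw [← hf, ← hg]; ring
    · simp only [P, map_sub, map_mul, not_isUnit_iff.1 hfu, not_isUnit_iff.1 hgu]; ring
    · intro h0
      rw [h0] at hc'
      exact hqu (hc' (dvd_zero _) dvd_rfl)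
  obtain ⟨c, hc⟩ := hS.infinite_compl.nonempty
  obtain ⟨c', hc', hne⟩ := (hS.infinite_compl.sdiff (Set.finite_singleton c)).nonempty
  obtain ⟨γ, h1, h2⟩ := harc c hc
  obtain ⟨γ', h3, h4⟩ := harc c' hc'
  exact ev_jac_ne_zero_of_arcs (fun h => hne h.symm) h1 h2 h3 h4 hJ

end GermMap

end

/-! ### Monomial form of generically injective germs. -/

noncomputable section

open Metric AnalyticGerm

namespace GermMap

/-- Off the critical set φ is open, so a germ vanishing after substitution vanishes on open sets
arbitrarily close to the origin. -/
theorem pull_injective {φ : GermMap (ℂ × ℂ)} (hJ : φ.jac ≠ 0) : Function.Injective φ.pull := by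
  rw [injective_iff_map_eq_zero]
  intro a ha
  by_contra ha0
  have hev : ∀ᶠ p in 𝓝 0, a (φ p) = 0 := by
    filter_upwards [φ.pull_apply a, AnalyticGerm.eq_zero_iff.1 ha] with p h1 h2
    rw [← h1, h2]
  obtain ⟨p, hpJ, h1, h2, h3⟩ := ((frequently_ne_zero hJ).and_eventually
    (φ.map_nhds_eq.and (hev.eventually_nhds.and
      (φ.tendsto.eventually (eventually_frequently_ne_zero ha0))))).exists
  rw [← h1 hpJ, frequently_map] at h3
  exact h3 (by simpa using h2)

theorem GenInj.of_comp {ψ φ : GermMap (ℂ × ℂ)} (h : (ψ.comp φ).GenInj) : φ.GenInj := by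
  obtain ⟨a, ha, U, hU, hinj⟩ := h
  refine ⟨a, ha, _, inter_mem hU (ψ.comp_apply φ), ?_⟩
  rintro p ⟨⟨hp, hp'⟩, hpa⟩ q ⟨⟨hq, hq'⟩, hqa⟩ hpq
  refine hinj ⟨hp, hpa⟩ ⟨hq, hqa⟩ ?_
  have h1 : (ψ.comp φ) p = ψ (φ p) := hp'
  have h2 : (ψ.comp φ) q = ψ (φ q) := hq'
  rw [h1, h2, hpq]

theorem GenInj.comp {ψ φ : GermMap (ℂ × ℂ)} (hψ : ψ.GenInj) (hφ : φ.GenInj) :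
    (ψ.comp φ).GenInj := by
  obtain ⟨U, hU, hinj⟩ := hφ.injOn
  obtain ⟨V, hV, hinj'⟩ := hψ.injOn
  have hJ := hφ.jac_ne_zero
  refine ⟨φ.jac * φ.pull ψ.jac, mul_ne_zero hJ fun h => hψ.jac_ne_zero
    (pull_injective hJ (by rw [h, _root_.map_zero])), _, inter_mem (inter_mem hU (φ.tendsto hV))
    ((ψ.comp_apply φ).and ((AnalyticGerm.mul_apply φ.jac (φ.pull ψ.jac)).and
      (φ.pull_apply ψ.jac))), ?_⟩
  rintro p ⟨⟨⟨hpU, hpV⟩, hp1, hp2, hp3⟩, hp⟩ q ⟨⟨⟨hqU, hqV⟩, hq1, hq2, hq3⟩, hq⟩ hpq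
  rw [hp2, hp3] at hp
  rw [hq2, hq3] at hq
  rw [hp1, hq1] at hpq
  exact hinj ⟨hpU, left_ne_zero_of_mul hp⟩ ⟨hqU, left_ne_zero_of_mul hq⟩
    (hinj' ⟨hpV, right_ne_zero_of_mul hp⟩ ⟨hqV, right_ne_zero_of_mul hq⟩ hpq)

theorem genInj_id : GenInj id := by
  refine ⟨1, one_ne_zero, _, id_apply, ?_⟩
  rintro p ⟨hp, -⟩ q ⟨hq, -⟩ hpq
  have h1 : id p = p := hp
  have h2 : id q = q := hq
  rw [← h1, ← h2, hpq]

theorem genInj_of_isUnit_jac {φ : GermMap (ℂ × ℂ)} (h : ev φ.jac ≠ 0) : φ.GenInj := by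
  obtain ⟨ψ, -, h2⟩ := exists_localInverse φ h
  exact GenInj.of_comp (ψ := ψ) (h2 ▸ genInj_id)

/-- Exchange of the components. -/
def flip (φ : GermMap (ℂ × ℂ)) : GermMap (ℂ × ℂ) := ⟨φ.snd, φ.fst, φ.ev_snd, φ.ev_fst⟩

@[simp] theorem flip_fst (φ : GermMap (ℂ × ℂ)) : φ.flip.fst = φ.snd := rfl
@[simp] theorem flip_snd (φ : GermMap (ℂ × ℂ)) : φ.flip.snd = φ.fst := rfl

@[simp] theorem jac_flip (φ : GermMap (ℂ × ℂ)) : φ.flip.jac = -φ.jac := by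
  simp only [jac, flip_fst, flip_snd]; ring

theorem GenInj.flip {φ : GermMap (ℂ × ℂ)} (h : φ.GenInj) : φ.flip.GenInj := by
  refine GenInj.of_comp (ψ := (id : GermMap (ℂ × ℂ)).flip) ?_
  have : (GermMap.flip id).comp φ.flip = φ := by
    ext1 <;> simp [GermMap.flip]
  rw [this]; exact h

/-- The components and the Jacobian of `φ` are monomials, up to units, in suitable coordinates. -/
def IsMonomial (φ ψ : GermMap (ℂ × ℂ)) (a b c d i j : ℕ) : Prop :=
  ev ψ.jac ≠ 0 ∧ (∃ u : O₂, IsUnit u ∧ φ.fst = ψ.fst ^ a * ψ.snd ^ b * u) ∧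
    (∃ u : O₂, IsUnit u ∧ φ.snd = ψ.fst ^ c * ψ.snd ^ d * u) ∧
    (∃ u : O₂, IsUnit u ∧ φ.jac = ψ.fst ^ i * ψ.snd ^ j * u) ∧
    (a * d = b * c ∨ a * d = b * c + 1 ∨ b * c = a * d + 1) ∧
    (1 ≤ i → 1 ≤ a ∧ 1 ≤ c) ∧ (1 ≤ j → 1 ≤ b ∧ 1 ≤ d)

theorem IsMonomial.flip {φ ψ : GermMap (ℂ × ℂ)} {a b c d i j : ℕ} (h : IsMonomial φ ψ a b c d i j) :
    IsMonomial φ.flip ψ c d a b i j := by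
  obtain ⟨h0, h1, h2, ⟨u, hu, h3⟩, h4, h5, h6⟩ := h
  refine ⟨h0, h2, h1, ⟨-u, hu.neg, by rw [jac_flip, h3]; ring⟩, ?_, fun h => (h5 h).symm,
    fun h => (h6 h).symm⟩
  rw [mul_comm c b, mul_comm d a]
  omega

/-- If the Jacobian vanishes at 0, one component divides the other. Dividing and subtracting the
value at 0 factors φ through the chart (x, x(y + c)), and the Jacobian of φ is that of the new germ
times the dividing component, a nonunit. The induction is thus on strict divisibility of Jacobians.
-/
theorem GenInj.exists_isMonomial {φ : GermMap (ℂ × ℂ)} (hφ : φ.GenInj) :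
    ∃ ψ a b c d i j, IsMonomial φ ψ a b c d i j := by
  obtain ⟨J, hJ⟩ : ∃ J, Associated φ.jac J := ⟨_, Associated.refl _⟩
  induction J using (IsWellFounded.wf (r := DvdNotUnit (α := O₂))).induction generalizing φ with
  | _ J ih =>
  by_cases hu : ev φ.jac = 0
  swap
  · exact ⟨φ, 1, 0, 0, 1, 0, 0, hu, ⟨1, isUnit_one, by ring⟩, ⟨1, isUnit_one, by ring⟩,
      ⟨φ.jac, isUnit_iff.2 hu, by ring⟩, by simp, by simp, by simp⟩
  have key : ∀ {φ : GermMap (ℂ × ℂ)}, φ.GenInj → Associated φ.jac J → ev φ.jac = 0 →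
      φ.fst ∣ φ.snd → ∃ ψ a b c d i j, IsMonomial φ ψ a b c d i j := by
    intro φ hφ hJ hu ⟨k, hk⟩
    let φ₁ : GermMap (ℂ × ℂ) := ⟨φ.fst, k - AnalyticGerm.C (ev k), φ.ev_fst, by simp⟩
    let F : GermMap (ℂ × ℂ) := ⟨X, X * (Y + AnalyticGerm.C (ev k)), by simp, by simp⟩
    have hF : F.comp φ₁ = φ := by
      ext1
      · simp [F, φ₁]
      · simp [F, φ₁, hk]
    have hφ₁ : φ₁.GenInj := GenInj.of_comp (ψ := F) (hF ▸ hφ)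
    have hjac : φ.jac = φ₁.jac * φ.fst := by
      simp only [jac, hk, φ₁, map_sub, Derivation.leibniz, dx_C, dy_C, smul_eq_mul]; ring
    have hdv : DvdNotUnit φ₁.jac J := by
      obtain ⟨v, hv⟩ := hJ
      refine ⟨hφ₁.jac_ne_zero, φ.fst * v, ?_, by rw [← hv, hjac]; ring⟩
      rw [not_isUnit_iff, map_mul, φ.ev_fst, zero_mul]
    obtain ⟨ψ, a, b, c, d, i, j, h0, ⟨u, hu, h1⟩, ⟨w, hw, h2⟩, ⟨v, hv, h3⟩, h4, h5, h6⟩ :=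
      ih _ hdv hφ₁ (Associated.refl _)
    change φ.fst = _ at h1
    change k - _ = _ at h2
    -- If the quotient k vanishes at 0, the second row of exponents gains the first and the
    -- determinant is unchanged. Otherwise k is a unit, the two rows agree, and the determinant is
    -- 0.
    by_cases hk0 : ev k = 0
    · rw [hk0, _root_.map_zero, sub_zero] at h2
      refine ⟨ψ, a, b, a + c, b + d, a + i, b + j, h0, ⟨u, hu, h1⟩, ⟨u * w, hu.mul hw, ?_⟩,
        ⟨v * u, hv.mul hu, ?_⟩, ?_, fun h => ?_, fun h => ?_⟩
      · rw [hk, h1, h2]; ring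
      · rw [hjac, h3, h1]; ring
      · rw [mul_add, mul_add, mul_comm b a]; omega
      · have : 1 ≤ a := by
          rcases Nat.eq_zero_or_pos i with hi | hi
          · omega
          · exact (h5 hi).1
        omega
      · have : 1 ≤ b := by
          rcases Nat.eq_zero_or_pos j with hi | hi
          · omega
          · exact (h6 hi).1
        omega
    · refine ⟨ψ, a, b, a, b, a + i, b + j, h0, ⟨u, hu, h1⟩, ⟨u * k, hu.mul (isUnit_iff.2 hk0), ?_⟩,
        ⟨v * u, hv.mul hu, ?_⟩, Or.inl (mul_comm _ _), fun h => ?_, fun h => ?_⟩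
      · rw [hk, h1]; ring
      · rw [hjac, h3, h1]; ring
      · have : 1 ≤ a := by
          rcases Nat.eq_zero_or_pos i with hi | hi
          · omega
          · exact (h5 hi).1
        omega
      · have : 1 ≤ b := by
          rcases Nat.eq_zero_or_pos j with hi | hi
          · omega
          · exact (h6 hi).1
        omega
  rcases hφ.dvd_or_dvd hu with h | h
  · exact key hφ hJ hu h
  · obtain ⟨ψ, a, b, c, d, i, j, hm⟩ := key hφ.flip (by
      rw [jac_flip]; exact (Associated.neg_left (Associated.refl _)).trans hJ) (by simp [hu]) h
    exact ⟨ψ, c, d, a, b, i, j, hm.flip⟩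

end GermMap

end

/-! ### Exponentials, primitives, and functional equations for superattracting germs. -/

noncomputable section

open Metric AnalyticGerm

theorem SepHolOn.of_differentiableOn {r m : ℝ} {f : ℂ × ℂ → ℂ}
    (hf : DifferentiableOn ℂ f (ball 0 r)) (hm : ∀ p ∈ ball (0 : ℂ × ℂ) r, ‖f p‖ ≤ m) :
    SepHolOn r r m f := by
  have hmem : ∀ x ∈ ball (0 : ℂ) r, ∀ y ∈ ball (0 : ℂ) r, (x, y) ∈ ball (0 : ℂ × ℂ) r := by
    intro x hx y hy
    rw [mem_ball_zero_iff, Prod.norm_def]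
    exact max_lt (mem_ball_zero_iff.1 hx) (mem_ball_zero_iff.1 hy)
  refine ⟨fun y hy x hx => ?_, fun x hx y hy => ?_, fun x hx y hy => hm _ (hmem x hx y hy)⟩
  · have : DifferentiableAt ℂ f (x, y) := hf.differentiableAt (isOpen_ball.mem_nhds (hmem x hx y hy))
    exact (this.comp x (by fun_prop)).differentiableWithinAt
  · have : DifferentiableAt ℂ f (x, y) := hf.differentiableAt (isOpen_ball.mem_nhds (hmem x hx y hy))
    exact (this.comp y (by fun_prop)).differentiableWithinAt

namespace AnalyticGerm

variable {E E' : Type*} [NormedAddCommGroup E] [NormedSpace ℂ E] [NormedAddCommGroup E']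
  [NormedSpace ℂ E']

theorem exists_norm_le {a : AnalyticGerm E} (ha : ev a = 0) :
    ∃ L ≥ 0, ∀ᶠ p in 𝓝 0, ‖a p‖ ≤ L * ‖p‖ := by
  obtain ⟨L, hL, h⟩ := (a.analyticAt.differentiableAt.isBigO_sub).exists_nonneg
  refine ⟨L, hL, h.bound.mono fun p hp => ?_⟩
  have h0 : a 0 = 0 := ha
  simpa [h0] using hp

/-- The exponential of a germ. -/
def exp (a : AnalyticGerm E) : AnalyticGerm E := mk (fun p => Complex.exp (a p)) a.analyticAt.cexp

theorem exp_apply (a : AnalyticGerm E) : ∀ᶠ p in 𝓝 0, exp a p = Complex.exp (a p) := mk_apply _ _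

@[simp] theorem ev_exp (a : AnalyticGerm E) : ev (exp a) = Complex.exp (ev a) := ev_mk _ _

theorem isUnit_exp (a : AnalyticGerm E) : IsUnit (exp a) := by
  rw [isUnit_iff, ev_exp]; exact Complex.exp_ne_zero _

theorem exp_add (a b : AnalyticGerm E) : exp (a + b) = exp a * exp b := by
  refine ext ?_
  filter_upwards [exp_apply (a + b), exp_apply a, exp_apply b, mul_apply (exp a) (exp b),
    add_apply a b] with p h1 h2 h3 h4 h5
  rw [h1, h4, h2, h3, h5, Complex.exp_add]

theorem exp_C (c : ℂ) : exp (C c : AnalyticGerm E) = C (Complex.exp c) := by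
  refine ext ?_
  filter_upwards [exp_apply (C c : AnalyticGerm E), C_apply (E := E) c,
    C_apply (E := E) (Complex.exp c)] with p h1 h2 h3
  rw [h1, h2, h3]

@[simp] theorem exp_zero : exp (0 : AnalyticGerm E) = 1 := by
  rw [← map_zero C, exp_C, Complex.exp_zero, map_one]

theorem exp_nat_mul (n : ℕ) (a : AnalyticGerm E) : exp ((n : AnalyticGerm E) * a) = exp a ^ n := by
  induction n with
  | zero => simp
  | succ n ih => rw [Nat.cast_succ, add_mul, one_mul, exp_add, ih, pow_succ]

theorem pullback_exp (φ : E → E') (hφ : AnalyticAt ℂ φ 0) (h0 : φ 0 = 0) (a : AnalyticGerm E') :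
    pullback φ hφ h0 (exp a) = exp (pullback φ hφ h0 a) := by
  have ht : Tendsto φ (𝓝 0) (𝓝 0) := by
    have := hφ.continuousAt.tendsto
    rwa [h0] at this
  refine ext ?_
  filter_upwards [pullback_apply φ hφ h0 (exp a), exp_apply (pullback φ hφ h0 a),
    pullback_apply φ hφ h0 a, ht.eventually (exp_apply a)] with p h1 h2 h3 h4
  rw [h1, h2, h3, h4]

theorem dirDeriv_exp (v : E) (a : AnalyticGerm E) : dirDeriv v (exp a) = exp a * dirDeriv v a := by
  refine ext ?_
  filter_upwards [dirDeriv_apply v (exp a), (exp_apply a).eventually_nhds, dirDeriv_apply v a,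
    mul_apply (exp a) (dirDeriv v a), a.analyticAt.eventually_analyticAt] with p h1 h2 h3 h4 h5
  have h6 : (exp a).rep =ᶠ[𝓝 p] fun q => Complex.exp (a q) := h2
  rw [h1, h4, h3, h6.fderiv_eq, h6.self_of_nhds, h5.differentiableAt.hasFDerivAt.cexp.fderiv]
  simp

theorem dx_exp (a : O₂) : dx (exp a) = exp a * dx a := dirDeriv_exp _ _
theorem dy_exp (a : O₂) : dy (exp a) = exp a * dy a := dirDeriv_exp _ _

/-- Every unit is a constant times an exponential. -/
theorem exists_eq_C_mul_exp {u : AnalyticGerm E} (hu : IsUnit u) :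
    ∃ a, ev a = 0 ∧ u = C (ev u) * exp a := by
  have hu0 : u 0 ≠ 0 := isUnit_iff.1 hu
  have han : AnalyticAt ℂ (fun p => Complex.log (u p / u 0)) 0 := by
    refine (u.analyticAt.div analyticAt_const hu0).clog ?_
    simp [div_self hu0]
  refine ⟨mk _ han, by rw [ev_mk, div_self hu0, Complex.log_one], ext ?_⟩
  filter_upwards [mul_apply (C (ev u)) (exp (mk _ han)), C_apply (E := E) (ev u),
    exp_apply (mk _ han), mk_apply _ han, u.analyticAt.continuousAt.eventually_ne hu0]
    with p h1 h2 h3 h4 h5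
  rw [h1, h2, h3, h4, Complex.exp_log (div_ne_zero h5 hu0), ev_def]
  field_simp

/-- Every germ is a derivative in the second variable. -/
theorem exists_dy_eq (a : O₂) : ∃ b, dy b = a ∧ resY b = 0 := by
  obtain ⟨r, hr, -, m, hm⟩ := a.analyticAt.exists_sepHolOn univ_mem
  have h00 : (0 : ℂ) ∈ ball (0 : ℂ) r := by simpa using hr
  have hm0 : 0 ≤ m := (norm_nonneg _).trans (hm.bound 0 h00 0 h00)
  let c : ℕ → ℂ → ℂ := fun n x => (shiftSnd^[n] a) (x, 0)
  -- The Taylor series in y integrated termwise. The n-th coefficient is at most m(2/r)^n, so on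
  -- radius r / 4 in y the terms decay like (1/2)^n.
  let f : ℕ → ℂ × ℂ → ℂ := fun n p => p.2 ^ (n + 1) / (n + 1) * c n p.1
  have hcb : ∀ n x, x ∈ ball (0 : ℂ) r → ‖c n x‖ ≤ (2 / r) ^ n * m := fun n x hx =>
    (hm.iterate_shiftSnd hr n).bound x hx 0 h00
  have hcd : ∀ n, DifferentiableOn ℂ (c n) (ball 0 r) := fun n =>
    (hm.iterate_shiftSnd hr n).diff_fst 0 h00
  have hgeom : ∀ n : ℕ, (2 / r) ^ n * (r / 4) ^ n = (1 / 2) ^ n := fun n => by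
    rw [← mul_pow]; congr 1; field_simp; norm_num
  have hf : ∀ n, SepHolOn r (r / 4) ((1 / 2) ^ n * (m * (r / 4))) (f n) := fun n => by
    refine ⟨fun y hy => ?_, fun x hx => ?_, fun x hx y hy => ?_⟩
    · exact (hcd n).const_mul (y ^ (n + 1) / ((n : ℂ) + 1))
    · exact fun y _ => (((hasDerivAt_pow (n + 1) y).div_const ((n : ℂ) + 1)).mul_const
        (c n x)).differentiableAt.differentiableWithinAt
    · have hy' : ‖y‖ ≤ r / 4 := (mem_ball_zero_iff.1 hy).le
      have h1 : ‖y ^ (n + 1) / ((n : ℂ) + 1)‖ ≤ (r / 4) ^ (n + 1) := by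
        rw [norm_div, norm_pow]
        have h2 : (1 : ℝ) ≤ ‖(n : ℂ) + 1‖ := by
          have : ((n : ℂ) + 1) = ((n + 1 : ℕ) : ℂ) := by push_cast; ring
          rw [this, Complex.norm_natCast]
          exact_mod_cast Nat.succ_pos n
        exact (div_le_self (by positivity) h2).trans (by gcongr)
      calc ‖f n (x, y)‖ = ‖y ^ (n + 1) / ((n : ℂ) + 1)‖ * ‖c n x‖ := norm_mul _ _
        _ ≤ (r / 4) ^ (n + 1) * ((2 / r) ^ n * m) := by
            gcongr
            exact hcb n x hx
        _ = (1 / 2) ^ n * (m * (r / 4)) := by rw [← hgeom n]; ring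
  have hsum : Summable fun n : ℕ => (1 / 2 : ℝ) ^ n * (m * (r / 4)) :=
    (summable_geometric_of_lt_one (by norm_num) (by norm_num)).mul_right _
  have hb := SepHolOn.tsum hsum hf
  have hban : AnalyticAt ℂ (fun p => ∑' n, f n p) 0 := hb.analyticAt hr (by positivity)
  have hderiv : ∀ x ∈ ball (0 : ℂ) r, ∀ y ∈ ball (0 : ℂ) (r / 4),
      deriv (fun y => ∑' n, f n (x, y)) y = a (x, y) := by
    intro x hx y hy
    have h1 := Complex.hasSum_deriv_of_summable_norm (F := fun n y => f n (x, y)) hsum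
      (fun n => (hf n).diff_snd x hx) isOpen_ball (fun n w hw => (hf n).bound x hx w hw) hy
    have hy' : ‖y‖ < r / 4 := mem_ball_zero_iff.1 hy
    have h2 : ∀ n, deriv (fun y => f n (x, y)) y = c n x * y ^ n := fun n => by
      have hn : ((n : ℂ) + 1) ≠ 0 := by exact_mod_cast Nat.succ_ne_zero n
      have : HasDerivAt (fun y => f n (x, y)) (((n + 1 : ℕ) : ℂ) * y ^ n / (n + 1) * c n x) y :=
        ((hasDerivAt_pow (n + 1) y).div_const ((n : ℂ) + 1)).mul_const (c n x)
      rw [this.deriv]; push_cast; field_simp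
    simp only [h2] at h1
    refine tendsto_nhds_unique h1.tendsto_sum_nat ?_
    have h3 : ∀ n, ∑ i ∈ Finset.range n, c i x * y ^ i =
        a (x, y) - y ^ n * (shiftSnd^[n] a) (x, y) := fun n => by
      rw [eq_sub_iff_add_eq]
      exact (eq_sum_add_pow_mul_shiftSnd a n (x, y)).symm
    simp only [h3]
    have hyr : y ∈ ball (0 : ℂ) r := ball_subset_ball (by linarith) hy
    have h4 : Tendsto (fun n => y ^ n * (shiftSnd^[n] a) (x, y)) atTop (𝓝 0) := by
      refine squeeze_zero_norm (a := fun n => (1 / 2 : ℝ) ^ n * m) (fun n => ?_) ?_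
      · rw [norm_mul, norm_pow]
        calc ‖y‖ ^ n * ‖(shiftSnd^[n] a) (x, y)‖ ≤ (r / 4) ^ n * ((2 / r) ^ n * m) := by
              gcongr
              exact (hm.iterate_shiftSnd hr n).bound x hx y hyr
          _ = (1 / 2) ^ n * m := by rw [← hgeom n]; ring
      · simpa using (tendsto_pow_atTop_nhds_zero_of_lt_one (r := (1 / 2 : ℝ)) (by norm_num)
          (by norm_num)).mul_const m
    simpa using tendsto_const_nhds.sub h4
  have hmem : ∀ᶠ p in 𝓝 (0 : ℂ × ℂ), p.1 ∈ ball (0 : ℂ) r ∧ p.2 ∈ ball (0 : ℂ) (r / 4) :=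
    (tendsto_fst_zero.eventually (ball_mem_nhds 0 hr)).and
      (tendsto_snd_zero.eventually (ball_mem_nhds 0 (by positivity)))
  refine ⟨mk _ hban, ext ?_, ext ?_⟩
  · filter_upwards [dirDeriv_apply (0, 1) (mk _ hban), (mk_apply _ hban).eventually_nhds, hmem,
      (mk _ hban).analyticAt.eventually_analyticAt] with p h1 h2 h3 h4
    obtain ⟨x, y⟩ := p
    rw [dy, h1, ← hderiv x h3.1 y h3.2]
    have h5 : HasDerivAt (fun y => mk _ hban (x, y)) (fderiv ℂ (mk _ hban) (x, y) (0, 1)) y :=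
      h4.differentiableAt.hasFDerivAt.comp_hasDerivAt y
        ((hasDerivAt_const y x).prodMk (hasDerivAt_id y))
    have h6 : Tendsto (fun y' => (x, y')) (𝓝 y) (𝓝 (x, y)) :=
      Continuous.tendsto (by fun_prop) _
    rw [← h5.deriv]
    exact Filter.EventuallyEq.deriv_eq (h6.eventually h2)
  · filter_upwards [resY_apply (mk _ hban), tendsto_zero_left.eventually (mk_apply _ hban),
      zero_apply (E := ℂ)] with t h1 h2 h3
    rw [h1, h2, h3]
    simp [f]

/-- A germ of order at least two. -/
theorem exists_norm_le_sq {a : O₂} (h0 : ev a = 0) (hx : ev (dx a) = 0) (hy : ev (dy a) = 0) :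
    ∃ K ≥ 0, ∀ᶠ p in 𝓝 0, ‖a p‖ ≤ K * ‖p‖ ^ 2 := by
  obtain ⟨b, hb⟩ := exists_eq_add_Y_mul a
  obtain ⟨c, hc⟩ := T_dvd_iff.2 (show ev (resY a) = 0 by simpa using h0)
  rw [hc, map_mul, inclX_T] at hb
  have hc0 : ev c = 0 := by
    have : ev (dx a) = ev c := by rw [hb]; simp [Derivation.leibniz]
    rw [← this, hx]
  have hb0 : ev b = 0 := by
    have : ev (dy a) = ev b := by rw [hb]; simp [Derivation.leibniz]
    rw [← this, hy]
  obtain ⟨K, hK, h1⟩ := exists_norm_le (a := inclX c) (by simpa using hc0)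
  obtain ⟨L, hL, h2⟩ := exists_norm_le hb0
  refine ⟨K + L, by positivity, ?_⟩
  have hb' : ∀ᶠ p in 𝓝 0, a p = (X * inclX c + Y * b : O₂) p := by
    rw [← hb]; exact Eventually.of_forall fun _ => rfl
  filter_upwards [h1, h2, hb', add_apply (X * inclX c) (Y * b), mul_apply X (inclX c),
    mul_apply Y b, X_apply, Y_apply] with p h3 h4 h5 h6 h7 h8 h9 h10
  rw [h5, h6, h7, h8, h9, h10]
  calc ‖p.1 * inclX c p + p.2 * b p‖ ≤ ‖p.1‖ * ‖inclX c p‖ + ‖p.2‖ * ‖b p‖ := by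
        refine (norm_add_le _ _).trans ?_
        rw [norm_mul, norm_mul]
    _ ≤ ‖p‖ * (K * ‖p‖) + ‖p‖ * (L * ‖p‖) := by
        gcongr
        · exact norm_fst_le p
        · exact norm_snd_le p
    _ = (K + L) * ‖p‖ ^ 2 := by ring

end AnalyticGerm

namespace GermMap

theorem pull_exp {E : Type*} [NormedAddCommGroup E] [NormedSpace ℂ E] (φ : GermMap E) (a : O₂) :
    φ.pull (exp a) = exp (φ.pull a) := pullback_exp _ _ _ _

/-- The differential at the origin vanishes. -/
def IsSuperattracting (φ : GermMap (ℂ × ℂ)) : Prop :=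
  ev (dx φ.fst) = 0 ∧ ev (dy φ.fst) = 0 ∧ ev (dx φ.snd) = 0 ∧ ev (dy φ.snd) = 0

theorem IsSuperattracting.contract {φ : GermMap (ℂ × ℂ)} (h : φ.IsSuperattracting) {ε : ℝ}
    (hε : 0 < ε) : ∀ᶠ p in 𝓝 0, ‖φ p‖ ≤ ε * ‖p‖ := by
  obtain ⟨K, hK, h1⟩ := exists_norm_le_sq φ.ev_fst h.1 h.2.1
  obtain ⟨L, hL, h2⟩ := exists_norm_le_sq φ.ev_snd h.2.2.1 h.2.2.2
  filter_upwards [h1, h2, ball_mem_nhds 0 (show 0 < ε / (K + L + 1) by positivity)] with p h3 h4 h5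
  have h6 : ‖p‖ * (K + L + 1) ≤ ε := by
    rw [mem_ball_zero_iff, lt_div_iff₀ (by positivity)] at h5
    exact h5.le
  have h7 := norm_nonneg p
  have h8 : K * ‖p‖ ^ 2 ≤ ε * ‖p‖ := by nlinarith
  have h9 : L * ‖p‖ ^ 2 ≤ ε * ‖p‖ := by nlinarith
  exact max_le (h3.trans h8) (h4.trans h9)

theorem iterate_bound {ψ : ℂ × ℂ → ℂ × ℂ} {r ε : ℝ} (hε0 : 0 ≤ ε) (hε : ε ≤ 1)
    (h : ∀ p ∈ ball (0 : ℂ × ℂ) r, ‖ψ p‖ ≤ ε * ‖p‖) (n : ℕ) :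
    ∀ p ∈ ball (0 : ℂ × ℂ) r, ψ^[n] p ∈ ball (0 : ℂ × ℂ) r ∧ ‖ψ^[n] p‖ ≤ ε ^ n * ‖p‖ := by
  induction n with
  | zero => intro p hp; simpa using hp
  | succ n ih =>
    intro p hp
    obtain ⟨h1, h2⟩ := ih p hp
    rw [Function.iterate_succ_apply']
    have h3 := h _ h1
    have h4 : ‖ψ (ψ^[n] p)‖ ≤ ε ^ (n + 1) * ‖p‖ := by
      calc _ ≤ ε * ‖ψ^[n] p‖ := h3
        _ ≤ ε * (ε ^ n * ‖p‖) := by gcongr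
        _ = _ := by ring
    refine ⟨?_, h4⟩
    rw [mem_ball_zero_iff] at h1 ⊢
    exact (h3.trans (mul_le_of_le_one_left (norm_nonneg _) hε)).trans_lt h1

/-- Iterating the equation gives D = ν^n D∘ψ^n. Near 0 the map contracts by any chosen ε, here with
|ν|ε ≤ 1/2, and D vanishes at 0, so the right side tends to 0. -/
theorem IsSuperattracting.eq_zero_of_eq_mul_pull {ψ : GermMap (ℂ × ℂ)} (h : ψ.IsSuperattracting)
    {ν : ℂ} {D : O₂} (h0 : ev D = 0) (hD : D = AnalyticGerm.C ν * ψ.pull D) : D = 0 := by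
  obtain ⟨L, hL, hLD⟩ := exists_norm_le h0
  have hε : 0 < 1 / (2 * (‖ν‖ + 1)) := by positivity
  set ε := 1 / (2 * (‖ν‖ + 1)) with hεd
  have hνε : ‖ν‖ * ε ≤ 1 / 2 := by
    rw [hεd, mul_one_div, div_le_div_iff₀ (by positivity) (by norm_num)]; linarith
  have hε1 : ε ≤ 1 := by
    rw [hεd, div_le_one (by positivity)]; linarith [norm_nonneg ν]
  have hD' : ∀ᶠ p in 𝓝 0, D p = ν * D (ψ p) := by
    have : ∀ᶠ p in 𝓝 0, D p = (AnalyticGerm.C ν * ψ.pull D : O₂) p := by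
      rw [← hD]; exact Eventually.of_forall fun _ => rfl
    filter_upwards [this, AnalyticGerm.mul_apply (AnalyticGerm.C ν) (ψ.pull D), C_apply ν,
      ψ.pull_apply D] with p h1 h2 h3 h4
    rw [h1, h2, h3, h4]
  obtain ⟨r, hr, hB⟩ := eventually_nhds_iff_ball.1 ((h.contract hε).and (hLD.and hD'))
  refine AnalyticGerm.eq_zero_iff.2 ?_
  filter_upwards [ball_mem_nhds 0 hr] with p hp
  have hit := iterate_bound hε.le hε1 (fun p hp => (hB p hp).1)
  have h1 : ∀ n : ℕ, D p = ν ^ n * D (ψ^[n] p) := fun n => by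
    induction n with
    | zero => simp
    | succ n ih =>
      rw [ih, (hB _ (hit n p hp).1).2.2, Function.iterate_succ_apply', pow_succ, mul_assoc]
  have h2 : ∀ n : ℕ, ‖D p‖ ≤ (1 / 2) ^ n * (L * ‖p‖) := fun n => by
    rw [h1 n, norm_mul, norm_pow]
    calc ‖ν‖ ^ n * ‖D (ψ^[n] p)‖ ≤ ‖ν‖ ^ n * (L * (ε ^ n * ‖p‖)) := by
          gcongr
          exact (hB _ (hit n p hp).1).2.1.trans (by gcongr; exact (hit n p hp).2)
      _ = (‖ν‖ * ε) ^ n * (L * ‖p‖) := by rw [mul_pow]; ring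
      _ ≤ _ := by gcongr
  have h3 : Tendsto (fun n : ℕ => (1 / 2 : ℝ) ^ n * (L * ‖p‖)) atTop (𝓝 0) := by
    simpa using (tendsto_pow_atTop_nhds_zero_of_lt_one (r := (1 / 2 : ℝ)) (by norm_num)
      (by norm_num)).mul_const (L * ‖p‖)
  exact norm_le_zero_iff.1 (ge_of_tendsto' h3 h2)

/-- The solution is the sum of ν^n l∘ψ^n. Superattraction makes it converge geometrically whatever
the size of ν. -/
theorem IsSuperattracting.exists_eq_add_mul_pull {ψ : GermMap (ℂ × ℂ)} (h : ψ.IsSuperattracting)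
    (ν : ℂ) {l : O₂} (hl : ev l = 0) :
    ∃ H : O₂, ev H = 0 ∧ H = l + AnalyticGerm.C ν * ψ.pull H := by
  obtain ⟨L, hL, hLl⟩ := exists_norm_le hl
  have hε : 0 < 1 / (2 * (‖ν‖ + 1)) := by positivity
  set ε := 1 / (2 * (‖ν‖ + 1)) with hεd
  have hνε : ‖ν‖ * ε ≤ 1 / 2 := by
    rw [hεd, mul_one_div, div_le_div_iff₀ (by positivity) (by norm_num)]; linarith
  have hε1 : ε ≤ 1 := by
    rw [hεd, div_le_one (by positivity)]; linarith [norm_nonneg ν]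
  obtain ⟨r, hr, hB⟩ := eventually_nhds_iff_ball.1 ((h.contract hε).and (hLl.and
    (ψ.analyticAt.eventually_analyticAt.and l.analyticAt.eventually_analyticAt)))
  have hit := iterate_bound hε.le hε1 (fun p hp => (hB p hp).1)
  let f : ℕ → ℂ × ℂ → ℂ := fun n p => ν ^ n * l (ψ^[n] p)
  have hitd : ∀ n, DifferentiableOn ℂ (ψ^[n]) (ball 0 r) := fun n => by
    induction n with
    | zero => exact differentiableOn_id
    | succ n ih =>
      rw [Function.iterate_succ']
      refine DifferentiableOn.comp (t := ball 0 r) (fun p hp => ?_) ih fun p hp => (hit n p hp).1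
      exact (hB p hp).2.2.1.differentiableAt.differentiableWithinAt
  have hbound : ∀ n, ∀ p ∈ ball (0 : ℂ × ℂ) r, ‖f n p‖ ≤ (1 / 2) ^ n * (L * r) := fun n p hp => by
    have hp' : ‖p‖ ≤ r := (mem_ball_zero_iff.1 hp).le
    calc ‖f n p‖ = ‖ν‖ ^ n * ‖l (ψ^[n] p)‖ := by simp [f]
      _ ≤ ‖ν‖ ^ n * (L * (ε ^ n * ‖p‖)) := by
          gcongr
          exact (hB _ (hit n p hp).1).2.1.trans (by gcongr; exact (hit n p hp).2)
      _ = (‖ν‖ * ε) ^ n * (L * ‖p‖) := by rw [mul_pow]; ring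
      _ ≤ _ := by gcongr
  have hsum : Summable fun n : ℕ => (1 / 2 : ℝ) ^ n * (L * r) :=
    (summable_geometric_of_lt_one (by norm_num) (by norm_num)).mul_right _
  have hf : ∀ n, SepHolOn r r ((1 / 2) ^ n * (L * r)) (f n) := fun n => by
    refine SepHolOn.of_differentiableOn ?_ (hbound n)
    refine (differentiableOn_const _).mul (DifferentiableOn.comp (t := ball 0 r) (g := l)
      (fun p hp => (hB p hp).2.2.2.differentiableAt.differentiableWithinAt) (hitd n)
      fun p hp => (hit n p hp).1)
  have hH : AnalyticAt ℂ (fun p => ∑' n, f n p) 0 := (SepHolOn.tsum hsum hf).analyticAt hr hr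
  have h00 : ψ^[0] 0 = 0 := rfl
  have hit0 : ∀ n, ψ^[n] 0 = 0 := fun n => Function.iterate_fixed ψ.map_zero n
  refine ⟨AnalyticGerm.mk _ hH, ?_, AnalyticGerm.ext ?_⟩
  · rw [ev_mk]
    have hl0 : l 0 = 0 := hl
    simp [f, hit0, hl0]
  · filter_upwards [mk_apply _ hH, ψ.tendsto.eventually (mk_apply _ hH), ball_mem_nhds 0 hr,
      AnalyticGerm.add_apply l (AnalyticGerm.C ν * ψ.pull (AnalyticGerm.mk _ hH)),
      AnalyticGerm.mul_apply (AnalyticGerm.C ν) (ψ.pull (AnalyticGerm.mk _ hH)), C_apply ν,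
      ψ.pull_apply (AnalyticGerm.mk _ hH)] with p h1 h2 h3 h4 h5 h6 h7
    rw [h4, h5, h6, h7, h1, h2]
    have hs : Summable fun n => f n p :=
      Summable.of_norm_bounded hsum fun n => hbound n p h3
    rw [hs.tsum_eq_zero_add, ← tsum_mul_left]
    congr 1
    · simp [f]
    · refine tsum_congr fun n => ?_
      simp only [f, Function.iterate_succ_apply, pow_succ]; ring

/-- Solution of a linear functional equation for a germ whose second iterate is superattracting. -/
theorem exists_eq_add_mul_pull {φ : GermMap (ℂ × ℂ)} (h : (φ.comp φ).IsSuperattracting)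
    (μ : ℂ) {l : O₂} (hl : ev l = 0) :
    ∃ H : O₂, ev H = 0 ∧ H = l + AnalyticGerm.C μ * φ.pull H := by
  -- Applying the desired equation twice gives one for φ∘φ. The defect of its solution in the
  -- original equation satisfies the homogeneous equation for φ∘φ, hence vanishes.
  obtain ⟨H, hH0, hH⟩ := h.exists_eq_add_mul_pull (μ * μ)
    (l := l + AnalyticGerm.C μ * φ.pull l) (by simp [hl])
  refine ⟨H, hH0, ?_⟩
  rw [pull_comp, _root_.map_mul] at hH
  have hD := h.eq_zero_of_eq_mul_pull (ν := μ * μ)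
    (D := H - l - AnalyticGerm.C μ * φ.pull H) (by simp [hl, hH0]) (by
      have h2 : φ.pull H = φ.pull l + AnalyticGerm.C μ * φ.pull (φ.pull l) +
          AnalyticGerm.C μ * AnalyticGerm.C μ * φ.pull (φ.pull (φ.pull H)) := by
        conv_lhs => rw [hH]
        simp
      rw [pull_comp, _root_.map_mul]
      simp only [map_sub, _root_.map_mul, pull_C]
      linear_combination hH - AnalyticGerm.C μ * h2)
  linear_combination hD

end GermMap

end

/-! ### One-forms, pullbacks and changes of coordinates. -/

noncomputable section

open Metric AnalyticGerm

namespace AnalyticGerm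

/-- The wedge product of the 1-forms `ω.1 dx + ω.2 dy` and `η.1 dx + η.2 dy`. -/
def wedge (ω η : O₂ × O₂) : O₂ := ω.1 * η.2 - ω.2 * η.1

/-- The exterior derivative of a function. -/
def d (h : O₂) : O₂ × O₂ := (dx h, dy h)

theorem wedge_comm_eq_zero {ω η : O₂ × O₂} (h : wedge ω η = 0) : wedge η ω = 0 := by
  unfold wedge at *; linear_combination -h

theorem wedge_trans {ω η θ : O₂ × O₂} (h1 : wedge ω η = 0) (h2 : wedge η θ = 0) (h : η ≠ 0) :
    wedge ω θ = 0 := by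
  unfold wedge at *
  by_cases h3 : η.1 = 0
  · have h4 : η.2 ≠ 0 := fun h4 => h (Prod.ext h3 h4)
    apply mul_left_cancel₀ h4
    rw [h3] at h1 h2
    linear_combination θ.2 * h1 + ω.2 * h2
  · apply mul_left_cancel₀ h3
    linear_combination θ.1 * h1 + ω.1 * h2

end AnalyticGerm

namespace GermMap

/-- The pullback of the 1-form `ω.1 dx + ω.2 dy`. -/
def pullForm (φ : GermMap (ℂ × ℂ)) (ω : O₂ × O₂) : O₂ × O₂ :=
  (φ.pull ω.1 * dx φ.fst + φ.pull ω.2 * dx φ.snd, φ.pull ω.1 * dy φ.fst + φ.pull ω.2 * dy φ.snd)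

theorem pullForm_d (φ : GermMap (ℂ × ℂ)) (h : O₂) : φ.pullForm (d h) = d (φ.pull h) := by
  simp only [pullForm, d, dx_pull, dy_pull]

theorem pullForm_comp (ψ φ : GermMap (ℂ × ℂ)) (ω : O₂ × O₂) :
    (ψ.comp φ).pullForm ω = φ.pullForm (ψ.pullForm ω) := by
  simp only [pullForm, comp_fst, comp_snd, pull_comp, dx_pull, dy_pull, map_add, map_mul,
    Prod.mk.injEq]
  constructor <;> ring

@[simp] theorem pullForm_id (ω : O₂ × O₂) : id.pullForm ω = ω := by
  simp [pullForm]

theorem wedge_pullForm (φ : GermMap (ℂ × ℂ)) (ω η : O₂ × O₂) :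
    wedge (φ.pullForm ω) (φ.pullForm η) = φ.jac * φ.pull (wedge ω η) := by
  simp only [wedge, pullForm, jac, map_sub, map_mul]; ring

theorem pullForm_ne_zero {φ : GermMap (ℂ × ℂ)} (hJ : φ.jac ≠ 0) {ω : O₂ × O₂} (h : ω ≠ 0) :
    φ.pullForm ω ≠ 0 := by
  intro h0
  have hw : ∀ η, wedge ω η = 0 := fun η => by
    have h1 := φ.wedge_pullForm ω η
    rw [h0] at h1
    have h2 : wedge (0 : O₂ × O₂) (φ.pullForm η) = 0 := by simp [wedge]
    rw [h2] at h1
    exact pull_injective hJ (by rw [_root_.map_zero]; exact (mul_eq_zero.1 h1.symm).resolve_left hJ)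
  have h1 := hw (1, 0)
  have h2 := hw (0, 1)
  simp only [wedge, mul_zero, mul_one, zero_sub, neg_eq_zero, sub_zero] at h1 h2
  exact h (Prod.ext h2 h1)

/-- The foliation defined by `ω` is invariant under `φ`. -/
def Preserves (φ : GermMap (ℂ × ℂ)) (ω : O₂ × O₂) : Prop := wedge (φ.pullForm ω) ω = 0

/-- M need not be invertible. Besides coordinate changes, this serves when φ is a composite of two
maps and the factors are exchanged. -/
theorem Preserves.semiconj {φ φ' M : GermMap (ℂ × ℂ)} {ω : O₂ × O₂} (h : φ.Preserves ω)
    (hM : M.comp φ' = φ.comp M) : φ'.Preserves (M.pullForm ω) := by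
  unfold Preserves at *
  rw [← pullForm_comp, hM, pullForm_comp, wedge_pullForm, h, _root_.map_zero, mul_zero]

theorem Preserves.comp_self {φ : GermMap (ℂ × ℂ)} {ω : O₂ × O₂} (h : φ.Preserves ω)
    (hJ : φ.jac ≠ 0) (h0 : ω ≠ 0) : (φ.comp φ).Preserves ω := by
  unfold Preserves at *
  rw [pullForm_comp]
  refine wedge_trans ?_ h (pullForm_ne_zero hJ h0)
  rw [wedge_pullForm, h, _root_.map_zero, mul_zero]

/-- `M` and `ψ` are mutually inverse changes of coordinates. -/
structure IsInverse (ψ M : GermMap (ℂ × ℂ)) : Prop where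
  left : ψ.comp M = id
  right : M.comp ψ = id

theorem exists_isInverse {ψ : GermMap (ℂ × ℂ)} (h : ev ψ.jac ≠ 0) : ∃ M, IsInverse ψ M := by
  obtain ⟨M, h1, h2⟩ := exists_localInverse ψ h
  exact ⟨M, h1, h2⟩

namespace IsInverse

variable {ψ M : GermMap (ℂ × ℂ)}

theorem symm (h : IsInverse ψ M) : IsInverse M ψ := ⟨h.right, h.left⟩

theorem pull_fst (h : IsInverse ψ M) : M.pull ψ.fst = X := congrArg GermMap.fst h.left
theorem pull_snd (h : IsInverse ψ M) : M.pull ψ.snd = Y := congrArg GermMap.snd h.left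

theorem pull_pull (h : IsInverse ψ M) (a : O₂) : M.pull (ψ.pull a) = a := by rw [← pull_comp, h.left, pull_id]
theorem pullForm_pullForm (h : IsInverse ψ M) (ω : O₂ × O₂) : M.pullForm (ψ.pullForm ω) = ω := by
  rw [← pullForm_comp, h.left, pullForm_id]

theorem ev_jac_ne_zero (h : IsInverse ψ M) : ev M.jac ≠ 0 := by
  intro h0
  have := congrArg (fun φ => ev (jac φ)) h.left
  simp [jac_comp, h0] at this

theorem isRelPrime_pullForm (h : IsInverse ψ M) {ω : O₂ × O₂} (hω : IsRelPrime ω.1 ω.2) :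
    IsRelPrime (M.pullForm ω).1 (M.pullForm ω).2 := by
  intro c h1 h2
  have h3 : ∀ η : O₂ × O₂, c ∣ η.1 → c ∣ η.2 → ψ.pull c ∣ (ψ.pullForm η).1 ∧
      ψ.pull c ∣ (ψ.pullForm η).2 := fun η h1 h2 =>
    ⟨dvd_add ((map_dvd _ h1).mul_right _) ((map_dvd _ h2).mul_right _),
      dvd_add ((map_dvd _ h1).mul_right _) ((map_dvd _ h2).mul_right _)⟩
  have h4 := h3 _ h1 h2
  rw [h.symm.pullForm_pullForm] at h4
  have := hω h4.1 h4.2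
  rw [AnalyticGerm.isUnit_iff, ev_pull] at this
  exact AnalyticGerm.isUnit_iff.2 this

/-- The map `φ` in the coordinates `ψ`. -/
theorem semiconj (h : IsInverse ψ M) (φ : GermMap (ℂ × ℂ)) :
    M.comp (ψ.comp (φ.comp M)) = φ.comp M := by
  rw [← comp_assoc, h.right, id_comp]

theorem genInj (h : IsInverse ψ M) {φ : GermMap (ℂ × ℂ)} (hφ : φ.GenInj) : (ψ.comp (φ.comp M)).GenInj :=
  (genInj_of_isUnit_jac h.symm.ev_jac_ne_zero).comp
    (hφ.comp (genInj_of_isUnit_jac h.ev_jac_ne_zero))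

theorem associated_jac (h : IsInverse ψ M) (φ : GermMap (ℂ × ℂ)) :
    Associated (ψ.comp (φ.comp M)).jac (M.pull φ.jac) := by
  have h1 : IsUnit ((φ.comp M).pull ψ.jac * M.jac) := by
    rw [AnalyticGerm.isUnit_iff, map_mul, ev_pull]
    exact mul_ne_zero h.symm.ev_jac_ne_zero h.ev_jac_ne_zero
  rw [jac_comp, jac_comp]
  rw [show (φ.comp M).pull ψ.jac * (M.pull φ.jac * M.jac) =
    M.pull φ.jac * ((φ.comp M).pull ψ.jac * M.jac) by ring]
  exact (associated_mul_unit_right (M.pull φ.jac) _ h1).symm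

end IsInverse

theorem comp_conj_comp_conj {ψ M : GermMap (ℂ × ℂ)} (h : IsInverse ψ M) (φ : GermMap (ℂ × ℂ)) :
    (ψ.comp (φ.comp M)).comp (ψ.comp (φ.comp M)) = ψ.comp ((φ.comp φ).comp M) := by
  simp only [comp_assoc]
  rw [← comp_assoc M, h.right, id_comp]

end GermMap

namespace AnalyticGerm

theorem exists_eq_X_pow_mul {a : O₂} (ha : a ≠ 0) : ∃ (n : ℕ) (b : O₂), ¬ X ∣ b ∧ a = X ^ n * b := by
  obtain ⟨b, h1, h2⟩ :=
    (FiniteMultiplicity.of_not_isUnit prime_X.not_isUnit ha).exists_eq_pow_mul_and_not_dvd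
  exact ⟨_, b, h2, h1⟩

theorem isRelPrime_X_pow {b : O₂} (hb : ¬ X ∣ b) (n : ℕ) : IsRelPrime b (X ^ n) := by
  apply IsRelPrime.pow_right
  exact ((prime_X.irreducible.isRelPrime_iff_not_dvd).2 hb).symm

/-- A form proportional to a logarithmic form with unit residues. -/
theorem exists_eq_of_log {a b p q : O₂} (hp : IsUnit p) (hq : IsUnit q)
    (h : X * a * q = Y * b * p) (hab : IsRelPrime a b) :
    ∃ k, IsUnit k ∧ a = Y * (k * p) ∧ b = X * (k * q) := by
  have hXY : ¬ X ∣ Y := fun h => T_ne_zero (by rw [← resX_Y, X_dvd_iff.1 h])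
  have hYX : ¬ Y ∣ X := fun h => T_ne_zero (by rw [← resY_X, Y_dvd_iff.1 h])
  obtain ⟨b', rfl⟩ : X ∣ b := by
    have h1 : X ∣ Y * b * p := ⟨a * q, by rw [← h]; ring⟩
    rw [hp.dvd_mul_right] at h1
    exact (prime_X.dvd_or_dvd h1).resolve_left hXY
  obtain ⟨a', rfl⟩ : Y ∣ a := by
    have h1 : Y ∣ X * a * q := ⟨X * b' * p, by rw [h]; ring⟩
    rw [hq.dvd_mul_right] at h1
    exact (prime_Y.dvd_or_dvd h1).resolve_left hYX
  have h1 : a' * q = b' * p :=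
    mul_left_cancel₀ (mul_ne_zero X_ne_zero Y_ne_zero) (by linear_combination h)
  obtain ⟨k, rfl⟩ : p ∣ a' := hp.dvd
  have h2 : b' = k * q := mul_right_cancel₀ hp.ne_zero (by linear_combination -h1)
  refine ⟨k, hab ⟨Y * p, by ring⟩ ⟨X * q, by rw [h2]; ring⟩, by ring, by rw [h2]⟩

theorem dirDeriv_inclX (v : ℂ × ℂ) (c : O₁) :
    dirDeriv v (inclX c) = C v.1 * inclX (der c) := by
  refine ext ?_
  filter_upwards [dirDeriv_apply v (inclX c), (inclX_apply c).eventually_nhds,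
    tendsto_fst_zero.eventually c.analyticAt.eventually_analyticAt, inclX_apply (der c),
    tendsto_fst_zero.eventually (der_apply c), mul_apply (C v.1) (inclX (der c)),
    C_apply (E := ℂ × ℂ) v.1] with p h1 h2 h3 h6 h7 h8 h9
  have h4 : (inclX c).rep =ᶠ[𝓝 p] fun q => c q.1 := h2
  rw [h1, h4.fderiv_eq, h8, h9, h6, h7]
  have h5 : HasFDerivAt (fun q : ℂ × ℂ => c q.1) _ p :=
    h3.differentiableAt.hasFDerivAt.comp p hasFDerivAt_fst
  rw [h5.fderiv]
  simp

@[simp] theorem dy_inclX (c : O₁) : dy (inclX c) = 0 := by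
  rw [dy, dirDeriv_inclX]; simp

@[simp] theorem dx_inclX (c : O₁) : dx (inclX c) = inclX (der c) := by
  rw [dx, dirDeriv_inclX]; simp

/-- The difference vanishes on y = 0 and has no y-derivative, so it is divisible by y^m for every m.
-/
theorem eq_inclX_of_dy_eq_zero {a : O₂} (h : dy a = 0) : a = inclX (resY a) := by
  rw [← sub_eq_zero]
  have h1 : dy (a - inclX (resY a)) = 0 := by rw [map_sub, h, dy_inclX, sub_zero]
  have h2 : resY (a - inclX (resY a)) = 0 := by simp
  generalize a - inclX (resY a) = c at h1 h2
  refine eq_zero_of_forall_pow_dvd ev_Y fun n => ?_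
  induction n with
  | zero => simp
  | succ n ih =>
    rcases Nat.eq_zero_or_pos n with rfl | hn
    · simpa using Y_dvd_iff.2 h2
    · obtain ⟨m, rfl⟩ := Nat.exists_eq_succ_of_ne_zero hn.ne'
      obtain ⟨b, rfl⟩ := ih
      have h3 : Y ^ m * (((m + 1 : ℕ) : O₂) * b + Y * dy b) = 0 := by
        rw [← h1, Derivation.leibniz, Derivation.leibniz_pow, dy_Y]
        simp only [smul_eq_mul, Nat.succ_eq_add_one, Nat.add_sub_cancel, nsmul_eq_mul]
        ring
      have h4 := (mul_eq_zero.1 h3).resolve_left (pow_ne_zero _ Y_ne_zero)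
      have hu : IsUnit ((m + 1 : ℕ) : O₂) := by
        rw [← map_natCast C]; exact isUnit_C (by exact_mod_cast Nat.succ_ne_zero m)
      have h5 : Y ∣ ((m + 1 : ℕ) : O₂) * b := ⟨-dy b, by linear_combination h4⟩
      rw [hu.dvd_mul_left] at h5
      rw [pow_succ]
      exact mul_dvd_mul_left _ h5

end AnalyticGerm

end

/-! ### Maps with first component x^p, p ≥ 2: no invariant curve besides x = 0. -/

noncomputable section

open Metric AnalyticGerm

theorem exists_pow_eq_one_ne_one {p : ℕ} (hp : 2 ≤ p) : ∃ ζ : ℂ, ζ ^ p = 1 ∧ ζ ≠ 1 ∧ ‖ζ‖ = 1 := by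
  have h := Complex.isPrimitiveRoot_exp p (by omega)
  exact ⟨_, h.pow_eq_one, h.ne_one (by omega), Complex.norm_eq_one_of_pow_eq_one h.pow_eq_one (by omega)⟩

namespace AnalyticGerm

variable {E : Type*} [NormedAddCommGroup E] [NormedSpace ℂ E]

theorem eventually_norm_le (a : AnalyticGerm E) : ∀ᶠ p in 𝓝 0, ‖a p‖ ≤ ‖ev a‖ + 1 := by
  have h : ‖a 0‖ < ‖ev a‖ + 1 := by rw [ev_def]; linarith
  exact (a.analyticAt.continuousAt.norm.eventually (gt_mem_nhds h)).mono fun p hp => hp.le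

theorem eventually_eq_of_eq {a b : AnalyticGerm E} (h : a = b) : ∀ᶠ p in 𝓝 0, a p = b p :=
  h ▸ Eventually.of_forall fun _ => rfl

end AnalyticGerm

namespace GermMap

/-- Injectivity off the critical axis. -/
theorem GenInj.injOn_axis {φ : GermMap (ℂ × ℂ)} (hφ : φ.GenInj) {N : ℕ} {v : O₂} (hv : IsUnit v)
    (hJ : φ.jac = X ^ N * v) :
    ∀ᶠ r in 𝓝[>] (0 : ℝ), ∀ p ∈ ball (0 : ℂ × ℂ) r, ∀ q ∈ ball (0 : ℂ × ℂ) r,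
      p.1 ≠ 0 → q.1 ≠ 0 → φ p = φ q → p = q := by
  obtain ⟨U, hU, hinj⟩ := hφ.injOn
  have h1 : ∀ᶠ p in 𝓝 (0 : ℂ × ℂ), p ∈ U ∧ (p.1 ≠ 0 → φ.jac p ≠ 0) := by
    filter_upwards [hU, eventually_eq_of_eq hJ, AnalyticGerm.mul_apply (X ^ N) v,
      AnalyticGerm.pow_apply X N, X_apply, eventually_ne_zero_of_isUnit hv] with p h1 h2 h3 h4 h5 h6
    refine ⟨h1, fun h7 => ?_⟩
    rw [h2, h3, h4, h5]
    exact mul_ne_zero (pow_ne_zero _ h7) h6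
  obtain ⟨R, hR, hB⟩ := eventually_nhds_iff_ball.1 h1
  filter_upwards [Ioo_mem_nhdsGT hR] with r hr p hp q hq hp1 hq1 hpq
  have hp' := hB p (ball_subset_ball hr.2.le hp)
  have hq' := hB q (ball_subset_ball hr.2.le hq)
  exact hinj ⟨hp'.1, hp'.2 hp1⟩ ⟨hq'.1, hq'.2 hq1⟩ hpq

/-- A map contracting the first axis, of local degree at least two transversally to it, has no
other invariant curve. -/
theorem GenInj.isUnit_of_dvd_pull {φ : GermMap (ℂ × ℂ)} (hφ : φ.GenInj) {p N : ℕ} (hp : 2 ≤ p)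
    (hf : φ.fst = X ^ p) (hg : X ∣ φ.snd) {v : O₂} (hv : IsUnit v) (hJ : φ.jac = X ^ N * v)
    {B : O₂} (hBX : ¬ X ∣ B) (hB : B ∣ φ.pull B) : IsUnit B := by
  by_contra hBu
  rw [not_isUnit_iff] at hBu
  have hres : resX B ≠ 0 := fun h => hBX (X_dvd_iff.2 h)
  obtain ⟨d, u, hu, hd⟩ := exists_eq_T_pow_mul hres
  -- Dividing y^d by B shows that on each vertical line the zeros of B are roots of a monic
  -- polynomial of degree d, so there are at most d of them.
  obtain ⟨q, r, hdiv⟩ := weierstrass_division hu hd (Y ^ d)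
  obtain ⟨k, hk⟩ := hg
  obtain ⟨c, hc⟩ := hB
  obtain ⟨ζ, hζp, hζ1, hζn⟩ := exists_pow_eq_one_ne_one hp
  have hev : ∀ᶠ z in 𝓝 (0 : ℂ × ℂ), (B z = 0 → z.2 ^ d = ∑ i ∈ Finset.range d, r i z.1 * z.2 ^ i) ∧
      φ z = (z.1 ^ p, z.1 * k z) ∧ ‖k z‖ ≤ ‖ev k‖ + 1 ∧ (B z = 0 → B (φ z) = 0) := by
    have hs : ∀ᶠ z in 𝓝 (0 : ℂ × ℂ), ∀ i ∈ Finset.range d,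
        (inclX (r i) * Y ^ i : O₂) z = r i z.1 * z.2 ^ i := by
      rw [eventually_all_finset]
      intro i _
      filter_upwards [AnalyticGerm.mul_apply (inclX (r i)) (Y ^ i), inclX_apply (r i),
        AnalyticGerm.pow_apply Y i, Y_apply] with z h1 h2 h3 h4
      rw [h1, h2, h3, h4]
    filter_upwards [eventually_eq_of_eq hdiv, AnalyticGerm.pow_apply Y d, Y_apply,
      AnalyticGerm.add_apply (q * B) (∑ i ∈ Finset.range d, inclX (r i) * Y ^ i),
      AnalyticGerm.mul_apply q B, sum_apply (Finset.range d) (fun i => inclX (r i) * Y ^ i), hs,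
      eventually_eq_of_eq hf, AnalyticGerm.pow_apply X p, X_apply, eventually_eq_of_eq hk,
      AnalyticGerm.mul_apply X k, eventually_norm_le k, eventually_eq_of_eq hc, φ.pull_apply B,
      AnalyticGerm.mul_apply B c]
      with z h1 h2 h3 h4 h5 h6 h7 h8 h9 h10 h11 h12 h13 h14 h15 h16
    refine ⟨fun hBz => ?_, Prod.ext ?_ ?_, h13, fun hBz => ?_⟩
    · rw [← h3, ← h2, h1, h4, h5, hBz, mul_zero, zero_add, h6]
      rw [h3]
      exact Finset.sum_congr rfl h7
    · exact h8.trans (h9.trans (by rw [h10]))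
    · exact h11.trans (h12.trans (by rw [h10]))
    · rw [← h15, h14, h16, hBz, zero_mul]
  obtain ⟨R₁, hR₁, hball⟩ := eventually_nhds_iff_ball.1 hev
  obtain ⟨R₂, hinj, hR₂⟩ := ((hφ.injOn_axis hv hJ).and self_mem_nhdsWithin).exists
  set ε := min R₁ R₂ with hε
  have hε0 : 0 < ε := lt_min hR₁ hR₂
  obtain ⟨δ₁, hδ₁, hex⟩ := eventually_nhds_iff_ball.1 (eventually_exists_apply_eq_zero hBu hres hε0)
  set K := ‖ev k‖ + 1 with hK
  have hK0 : 0 < K := by positivity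
  set δ := min (min ε δ₁) (min 1 (ε / K)) with hδ
  have hδ0 : 0 < δ := by positivity
  have hmem : ∀ x y : ℂ, ‖x‖ < δ → ‖y‖ < ε → (x, y) ∈ ball (0 : ℂ × ℂ) ε := fun x y hx hy => by
    rw [mem_ball_zero_iff, Prod.norm_def]
    exact max_lt (hx.trans_le ((min_le_left _ _).trans (min_le_left _ _))) hy
  have hinj' : ∀ x y x' y' : ℂ, ‖x‖ < δ → ‖y‖ < ε → ‖x'‖ < δ → ‖y'‖ < ε → x ≠ 0 → x' ≠ 0 →
      x ^ p = x' ^ p → x * k (x, y) = x' * k (x', y') → x = x' ∧ y = y' := by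
    intro x y x' y' hx hy hx' hy' h0 h0' h1 h2
    have h3 := hmem x y hx hy
    have h4 := hmem x' y' hx' hy'
    have h5 := hinj _ (ball_subset_ball (min_le_right _ _) h3) _
      (ball_subset_ball (min_le_right _ _) h4) h0 h0' (by
        rw [(hball _ (ball_subset_ball (min_le_left _ _) h3)).2.1,
          (hball _ (ball_subset_ball (min_le_left _ _) h4)).2.1]
        exact Prod.ext h1 h2)
    exact ⟨congrArg Prod.fst h5, congrArg Prod.snd h5⟩
  have himg : ∀ x y : ℂ, ‖x‖ < δ → ‖y‖ < ε → B (x, y) = 0 →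
      ‖x * k (x, y)‖ < ε ∧ B (x ^ p, x * k (x, y)) = 0 := by
    intro x y hx hy h0
    obtain ⟨-, h1, h2, h3⟩ := hball _ (ball_subset_ball (min_le_left _ _) (hmem x y hx hy))
    refine ⟨?_, by rw [← h1]; exact h3 h0⟩
    rw [norm_mul]
    calc ‖x‖ * ‖k (x, y)‖ ≤ ‖x‖ * K := by gcongr
      _ < ε := by
        rw [← lt_div_iff₀ hK0]
        exact hx.trans_le ((min_le_right _ _).trans (min_le_right _ _))
  -- The curve B = 0 is forward invariant, and φ sends the lines over x and ζx into the line over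
  -- x^p. Injectivity keeps the images of the points over x distinct from one another and from the
  -- image of a point over ζx. Each application therefore gains a point, which contradicts the bound
  -- d.
  have hmany : ∀ n : ℕ, ∃ x : ℂ, x ≠ 0 ∧ ‖x‖ < δ ∧ ∃ S : Finset ℂ, n ≤ S.card ∧
      ∀ y ∈ S, ‖y‖ < ε ∧ B (x, y) = 0 := by
    intro n
    induction n with
    | zero =>
      refine ⟨((δ / 2 : ℝ) : ℂ), by exact_mod_cast (half_pos hδ0).ne', ?_, ∅, by simp, by simp⟩
      rw [Complex.norm_real, Real.norm_of_nonneg (half_pos hδ0).le]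
      exact half_lt_self hδ0
    | succ n ih =>
      obtain ⟨x, hx0, hxδ, S, hS, hSB⟩ := ih
      have hζx : ‖ζ * x‖ < δ := by rwa [norm_mul, hζn, one_mul]
      have hζ0 : ζ ≠ 0 := by rintro rfl; simp at hζn
      obtain ⟨y₀, hy₀, hB₀⟩ := hex (ζ * x) (by
        rw [mem_ball_zero_iff]
        exact hζx.trans_le ((min_le_left _ _).trans (min_le_right _ _)))
      have hxp : (ζ * x) ^ p = x ^ p := by rw [mul_pow, hζp, one_mul]
      have hnot : ζ * x * k (ζ * x, y₀) ∉ S.image fun y => x * k (x, y) := by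
        rw [Finset.mem_image]
        rintro ⟨y, hy, hyeq⟩
        have := (hinj' x y (ζ * x) y₀ hxδ (hSB y hy).1 hζx hy₀ hx0 (mul_ne_zero hζ0 hx0) hxp.symm
          hyeq).1
        exact hζ1 (mul_right_cancel₀ hx0 (by rw [← this, one_mul]))
      refine ⟨x ^ p, pow_ne_zero _ hx0, ?_,
        insert (ζ * x * k (ζ * x, y₀)) (S.image fun y => x * k (x, y)), ?_, ?_⟩
      · rw [norm_pow]
        have h1 : ‖x‖ ≤ 1 := hxδ.le.trans ((min_le_right _ _).trans (min_le_left _ _))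
        exact (pow_le_of_le_one (norm_nonneg _) h1 (by omega)).trans_lt hxδ
      · rw [Finset.card_insert_of_notMem hnot, Finset.card_image_of_injOn]
        · omega
        · intro y hy y' hy' h
          exact (hinj' x y x y' hxδ (hSB y hy).1 hxδ (hSB y' hy').1 hx0 hx0 rfl h).2
      · intro y hy
        rw [Finset.mem_insert, Finset.mem_image] at hy
        rcases hy with rfl | ⟨y, hy, rfl⟩
        · have := himg (ζ * x) y₀ hζx hy₀ hB₀
          rwa [hxp] at this
        · exact himg x y hxδ (hSB y hy).1 (hSB y hy).2
  obtain ⟨x, -, hxδ, S, hS, hSB⟩ := hmany (d + 1)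
  let Q : Polynomial ℂ := Polynomial.X ^ d -
    ∑ i ∈ Finset.range d, Polynomial.C (r i x) * Polynomial.X ^ i
  have hdeg : (∑ i ∈ Finset.range d, Polynomial.C (r i x) * Polynomial.X ^ i).degree <
      (d : WithBot ℕ) := by
    refine (Polynomial.degree_sum_le _ _).trans_lt ((Finset.sup_lt_iff (WithBot.bot_lt_coe d)).2 ?_)
    intro i hi
    exact (Polynomial.degree_C_mul_X_pow_le _ _).trans_lt (WithBot.coe_lt_coe.2 (Finset.mem_range.1 hi))
  have hQm : Q.Monic := Polynomial.monic_X_pow_sub hdeg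
  have hQd : Q.natDegree ≤ d := by
    refine (Polynomial.natDegree_sub_le _ _).trans (max_le (by simp) ?_)
    exact Polynomial.natDegree_le_of_degree_le hdeg.le
  have := Polynomial.card_le_degree_of_subset_roots (p := Q) (Z := S) (by
    intro y hy
    have hy' := hSB y hy
    rw [Polynomial.mem_roots hQm.ne_zero, Polynomial.IsRoot.def]
    have h1 := (hball _ (ball_subset_ball (min_le_left _ _) (hmem x y hxδ hy'.1))).1 hy'.2
    simp only [Q, Polynomial.eval_sub, Polynomial.eval_pow, Polynomial.eval_X,
      Polynomial.eval_finsetSum, Polynomial.eval_mul, Polynomial.eval_C]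
    rw [sub_eq_zero]; exact h1)
  omega

end GermMap

end

/-! ### A one-variable equation incompatible with injectivity. -/

noncomputable section

open Metric AnalyticGerm

namespace AnalyticGerm

/-- Substitution of a germ vanishing at the origin. -/
def subst (θ : O₁) (hθ : ev θ = 0) : O₁ →+* O₁ := pullback θ θ.analyticAt hθ

theorem subst_apply (θ : O₁) (hθ : ev θ = 0) (a : O₁) : ∀ᶠ t in 𝓝 0, subst θ hθ a t = a (θ t) :=
  pullback_apply _ _ _ _

@[simp] theorem subst_C (θ : O₁) (hθ : ev θ = 0) (c : ℂ) : subst θ hθ (C c) = C c :=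
  pullback_C _ _ _ _

@[simp] theorem ev_subst (θ : O₁) (hθ : ev θ = 0) (a : O₁) : ev (subst θ hθ a) = ev a :=
  ev_pullback _ _ _ _

theorem tendsto_of_ev_eq_zero (θ : O₁) (hθ : ev θ = 0) : Tendsto θ (𝓝 0) (𝓝 0) := by
  have := θ.analyticAt.continuousAt.tendsto
  rwa [show θ 0 = 0 from hθ] at this

@[simp] theorem subst_T (θ : O₁) (hθ : ev θ = 0) : subst θ hθ T = θ := by
  refine ext ?_
  filter_upwards [subst_apply θ hθ T, (tendsto_of_ev_eq_zero θ hθ).eventually T_apply] with t h1 h2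
  rw [h1, h2]

theorem subst_subst (θ η : O₁) (hθ : ev θ = 0) (hη : ev η = 0) (a : O₁) :
    subst θ hθ (subst η hη a) = subst (subst θ hθ η) (by simpa using hη) a := by
  refine ext ?_
  filter_upwards [subst_apply θ hθ (subst η hη a),
    (tendsto_of_ev_eq_zero θ hθ).eventually (subst_apply η hη a),
    subst_apply (subst θ hθ η) (by simpa using hη) a, subst_apply θ hθ η] with t h1 h2 h3 h4
  rw [h1, h2, h3, h4]

theorem der_subst (θ : O₁) (hθ : ev θ = 0) (a : O₁) :
    der (subst θ hθ a) = subst θ hθ (der a) * der θ := by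
  refine ext ?_
  filter_upwards [der_apply (subst θ hθ a), (subst_apply θ hθ a).eventually_nhds,
    subst_apply θ hθ (der a), (tendsto_of_ev_eq_zero θ hθ).eventually (der_apply a), der_apply θ,
    mul_apply (subst θ hθ (der a)) (der θ),
    (tendsto_of_ev_eq_zero θ hθ).eventually a.analyticAt.eventually_analyticAt,
    θ.analyticAt.eventually_analyticAt] with t h1 h2 h3 h4 h5 h6 h7 h8
  have h9 : (subst θ hθ a).rep =ᶠ[𝓝 t] fun z => a (θ z) := h2
  rw [h1, h6, h3, h4, h5, h9.deriv_eq]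
  exact (h7.differentiableAt.hasDerivAt.comp t h8.differentiableAt.hasDerivAt).deriv

theorem resY_pull_inclX (φ : GermMap (ℂ × ℂ)) (c : O₁) :
    resY (φ.pull (inclX c)) = subst (resY φ.fst) (by simp) c := by
  refine ext ?_
  filter_upwards [resY_apply (φ.pull (inclX c)),
    tendsto_zero_left.eventually (φ.pull_apply (inclX c)),
    tendsto_zero_left.eventually (φ.tendsto.eventually (inclX_apply c)),
    subst_apply (resY φ.fst) (by simp) c, resY_apply φ.fst] with t h1 h2 h3 h4 h5
  rw [h1, h2, h3, h4, h5]
  rfl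

theorem resY_dx (a : O₂) : resY (dx a) = der (resY a) := by
  obtain ⟨b, hb⟩ := exists_eq_add_Y_mul a
  conv_lhs => rw [hb]
  simp [Derivation.leibniz]

theorem not_T_dvd_of_isUnit {a : O₁} (ha : IsUnit a) : ¬ T ∣ a := fun h =>
  prime_T.not_isUnit (isUnit_of_dvd_unit h ha)

/-- The Euler operator `t d/dt - κ` preserves orders when `κ` is not a small natural number. -/
theorem T_pow_dvd_of_euler {D : O₁} {κ : ℂ} {n : ℕ} (hκ : ∀ k < n, (k : ℂ) ≠ κ)
    (h : T ^ n ∣ T * der D - C κ * D) : T ^ n ∣ D := by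
  suffices ∀ m ≤ n, T ^ m ∣ D from this n le_rfl
  intro m
  induction m with
  | zero => simp
  | succ m ih =>
    intro hm
    obtain ⟨E, rfl⟩ := ih (by omega)
    have h1 : T * der (T ^ m * E) - C κ * (T ^ m * E) =
        T ^ m * (C ((m : ℂ) - κ) * E + T * der E) := by
      rcases m with _ | m
      · simp
        ring
      · rw [Derivation.leibniz, Derivation.leibniz_pow, der_T]
        simp only [smul_eq_mul, Nat.add_sub_cancel, nsmul_eq_mul, map_sub, map_natCast]
        ring
    rw [h1] at h
    have h2 : T ^ m * T ∣ T ^ m * (C ((m : ℂ) - κ) * E + T * der E) := by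
      rw [← pow_succ]; exact (pow_dvd_pow T hm).trans h
    rw [mul_dvd_mul_iff_left (pow_ne_zero _ T_ne_zero)] at h2
    have h3 : T ∣ C ((m : ℂ) - κ) * E := (dvd_add_left (dvd_mul_right T (der E))).1 h2
    rw [(isUnit_C (sub_ne_zero.2 (hκ m (by omega)))).dvd_mul_left] at h3
    rw [pow_succ]
    exact mul_dvd_mul_left _ h3

end AnalyticGerm

namespace GermMap

/-- The one-variable part of the invariance equation contradicts injectivity. -/
theorem GenInj.false_of_radial {φ : GermMap (ℂ × ℂ)} (hφ : φ.GenInj) {n s : ℕ} (hn : 1 ≤ n)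
    {l : ℂ} (hl : l ≠ 0) {P : O₁} (hf : φ.fst = X ^ (n + 1))
    (hg : φ.snd = AnalyticGerm.C l * X ^ s * Y + inclX P) {N : ℕ} {v : O₂} (hv : IsUnit v)
    (hJ : φ.jac = X ^ N * v) {q : O₁} (hq0 : ev q = 0) {κ : ℂ} (hκ : ∀ k < s + 1, (k : ℂ) ≠ κ)
    (h : ((n + 1 : ℕ) : O₁) * subst (T ^ (n + 1)) (by simp) q + T * der P - AnalyticGerm.C κ * P =
      AnalyticGerm.C l * T ^ s * q) : False := by
  obtain ⟨ζ, hζp, hζ1, hζn⟩ := exists_pow_eq_one_ne_one (show 2 ≤ n + 1 by omega)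
  have hζ0 : ζ ≠ 0 := by rintro rfl; simp at hζn
  have he : ev (AnalyticGerm.C ζ * T) = 0 := by simp
  -- Substituting ζt leaves the term in t^(n+1) unchanged, so it disappears from the difference of
  -- the equation and its image.
  set σ := subst (AnalyticGerm.C ζ * T) he with hσ
  have hσT : σ T = AnalyticGerm.C ζ * T := subst_T _ _
  have hσq : σ (subst (T ^ (n + 1)) (by simp) q) = subst (T ^ (n + 1)) (by simp) q := by
    rw [hσ, subst_subst]
    congr 2
    rw [_root_.map_pow, ← hσ, hσT, mul_pow, ← _root_.map_pow, hζp, _root_.map_one, one_mul]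
  have hσd : der (σ P) = σ (der P) * AnalyticGerm.C ζ := by
    rw [hσ, der_subst]; simp [Derivation.leibniz]
  have h2 := congrArg σ h
  simp only [_root_.map_add, _root_.map_sub, _root_.map_mul, _root_.map_pow, _root_.map_natCast, hσq, hσT] at h2
  rw [hσ, subst_C, subst_C, ← hσ] at h2
  obtain ⟨q₁, hq₁⟩ := T_dvd_iff.2 hq0
  -- The Euler operator applied to P(ζt) - P(t) has order at least s + 1, as q vanishes at 0. By the
  -- condition on κ it does not lower that order.
  have hD : T ^ (s + 1) ∣ σ P - P := by
    refine T_pow_dvd_of_euler hκ ⟨AnalyticGerm.C l * (AnalyticGerm.C ζ ^ (s + 1) * σ q₁ - q₁), ?_⟩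
    have h3 : σ q = AnalyticGerm.C ζ * T * σ q₁ := by rw [hq₁, _root_.map_mul, hσT]
    rw [h3] at h2
    rw [map_sub, hσd]
    rw [hq₁] at h h2
    linear_combination h2 - h
  obtain ⟨D, hD⟩ := hD
  obtain ⟨r, hinj, hr⟩ := ((hφ.injOn_axis hv hJ).and self_mem_nhdsWithin).exists
  have hval : ∀ᶠ z in 𝓝 (0 : ℂ × ℂ), φ z = (z.1 ^ (n + 1), l * z.1 ^ s * z.2 + P z.1) := by
    filter_upwards [eventually_eq_of_eq hf, AnalyticGerm.pow_apply X (n + 1), X_apply, Y_apply,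
      eventually_eq_of_eq hg, AnalyticGerm.add_apply (AnalyticGerm.C l * X ^ s * Y) (inclX P),
      AnalyticGerm.mul_apply (AnalyticGerm.C l * X ^ s) Y,
      AnalyticGerm.mul_apply (AnalyticGerm.C l) (X ^ s), AnalyticGerm.pow_apply X s, C_apply l,
      inclX_apply P] with z h1 h2 h3 h4 h5 h6 h7 h8 h9 h10 h11
    refine Prod.ext (h1.trans (h2.trans (by rw [h3]))) ?_
    change φ.snd z = _
    rw [h5, h6, h7, h8, h9, h10, h11, h3, h4]
  have hDval : ∀ᶠ t in 𝓝 (0 : ℂ), P (ζ * t) - P t = t ^ (s + 1) * D t := by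
    filter_upwards [eventually_eq_of_eq hD, AnalyticGerm.sub_apply (σ P) P,
      subst_apply (AnalyticGerm.C ζ * T) he P, AnalyticGerm.mul_apply (AnalyticGerm.C ζ) T, C_apply ζ,
      T_apply, AnalyticGerm.mul_apply (T ^ (s + 1)) D, AnalyticGerm.pow_apply T (s + 1)]
      with t h1 h2 h3 h4 h5 h6 h7 h8
    rw [h2] at h1
    rw [hσ, h3, h4, h5, h6, h7, h8, h6] at h1
    exact h1
  let A : ℂ → ℂ × ℂ := fun t => (t, 0)
  -- The height is chosen so that this point has the same image as (t, 0). Divisibility by t^(s+1)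
  -- keeps the point close to the origin, which contradicts injectivity.
  let B : ℂ → ℂ × ℂ := fun t => (ζ * t, -(t * D t / (l * ζ ^ s)))
  have hA : Tendsto A (𝓝 0) (𝓝 0) := tendsto_zero_left
  have hBc : ContinuousAt B 0 :=
    ContinuousAt.prodMk (by fun_prop) (((continuousAt_id.mul D.analyticAt.continuousAt).div_const
      _).neg)
  have hB : Tendsto B (𝓝 0) (𝓝 0) := by
    have h0 : B 0 = 0 := by simp [B]
    rw [ContinuousAt, h0] at hBc
    exact hBc
  obtain ⟨t, ⟨h1, h2, h3, h4, h5⟩, ht⟩ := (((hA.eventually hval).and ((hB.eventually hval).and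
    (hDval.and ((hA.eventually (ball_mem_nhds 0 hr)).and
      (hB.eventually (ball_mem_nhds 0 hr))))) |>.filter_mono nhdsWithin_le_nhds).and
        (self_mem_nhdsWithin (s := {(0 : ℂ)}ᶜ))).exists
  have ht0 : t ≠ 0 := ht
  have := hinj _ h4 _ h5 ht0 (mul_ne_zero hζ0 ht0) (by
    rw [h1, h2]
    refine Prod.ext ?_ ?_
    · simp only [A, B]
      rw [mul_pow, hζp, one_mul]
    · simp only [A, B]
      have h6 : l * (ζ * t) ^ s * -(t * D t / (l * ζ ^ s)) = -(t ^ (s + 1) * D t) := by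
        rw [mul_pow]; field_simp; ring
      rw [h6]
      linear_combination -h3)
  have h6 : t = ζ * t := congrArg Prod.fst this
  exact hζ1 (mul_right_cancel₀ ht0 (by rw [← h6, one_mul]))

end GermMap

end

/-! ### Invariant foliations of the normal form (x^(n+1), l x^s y + P(x)). -/

noncomputable section

open Metric AnalyticGerm

namespace GermMap

/-- A germ that satisfies a twisted invariance equation vanishes. -/
theorem GenInj.eq_zero_of_twisted {φ : GermMap (ℂ × ℂ)} (hφ : φ.GenInj) {n N : ℕ} (hn : 1 ≤ n)
    (hf : φ.fst = X ^ (n + 1)) (hg : X ∣ φ.snd) {v : O₂} (hv : IsUnit v) (hJ : φ.jac = X ^ N * v)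
    {A : O₂} {j : ℕ} (h : X ^ (n * j) * A = ((n + 1 : ℕ) : O₂) * φ.pull A) : A = 0 := by
  by_contra hA
  obtain ⟨k, B, hB, rfl⟩ := exists_eq_X_pow_mul hA
  rw [map_mul, map_pow, pull_X, hf, ← pow_mul] at h
  have h1 : B ∣ X ^ ((n + 1) * k) * φ.pull B := by
    have hu : IsUnit ((n + 1 : ℕ) : O₂) := by
      rw [← map_natCast AnalyticGerm.C]; exact isUnit_C (by exact_mod_cast Nat.succ_ne_zero n)
    rw [← hu.dvd_mul_left, ← h]
    exact ⟨X ^ (n * j) * X ^ k, by ring⟩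
  -- Away from x = 0 the zero curve of A would be invariant, so A is a power of x times a unit.
  -- Comparing orders fixes the power, and comparing values at 0 gives n + 1 = 1.
  have hBu : IsUnit B := hφ.isUnit_of_dvd_pull (p := n + 1) (by omega) hf hg hv hJ hB
    ((isRelPrime_X_pow hB _).dvd_of_dvd_mul_left h1)
  have hX : ∀ {a b : ℕ} {c d : O₂}, IsUnit c → IsUnit d → X ^ a * c = X ^ b * d → a ≤ b := by
    intro a b c d hc hd h
    by_contra! hlt
    obtain ⟨e, rfl⟩ := Nat.exists_eq_add_of_lt hlt
    have h2 : X ^ b * (X * (X ^ e * c)) = X ^ b * d := by rw [← h]; ring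
    have h3 := mul_left_cancel₀ (pow_ne_zero _ X_ne_zero) h2
    exact prime_X.not_isUnit (isUnit_of_dvd_unit ⟨_, h3.symm⟩ hd)
  have hnu : IsUnit ((n + 1 : ℕ) : O₂) := by
    rw [← map_natCast AnalyticGerm.C]; exact isUnit_C (by exact_mod_cast Nat.succ_ne_zero n)
  have hpu : IsUnit (((n + 1 : ℕ) : O₂) * φ.pull B) := hnu.mul (hBu.map _)
  have h2 : X ^ (n * j + k) * B = X ^ ((n + 1) * k) * (((n + 1 : ℕ) : O₂) * φ.pull B) := by
    rw [pow_add]; linear_combination h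
  have h3 := hX hBu hpu h2
  have h4 := hX hpu hBu h2.symm
  have h5 : n * j + k = (n + 1) * k := le_antisymm h3 h4
  rw [h5] at h2
  have h6 := mul_left_cancel₀ (pow_ne_zero _ X_ne_zero) h2
  have h7 := congrArg ev h6
  rw [map_mul, ev_pull, map_natCast] at h7
  have h8 : ev B ≠ 0 := AnalyticGerm.isUnit_iff.1 hBu
  have h9 : ((n : ℂ)) * ev B = 0 := by push_cast at h7; linear_combination -h7
  rcases mul_eq_zero.1 h9 with h | h
  · exact absurd (Nat.cast_eq_zero.1 h) (by omega)
  · exact h8 h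

set_option maxHeartbeats 1000000 in
/-- In normal form, the only invariant foliation is the one by vertical lines. -/
theorem GenInj.snd_eq_zero_of_preserves {φ : GermMap (ℂ × ℂ)} (hφ : φ.GenInj) {n s : ℕ}
    (hn : 1 ≤ n) (hs : 1 ≤ s) {l : ℂ} (hl : l ≠ 0) {P : O₁} (hf : φ.fst = X ^ (n + 1))
    (hg : φ.snd = AnalyticGerm.C l * X ^ s * Y + inclX P) {a b : O₂} (hinv : φ.Preserves (a, b)) :
    b = 0 := by
  by_contra hb
  obtain ⟨t, rfl⟩ := Nat.exists_eq_add_of_le' hs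
  have hdxf : X * dx φ.fst = ((n + 1 : ℕ) : O₂) * X ^ (n + 1) := by
    rw [hf, Derivation.leibniz_pow, dx_X]
    simp only [smul_eq_mul, Nat.add_sub_cancel, nsmul_eq_mul]; ring
  have hdyf : dy φ.fst = 0 := by
    rw [hf, Derivation.leibniz_pow, dy_X]; simp
  have hdyg : dy φ.snd = AnalyticGerm.C l * X ^ (t + 1) := by
    rw [hg]; simp [Derivation.leibniz, Derivation.leibniz_pow]
  set W : O₂ := X * dx φ.snd with hW
  have hWe : W = AnalyticGerm.C l * ((t + 1 : ℕ) : O₂) * X ^ (t + 1) * Y + X * inclX (der P) := by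
    rw [hW, hg]
    simp only [map_add, Derivation.leibniz, Derivation.leibniz_pow, dx_X, dx_C, dx_Y, smul_eq_mul,
      dx_inclX, Nat.add_sub_cancel, nsmul_eq_mul]
    ring
  have hXg : X ∣ φ.snd := by
    rw [X_dvd_iff, hg]
    have h0 : ev P = 0 := by
      have := φ.ev_snd
      rw [hg] at this
      simpa using this
    simp [h0]
  have hlu : IsUnit (AnalyticGerm.C l : O₂) := isUnit_C hl
  have hnu : IsUnit ((n + 1 : ℕ) : O₂) := by
    rw [← map_natCast AnalyticGerm.C]; exact isUnit_C (by exact_mod_cast Nat.succ_ne_zero n)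
  have hv : IsUnit (((n + 1 : ℕ) : O₂) * AnalyticGerm.C l) := hnu.mul hlu
  have hJ : φ.jac = X ^ (n + (t + 1)) * (((n + 1 : ℕ) : O₂) * AnalyticGerm.C l) := by
    apply mul_left_cancel₀ X_ne_zero
    rw [jac, hdyf, hdyg]
    linear_combination (AnalyticGerm.C l * X ^ (t + 1)) * hdxf
  have hpinj := pull_injective hφ.jac_ne_zero
  -- reduced fraction
  obtain ⟨B, A, c, hcop, hcB, hcA⟩ := UniqueFactorizationMonoid.exists_reduced_factors b hb (X * a)
  have hc0 : c ≠ 0 := by rintro rfl; exact hb (by rw [← hcB, zero_mul])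
  have hφc0 : φ.pull c ≠ 0 := fun h => hc0 (hpinj (by rw [h, _root_.map_zero]))
  have hstar : ((n + 1 : ℕ) : O₂) * φ.pull A * B + φ.pull B * W * B -
      AnalyticGerm.C l * X ^ (t + 1) * φ.pull B * A = 0 := by
    have h1 : (φ.pull a * dx φ.fst + φ.pull b * dx φ.snd) * b -
        (φ.pull a * dy φ.fst + φ.pull b * dy φ.snd) * a = 0 := hinv
    rw [hdyf, hdyg] at h1
    have h2 : X ^ (n + 1) * φ.pull a = φ.pull c * φ.pull A := by
      rw [← map_mul, hcA, map_mul, pull_X, hf]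
    have h3 : φ.pull b = φ.pull c * φ.pull B := by rw [← map_mul, hcB]
    rw [h3, ← hcB] at h1
    apply mul_left_cancel₀ (mul_ne_zero hφc0 hc0)
    rw [mul_zero, hW]
    linear_combination X * h1 - φ.pull a * c * B * hdxf - ((n + 1 : ℕ) : O₂) * c * B * h2 -
      φ.pull c * φ.pull B * AnalyticGerm.C l * X ^ (t + 1) * hcA
  have hB0 : B ≠ 0 := by rintro rfl; exact hb (by rw [← hcB, mul_zero])
  obtain ⟨j, B₁, hB₁, rfl⟩ := exists_eq_X_pow_mul hB0
  -- The poles of A/B off x = 0 would form an invariant curve.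
  have hB₁u : IsUnit B₁ := by
    refine hφ.isUnit_of_dvd_pull (p := n + 1) (by omega) hf hXg hv hJ hB₁ ?_
    have h1 : B₁ ∣ A * (X ^ (t + 1) * φ.pull (X ^ j * B₁)) := by
      rw [← hlu.dvd_mul_left]
      exact ⟨((n + 1 : ℕ) : O₂) * φ.pull A * X ^ j + φ.pull (X ^ j * B₁) * W * X ^ j, by
        linear_combination -hstar⟩
    have h2 : IsRelPrime B₁ A := hcop.of_mul_left_right
    have h3 := h2.dvd_of_dvd_mul_left h1
    rw [map_mul, map_pow, pull_X, hf, ← pow_mul, ← mul_assoc, ← pow_add] at h3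
    exact (isRelPrime_X_pow hB₁ _).dvd_of_dvd_mul_left h3
  obtain ⟨w, hw⟩ := isUnit_iff_exists_inv.1 hB₁u
  obtain ⟨A₁, hA₁⟩ : ∃ A₁, A = A₁ * B₁ := ⟨A * w, by rw [mul_assoc, mul_comm w, hw, mul_one]⟩
  have hss : ((n + 1 : ℕ) : O₂) * φ.pull A₁ + X ^ ((n + 1) * j) * W =
      AnalyticGerm.C l * X ^ (t + 1 + n * j) * A₁ := by
    have hB₁0 : B₁ ≠ 0 := hB₁u.ne_zero
    have hφB₁0 : φ.pull B₁ ≠ 0 := (hB₁u.map φ.pull).ne_zero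
    apply mul_left_cancel₀ (mul_ne_zero (mul_ne_zero hB₁0 hφB₁0) (pow_ne_zero j X_ne_zero))
    rw [hA₁] at hstar
    simp only [map_mul, map_pow, pull_X, hf, ← pow_mul] at hstar
    have e1 : X ^ (t + 1 + n * j) * X ^ j = X ^ (t + 1) * X ^ ((n + 1) * j) := by
      rw [← pow_add, ← pow_add]; congr 1; ring
    linear_combination hstar - AnalyticGerm.C l * A₁ * B₁ * φ.pull B₁ * e1
  -- the dependence on the second variable
  set κ : ℂ := ((t + 1 : ℕ) : ℂ) / n with hκ
  have hn0 : (n : ℂ) ≠ 0 := by exact_mod_cast (by omega : n ≠ 0)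
  have hκn : AnalyticGerm.C κ * (n : O₂) = ((t + 1 : ℕ) : O₂) := by
    rw [← map_natCast AnalyticGerm.C n, ← map_natCast AnalyticGerm.C (t + 1), ← map_mul, hκ,
      div_mul_cancel₀ _ hn0]
  have hdyX : ∀ m : ℕ, dy (X ^ m) = 0 := fun m => by simp [Derivation.leibniz_pow]
  have hdyN : ∀ m : ℕ, dy ((m : ℕ) : O₂) = 0 := fun m => by simp
  have hA0 : dy A₁ + AnalyticGerm.C κ * X ^ j = 0 := by
    refine hφ.eq_zero_of_twisted hn hf hXg hv hJ (j := j) ?_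
    have h1 := congrArg dy hss
    rw [map_add, hWe] at h1
    simp only [Derivation.leibniz, map_add, dy_pull, hdyf, hdyg, hdyX, hdyN, dy_C, dy_Y, dy_X,
      dy_inclX, smul_eq_mul] at h1
    have h2 : ((n + 1 : ℕ) : O₂) * φ.pull (dy A₁) + ((t + 1 : ℕ) : O₂) * X ^ ((n + 1) * j) =
        X ^ (n * j) * dy A₁ := by
      apply mul_left_cancel₀ (mul_ne_zero hlu.ne_zero (pow_ne_zero (t + 1) X_ne_zero))
      rw [pow_add] at h1
      linear_combination h1
    rw [map_add, map_mul, map_pow, pull_X, pull_C, hf, ← pow_mul]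
    have e1 : X ^ (n * j) * X ^ j = X ^ ((n + 1) * j) := by
      rw [← pow_add]; congr 1; ring
    push_cast at h2 hκn ⊢
    linear_combination -h2 + AnalyticGerm.C κ * e1 - X ^ ((n + 1) * j) * hκn
  obtain ⟨q₁, hq₁⟩ : ∃ q₁ : O₁, A₁ = -(AnalyticGerm.C κ * X ^ j * Y) + inclX q₁ := by
    refine ⟨resY (A₁ + AnalyticGerm.C κ * X ^ j * Y), ?_⟩
    rw [← eq_inclX_of_dy_eq_zero]
    · ring
    · simp only [map_add, Derivation.leibniz, hdyX, dy_C, dy_Y, smul_eq_mul]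
      linear_combination hA0
  have hP0 : ev P = 0 := by
    have := φ.ev_snd
    rw [hg] at this
    simpa using this
  set S := subst (T ^ (n + 1)) (by simp) with hS
  have hresf : resY φ.fst = T ^ (n + 1) := by rw [hf]; simp
  have hresS : resY (φ.pull (inclX q₁)) = S q₁ := by
    rw [resY_pull_inclX, hS]
    congr 2
  have hdag : ((n + 1 : ℕ) : O₁) * S q₁ - ((n + 1 : ℕ) : O₁) * AnalyticGerm.C κ * T ^ ((n + 1) * j) * P +
      T ^ ((n + 1) * j) * (T * der P) = AnalyticGerm.C l * T ^ (t + 1 + n * j) * q₁ := by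
    have h1 := congrArg resY hss
    rw [hq₁, hWe] at h1
    simp only [map_add, map_neg, map_mul, map_pow, map_natCast, pull_X, pull_Y, pull_C, hresS, hf,
      hg, resY_X, resY_Y, resY_C, resY_inclX, mul_zero, zero_add, neg_zero] at h1
    push_cast at h1 ⊢
    rw [← pow_mul] at h1
    linear_combination h1
  -- If the order k of q₁ were below j, the term S q₁ of order (n + 1)k would be the only one of
  -- lowest order in the equation.
  obtain ⟨q, rfl⟩ : T ^ j ∣ q₁ := by
    by_cases hq0 : q₁ = 0
    · rw [hq0]; exact dvd_zero _
    obtain ⟨k, e, he, rfl⟩ := exists_eq_T_pow_mul hq0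
    by_cases hkj : j ≤ k
    · exact (pow_dvd_pow T hkj).mul_right e
    exfalso
    obtain ⟨i, rfl⟩ := Nat.exists_eq_add_of_lt (not_le.1 hkj)
    have hST : S (T ^ k * e) = T ^ ((n + 1) * k) * S e := by
      rw [map_mul, map_pow, hS, subst_T, ← pow_mul]
    rw [hST] at hdag
    have h1 : T ^ ((n + 1) * (k + i + 1)) = T ^ ((n + 1) * k) * (T * T ^ (n * (i + 1) + i)) := by
      rw [← pow_succ', ← pow_add]; congr 1; ring
    have h2 : T ^ (t + 1 + n * (k + i + 1)) * T ^ k =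
        T ^ ((n + 1) * k) * (T * T ^ (t + n * (i + 1))) := by
      rw [← pow_succ', ← pow_add, ← pow_add]; congr 1; ring
    have h3 : T ^ ((n + 1) * k) * (((n + 1 : ℕ) : O₁) * S e) = T ^ ((n + 1) * k) *
        (T * (((n + 1 : ℕ) : O₁) * AnalyticGerm.C κ * T ^ (n * (i + 1) + i) * P -
          T ^ (n * (i + 1) + i) * (T * der P) + AnalyticGerm.C l * T ^ (t + n * (i + 1)) * e)) := by
      linear_combination hdag + (((n + 1 : ℕ) : O₁) * AnalyticGerm.C κ * P - T * der P) * h1 +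
        AnalyticGerm.C l * e * h2
    have h4 := mul_left_cancel₀ (pow_ne_zero _ T_ne_zero) h3
    have hu : IsUnit (((n + 1 : ℕ) : O₁) * S e) := by
      refine IsUnit.mul ?_ (he.map S)
      rw [← map_natCast AnalyticGerm.C]; exact isUnit_C (by exact_mod_cast Nat.succ_ne_zero n)
    exact not_T_dvd_of_isUnit hu ⟨_, h4⟩
  have hdd : ((n + 1 : ℕ) : O₁) * S q + T * der P - AnalyticGerm.C (((n + 1 : ℕ) : ℂ) * κ) * P =
      AnalyticGerm.C l * T ^ (t + 1) * q := by
    apply mul_left_cancel₀ (pow_ne_zero ((n + 1) * j) T_ne_zero)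
    rw [map_mul, map_pow, hS, subst_T, ← hS, ← pow_mul] at hdag
    rw [map_mul, map_natCast]
    have e1 : T ^ (t + 1 + n * j) * T ^ j = T ^ (t + 1) * T ^ ((n + 1) * j) := by
      rw [← pow_add, ← pow_add]; congr 1; ring
    linear_combination hdag + AnalyticGerm.C l * q * e1
  have hq0 : ev q = 0 := by
    have h1 := congrArg ev hdd
    simp only [map_add, map_sub, map_mul, map_pow, map_natCast, hS, ev_subst, ev_T, hP0] at h1
    have h2 : ((n + 1 : ℕ) : ℂ) * ev q = 0 := by simpa using h1
    exact (mul_eq_zero.1 h2).resolve_left (by exact_mod_cast Nat.succ_ne_zero n)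
  -- With s = t + 1 the exponent is (n + 1)s / n > s, hence different from 0, ..., s.
  refine hφ.false_of_radial hn hl hf hg hv hJ hq0 (κ := ((n + 1 : ℕ) : ℂ) * κ) ?_ hdd
  intro k hk h
  rw [hκ] at h
  field_simp at h
  have h1 : k * n = (n + 1) * (t + 1) := by exact_mod_cast h
  have h2 : k * n ≤ (t + 1) * n := Nat.mul_le_mul_right _ (by omega)
  nlinarith

end GermMap

end

/-! ### Normalizing coordinates when the transverse local degree is at least two. -/

noncomputable section

open Metric AnalyticGerm

namespace AnalyticGerm

theorem le_of_X_pow_mul_eq {a b : ℕ} {c e : O₂} (he : IsUnit e) (h : X ^ a * c = X ^ b * e) :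
    a ≤ b := by
  by_contra! hlt
  obtain ⟨k, rfl⟩ := Nat.exists_eq_add_of_lt hlt
  have h2 : X ^ b * (X * (X ^ k * c)) = X ^ b * e := by rw [← h]; ring
  have h3 := mul_left_cancel₀ (pow_ne_zero _ X_ne_zero) h2
  exact prime_X.not_isUnit (isUnit_of_dvd_unit ⟨_, h3.symm⟩ he)

theorem isUnit_natCast {n : ℕ} (hn : n ≠ 0) : IsUnit ((n : ℕ) : O₂) := by
  rw [← map_natCast C]; exact isUnit_C (by exact_mod_cast hn)

end AnalyticGerm

namespace GermMap

theorem pull_inclX_of_fst_eq_X {M : GermMap (ℂ × ℂ)} (h : M.fst = X) (c : O₁) :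
    M.pull (inclX c) = inclX c := by
  refine AnalyticGerm.ext ?_
  filter_upwards [M.pull_apply (inclX c), M.tendsto.eventually (inclX_apply c), inclX_apply c,
    eventually_eq_of_eq h, X_apply] with p h1 h2 h3 h4 h5
  rw [h1, h2, h3, show (M p).1 = M.fst p from rfl, h4, h5]

theorem isSuperattracting_comp_self {φ : GermMap (ℂ × ℂ)} {f' g' : O₂} (hf : φ.fst = X * f')
    (hf' : ev f' = 0) (hg : φ.snd = X * g') : (φ.comp φ).IsSuperattracting := by
  have h1 : ev (dx φ.fst) = 0 := by rw [hf]; simp [Derivation.leibniz, hf']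
  have h2 : ev (dy φ.fst) = 0 := by rw [hf]; simp [Derivation.leibniz]
  have h3 : ev (dy φ.snd) = 0 := by rw [hg]; simp [Derivation.leibniz]
  refine ⟨?_, ?_, ?_, ?_⟩ <;> simp [dx_pull, dy_pull, h1, h2, h3]

theorem IsInverse.exists_jac_eq {ψ M φ : GermMap (ℂ × ℂ)} (h : IsInverse ψ M) {a b : O₂}
    (hb : IsUnit b) (hJ : φ.jac = a * b) :
    ∃ v, IsUnit v ∧ (ψ.comp (φ.comp M)).jac = M.pull a * v := by
  obtain ⟨w, hw⟩ := (h.associated_jac φ).symm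
  refine ⟨M.pull b * w, (hb.map _).mul w.isUnit, ?_⟩
  rw [← hw, hJ, map_mul, mul_assoc]

/-- A map germ over the power map preserves only the foliation by vertical lines. -/
theorem GenInj.snd_eq_zero_of_fst_eq_pow {φ : GermMap (ℂ × ℂ)} (hφ : φ.GenInj) {n N : ℕ}
    (hn : 1 ≤ n) (hf : φ.fst = X ^ (n + 1)) (hg : X ∣ φ.snd) {v : O₂} (hv : IsUnit v)
    (hJ : φ.jac = X ^ N * v) {ω : O₂ × O₂} (hω : φ.Preserves ω) : ω.2 = 0 := by
  obtain ⟨k, hk⟩ := hg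
  have hdyf : dy φ.fst = 0 := by rw [hf, Derivation.leibniz_pow, dy_X]; simp
  have hnu : IsUnit ((n + 1 : ℕ) : O₂) := isUnit_natCast (by omega)
  obtain ⟨t, v', hv', hdk⟩ : ∃ (t : ℕ) (v' : O₂), IsUnit v' ∧ dy φ.snd = X ^ (t + 1) * v' := by
    have h1 : X ^ (n + 1) * (((n + 1 : ℕ) : O₂) * dy k) = X ^ N * v := by
      rw [← hJ, jac, hdyf, hf, hk, Derivation.leibniz_pow, Derivation.leibniz, dx_X, dy_X]
      simp only [smul_eq_mul, Nat.add_sub_cancel, nsmul_eq_mul]; ring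
    obtain ⟨t, rfl⟩ := Nat.exists_eq_add_of_le (le_of_X_pow_mul_eq hv h1)
    rw [pow_add X (n + 1) t, mul_assoc] at h1
    have h2 := mul_left_cancel₀ (pow_ne_zero _ X_ne_zero) h1
    obtain ⟨w, hw⟩ := isUnit_iff_exists_inv.1 hnu
    refine ⟨t, v * w, hv.mul (IsUnit.of_mul_eq_one _ (by rw [mul_comm]; exact hw)), ?_⟩
    rw [hk, Derivation.leibniz, dy_X]
    simp only [smul_eq_mul]
    linear_combination X * w * h2 - X * dy k * hw
  obtain ⟨V, hV0, hV⟩ := exists_eq_C_mul_exp hv'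
  have hsup : (φ.comp φ).IsSuperattracting :=
    isSuperattracting_comp_self (f' := X ^ n) (by rw [hf]; ring)
      (by simp [show n ≠ 0 by omega]) hk
  -- A new fibre coordinate with y-derivative e^H is wanted, in which φ is affine on fibers. As the
  -- y-derivative of the second component is constant · x^(t+1) e^V, this requires H = V + H∘φ.
  obtain ⟨H, -, hH⟩ := exists_eq_add_mul_pull hsup 1 hV0
  rw [map_one, one_mul] at hH
  obtain ⟨y, hy, hy0⟩ := exists_dy_eq (exp H)
  have hyev : ev y = 0 := by rw [← ev_resY, hy0, _root_.map_zero]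
  let ψ : GermMap (ℂ × ℂ) := ⟨X, y, ev_X, hyev⟩
  have hψ : ev ψ.jac ≠ 0 := by
    have : ψ.jac = exp H := by simp [jac, ψ, hy]
    rw [this]; exact AnalyticGerm.isUnit_iff.1 (isUnit_exp H)
  obtain ⟨M, hM⟩ := exists_isInverse hψ
  have hMX : M.fst = X := by rw [← pull_X]; exact hM.pull_fst
  have hMy : M.pull y = Y := hM.pull_snd
  obtain ⟨P, hP⟩ : ∃ P : O₁, φ.pull y = AnalyticGerm.C (ev v') * X ^ (t + 1) * y + inclX P := by
    refine ⟨resY (φ.pull y - AnalyticGerm.C (ev v') * X ^ (t + 1) * y), ?_⟩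
    rw [← eq_inclX_of_dy_eq_zero]
    · ring
    · have h1 : exp H = exp V * exp (φ.pull H) := by rw [← exp_add, ← hH]
      rw [map_sub, dy_pull, hdyf, hy, hdk, pull_exp, hV]
      simp only [Derivation.leibniz, Derivation.leibniz_pow, dy_C, dy_X, smul_eq_mul, hy,
        smul_zero, mul_zero, add_zero, zero_add]
      rw [← hV]
      nth_rewrite 1 [hV]
      linear_combination -(AnalyticGerm.C (ev v') * X ^ (t + 1)) * h1
  have h2 := (hM.genInj hφ).snd_eq_zero_of_preserves (n := n) (s := t + 1) hn (by omega)
    (l := ev v') (AnalyticGerm.isUnit_iff.1 hv') (P := P) (a := (M.pullForm ω).1)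
    (b := (M.pullForm ω).2) (by simp [ψ, hf, hMX])
    (by
      simp only [comp_snd, ψ, pull_comp, hP]
      simp [hMX, hMy, pull_inclX_of_fst_eq_X hMX])
    (hω.semiconj (hM.semiconj φ))
  have h3 : ψ.pullForm (M.pullForm ω) = ω := hM.symm.pullForm_pullForm ω
  generalize M.pullForm ω = η at h2 h3
  rw [← h3]
  simp [pullForm, h2, ψ]

/-- A germ contracting an axis with local degree at least two transversally to it preserves
only one foliation. -/
theorem GenInj.exists_wedge_d_eq_zero {φ : GermMap (ℂ × ℂ)} (hφ : φ.GenInj) {n N : ℕ}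
    (hn : 1 ≤ n) {u : O₂} (hu : IsUnit u) (hf : φ.fst = X ^ (n + 1) * u) (hg : X ∣ φ.snd) {v : O₂}
    (hv : IsUnit v) (hJ : φ.jac = X ^ N * v) {ω : O₂ × O₂} (hω : φ.Preserves ω) :
    ∃ e, IsUnit e ∧ wedge ω (d (X * e)) = 0 := by
  obtain ⟨k, hk⟩ := hg
  obtain ⟨U, hU0, hU⟩ := exists_eq_C_mul_exp hu
  have hu0 : ev u ≠ 0 := AnalyticGerm.isUnit_iff.1 hu
  obtain ⟨ξ, hξ⟩ := IsAlgClosed.exists_pow_nat_eq (ev u) (show 0 < n by omega)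
  have hξ0 : ξ ≠ 0 := by
    rintro rfl
    rw [zero_pow (by omega)] at hξ
    exact hu0 hξ.symm
  have hsup : (φ.comp φ).IsSuperattracting :=
    isSuperattracting_comp_self (f' := X ^ n * u) (by rw [hf]; ring)
      (by simp [show n ≠ 0 by omega]) hk
  have hn0 : ((n + 1 : ℕ) : ℂ) ≠ 0 := by exact_mod_cast Nat.succ_ne_zero n
  -- Böttcher's coordinate is sought as ξ x e^H. Its pullback is its (n + 1)-st power exactly when
  -- (n + 1)H = U + H∘φ and ξ^n = u(0).
  obtain ⟨H, -, hH⟩ := exists_eq_add_mul_pull hsup (1 / ((n + 1 : ℕ) : ℂ))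
    (l := AnalyticGerm.C (1 / ((n + 1 : ℕ) : ℂ)) * U) (by simp [hU0])
  have hH' : ((n + 1 : ℕ) : O₂) * H = U + φ.pull H := by
    have h1 : ((n + 1 : ℕ) : O₂) * AnalyticGerm.C (1 / ((n + 1 : ℕ) : ℂ)) = 1 := by
      rw [← map_natCast AnalyticGerm.C, ← map_mul, mul_one_div_cancel hn0, map_one]
    linear_combination ((n + 1 : ℕ) : O₂) * hH + (U + φ.pull H) * h1
  set e := AnalyticGerm.C ξ * exp H with he
  have heu : IsUnit e := (isUnit_C hξ0).mul (isUnit_exp H)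
  have hxe : φ.pull (X * e) = (X * e) ^ (n + 1) := by
    have h1 : exp H ^ (n + 1) = exp U * exp (φ.pull H) := by
      rw [← exp_add, ← hH', exp_nat_mul]
    have h2 : AnalyticGerm.C ξ ^ (n + 1) = AnalyticGerm.C ξ * (AnalyticGerm.C (ev u) : O₂) := by
      rw [← hξ, map_pow]; ring
    rw [he, map_mul, map_mul, pull_X, pull_C, pull_exp, hf, mul_pow, mul_pow, h1, h2]
    nth_rewrite 1 [hU]
    ring
  refine ⟨e, heu, ?_⟩
  let ψ : GermMap (ℂ × ℂ) := ⟨X * e, Y, by simp, ev_Y⟩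
  have hψ : ev ψ.jac ≠ 0 := by
    have : ev ψ.jac = ev e := by simp [jac, ψ, Derivation.leibniz]
    rw [this]; exact AnalyticGerm.isUnit_iff.1 heu
  obtain ⟨M, hM⟩ := exists_isInverse hψ
  have hMX : M.pull X * M.pull e = X := by rw [← map_mul]; exact hM.pull_fst
  have hMX' : Associated (M.pull X) X := ⟨(heu.map M.pull).unit, hMX⟩
  obtain ⟨w, hw⟩ := hMX'.symm
  obtain ⟨v', hv', hJ'⟩ := hM.exists_jac_eq hv hJ
  have h2 := (hM.genInj hφ).snd_eq_zero_of_fst_eq_pow (n := n) (N := N) hn (by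
      simp only [comp_fst, ψ, pull_comp, hxe, map_pow]
      rw [map_mul, hMX]) (by
      have : (ψ.comp (φ.comp M)).snd = M.pull X * M.pull k := by
        simp [ψ, hk]
      rw [this, ← hw]
      exact ⟨w * M.pull k, by ring⟩)
    (v := w ^ N * v') ((w.isUnit.pow N).mul hv') (by rw [hJ', map_pow, ← hw]; ring)
    (hω.semiconj (hM.semiconj φ))
  have h3 : ψ.pullForm (M.pullForm ω) = ω := hM.symm.pullForm_pullForm ω
  generalize M.pullForm ω = η at h2 h3
  rw [← h3]
  simp only [wedge, pullForm, h2, d, ψ, _root_.map_zero, zero_mul, add_zero]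
  ring

end GermMap

end

/-! ### Leading monomials for irrational weights, and eigenvalues of exponent matrices. -/

noncomputable section

open Metric AnalyticGerm

namespace AnalyticGerm

/-- Expansion of a germ in powers of the second variable. -/
theorem exists_expansion (a : O₂) : ∃ (c : ℕ → O₁) (b : ℕ → O₂), ∀ N,
    a = ∑ k ∈ Finset.range N, inclX (c k) * Y ^ k + Y ^ N * b N := by
  choose f hf using exists_eq_add_Y_mul
  refine ⟨fun k => resY (f^[k] a), fun N => f^[N] a, fun N => ?_⟩
  induction N with
  | zero => simp
  | succ N ih =>
    beta_reduce at ih ⊢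
    rw [Finset.sum_range_succ, Function.iterate_succ_apply', pow_succ]
    linear_combination ih + Y ^ N * hf (f^[N] a)

/-- A nonzero germ has a leading monomial with respect to an irrational weight. -/
theorem exists_leading {a : O₂} (ha : a ≠ 0) {r s : ℝ} (hr : 0 < r) (hs : 0 < s)
    (hrs : ∀ m n m' n' : ℕ, r * m + s * n = r * m' + s * n' → m = m' ∧ n = n') :
    ∃ (m n : ℕ) (c : ℂ), c ≠ 0 ∧ ∀ (θ : ℝ → ℝ) (x y : ℝ → ℂ) (ξ η : ℂ), Tendsto θ atTop atTop →
      Tendsto (fun τ => x τ * Complex.exp (r * θ τ)) atTop (𝓝 ξ) →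
      Tendsto (fun τ => y τ * Complex.exp (s * θ τ)) atTop (𝓝 η) →
      Tendsto (fun τ => a (x τ, y τ) * Complex.exp (((r * m + s * n : ℝ) : ℂ) * θ τ)) atTop
        (𝓝 (c * ξ ^ m * η ^ n)) := by
  classical
  obtain ⟨c, b, hab⟩ := exists_expansion a
  have hex : ∀ k, ∃ (m : ℕ) (e : O₁), c k = T ^ m * e ∧ (c k ≠ 0 → IsUnit e) := fun k => by
    by_cases hk : c k = 0
    · exact ⟨0, 0, by simp [hk], fun h => absurd hk h⟩
    · obtain ⟨m, e, he, h⟩ := exists_eq_T_pow_mul hk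
      exact ⟨m, e, h, fun _ => he⟩
  choose m e hce heu using hex
  obtain ⟨k₀, hk₀⟩ : ∃ k, c k ≠ 0 := by
    by_contra! hall
    refine ha (eq_zero_of_forall_pow_dvd ev_Y fun N => ?_)
    rw [hab N]
    simp [hall]
  let v : ℕ → ℝ := fun k => r * m k + s * k
  -- The expansion in y is cut where the remainder y^N already outweighs one nonzero term. The
  -- minimum over finitely many terms is then the true leading weight, and irrationality makes it
  -- occur once.
  obtain ⟨N, hN⟩ := exists_nat_gt (v k₀ / s)
  rw [div_lt_iff₀ hs] at hN
  have hk₀N : k₀ < N := by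
    have h1 : s * k₀ ≤ v k₀ := by simp only [v]; nlinarith [hr, (Nat.cast_nonneg (m k₀) : (0 : ℝ) ≤ _)]
    have h2 : (k₀ : ℝ) < N := by nlinarith
    exact_mod_cast h2
  let S := (Finset.range N).filter fun k => c k ≠ 0
  have hk₀S : k₀ ∈ S := Finset.mem_filter.2 ⟨Finset.mem_range.2 hk₀N, hk₀⟩
  obtain ⟨n, hnS, hmin⟩ := S.exists_min_image v ⟨k₀, hk₀S⟩
  have hn : n < N ∧ c n ≠ 0 := by simpa [S] using hnS
  refine ⟨m n, n, ev (e n), isUnit_iff.1 (heu n hn.2), ?_⟩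
  intro θ x y ξ η hθ hx hy
  change Tendsto (fun τ => a (x τ, y τ) * Complex.exp ((v n : ℂ) * θ τ)) atTop _
  have hdecay : ∀ {κ : ℝ}, κ < 0 →
      Tendsto (fun τ => Complex.exp ((κ : ℂ) * θ τ)) atTop (𝓝 0) := fun {κ} hκ => by
    rw [tendsto_zero_iff_norm_tendsto_zero]
    have h1 : ∀ τ, ‖Complex.exp ((κ : ℂ) * θ τ)‖ = Real.exp (κ * θ τ) := fun τ => by
      rw [← Complex.ofReal_mul, ← Complex.ofReal_exp, Complex.norm_real,
        Real.norm_of_nonneg (Real.exp_pos _).le]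
    simp only [h1]
    exact Real.tendsto_exp_atBot.comp (hθ.const_mul_atTop_of_neg hκ)
  have hzero : ∀ {κ : ℝ} {z : ℝ → ℂ} {ζ : ℂ}, 0 < κ →
      Tendsto (fun τ => z τ * Complex.exp (κ * θ τ)) atTop (𝓝 ζ) → Tendsto z atTop (𝓝 0) := by
    intro κ z ζ hκ hz
    have h1 := hz.mul (hdecay (neg_neg_of_pos hκ))
    rw [mul_zero] at h1
    refine h1.congr fun τ => ?_
    rw [mul_assoc, ← Complex.exp_add]
    have : (κ : ℂ) * θ τ + ((-κ : ℝ) : ℂ) * θ τ = 0 := by push_cast; ring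
    rw [this, Complex.exp_zero, mul_one]
  have hx0 := hzero hr hx
  have hy0 := hzero hs hy
  have hxy : Tendsto (fun τ => (x τ, y τ)) atTop (𝓝 (0 : ℂ × ℂ)) := hx0.prodMk_nhds hy0
  have hexp : ∀ (i k : ℕ) (κ : ℝ) (τ : ℝ), x τ ^ i * y τ ^ k * Complex.exp ((κ : ℂ) * θ τ) =
      (x τ * Complex.exp (r * θ τ)) ^ i * (y τ * Complex.exp (s * θ τ)) ^ k *
        Complex.exp (((κ - (r * i + s * k) : ℝ) : ℂ) * θ τ) := fun i k κ τ => by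
    have h1 : Complex.exp ((κ : ℂ) * θ τ) = Complex.exp (r * θ τ) ^ i * Complex.exp (s * θ τ) ^ k *
        Complex.exp (((κ - (r * i + s * k) : ℝ) : ℂ) * θ τ) := by
      rw [← Complex.exp_nat_mul, ← Complex.exp_nat_mul, ← Complex.exp_add, ← Complex.exp_add]
      congr 1
      push_cast; ring
    rw [h1, mul_pow, mul_pow]; ring
  have hterm : ∀ k ∈ Finset.range N, Tendsto
      (fun τ => (inclX (c k) * Y ^ k : O₂) (x τ, y τ) * Complex.exp ((v n : ℂ) * θ τ)) atTop
      (𝓝 (if k = n then ev (e n) * ξ ^ m n * η ^ n else 0)) := by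
    intro k hk
    have hval : ∀ᶠ z in 𝓝 (0 : ℂ × ℂ), (inclX (c k) * Y ^ k : O₂) z =
        z.1 ^ m k * z.2 ^ k * e k z.1 := by
      filter_upwards [mul_apply (inclX (c k)) (Y ^ k), inclX_apply (c k), pow_apply Y k, Y_apply,
        tendsto_fst_zero.eventually (eventually_eq_of_eq (hce k)),
        tendsto_fst_zero.eventually (mul_apply (T ^ m k) (e k)),
        tendsto_fst_zero.eventually (pow_apply T (m k)), tendsto_fst_zero.eventually T_apply]
        with z h1 h2 h3 h4 h5 h6 h7 h8
      rw [h1, h2, h3, h4, h5, h6, h7, h8]; ring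
    have heq : ∀ᶠ τ in atTop, (x τ * Complex.exp (r * θ τ)) ^ m k *
        (y τ * Complex.exp (s * θ τ)) ^ k * Complex.exp (((v n - v k : ℝ) : ℂ) * θ τ) * e k (x τ) =
        (inclX (c k) * Y ^ k : O₂) (x τ, y τ) * Complex.exp ((v n : ℂ) * θ τ) := by
      filter_upwards [hxy.eventually hval] with τ h1
      rw [h1, ← hexp (m k) k (v n) τ]; ring
    have hek : Tendsto (fun τ => e k (x τ)) atTop (𝓝 (ev (e k))) :=
      (e k).analyticAt.continuousAt.tendsto.comp hx0
    have hlim := (hx.pow (m k)).mul (hy.pow k)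
    split_ifs with hkn
    · subst hkn
      refine Tendsto.congr' heq ?_
      have := hlim.mul hek
      refine (this.congr fun τ => ?_).trans (by rw [mul_comm, mul_assoc])
      simp
    · by_cases hck : c k = 0
      · have : (inclX (c k) * Y ^ k : O₂) = 0 := by simp [hck]
        rw [this]
        refine tendsto_const_nhds.congr' ?_
        filter_upwards [hxy.eventually (zero_apply (E := ℂ × ℂ))] with τ h1
        rw [h1, zero_mul]
      · have hlt : v n < v k := by
          refine lt_of_le_of_ne (hmin k (Finset.mem_filter.2 ⟨hk, hck⟩)) fun h => hkn ?_
          exact (hrs _ _ _ _ h).2.symm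
        refine Tendsto.congr' heq ?_
        have := (hlim.mul (hdecay (sub_neg.2 hlt))).mul hek
        simpa using this
  have hrem : Tendsto (fun τ => (Y ^ N * b N : O₂) (x τ, y τ) * Complex.exp ((v n : ℂ) * θ τ)) atTop
      (𝓝 0) := by
    have hval : ∀ᶠ z in 𝓝 (0 : ℂ × ℂ), (Y ^ N * b N : O₂) z = z.2 ^ N * b N z := by
      filter_upwards [mul_apply (Y ^ N) (b N), pow_apply Y N, Y_apply] with z h1 h2 h3
      rw [h1, h2, h3]
    have hlt : v n < s * N := (hmin k₀ hk₀S).trans_lt (by rw [mul_comm]; exact hN)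
    have hb : Tendsto (fun τ => b N (x τ, y τ)) atTop (𝓝 (ev (b N))) :=
      (b N).analyticAt.continuousAt.tendsto.comp hxy
    have hκ : v n - (r * (0 : ℕ) + s * N) < 0 := by simp only [Nat.cast_zero]; linarith
    have := ((hy.pow N).mul (hdecay hκ)).mul hb
    rw [mul_zero, zero_mul] at this
    refine this.congr' ?_
    filter_upwards [hxy.eventually hval] with τ h1
    have h2 := hexp 0 N (v n) τ
    rw [pow_zero, one_mul, pow_zero, one_mul] at h2
    rw [h1, ← h2]; ring
  have hall := (tendsto_finsetSum _ hterm).add hrem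
  rw [Finset.sum_ite_eq' , if_pos (Finset.mem_range.2 hn.1), add_zero] at hall
  refine hall.congr' ?_
  filter_upwards [hxy.eventually (eventually_eq_of_eq (hab N)),
    hxy.eventually (add_apply (∑ k ∈ Finset.range N, inclX (c k) * Y ^ k) (Y ^ N * b N)),
    hxy.eventually (sum_apply (Finset.range N) fun k => inclX (c k) * Y ^ k)] with τ h1 h2 h3
  rw [h1, h2, h3, add_mul, Finset.sum_mul]

end AnalyticGerm

/-- The eigenvalues of a positive integer matrix of determinant `±1`. -/
theorem exists_irrational_eigenvalues {a b c d : ℕ} (ha : 1 ≤ a) (hb : 1 ≤ b) (hc : 1 ≤ c)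
    (hd : 1 ≤ d) (h : a * d = b * c + 1 ∨ b * c = a * d + 1) :
    ∃ Λ Λ' : ℝ, Irrational Λ ∧ Irrational Λ' ∧ Λ ≠ Λ' ∧ (a : ℝ) < Λ ∧ 1 < Λ ∧
      (Λ - a) * (Λ - d) = b * c ∧ (Λ' - a) * (Λ' - d) = b * c := by
  -- The discriminant, equal to (a + d)^2 - 4 or (a + d)^2 + 4. A square that close to (a + d)^2
  -- would be that of a neighbour of a + d, against parity.
  obtain ⟨D, hD⟩ : ∃ D : ℕ, D + 4 * (a * d) = (a + d) ^ 2 + 4 * (b * c) := by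
    refine ⟨(a + d) ^ 2 + 4 * (b * c) - 4 * (a * d), Nat.sub_add_cancel ?_⟩
    nlinarith [sq_nonneg ((a : ℤ) - d), Nat.zero_le (b * c), four_mul_le_sq_add a d]
  have hsq : ¬ IsSquare D := by
    rintro ⟨k, hk⟩
    have h1 : a + d = a + d := rfl
    generalize hS : a + d = S at hD h1
    have hbc : 1 ≤ b * c := Nat.mul_le_mul hb hc
    rcases h with h | h
    · have h2 : k * k + 4 = S * S := by rw [← hk]; nlinarith
      have hS3 : 3 ≤ S := by
        by_contra hlt
        have h3 : a = 1 := by omega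
        have h4 : d = 1 := by omega
        subst h3 h4; omega
      have h3 : k < S := by nlinarith
      have h4 : S < k + 2 := by nlinarith
      have h5 : S = k + 1 := by omega
      subst h5
      ring_nf at h2; omega
    · have h2 : k * k = S * S + 4 := by rw [← hk]; nlinarith
      have h3 : S < k := by nlinarith
      have h4 : k < S + 2 := by nlinarith
      have h5 : k = S + 1 := by omega
      subst h5
      ring_nf at h2; omega
  have hirr : Irrational (√(D : ℝ)) := irrational_sqrt_natCast_iff.2 hsq
  have hDr : (D : ℝ) + 4 * (a * d) = (a + d) ^ 2 + 4 * (b * c) := by exact_mod_cast hD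
  have hsq' : √(D : ℝ) ^ 2 = D := Real.sq_sqrt (Nat.cast_nonneg D)
  have hs0 : 0 < √(D : ℝ) := lt_of_le_of_ne (Real.sqrt_nonneg _) fun h0 => by
    rw [← h0] at hirr
    exact hirr ⟨0, by simp⟩
  have ha' : (1 : ℝ) ≤ a := by exact_mod_cast ha
  have hb' : (1 : ℝ) ≤ b := by exact_mod_cast hb
  have hc' : (1 : ℝ) ≤ c := by exact_mod_cast hc
  have hd' : (1 : ℝ) ≤ d := by exact_mod_cast hd
  have hbc : (1 : ℝ) ≤ b * c := by nlinarith
  have haΛ : (a : ℝ) < (a + d + √(D : ℝ)) / 2 := by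
    by_contra! hle
    nlinarith
  refine ⟨(a + d + √(D : ℝ)) / 2, (a + d - √(D : ℝ)) / 2, ?_, ?_, ?_, haΛ, by linarith, ?_, ?_⟩
  · have h1 : (a + d + √(D : ℝ)) / 2 = ((a + d : ℕ) + √(D : ℝ)) / (2 : ℕ) := by push_cast; ring
    rw [h1]
    exact (hirr.natCast_add _).div_natCast (by norm_num)
  · have h1 : (a + d - √(D : ℝ)) / 2 = ((a + d : ℕ) - √(D : ℝ)) / (2 : ℕ) := by push_cast; ring
    rw [h1]
    exact (hirr.natCast_sub _).div_natCast (by norm_num)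
  · intro h1; linarith
  · nlinarith
  · nlinarith

end

/-! ### Logarithmic forms, and exponent matrices of determinant ±1. -/

noncomputable section

open Metric AnalyticGerm

namespace AnalyticGerm

/-- The form is `y α dx + x β dy` with units `α`, `β` whose values satisfy no positive integral
linear relation. -/
def IsReducedLog (ω : O₂ × O₂) : Prop :=
  ∃ α β, ω.1 = Y * α ∧ ω.2 = X * β ∧ IsUnit α ∧ IsUnit β ∧
    ∀ m n : ℕ, 0 < m → 0 < n → (m : ℂ) * ev α + n * ev β ≠ 0

theorem X_mul_dx_pow (a : ℕ) : X * dx (X ^ a) = a * X ^ a := by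
  rcases a with _ | a
  · simp
  · rw [Derivation.leibniz_pow, dx_X]
    simp only [Nat.add_sub_cancel, smul_eq_mul, mul_one, nsmul_eq_mul]
    ring

theorem Y_mul_dy_pow (a : ℕ) : Y * dy (Y ^ a) = a * Y ^ a := by
  rcases a with _ | a
  · simp
  · rw [Derivation.leibniz_pow, dy_Y]
    simp only [Nat.add_sub_cancel, smul_eq_mul, mul_one, nsmul_eq_mul]
    ring

@[simp] theorem dx_Y_pow (a : ℕ) : dx (Y ^ a) = 0 := by rw [Derivation.leibniz_pow, dx_Y]; simp
@[simp] theorem dy_X_pow (a : ℕ) : dy (X ^ a) = 0 := by rw [Derivation.leibniz_pow, dy_X]; simp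

theorem X_mul_dx_monomial (a b : ℕ) (c : ℂ) (U : O₂) :
    X * dx (X ^ a * Y ^ b * (C c * exp U)) = X ^ a * Y ^ b * (C c * exp U) * ((a : O₂) + X * dx U) := by
  simp only [Derivation.leibniz, smul_eq_mul, dx_exp, dx_C, dx_Y_pow]
  linear_combination Y ^ b * (C c * exp U) * X_mul_dx_pow a

theorem Y_mul_dy_monomial (a b : ℕ) (c : ℂ) (U : O₂) :
    Y * dy (X ^ a * Y ^ b * (C c * exp U)) = X ^ a * Y ^ b * (C c * exp U) * ((b : O₂) + Y * dy U) := by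
  simp only [Derivation.leibniz, smul_eq_mul, dy_exp, dy_C, dy_X_pow]
  linear_combination X ^ a * (C c * exp U) * Y_mul_dy_pow b

theorem isReducedLog_of_log {ω : O₂ × O₂} {p q : O₂} (hp : IsUnit p) (hq : IsUnit q)
    (h : X * ω.1 * q = Y * ω.2 * p) (hab : IsRelPrime ω.1 ω.2)
    (hpq : ∀ m n : ℕ, 0 < m → 0 < n → (m : ℂ) * ev p + n * ev q ≠ 0) : IsReducedLog ω := by
  obtain ⟨k, hk, h1, h2⟩ := exists_eq_of_log hp hq h hab
  refine ⟨k * p, k * q, h1, h2, hk.mul hp, hk.mul hq, fun m n hm hn h0 => ?_⟩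
  have h3 : ev k * ((m : ℂ) * ev p + n * ev q) = 0 := by
    rw [map_mul, map_mul] at h0; linear_combination h0
  exact mul_ne_zero (isUnit_iff.1 hk) (hpq m n hm hn) h3

end AnalyticGerm

namespace GermMap

/-- A logarithmic 1-form which is an eigenvector of the pullback. -/
theorem exists_eigenform {φ : GermMap (ℂ × ℂ)} {a b c d : ℕ} {u₀ w₀ : ℂ} {U W : O₂}
    (hs : φ.IsSuperattracting)
    (hf : φ.fst = X ^ a * Y ^ b * (AnalyticGerm.C u₀ * exp U))
    (hg : φ.snd = X ^ c * Y ^ d * (AnalyticGerm.C w₀ * exp W)) (hU : ev U = 0) (hW : ev W = 0)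
    {α β μ : ℂ} (hμ : μ ≠ 0) (h1 : α * a + β * c = μ * α) (h2 : α * b + β * d = μ * β) :
    ∃ p q : O₂, ev p = α ∧ ev q = β ∧
      φ.pull p * ((a : O₂) + X * dx U) + φ.pull q * ((c : O₂) + X * dx W) = AnalyticGerm.C μ * p ∧
      φ.pull p * ((b : O₂) + Y * dy U) + φ.pull q * ((d : O₂) + Y * dy W) = AnalyticGerm.C μ * q := by
  -- The form is the logarithmic differential of x^α y^β e^H. Since (α, β) is a left eigenvector of
  -- the exponent matrix, it remains to solve μH = αU + βW + H∘φ.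
  obtain ⟨H, hH0, hH⟩ := hs.exists_eq_add_mul_pull μ⁻¹
    (l := AnalyticGerm.C μ⁻¹ * (AnalyticGerm.C α * U + AnalyticGerm.C β * W)) (by simp [hU, hW])
  have hH' : AnalyticGerm.C μ * H = AnalyticGerm.C α * U + AnalyticGerm.C β * W + φ.pull H := by
    have hμμ : (AnalyticGerm.C μ : O₂) * AnalyticGerm.C μ⁻¹ = 1 := by
      rw [← map_mul, mul_inv_cancel₀ hμ, map_one]
    linear_combination AnalyticGerm.C μ * hH +
      (AnalyticGerm.C α * U + AnalyticGerm.C β * W + φ.pull H) * hμμ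
  have hdx := congrArg (fun z => X * dx z) hH'
  have hdy := congrArg (fun z => Y * dy z) hH'
  simp only [map_add, Derivation.leibniz, smul_eq_mul, dx_C, dy_C, dx_pull, dy_pull, mul_zero,
    add_zero] at hdx hdy
  have e1 := X_mul_dx_monomial a b u₀ U
  have e2 := Y_mul_dy_monomial a b u₀ U
  have e3 := X_mul_dx_monomial c d w₀ W
  have e4 := Y_mul_dy_monomial c d w₀ W
  rw [← hf] at e1 e2
  rw [← hg] at e3 e4
  have g1 := congrArg (AnalyticGerm.C (E := ℂ × ℂ)) h1
  have g2 := congrArg (AnalyticGerm.C (E := ℂ × ℂ)) h2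
  simp only [map_add, map_mul, map_natCast] at g1 g2
  refine ⟨AnalyticGerm.C α + X * dx H, AnalyticGerm.C β + Y * dy H, by simp, by simp, ?_, ?_⟩
  · simp only [map_add, map_mul, pull_C, pull_X, pull_Y]
    linear_combination g1 - hdx - φ.pull (dx H) * e1 - φ.pull (dy H) * e3
  · simp only [map_add, map_mul, pull_C, pull_X, pull_Y]
    linear_combination g2 - hdy - φ.pull (dx H) * e2 - φ.pull (dy H) * e4

/-- Take the weights (b, Λ - a), a right eigenvector of the exponent matrix: substituting φ
multiplies weights by Λ. If A₁, A₂ have leading weights v₁, v₂, the relation gives Λv₁ + v₂ = Λv₂ +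
v₁, so v₁ = v₂. By irrationality the leading monomials agree, and comparing coefficients gives μ₁ =
μ₂. -/
theorem eq_of_pull_mul_eq {φ : GermMap (ℂ × ℂ)} {a b c d : ℕ} {u w : O₂} (hb : 1 ≤ b)
    (hu : IsUnit u) (hw : IsUnit w) (hf : φ.fst = X ^ a * Y ^ b * u) (hg : φ.snd = X ^ c * Y ^ d * w)
    {Λ : ℝ} (hΛ : Irrational Λ) (haΛ : (a : ℝ) < Λ) (hΛ1 : 1 < Λ)
    (hΛe : (Λ - a) * (Λ - d) = b * c) {μ₁ μ₂ : ℂ} (hμ₁ : μ₁ ≠ 0) (hμ₂ : μ₂ ≠ 0) {A₁ A₂ : O₂}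
    (hA₁ : A₁ ≠ 0) (hA₂ : A₂ ≠ 0)
    (h : AnalyticGerm.C μ₁ * φ.pull A₁ * A₂ = AnalyticGerm.C μ₂ * φ.pull A₂ * A₁) : μ₁ = μ₂ := by
  set r : ℝ := (b : ℝ) with hr_def
  set s : ℝ := Λ - a with hs_def
  have hr : 0 < r := by rw [hr_def]; exact_mod_cast hb
  have hs : 0 < s := sub_pos.2 haΛ
  have hrs : ∀ m n m' n' : ℕ, r * m + s * n = r * m' + s * n' → m = m' ∧ n = n' := by
    intro m n m' n' he
    have hn : n = n' := by
      by_contra hne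
      have hne' : (n : ℝ) - n' ≠ 0 := sub_ne_zero.2 (by exact_mod_cast hne)
      refine hΛ ⟨((a : ℚ) * ((n : ℚ) - n') + b * ((m' : ℚ) - m)) / ((n : ℚ) - n'), ?_⟩
      push_cast
      rw [div_eq_iff hne']
      rw [hr_def, hs_def] at he
      linear_combination -he
    refine ⟨?_, hn⟩
    subst hn
    have : (m : ℝ) = m' := by
      have : r * m = r * m' := by linarith
      exact mul_left_cancel₀ hr.ne' this
    exact_mod_cast this
  have hu0 : ev u ≠ 0 := AnalyticGerm.isUnit_iff.1 hu
  have hw0 : ev w ≠ 0 := AnalyticGerm.isUnit_iff.1 hw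
  -- Weights are read off along the arc (e^(-rτ), e^(-sτ)); its image under φ follows, up to
  -- constants, the same arc at time Λτ.
  set x : ℝ → ℂ := fun τ => Complex.exp (((-r * τ : ℝ)) : ℂ) with hx_def
  set y : ℝ → ℂ := fun τ => Complex.exp (((-s * τ : ℝ)) : ℂ) with hy_def
  have hx : Tendsto (fun τ => x τ * Complex.exp (r * τ)) atTop (𝓝 1) := by
    refine tendsto_const_nhds.congr fun τ => ?_
    rw [hx_def]; beta_reduce
    rw [← Complex.exp_add]; push_cast
    rw [show -(r : ℂ) * τ + r * τ = 0 by ring, Complex.exp_zero]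
  have hy : Tendsto (fun τ => y τ * Complex.exp (s * τ)) atTop (𝓝 1) := by
    refine tendsto_const_nhds.congr fun τ => ?_
    rw [hy_def]; beta_reduce
    rw [← Complex.exp_add]; push_cast
    rw [show -(s : ℂ) * τ + s * τ = 0 by ring, Complex.exp_zero]
  have hto : ∀ κ : ℝ, 0 < κ → Tendsto (fun τ : ℝ => Complex.exp (((-κ * τ : ℝ)) : ℂ)) atTop (𝓝 0) := by
    intro κ hκ
    rw [tendsto_zero_iff_norm_tendsto_zero]
    have h1 : ∀ τ : ℝ, ‖Complex.exp (((-κ * τ : ℝ)) : ℂ)‖ = Real.exp (-κ * τ) := fun τ => by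
      rw [← Complex.ofReal_exp, Complex.norm_real, Real.norm_of_nonneg (Real.exp_pos _).le]
    simp only [h1]
    exact Real.tendsto_exp_atBot.comp (tendsto_id.const_mul_atTop_of_neg (neg_neg_of_pos hκ))
  have hxy : Tendsto (fun τ => (x τ, y τ)) atTop (𝓝 (0 : ℂ × ℂ)) := (hto r hr).prodMk_nhds (hto s hs)
  have hval : ∀ (i j : ℕ) (v F : O₂), F = X ^ i * Y ^ j * v →
      ∀ᶠ z in 𝓝 (0 : ℂ × ℂ), F z = z.1 ^ i * z.2 ^ j * v z := by
    intro i j v F hF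
    filter_upwards [eventually_eq_of_eq hF, AnalyticGerm.mul_apply (X ^ i * Y ^ j) v,
      AnalyticGerm.mul_apply (X ^ i) (Y ^ j), AnalyticGerm.pow_apply X i,
      AnalyticGerm.pow_apply Y j, X_apply, Y_apply] with z h1 h2 h3 h4 h5 h6 h7
    rw [h1, h2, h3, h4, h5, h6, h7]
  have hcomp : ∀ (i j : ℕ) (v F : O₂) (κ : ℝ), F = X ^ i * Y ^ j * v → i * r + j * s = Λ * κ →
      Tendsto (fun τ => F (x τ, y τ) * Complex.exp (κ * ((Λ * τ : ℝ) : ℂ))) atTop (𝓝 (ev v)) := by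
    intro i j v F κ hF he
    have hv : Tendsto (fun τ => v (x τ, y τ)) atTop (𝓝 (ev v)) :=
      v.analyticAt.continuousAt.tendsto.comp hxy
    refine hv.congr' ?_
    filter_upwards [hxy.eventually (hval i j v F hF)] with τ h1
    have h2 : x τ ^ i * y τ ^ j * Complex.exp (κ * ((Λ * τ : ℝ) : ℂ)) = 1 := by
      rw [hx_def, hy_def]; beta_reduce
      rw [← Complex.exp_nat_mul, ← Complex.exp_nat_mul, ← Complex.exp_add, ← Complex.exp_add]
      have he' : (i : ℂ) * r + j * s = Λ * κ := by exact_mod_cast he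
      have : (i : ℂ) * ((-r * τ : ℝ) : ℂ) + j * ((-s * τ : ℝ) : ℂ) + κ * ((Λ * τ : ℝ) : ℂ) = 0 := by
        push_cast; linear_combination -τ * he'
      rw [this, Complex.exp_zero]
    rw [h1]
    linear_combination -(v (x τ, y τ)) * h2
  have hfx := hcomp a b u φ.fst r hf (by rw [hr_def, hs_def]; ring)
  have hgy := hcomp c d w φ.snd s hg (by rw [hr_def, hs_def]; linear_combination -hΛe)
  have hΛτ : Tendsto (fun τ : ℝ => Λ * τ) atTop atTop :=
    tendsto_id.const_mul_atTop (by linarith)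
  have hlt : ∀ {m₁ n₁ m₂ n₂ : ℕ} {L₁ L₂ : ℂ} {F₁ F₂ : ℝ → ℂ}, L₁ ≠ 0 → (∀ᶠ τ in atTop, F₁ τ = F₂ τ) →
      Tendsto (fun τ : ℝ => F₁ τ * (Complex.exp (((r * m₁ + s * n₁ : ℝ) : ℂ) * ((Λ * τ : ℝ) : ℂ)) *
        Complex.exp (((r * m₂ + s * n₂ : ℝ) : ℂ) * τ))) atTop (𝓝 L₁) →
      Tendsto (fun τ : ℝ => F₂ τ * (Complex.exp (((r * m₂ + s * n₂ : ℝ) : ℂ) * ((Λ * τ : ℝ) : ℂ)) *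
        Complex.exp (((r * m₁ + s * n₁ : ℝ) : ℂ) * τ))) atTop (𝓝 L₂) →
      r * m₂ + s * n₂ ≤ r * m₁ + s * n₁ := by
    intro m₁ n₁ m₂ n₂ L₁ L₂ F₁ F₂ hL he h1 h2
    by_contra! hlt
    have hκ : 0 < (Λ - 1) * ((r * m₂ + s * n₂) - (r * m₁ + s * n₁)) :=
      mul_pos (by linarith) (by linarith)
    have h3 := h2.mul (hto _ hκ)
    rw [mul_zero] at h3
    refine hL (tendsto_nhds_unique h1 (h3.congr' ?_))
    filter_upwards [he] with τ h4
    rw [h4, mul_assoc, ← Complex.exp_add, ← Complex.exp_add, ← Complex.exp_add]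
    congr 2
    push_cast; ring
  obtain ⟨m₁, n₁, c₁, hc₁, hl₁⟩ := exists_leading hA₁ hr hs hrs
  obtain ⟨m₂, n₂, c₂, hc₂, hl₂⟩ := exists_leading hA₂ hr hs hrs
  have k1 := hl₁ (fun τ => τ) x y 1 1 tendsto_id hx hy
  have k2 := hl₂ (fun τ => τ) x y 1 1 tendsto_id hx hy
  have k3 := hl₁ _ _ _ _ _ hΛτ hfx hgy
  have k4 := hl₂ _ _ _ _ _ hΛτ hfx hgy
  have hrel : ∀ᶠ τ in atTop, μ₁ * A₁ (φ (x τ, y τ)) * A₂ (x τ, y τ) =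
      μ₂ * A₂ (φ (x τ, y τ)) * A₁ (x τ, y τ) := by
    refine hxy.eventually (p := fun z => μ₁ * A₁ (φ z) * A₂ z = μ₂ * A₂ (φ z) * A₁ z) ?_
    filter_upwards [eventually_eq_of_eq h, AnalyticGerm.mul_apply (AnalyticGerm.C μ₁ * φ.pull A₁) A₂,
      AnalyticGerm.mul_apply (AnalyticGerm.C μ₂ * φ.pull A₂) A₁,
      AnalyticGerm.mul_apply (AnalyticGerm.C μ₁) (φ.pull A₁),
      AnalyticGerm.mul_apply (AnalyticGerm.C μ₂) (φ.pull A₂), φ.pull_apply A₁, φ.pull_apply A₂,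
      AnalyticGerm.C_apply μ₁, AnalyticGerm.C_apply μ₂] with z h1 h2 h3 h4 h5 h6 h7 h8 h9
    rw [h2, h3, h4, h5, h6, h7, h8, h9] at h1
    exact h1
  have K1 := (k3.mul k2).const_mul μ₁
  have K2 := (k4.mul k1).const_mul μ₂
  have hL1 : μ₁ * (c₁ * ev u ^ m₁ * ev w ^ n₁ * (c₂ * 1 ^ m₂ * 1 ^ n₂)) ≠ 0 := by
    simp only [one_pow, mul_one]; positivity
  have hL2 : μ₂ * (c₂ * ev u ^ m₂ * ev w ^ n₂ * (c₁ * 1 ^ m₁ * 1 ^ n₁)) ≠ 0 := by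
    simp only [one_pow, mul_one]; positivity
  have K1' : Tendsto (fun τ : ℝ => μ₁ * A₁ (φ (x τ, y τ)) * A₂ (x τ, y τ) *
      (Complex.exp (((r * m₁ + s * n₁ : ℝ) : ℂ) * ((Λ * τ : ℝ) : ℂ)) *
        Complex.exp (((r * m₂ + s * n₂ : ℝ) : ℂ) * τ))) atTop
      (𝓝 (μ₁ * (c₁ * ev u ^ m₁ * ev w ^ n₁ * (c₂ * 1 ^ m₂ * 1 ^ n₂)))) :=
    K1.congr fun τ => by
      change _ * (A₁ (φ (x τ, y τ)) * _ * _) = _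
      ring
  have K2' : Tendsto (fun τ : ℝ => μ₂ * A₂ (φ (x τ, y τ)) * A₁ (x τ, y τ) *
      (Complex.exp (((r * m₂ + s * n₂ : ℝ) : ℂ) * ((Λ * τ : ℝ) : ℂ)) *
        Complex.exp (((r * m₁ + s * n₁ : ℝ) : ℂ) * τ))) atTop
      (𝓝 (μ₂ * (c₂ * ev u ^ m₂ * ev w ^ n₂ * (c₁ * 1 ^ m₁ * 1 ^ n₁)))) :=
    K2.congr fun τ => by
      change _ * (A₂ (φ (x τ, y τ)) * _ * _) = _
      ring
  have hle := hlt hL1 hrel K1' K2'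
  have hge := hlt hL2 (hrel.mono fun _ h => h.symm) K2' K1'
  obtain ⟨hm, hn⟩ := hrs _ _ _ _ (le_antisymm hge hle)
  subst hm hn
  have hlim := tendsto_nhds_unique (K1'.congr' (hrel.mono fun τ h1 => by rw [h1])) K2'
  simp only [one_pow, mul_one] at hlim
  have hne : c₁ * ev u ^ m₁ * ev w ^ n₁ * c₂ ≠ 0 := by positivity
  refine mul_right_cancel₀ hne ?_
  linear_combination hlim

/-- The invariant form of a monomial type germ with unimodular exponent matrix. -/
theorem isReducedLog_of_unimodular {φ : GermMap (ℂ × ℂ)} {a b c d : ℕ} {u w : O₂}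
    (ha : 1 ≤ a) (hb : 1 ≤ b) (hc : 1 ≤ c) (hd : 1 ≤ d) (hs : φ.IsSuperattracting)
    (hu : IsUnit u) (hw : IsUnit w) (hf : φ.fst = X ^ a * Y ^ b * u) (hg : φ.snd = X ^ c * Y ^ d * w)
    (hdet : a * d = b * c + 1 ∨ b * c = a * d + 1) {ω : O₂ × O₂} (hω : φ.Preserves ω)
    (hrel : IsRelPrime ω.1 ω.2) : IsReducedLog ω := by
  obtain ⟨Λ, Λ', hΛ, hΛ', hne, haΛ, hΛ1, he, he'⟩ := exists_irrational_eigenvalues ha hb hc hd hdet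
  obtain ⟨U, hU0, hU⟩ := exists_eq_C_mul_exp hu
  obtain ⟨W, hW0, hW⟩ := exists_eq_C_mul_exp hw
  have hf' := hf
  have hg' := hg
  rw [hU] at hf'
  rw [hW] at hg'
  have hform : ∀ L : ℝ, Irrational L → (L - a) * (L - d) = b * c → ∃ p q : O₂,
      ev p = c ∧ ev q = L - a ∧
      φ.pull p * ((a : O₂) + X * dx U) + φ.pull q * ((c : O₂) + X * dx W) = AnalyticGerm.C (L : ℂ) * p ∧
      φ.pull p * ((b : O₂) + Y * dy U) + φ.pull q * ((d : O₂) + Y * dy W) = AnalyticGerm.C (L : ℂ) * q := by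
    intro L hL hLe
    have hLe' : ((L : ℂ) - a) * (L - d) = b * c := by exact_mod_cast hLe
    refine exists_eigenform hs hf' hg' hU0 hW0 (by exact_mod_cast hL.ne_zero) (by ring) ?_
    linear_combination -hLe'
  have hfinal : ∀ L : ℝ, Irrational L → ∀ p q : O₂, ev p = c → ev q = L - a →
      X * ω.1 * q = Y * ω.2 * p → IsReducedLog ω := by
    intro L hL p q hp hq h
    have hcne : (c : ℂ) ≠ 0 := by exact_mod_cast (by omega : c ≠ 0)
    have hkey : ∀ m n : ℕ, 0 < n → (m : ℂ) * ev p + n * ev q ≠ 0 := by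
      intro m n hn h0
      rw [hp, hq] at h0
      have h1 : (m : ℝ) * c + n * (L - a) = 0 := by exact_mod_cast h0
      have hn' : (n : ℝ) ≠ 0 := by exact_mod_cast hn.ne'
      refine hL ⟨((n : ℚ) * a - m * c) / n, ?_⟩
      push_cast
      rw [div_eq_iff hn']
      linear_combination -h1
    refine isReducedLog_of_log (AnalyticGerm.isUnit_iff.2 (by rw [hp]; exact hcne))
      (AnalyticGerm.isUnit_iff.2 ?_) h hrel fun m n _ hn => hkey m n hn
    have := hkey 0 1 one_pos
    simpa using this
  obtain ⟨p₁, q₁, hp₁, hq₁, h11, h12⟩ := hform Λ hΛ he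
  obtain ⟨p₂, q₂, hp₂, hq₂, h21, h22⟩ := hform Λ' hΛ' he'
  have hD : IsUnit (p₁ * q₂ - p₂ * q₁) := by
    rw [AnalyticGerm.isUnit_iff, map_sub, map_mul, map_mul, hp₁, hq₁, hp₂, hq₂]
    have hcne : (c : ℂ) ≠ 0 := by exact_mod_cast (by omega : c ≠ 0)
    have : (Λ : ℂ) ≠ Λ' := by exact_mod_cast hne
    have h1 : (c : ℂ) * (Λ' - a) - c * (Λ - a) = c * (Λ' - Λ) := by ring
    rw [h1]
    exact mul_ne_zero hcne (sub_ne_zero.2 this.symm)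
  obtain ⟨E, hE⟩ := hD.exists_right_inv
  have e1 := X_mul_dx_monomial a b (ev u) U
  have e2 := Y_mul_dy_monomial a b (ev u) U
  have e3 := X_mul_dx_monomial c d (ev w) W
  have e4 := Y_mul_dy_monomial c d (ev w) W
  rw [← hf'] at e1 e2
  rw [← hg'] at e3 e4
  -- Cramer's rule expresses ω, up to the factor xy, in the basis of the two eigenforms. The
  -- determinant is a unit because the eigenvalues differ.
  set A₁ := E * (X * ω.1 * q₂ - Y * ω.2 * p₂) with hA₁
  set A₂ := E * (Y * ω.2 * p₁ - X * ω.1 * q₁) with hA₂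
  have hA : X * ω.1 = A₁ * p₁ + A₂ * p₂ := by
    rw [hA₁, hA₂]; linear_combination -(X * ω.1) * hE
  have hB : Y * ω.2 = A₁ * q₁ + A₂ * q₂ := by
    rw [hA₁, hA₂]; linear_combination -(Y * ω.2) * hE
  have hrelA : AnalyticGerm.C (Λ : ℂ) * φ.pull A₁ * A₂ = AnalyticGerm.C (Λ' : ℂ) * φ.pull A₂ * A₁ := by
    have hφA := congrArg φ.pull hA
    have hφB := congrArg φ.pull hB
    simp only [map_add, map_mul, pull_X, pull_Y] at hφA hφB
    have hinv : X * Y * wedge (φ.pullForm ω) ω = 0 := by rw [hω, mul_zero]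
    have hinv' : (φ.fst * φ.pull ω.1 * ((a : O₂) + X * dx U) + φ.snd * φ.pull ω.2 * ((c : O₂) + X * dx W)) *
        (Y * ω.2) - (φ.fst * φ.pull ω.1 * ((b : O₂) + Y * dy U) + φ.snd * φ.pull ω.2 * ((d : O₂) + Y * dy W)) *
        (X * ω.1) = 0 := by
      rw [← hinv]
      simp only [wedge, pullForm]
      linear_combination -φ.pull ω.1 * (Y * ω.2) * e1 + φ.pull ω.1 * (X * ω.1) * e2 -
        φ.pull ω.2 * (Y * ω.2) * e3 + φ.pull ω.2 * (X * ω.1) * e4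
    rw [hφA, hφB, hA, hB] at hinv'
    have hE0 : (p₁ * q₂ - p₂ * q₁) * (AnalyticGerm.C (Λ : ℂ) * φ.pull A₁ * A₂ -
        AnalyticGerm.C (Λ' : ℂ) * φ.pull A₂ * A₁) = 0 := by
      linear_combination hinv' - φ.pull A₁ * (A₁ * q₁ + A₂ * q₂) * h11 +
        φ.pull A₁ * (A₁ * p₁ + A₂ * p₂) * h12 - φ.pull A₂ * (A₁ * q₁ + A₂ * q₂) * h21 +
        φ.pull A₂ * (A₁ * p₁ + A₂ * p₂) * h22
    exact sub_eq_zero.1 ((mul_eq_zero.1 hE0).resolve_left hD.ne_zero)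
  by_cases h1 : A₁ = 0
  · refine hfinal Λ' hΛ' p₂ q₂ hp₂ hq₂ ?_
    rw [hA, hB, h1]; ring
  by_cases h2 : A₂ = 0
  · refine hfinal Λ hΛ p₁ q₁ hp₁ hq₁ ?_
    rw [hA, hB, h2]; ring
  exact absurd (eq_of_pull_mul_eq hb hu hw hf hg hΛ haΛ hΛ1 he (by exact_mod_cast hΛ.ne_zero)
    (by exact_mod_cast hΛ'.ne_zero) h1 h2 hrelA) (by exact_mod_cast hne)

end GermMap

end

/-! ### Exponent matrices of determinant 0, and the normal crossing case. -/

noncomputable section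

open Metric AnalyticGerm

namespace AnalyticGerm

theorem exp_mul_exp_of_add_eq (a b c : O₂) (h : a + b = c) : exp a * exp b = exp c := by
  rw [← h, exp_add]

theorem intCast_apply {E : Type*} [NormedAddCommGroup E] [NormedSpace ℂ E] (k : ℤ) :
    ∀ᶠ p in 𝓝 0, (k : AnalyticGerm E) p = k := by
  have := C_apply (E := E) k
  rwa [map_intCast] at this

theorem exists_eq_X_mul_add_Y_mul {z : O₂} (hz : ev z = 0) : ∃ b c, z = X * b + Y * c := by
  obtain ⟨c, hc⟩ := exists_eq_add_Y_mul z
  obtain ⟨b, hb⟩ := T_dvd_iff.2 (show ev (resY z) = 0 by simpa using hz)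
  refine ⟨inclX b, c, ?_⟩
  rw [hb, map_mul, inclX_T] at hc
  exact hc

theorem exists_eq_of_dvd_monomial {h v : O₂} (hv : IsUnit v) {i j : ℕ} (hd : h ∣ X ^ i * Y ^ j * v) :
    ∃ (i' j' : ℕ) (v' : O₂), IsUnit v' ∧ h = X ^ i' * Y ^ j' * v' := by
  rw [hv.dvd_mul_right] at hd
  obtain ⟨x, y, hx, hy, rfl⟩ := exists_dvd_and_dvd_of_dvd_mul hd
  obtain ⟨i', -, hx'⟩ := (dvd_prime_pow prime_X i).1 hx
  obtain ⟨j', -, hy'⟩ := (dvd_prime_pow prime_Y j).1 hy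
  obtain ⟨s, hs⟩ := hx'.symm
  obtain ⟨t, ht⟩ := hy'.symm
  exact ⟨i', j', s * t, s.isUnit.mul t.isUnit, by rw [← hs, ← ht]; ring⟩

/-- The logarithmic differential of the first integral has residues P and Q along the axes, and
positive integers satisfy no positive relation. -/
theorem isReducedLog_of_wedge_d {ω : O₂ × O₂} (hrel : IsRelPrime ω.1 ω.2) {P Q : ℕ} (hP : 1 ≤ P)
    (hQ : 1 ≤ Q) {e : O₂} (he : IsUnit e) (h : wedge ω (d (X ^ P * Y ^ Q * e)) = 0) :
    IsReducedLog ω := by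
  obtain ⟨E, -, hE⟩ := exists_eq_C_mul_exp he
  have e1 := X_mul_dx_monomial P Q (ev e) E
  have e2 := Y_mul_dy_monomial P Q (ev e) E
  rw [← hE] at e1 e2
  have hF : X ^ P * Y ^ Q * e ≠ 0 :=
    mul_ne_zero (mul_ne_zero (pow_ne_zero _ X_ne_zero) (pow_ne_zero _ Y_ne_zero)) he.ne_zero
  have hPc : (P : ℂ) ≠ 0 := by exact_mod_cast (by omega : P ≠ 0)
  have hQc : (Q : ℂ) ≠ 0 := by exact_mod_cast (by omega : Q ≠ 0)
  refine isReducedLog_of_log (p := P + X * dx E) (q := Q + Y * dy E) ?_ ?_ ?_ hrel ?_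
  · rw [isUnit_iff]; simpa using hPc
  · rw [isUnit_iff]; simpa using hQc
  · refine mul_left_cancel₀ hF ?_
    simp only [wedge, d] at h
    linear_combination X * Y * h - X * ω.1 * e2 + Y * ω.2 * e1
  · intro m n hm hn
    simp only [map_add, map_natCast, map_mul, ev_X, ev_Y, zero_mul, add_zero]
    exact_mod_cast (by positivity : m * P + n * Q ≠ 0)

end AnalyticGerm

namespace GermMap

/-- If two points with x, x' nonzero have the same image, the ratio of x and x' is 1 by the Bezout
relation. Then e^(y - y') = 1, and |y - y'| < 2 excludes nonzero multiples of 2πi. -/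
theorem genInj_of_power {m n : ℕ} {k l : ℤ} (h1 : k * m + l * n = 1)
    {u w : ℂ} (hu : u ≠ 0) (hw : w ≠ 0) {Ψ : GermMap (ℂ × ℂ)}
    (hf : Ψ.fst = AnalyticGerm.C u * X ^ m * exp ((l : O₂) * Y))
    (hg : Ψ.snd = AnalyticGerm.C w * X ^ n * exp (-(k : O₂) * Y)) : Ψ.GenInj := by
  have hev : ∀ᶠ p in 𝓝 (0 : ℂ × ℂ), X p = p.1 ∧ Ψ.fst p = u * p.1 ^ m * Complex.exp (l * p.2) ∧
      Ψ.snd p = w * p.1 ^ n * Complex.exp (-k * p.2) ∧ ‖p.2‖ < 1 := by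
    have hval : ∀ (c : ℂ) (r : ℕ) (s : ℤ) (F : O₂), F = AnalyticGerm.C c * X ^ r * exp ((s : O₂) * Y) →
        ∀ᶠ p in 𝓝 (0 : ℂ × ℂ), F p = c * p.1 ^ r * Complex.exp (s * p.2) := by
      intro c r s F hF
      filter_upwards [eventually_eq_of_eq hF, AnalyticGerm.mul_apply (AnalyticGerm.C c * X ^ r)
        (exp ((s : O₂) * Y)), AnalyticGerm.mul_apply (AnalyticGerm.C c) (X ^ r), AnalyticGerm.C_apply c,
        AnalyticGerm.pow_apply X r, X_apply, exp_apply ((s : O₂) * Y), AnalyticGerm.mul_apply (s : O₂) Y,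
        intCast_apply s, Y_apply] with p h1 h2 h3 h4 h5 h6 h7 h8 h9 h10
      rw [h1, h2, h3, h4, h5, h6, h7, h8, h9, h10]
    have hs : ∀ᶠ p in 𝓝 (0 : ℂ × ℂ), ‖p.2‖ < 1 := by
      have : ∀ᶠ z in 𝓝 (0 : ℂ), ‖z‖ < 1 := by
        filter_upwards [ball_mem_nhds (0 : ℂ) one_pos] with z hz
        simpa using hz
      exact tendsto_snd_zero.eventually this
    filter_upwards [X_apply, hval u m l _ hf, hval w n (-k) Ψ.snd (by rw [hg]; push_cast; rfl), hs]
      with p h1 h2 h3 h4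
    exact ⟨h1, h2, by rw [h3]; push_cast; rfl, h4⟩
  refine ⟨X, X_ne_zero, _, hev, ?_⟩
  rintro ⟨x, y⟩ ⟨⟨a1, a2, a3, a4⟩, a5⟩ ⟨x', y'⟩ ⟨⟨b1, b2, b3, b4⟩, b5⟩ heq
  simp only at a1 a2 a3 a4 b1 b2 b3 b4
  rw [a1] at a5
  rw [b1] at b5
  have e1 : u * x ^ m * Complex.exp (l * y) = u * x' ^ m * Complex.exp (l * y') := by
    rw [← a2, ← b2]; exact congrArg Prod.fst heq
  have e2 : w * x ^ n * Complex.exp (-k * y) = w * x' ^ n * Complex.exp (-k * y') := by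
    rw [← a3, ← b3]; exact congrArg Prod.snd heq
  set ρ := x / x' with hρ
  have hρ0 : ρ ≠ 0 := div_ne_zero a5 b5
  have hx : x = ρ * x' := by rw [hρ]; field_simp
  have f1 : ρ ^ m = Complex.exp (-l * (y - y')) := by
    have h2 : Complex.exp (-l * (y - y')) * Complex.exp (l * y) = Complex.exp (l * y') := by
      rw [← Complex.exp_add]; congr 1; ring
    have h3 : u * x' ^ m * Complex.exp (l * y) ≠ 0 :=
      mul_ne_zero (mul_ne_zero hu (pow_ne_zero _ b5)) (Complex.exp_ne_zero _)
    refine mul_left_cancel₀ h3 ?_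
    rw [hx, mul_pow] at e1
    linear_combination e1 - u * x' ^ m * h2
  have f2 : ρ ^ n = Complex.exp (k * (y - y')) := by
    have h2 : Complex.exp (k * (y - y')) * Complex.exp (-k * y) = Complex.exp (-k * y') := by
      rw [← Complex.exp_add]; congr 1; ring
    have h3 : w * x' ^ n * Complex.exp (-k * y) ≠ 0 :=
      mul_ne_zero (mul_ne_zero hw (pow_ne_zero _ b5)) (Complex.exp_ne_zero _)
    refine mul_left_cancel₀ h3 ?_
    rw [hx, mul_pow] at e2
    linear_combination e2 - w * x' ^ n * h2
  have hρ1 : ρ = 1 := by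
    have h2 : ρ = (ρ ^ m) ^ k * (ρ ^ n) ^ l := by
      rw [← zpow_natCast, ← zpow_natCast, ← zpow_mul, ← zpow_mul, ← zpow_add₀ hρ0]
      rw [show (m : ℤ) * k + n * l = 1 by linarith, zpow_one]
    rw [h2, f1, f2, ← Complex.exp_int_mul, ← Complex.exp_int_mul, ← Complex.exp_add]
    rw [show (k : ℂ) * (-l * (y - y')) + l * (k * (y - y')) = 0 by ring, Complex.exp_zero]
  have hexp : Complex.exp (y - y') = 1 := by
    have h1' : (k : ℂ) * m + l * n = 1 := by exact_mod_cast h1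
    have h2 : y - y' = m * (k * (y - y')) - n * (-l * (y - y')) := by
      linear_combination -(y - y') * h1'
    rw [h2, Complex.exp_sub, Complex.exp_nat_mul, Complex.exp_nat_mul, ← f1, ← f2, hρ1]; simp
  have hyy : y = y' := by
    obtain ⟨N, hN⟩ := Complex.exp_eq_one_iff.1 hexp
    have h3 : ‖y - y'‖ < 2 := (norm_sub_le _ _).trans_lt (by linarith)
    rw [hN, norm_mul] at h3
    have h4 : ‖(2 * Real.pi * Complex.I : ℂ)‖ = 2 * Real.pi := by
      simp [abs_of_pos Real.pi_pos]
    rw [h4, Complex.norm_intCast] at h3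
    have hN0 : N = 0 := by
      by_contra hne
      have h5 : (1 : ℝ) ≤ |(N : ℝ)| := by exact_mod_cast Int.one_le_abs hne
      nlinarith [Real.pi_gt_three]
    rw [hN0] at hN
    simpa [sub_eq_zero] using hN
  rw [hρ1, one_mul] at hx
  rw [hx, hyy]

set_option maxHeartbeats 1000000 in
/-- The invariant form of a monomial type germ with degenerate exponent matrix. -/
theorem GenInj.isReducedLog_of_degenerate {φ : GermMap (ℂ × ℂ)} (hφ : φ.GenInj) {a b c d i j : ℕ}
    {u w v : O₂} (ha : 1 ≤ a) (hb : 1 ≤ b) (hc : 1 ≤ c)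
    (hu : IsUnit u) (hw : IsUnit w) (hf : φ.fst = X ^ a * Y ^ b * u) (hg : φ.snd = X ^ c * Y ^ d * w)
    (hv : IsUnit v) (hJ : φ.jac = X ^ i * Y ^ j * v)
    (hdet : a * d = b * c) {ω : O₂ × O₂} (hω : φ.Preserves ω)
    (hrel : IsRelPrime ω.1 ω.2) : IsReducedLog ω := by
  obtain ⟨U, hU0, hU⟩ := exists_eq_C_mul_exp hu
  obtain ⟨W, hW0, hW⟩ := exists_eq_C_mul_exp hw
  have hu0 : ev u ≠ 0 := AnalyticGerm.isUnit_iff.1 hu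
  have hw0 : ev w ≠ 0 := AnalyticGerm.isUnit_iff.1 hw
  set P := Nat.gcd a c with hPdef
  have hP : 0 < P := Nat.gcd_pos_of_pos_left _ ha
  obtain ⟨m, n, hmn, ham, hcn⟩ := Nat.exists_coprime a c
  rw [← hPdef] at ham hcn
  have hm : 1 ≤ m := Nat.one_le_iff_ne_zero.2 fun h => by subst h; omega
  have hn : 1 ≤ n := Nat.one_le_iff_ne_zero.2 fun h => by subst h; omega
  have hdet' : m * d = b * n := by
    have : (m * d) * P = (b * n) * P := by rw [ham, hcn] at hdet; nlinarith
    exact Nat.eq_of_mul_eq_mul_right hP this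
  obtain ⟨Q, hQ⟩ : m ∣ b := hmn.dvd_of_dvd_mul_right ⟨d, hdet'.symm⟩
  have hQ1 : 1 ≤ Q := Nat.one_le_iff_ne_zero.2 fun h => by subst h; omega
  have hdQ : d = n * Q := by
    refine Nat.eq_of_mul_eq_mul_left hm ?_
    rw [hdet', hQ]; ring
  obtain ⟨k, l, hkl⟩ : ∃ k l : ℤ, k * m + l * n = 1 := by
    have := Nat.isCoprime_iff_coprime.2 hmn
    obtain ⟨k, l, h⟩ := this
    exact ⟨k, l, h⟩
  have hkl' : (k : O₂) * m + l * n = 1 := by exact_mod_cast congrArg (Int.cast (R := O₂)) hkl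
  -- The rows of exponents are m and n times (P, Q), with m, n coprime. The Bezout coefficients
  -- distribute the unit factors so that φ = Ψ∘π, π keeping only x^P y^Q and one combination of U
  -- and W.
  obtain ⟨π, hπ1, hπ2⟩ : ∃ π : GermMap (ℂ × ℂ),
      π.fst = X ^ P * Y ^ Q * exp ((k : O₂) * U + (l : O₂) * W) ∧
        π.snd = (n : O₂) * U - (m : O₂) * W := ⟨⟨X ^ P * Y ^ Q * exp ((k : O₂) * U + (l : O₂) * W), (n : O₂) * U - (m : O₂) * W,
    by simp [hP.ne'], by simp [hU0, hW0]⟩, rfl, rfl⟩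
  obtain ⟨Ψ, hΨ1, hΨ2⟩ : ∃ Ψ : GermMap (ℂ × ℂ),
      Ψ.fst = AnalyticGerm.C (ev u) * X ^ m * exp ((l : O₂) * Y) ∧
        Ψ.snd = AnalyticGerm.C (ev w) * X ^ n * exp (-(k : O₂) * Y) := ⟨⟨AnalyticGerm.C (ev u) * X ^ m * exp ((l : O₂) * Y),
    AnalyticGerm.C (ev w) * X ^ n * exp (-(k : O₂) * Y), by simp [show m ≠ 0 by omega],
    by simp [show n ≠ 0 by omega]⟩, rfl, rfl⟩
  have hΨ : Ψ.GenInj := genInj_of_power hkl hu0 hw0 hΨ1 hΨ2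
  have hΨπ : Ψ.comp π = φ := by
    ext1
    · rw [hf, hU, comp_fst]
      simp only [hΨ1, hπ1, hπ2, map_mul, map_pow, pull_C, pull_X, pull_exp, map_intCast, pull_Y]
      have h2 : exp ((k : O₂) * U + (l : O₂) * W) ^ m * exp ((l : O₂) * ((n : O₂) * U - (m : O₂) * W)) = exp U := by
        rw [← exp_nat_mul]
        refine exp_mul_exp_of_add_eq _ _ _ ?_
        linear_combination U * hkl'
      rw [ham, hQ]
      linear_combination AnalyticGerm.C (ev u) * (X ^ (m * P) * Y ^ (m * Q)) * h2
    · rw [hg, hW, comp_snd]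
      simp only [hΨ2, hπ1, hπ2, map_mul, map_pow, pull_C, pull_X, pull_exp, map_intCast, pull_Y,
        map_neg]
      have h2 : exp ((k : O₂) * U + (l : O₂) * W) ^ n * exp (-(k : O₂) * ((n : O₂) * U - (m : O₂) * W)) = exp W := by
        rw [← exp_nat_mul]
        refine exp_mul_exp_of_add_eq _ _ _ ?_
        linear_combination W * hkl'
      rw [hcn, hdQ]
      linear_combination AnalyticGerm.C (ev w) * (X ^ (n * P) * Y ^ (n * Q)) * h2
  have hπ : π.GenInj := GenInj.of_comp (ψ := Ψ) (hΨπ ▸ hφ)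
  obtain ⟨m', rfl⟩ : ∃ m', m = m' + 1 := ⟨m - 1, by omega⟩
  obtain ⟨n', rfl⟩ : ∃ n', n = n' + 1 := ⟨n - 1, by omega⟩
  replace hΨ1 : Ψ.fst = X ^ (m' + 1) * (AnalyticGerm.C (ev u) * exp ((l : O₂) * Y)) := by
    rw [hΨ1]; ring
  replace hΨ2 : Ψ.snd = X ^ (n' + 1) * (AnalyticGerm.C (ev w) * exp (-(k : O₂) * Y)) := by
    rw [hΨ2]; ring
  set E₁ := AnalyticGerm.C (ev u) * exp ((l : O₂) * Y) with hE₁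
  set E₂ := AnalyticGerm.C (ev w) * exp (-(k : O₂) * Y) with hE₂
  have hE₁u : IsUnit E₁ := (isUnit_C hu0).mul (isUnit_exp _)
  have hE₂u : IsUnit E₂ := (isUnit_C hw0).mul (isUnit_exp _)
  have dxE₁ : dx E₁ = 0 := by simp [hE₁, Derivation.leibniz, dx_exp]
  have dyE₁ : dy E₁ = (l : O₂) * E₁ := by
    simp only [hE₁, Derivation.leibniz, dy_exp, dy_C, smul_eq_mul, Derivation.map_intCast, dy_Y]
    ring
  have dxE₂ : dx E₂ = 0 := by simp [hE₂, Derivation.leibniz, dx_exp]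
  have dyE₂ : dy E₂ = -(k : O₂) * E₂ := by
    simp only [hE₂, Derivation.leibniz, dy_exp, dy_C, smul_eq_mul, map_neg, Derivation.map_intCast,
      dy_Y]
    ring
  have hΨJ : Ψ.jac = X ^ (m' + n' + 1) * (-(E₁ * E₂)) := by
    refine mul_left_cancel₀ X_ne_zero ?_
    have p1 := X_mul_dx_pow (m' + 1)
    have p2 := X_mul_dx_pow (n' + 1)
    simp only [jac, hΨ1, hΨ2, Derivation.leibniz, smul_eq_mul, dxE₁, dxE₂, dyE₁, dyE₂, dy_X_pow]
    linear_combination (-(k : O₂)) * E₁ * E₂ * X ^ (n' + 1) * p1 - (l : O₂) * E₁ * E₂ * X ^ (m' + 1) * p2 -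
      X ^ (m' + n' + 2) * E₁ * E₂ * hkl'
  obtain ⟨i', j', v', hv', hπJ⟩ : ∃ (i' j' : ℕ) (v' : O₂), IsUnit v' ∧ π.jac = X ^ i' * Y ^ j' * v' := by
    refine exists_eq_of_dvd_monomial hv (i := i) (j := j) ?_
    rw [← hJ, ← hΨπ, jac_comp]
    exact dvd_mul_left _ _
  have hmn1 : 1 ≤ (m' + 1) * P + (n' + 1) * Q - 1 := by
    have : 2 ≤ (m' + 1) * P + (n' + 1) * Q := by nlinarith
    omega
  -- The exchanged composite π∘Ψ preserves Ψ*ω and has first component x^(mP + nQ) times a unit, so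
  -- its only invariant foliation is known. Pulling back by π gives φ*ω ∧ dF = 0 with F = x^P y^Q
  -- times a unit, hence ω ∧ dF = 0 by invariance.
  obtain ⟨e, he, hwd⟩ := (hπ.comp hΨ).exists_wedge_d_eq_zero hmn1
    (u := E₁ ^ P * E₂ ^ Q * Ψ.pull (exp ((k : O₂) * U + (l : O₂) * W)))
    (((hE₁u.pow _).mul (hE₂u.pow _)).mul ((isUnit_exp _).map _)) (by
      rw [Nat.sub_add_cancel (by omega), comp_fst]
      simp only [hπ1, map_mul, map_pow, pull_X, pull_Y]
      rw [hΨ1, hΨ2]; ring)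
    (by
      obtain ⟨z₁, z₂, hz⟩ := exists_eq_X_mul_add_Y_mul π.ev_snd
      rw [comp_snd, hz, map_add, map_mul, map_mul, pull_X, pull_Y, hΨ1, hΨ2]
      exact ⟨X ^ m' * E₁ * Ψ.pull z₁ + X ^ n' * E₂ * Ψ.pull z₂, by ring⟩)
    (v := E₁ ^ i' * E₂ ^ j' * Ψ.pull v' * (-(E₁ * E₂)))
    (N := (m' + 1) * i' + (n' + 1) * j' + (m' + n' + 1))
    ((((hE₁u.pow _).mul (hE₂u.pow _)).mul (hv'.map _)).mul (hE₁u.mul hE₂u).neg) (by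
      rw [jac_comp, hΨJ, hπJ]
      simp only [map_mul, map_pow, pull_X, pull_Y]
      rw [hΨ1, hΨ2]; ring)
    (hω.semiconj (M := Ψ) (by rw [← comp_assoc, hΨπ]))
  have hω0 : ω ≠ 0 := by
    rintro rfl
    exact not_isUnit_zero (isRelPrime_zero_left.1 hrel)
  refine isReducedLog_of_wedge_d hrel hP hQ1 (e := exp ((k : O₂) * U + (l : O₂) * W) * π.pull e)
    ((isUnit_exp _).mul (he.map _)) ?_
  have h3 := π.wedge_pullForm (Ψ.pullForm ω) (AnalyticGerm.d (X * e))
  rw [hwd, _root_.map_zero, mul_zero, ← pullForm_comp, hΨπ, pullForm_d, map_mul, pull_X] at h3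
  have h4 : π.fst * π.pull e = X ^ P * Y ^ Q * (exp ((k : O₂) * U + (l : O₂) * W) * π.pull e) := by
    rw [hπ1]; ring
  rw [h4] at h3
  exact wedge_trans (wedge_comm_eq_zero hω) h3 (pullForm_ne_zero hφ.jac_ne_zero hω0)

theorem dvd_fst_or_dvd_snd {π : O₂} (hπ : Prime π) {ψ : GermMap (ℂ × ℂ)} {i j : ℕ} {u : O₂}
    (hu : IsUnit u) (h : π ∣ ψ.fst ^ i * ψ.snd ^ j * u) :
    (π ∣ ψ.fst ∧ 1 ≤ i) ∨ (π ∣ ψ.snd ∧ 1 ≤ j) := by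
  rw [hu.dvd_mul_right] at h
  rcases hπ.dvd_or_dvd h with h | h
  · refine Or.inl ⟨hπ.dvd_of_dvd_pow h, Nat.one_le_iff_ne_zero.2 ?_⟩
    rintro rfl
    exact hπ.not_isUnit (isUnit_of_dvd_one (by simpa using h))
  · refine Or.inr ⟨hπ.dvd_of_dvd_pow h, Nat.one_le_iff_ne_zero.2 ?_⟩
    rintro rfl
    exact hπ.not_isUnit (isUnit_of_dvd_one (by simpa using h))

theorem prime_fst {ψ : GermMap (ℂ × ℂ)} (h : ev ψ.jac ≠ 0) : Prime ψ.fst := by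
  obtain ⟨M, hM⟩ := exists_isInverse h
  have := prime_of_pull hM.left hM.right prime_X
  rwa [pull_X] at this

theorem prime_snd {ψ : GermMap (ℂ × ℂ)} (h : ev ψ.jac ≠ 0) : Prime ψ.snd := by
  obtain ⟨M, hM⟩ := exists_isInverse h
  have := prime_of_pull hM.left hM.right prime_Y
  rwa [pull_Y] at this

theorem not_fst_dvd_snd {ψ : GermMap (ℂ × ℂ)} (h : ev ψ.jac ≠ 0) : ¬ ψ.fst ∣ ψ.snd := by
  rintro ⟨k, hk⟩
  refine h ?_
  rw [jac, hk]
  simp [Derivation.leibniz]; ring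

/-- A generically injective germ whose Jacobian vanishes exactly on both axes is of monomial
type. -/
theorem GenInj.exists_eq_monomial {φ : GermMap (ℂ × ℂ)} (hφ : φ.GenInj) {i j : ℕ} (hi : 1 ≤ i)
    (hj : 1 ≤ j) {v : O₂} (hJ : φ.jac = X ^ i * Y ^ j * v) :
    ∃ (a b c d : ℕ) (u w : O₂), 1 ≤ a ∧ 1 ≤ b ∧ 1 ≤ c ∧ 1 ≤ d ∧ IsUnit u ∧ IsUnit w ∧
      φ.fst = X ^ a * Y ^ b * u ∧ φ.snd = X ^ c * Y ^ d * w ∧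
      (a * d = b * c ∨ a * d = b * c + 1 ∨ b * c = a * d + 1) := by
  obtain ⟨ψ, a, b, c, d, i', j', hψ, ⟨u, hu, hf⟩, ⟨w, hw, hg⟩, ⟨v', hv', hJ'⟩, hdet, h5, h6⟩ :=
    hφ.exists_isMonomial
  have hX : X ∣ φ.jac := by
    rw [hJ, mul_assoc]; exact (dvd_pow_self X (by omega)).mul_right _
  have hY : Y ∣ φ.jac := by
    rw [hJ]; exact ((dvd_pow_self Y (by omega)).mul_left _).mul_right _
  rw [hJ'] at hX hY
  have hXY : ¬ X ∣ Y := not_fst_dvd_snd (ψ := id) (by simp)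
  have hass : ∀ {s t : O₂}, Prime s → Prime t → s ∣ t → ∃ e : O₂, IsUnit e ∧ t = s * e := by
    intro s t hs ht h
    obtain ⟨e, he⟩ := hs.irreducible.associated_of_dvd ht.irreducible h
    exact ⟨e, e.isUnit, he.symm⟩
  have p1 := prime_fst hψ
  have p2 := prime_snd hψ
  have hcontra : ∀ {t : O₂}, Prime t → X ∣ t → Y ∣ t → False := fun ht h1 h2 =>
    hXY (((prime_X.irreducible.associated_of_dvd ht.irreducible h1).trans
      (prime_Y.irreducible.associated_of_dvd ht.irreducible h2).symm).dvd)
  -- Unique factorization of the Jacobian matches the monomial coordinates with x and y up to units,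
  -- possibly exchanged.
  rcases dvd_fst_or_dvd_snd prime_X hv' hX with ⟨hx, hi'⟩ | ⟨hx, hj'⟩
  · rcases dvd_fst_or_dvd_snd prime_Y hv' hY with ⟨hy, -⟩ | ⟨hy, hj'⟩
    · exact (hcontra p1 hx hy).elim
    obtain ⟨e, he, hxe⟩ := hass prime_X p1 hx
    obtain ⟨k, hk, hyk⟩ := hass prime_Y p2 hy
    refine ⟨a, b, c, d, e ^ a * k ^ b * u, e ^ c * k ^ d * w, (h5 hi').1, (h6 hj').1, (h5 hi').2,
      (h6 hj').2, ((he.pow _).mul (hk.pow _)).mul hu, ((he.pow _).mul (hk.pow _)).mul hw, ?_, ?_, hdet⟩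
    · rw [hf, hxe, hyk]; ring
    · rw [hg, hxe, hyk]; ring
  · rcases dvd_fst_or_dvd_snd prime_Y hv' hY with ⟨hy, hi'⟩ | ⟨hy, -⟩
    swap
    · exact (hcontra p2 hx hy).elim
    obtain ⟨e, he, hxe⟩ := hass prime_X p2 hx
    obtain ⟨k, hk, hyk⟩ := hass prime_Y p1 hy
    refine ⟨b, a, d, c, e ^ b * k ^ a * u, e ^ d * k ^ c * w, (h6 hj').1, (h5 hi').1, (h6 hj').2,
      (h5 hi').2, ((he.pow _).mul (hk.pow _)).mul hu, ((he.pow _).mul (hk.pow _)).mul hw, ?_, ?_,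
      by omega⟩
    · rw [hf, hxe, hyk]; ring
    · rw [hg, hxe, hyk]; ring

/-- An invariant foliation of a germ whose critical set is a normal crossing is reduced. -/
theorem GenInj.isReducedLog {φ : GermMap (ℂ × ℂ)} (hφ : φ.GenInj) {i j : ℕ} (hi : 1 ≤ i)
    (hj : 1 ≤ j) {v : O₂} (hv : IsUnit v) (hJ : φ.jac = X ^ i * Y ^ j * v) {ω : O₂ × O₂}
    (hω : φ.Preserves ω) (hrel : IsRelPrime ω.1 ω.2) : IsReducedLog ω := by
  obtain ⟨a, b, c, d, u, w, ha, hb, hc, hd, hu, hw, hf, hg, hdet⟩ := hφ.exists_eq_monomial hi hj hJ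
  rcases hdet with h | h
  · exact hφ.isReducedLog_of_degenerate ha hb hc hu hw hf hg hv hJ h hω hrel
  · have hs : φ.IsSuperattracting := by
      have key : ∀ {F u : O₂} {r s : ℕ}, 1 ≤ r → 1 ≤ s → F = X ^ r * Y ^ s * u →
          ev (dx F) = 0 ∧ ev (dy F) = 0 := by
        intro F u r s hr hs hF
        obtain ⟨r', rfl⟩ : ∃ r', r = r' + 1 := ⟨r - 1, by omega⟩
        obtain ⟨s', rfl⟩ : ∃ s', s = s' + 1 := ⟨s - 1, by omega⟩
        have : F = X * (Y * (X ^ r' * Y ^ s' * u)) := by rw [hF]; ring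
        rw [this]
        simp only [Derivation.leibniz, smul_eq_mul, map_add, map_mul, ev_X, ev_Y, zero_mul,
          add_zero, and_self]
      obtain ⟨h1, h2⟩ := key ha hb hf
      obtain ⟨h3, h4⟩ := key hc hd hg
      exact ⟨h1, h2, h3, h4⟩
    exact isReducedLog_of_unimodular ha hb hc hd hs hu hw hf hg h hω hrel

end GermMap

end

/-! ### Residues under a change of variable, and powers of x in coprime ideals. -/

noncomputable section

open Metric AnalyticGerm

namespace AnalyticGerm

theorem le_of_T_pow_mul_eq {a b : ℕ} {c e : O₁} (he : IsUnit e) (h : T ^ a * c = T ^ b * e) :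
    a ≤ b := by
  by_contra! hlt
  obtain ⟨k, rfl⟩ := Nat.exists_eq_add_of_lt hlt
  have h2 : T ^ b * (T * (T ^ k * c)) = T ^ b * e := by rw [← h]; ring
  have h3 := mul_left_cancel₀ (pow_ne_zero _ T_ne_zero) h2
  exact not_T_dvd_of_isUnit he ⟨_, h3.symm⟩

theorem T_mul_der_pow (a : ℕ) : T * der (T ^ a) = a * T ^ a := by
  rcases a with _ | a
  · simp
  · rw [Derivation.leibniz_pow, der_T]
    simp only [Nat.add_sub_cancel, smul_eq_mul, mul_one, nsmul_eq_mul]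
    ring

theorem mul_T_mul_der_pow {θ ε : O₁} (h : θ = T * ε) (k : ℕ) :
    ε * (T * der (θ ^ k)) = k * θ ^ k * der θ := by
  rcases k with _ | k
  · simp
  · rw [Derivation.leibniz_pow]
    simp only [Nat.add_sub_cancel, smul_eq_mul, nsmul_eq_mul]
    rw [show θ ^ (k + 1) = θ ^ k * (T * ε) by rw [pow_succ, h]]
    ring

theorem mul_T_mul_der_inv_pow {θ ε δ : O₁} (h : θ = T * ε) (hδ : ε * δ = 1) (k : ℕ) :
    ε * (T * der (δ ^ k)) = k * δ ^ k * (ε - der θ) := by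
  have h1 := congrArg der hδ
  have h2 : der θ = T * der ε + ε := by rw [h, Derivation.leibniz, der_T]; simp
  rw [Derivation.leibniz, Derivation.map_one_eq_zero] at h1
  simp only [smul_eq_mul] at h1
  rcases k with _ | k
  · simp
  · rw [Derivation.leibniz_pow]
    simp only [Nat.add_sub_cancel, smul_eq_mul, nsmul_eq_mul]
    linear_combination ((k + 1 : ℕ) : O₁) * δ ^ k * T * h1 + ((k + 1 : ℕ) : O₁) * δ ^ (k + 1) * h2

/-- Invariance of residues under a change of variable: the form `F dt/t^(b+1)` and its pullback
under `θ` have the same residue. -/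
theorem residue_eq_zero {θ ε : O₁} (hθ : ev θ = 0) (hε : IsUnit ε) (h : θ = T * ε) {b : ℕ}
    {F z : O₁} {κ : ℂ} (hF : ε * θ ^ b * F - T ^ b * subst θ hθ F * der θ =
      ε * T ^ b * θ ^ b * (C κ + T * z)) : κ = 0 := by
  obtain ⟨δ, hδ⟩ := hε.exists_right_inv
  have hθ0 : θ ≠ 0 := by rw [h]; exact mul_ne_zero T_ne_zero hε.ne_zero
  -- The polar part of F dt/t^(b+1) is removed one monomial at a time. A monomial other than dt/t is
  -- exact, and Q collects the primitives: T Q' - bQ encodes the differential of Q/t^b. With only a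
  -- simple pole left, the residue is visibly preserved.
  suffices key : ∀ j ≤ b, ∀ F Q : O₁, T ^ (b - j) ∣ F → ε * θ ^ b * F - T ^ b * subst θ hθ F * der θ +
      ε * θ ^ b * (T * der Q - (b : O₁) * Q) = ε * T ^ b * θ ^ b * (C κ + T * z) → κ = 0 from
    key b le_rfl F 0 (by simp) (by rw [← hF]; simp)
  intro j
  induction j with
  | zero =>
    rintro - F Q ⟨F₁, hF₁⟩ hQ
    rw [Nat.sub_zero] at hF₁
    have hθb : θ ^ b = T ^ b * ε ^ b := by rw [h, mul_pow]
    have hsub : subst θ hθ F = θ ^ b * subst θ hθ F₁ := by rw [hF₁]; simp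
    rw [hsub, hF₁] at hQ
    have h1 : T ^ b * (ε * F₁ - subst θ hθ F₁ * der θ) + ε * (T * der Q - (b : O₁) * Q) =
        ε * T ^ b * (C κ + T * z) := by
      refine mul_left_cancel₀ (pow_ne_zero b hθ0) ?_
      linear_combination hQ
    have h2 : T * der Q - C (b : ℂ) * Q =
        T ^ b * (C κ + T * z - δ * (ε * F₁ - subst θ hθ F₁ * der θ)) := by
      rw [map_natCast]
      linear_combination δ * h1 + (T ^ b * (C κ + T * z) - (T * der Q - (b : O₁) * Q)) * hδ
    obtain ⟨Q₁, hQ₁⟩ := T_pow_dvd_of_euler (fun k hk => by exact_mod_cast hk.ne) ⟨_, h2⟩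
    have h3 : C κ + T * z - δ * (ε * F₁ - subst θ hθ F₁ * der θ) = T * der Q₁ := by
      refine mul_left_cancel₀ (pow_ne_zero b T_ne_zero) ?_
      rw [← h2, hQ₁, map_natCast, Derivation.leibniz]
      simp only [smul_eq_mul]
      linear_combination Q₁ * T_mul_der_pow b
    have h4 : ev (der θ) = ev ε := by rw [h, Derivation.leibniz, der_T]; simp
    have h5 := congrArg ev h3
    simp only [map_sub, map_add, map_mul, ev_C, ev_T, zero_mul, add_zero, ev_subst, h4] at h5
    linear_combination h5
  | succ j ih =>
    rintro hj F Q ⟨F₁, hF₁⟩ hQ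
    obtain ⟨k, hk⟩ : ∃ k, k = b - (j + 1) := ⟨_, rfl⟩
    rw [← hk] at hF₁
    have hkb : (k : ℂ) - b ≠ 0 := sub_ne_zero.2 (by exact_mod_cast (by omega : k ≠ b))
    obtain ⟨F₂, hF₂⟩ := T_dvd_iff.2 (show ev (F₁ - C (ev F₁)) = 0 by simp)
    have hF' : F = C (ev F₁) * T ^ k + T ^ (k + 1) * F₂ := by
      rw [hF₁]; linear_combination T ^ k * hF₂
    obtain ⟨r, hr⟩ : ∃ r : ℂ, r * (k - b) = ev F₁ := ⟨ev F₁ / (k - b), div_mul_cancel₀ _ hkb⟩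
    have hr' : (C r : O₁) * ((k : O₁) - (b : O₁)) = C (ev F₁) := by rw [← hr]; simp
    refine ih (by omega) (T ^ (k + 1) * F₂) (Q + C r * T ^ k - C r * (θ ^ k * δ ^ b))
      (by rw [show b - j = k + 1 by omega]; exact ⟨_, rfl⟩) ?_
    have hsub : subst θ hθ F = C (ev F₁) * θ ^ k + subst θ hθ (T ^ (k + 1) * F₂) := by
      rw [hF', map_add, map_mul, subst_C, map_pow, subst_T]
    rw [← hQ, hsub, hF']
    have e1 := T_mul_der_pow k
    have e2 := mul_T_mul_der_pow h k
    have e3 := mul_T_mul_der_inv_pow h hδ b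
    have e4 : θ ^ b * δ ^ b = T ^ b := by
      rw [← mul_pow, h, mul_assoc, hδ, mul_one]
    simp only [map_add, map_sub, Derivation.leibniz, der_C, smul_eq_mul, mul_zero, add_zero]
    linear_combination ε * θ ^ b * C r * e1 - θ ^ b * C r * δ ^ b * e2 - θ ^ b * C r * θ ^ k * e3 +
      ε * θ ^ b * T ^ k * hr' - θ ^ k * der θ * θ ^ b * δ ^ b * hr' - C (ev F₁) * θ ^ k * der θ * e4

/-- Coprime germs generate an ideal containing a power of any nonunit; here for `X`. -/
theorem exists_X_pow_eq {A B : O₂} (h : IsRelPrime A B) : ∃ (K : ℕ) (α β : O₂), X ^ K = α * A + β * B := by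
  induction A using UniqueFactorizationMonoid.induction_on_prime with
  | h₁ =>
    obtain ⟨e, he⟩ := (isRelPrime_zero_left.1 h).exists_left_inv
    exact ⟨0, 0, e, by rw [he]; ring⟩
  | h₂ A hA =>
    obtain ⟨e, he⟩ := hA.exists_left_inv
    exact ⟨0, e, 0, by rw [he]; ring⟩
  | h₃ A p hA hp ih =>
    obtain ⟨K, α, β, hK⟩ := ih h.of_mul_left_right
    have hpB : ¬ p ∣ B := fun hd => hp.not_isUnit (h.of_mul_left_left dvd_rfl hd)
    -- Either p is associated to x, or elimination of y puts a nonzero germ in x, a power of x times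
    -- a unit, in the ideal.
    obtain ⟨L, a, b, hL⟩ : ∃ (L : ℕ) (a b : O₂), X ^ L = a * p + b * B := by
      by_cases hX : resX p = 0
      · obtain ⟨e, he⟩ :=
          (prime_X.irreducible.associated_of_dvd hp.irreducible (X_dvd_iff.2 hX)).symm
        exact ⟨1, e, 0, by rw [← he]; ring⟩
      · obtain ⟨r, hr, a, b, hab⟩ := exists_ne_zero_mem_span hp hX hpB
        obtain ⟨L, e, he, rfl⟩ := exists_eq_T_pow_mul hr
        obtain ⟨e', he'⟩ := he.exists_right_inv
        refine ⟨L, inclX e' * a, inclX e' * b, ?_⟩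
        have h1 := congrArg inclX he'
        simp only [map_mul, map_pow, inclX_T, map_one] at h1 hab
        linear_combination inclX e' * hab - X ^ L * h1
    refine ⟨L + K, a * α, a * p * β + b * α * A + b * β * B, ?_⟩
    rw [pow_add, hL, hK]; ring

end AnalyticGerm

end

/-! ### First component x times a unit: the residue obstruction. -/

noncomputable section

open Metric AnalyticGerm

namespace AnalyticGerm

/-- Restrictions to y = 0 of the invariance equations and of their first y-derivative. Here (θ, g₀)
is the image of the axis, g₁ the y-derivative of the second component, A₀ and A₁ the value and
y-derivative of A. Modulo t^(m+1) the axis is invariant and a separatrix. The normal connection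
(A₁/B₀) dt/t and its pullback by θ differ by the logarithmic derivative of g₁, of residue N, modulo
a holomorphic form. -/
theorem false_of_axis_relations {θ ε υ g₀ g₁ G₀ A₀ A₁ B₀ v₀ α₀ β₀ γ kA kB kAx kAy k₁ k₂ k₃ : O₁}
    {N K m : ℕ} (hθ0 : ev θ = 0) (hε : IsUnit ε) (hθ : θ = T * ε) (hg₀ : g₀ = T ^ (m + 1) * γ)
    (hv₀ : IsUnit v₀) (hN : 1 ≤ N) (hm : 2 * K + N ≤ m)
    (r1 : (subst θ hθ0 A₀ + g₀ * kA) * der θ + T * ε * (subst θ hθ0 B₀ + g₀ * kB) * der g₀ =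
      T * G₀ * A₀)
    (r2 : (subst θ hθ0 A₀ + g₀ * kA) * υ + ε * (subst θ hθ0 B₀ + g₀ * kB) * g₁ = T * G₀ * B₀)
    (r3 : (subst θ hθ0 A₀ + g₀ * kA) * k₁ + der θ * ((subst θ hθ0 (der A₀) + g₀ * kAx) * (T * υ) +
      (subst θ hθ0 A₁ + g₀ * kAy) * g₁) + (T * ε * (subst θ hθ0 B₀ + g₀ * kB) * der g₁ +
        T * der g₀ * k₂) = T * G₀ * A₁ + A₀ * k₃)
    (rJ : der θ * g₁ - T * υ * der g₀ = T ^ N * v₀) (rK : T ^ K = α₀ * A₀ + β₀ * B₀) : False := by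
  have hε0 : ev ε ≠ 0 := isUnit_iff.1 hε
  have hθd : IsUnit (der θ) := by
    rw [isUnit_iff, hθ, Derivation.leibniz]
    simpa using hε0
  have hTg : T * der g₀ = T ^ (m + 1) * (((m + 1 : ℕ) : O₁) * γ + T * der γ) := by
    rw [hg₀, Derivation.leibniz]
    simp only [smul_eq_mul]
    linear_combination γ * T_mul_der_pow (m + 1)
  have hsubst : ∀ (k : ℕ) (e : O₁), subst θ hθ0 (T ^ k * e) = T ^ k * (ε ^ k * subst θ hθ0 e) := by
    intro k e
    rw [map_mul, map_pow, subst_T, ← mul_assoc, ← mul_pow, ← hθ]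
  -- In `r1`, modulo t^(m+1), the side T G₀ A₀ would have order larger than k = ord A₀, but A₀(θ) θ'
  -- has order exactly k.
  obtain ⟨a₀, ha₀⟩ : T ^ (m + 1) ∣ A₀ := by
    by_contra hd
    have hA₀ : A₀ ≠ 0 := fun h0 => hd (h0 ▸ dvd_zero _)
    obtain ⟨k, e, he, hke⟩ := exists_eq_T_pow_mul hA₀
    have hkm : k < m + 1 := by
      by_contra! hle
      exact hd (hke ▸ (pow_dvd_pow T hle).mul_right e)
    obtain ⟨l, hl⟩ := Nat.exists_eq_add_of_lt hkm
    have hs : subst θ hθ0 A₀ = T ^ k * (ε ^ k * subst θ hθ0 e) := by rw [hke, hsubst]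
    have hTl : T ^ (m + 1) = T ^ (k + 1) * T ^ l := by rw [← pow_add]; congr 1; omega
    have h1 : T ^ (k + 1) * (G₀ * e - T ^ l * γ * kA * der θ -
        T ^ l * (((m + 1 : ℕ) : O₁) * γ + T * der γ) * ε * (subst θ hθ0 B₀ + g₀ * kB)) =
        T ^ k * (ε ^ k * subst θ hθ0 e * der θ) := by
      linear_combination -r1 - T * G₀ * hke + der θ * hs + ε * (subst θ hθ0 B₀ + g₀ * kB) * hTg +
        kA * der θ * hg₀ + (γ * kA * der θ + (((m + 1 : ℕ) : O₁) * γ + T * der γ) * ε *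
          (subst θ hθ0 B₀ + g₀ * kB)) * hTl
    have h2 := le_of_T_pow_mul_eq (((hε.pow k).mul (he.map _)).mul hθd) h1
    omega
  obtain ⟨b, e, he, hbe⟩ : ∃ (b : ℕ) (e : O₁), IsUnit e ∧ B₀ = T ^ b * e := by
    refine exists_eq_T_pow_mul fun h0 => ?_
    rw [h0, ha₀] at rK
    have h1 : T ^ (m + 1) * (α₀ * a₀) = T ^ K * 1 := by rw [mul_one, rK]; ring
    have := le_of_T_pow_mul_eq isUnit_one h1
    omega
  have hbK : b ≤ K := by
    by_contra! hlt
    have h1 : T ^ (K + 1) * (T ^ (m - K) * α₀ * a₀ + T ^ (b - (K + 1)) * β₀ * e) = T ^ K * 1 := by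
      have e1 : T ^ (m + 1) = T ^ (K + 1) * T ^ (m - K) := by rw [← pow_add]; congr 1; omega
      have e2 : T ^ b = T ^ (K + 1) * T ^ (b - (K + 1)) := by rw [← pow_add]; congr 1; omega
      rw [mul_one, rK, ha₀, hbe, e1, e2]; ring
    have := le_of_T_pow_mul_eq isUnit_one h1
    omega
  obtain ⟨w, hw, hg₁⟩ : ∃ w, IsUnit w ∧ g₁ = T ^ N * w := by
    obtain ⟨δ, hδ⟩ := hθd.exists_left_inv
    refine ⟨δ * (v₀ + T ^ (m + 1 - N) * (υ * (((m + 1 : ℕ) : O₁) * γ + T * der γ))), ?_, ?_⟩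
    · refine (IsUnit.of_mul_eq_one _ hδ).mul ?_
      rw [isUnit_iff]
      simpa [show m + 1 - N ≠ 0 by omega] using isUnit_iff.1 hv₀
    · have e1 : T ^ (m + 1) = T ^ N * T ^ (m + 1 - N) := by rw [← pow_add]; congr 1; omega
      linear_combination -g₁ * hδ + δ * rJ + δ * υ * hTg +
        δ * υ * (((m + 1 : ℕ) : O₁) * γ + T * der γ) * e1
  have hTg₁ : T * der g₁ = T ^ N * ((N : O₁) * w + T * der w) := by
    rw [hg₁, Derivation.leibniz]
    simp only [smul_eq_mul]
    linear_combination w * T_mul_der_pow N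
  have hTA : ∃ s, T * subst θ hθ0 (der A₀) = T ^ (m + 1) * s := by
    obtain ⟨δ, hδ⟩ := hε.exists_left_inv
    have h1 : T * der A₀ = T ^ (m + 1) * (((m + 1 : ℕ) : O₁) * a₀ + T * der a₀) := by
      rw [ha₀, Derivation.leibniz]
      simp only [smul_eq_mul]
      linear_combination a₀ * T_mul_der_pow (m + 1)
    have h2 := congrArg (subst θ hθ0) h1
    rw [hsubst, map_mul, subst_T] at h2
    refine ⟨δ * (ε ^ (m + 1) * subst θ hθ0 (((m + 1 : ℕ) : O₁) * a₀ + T * der a₀)), ?_⟩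
    linear_combination δ * h2 - δ * subst θ hθ0 (der A₀) * hθ - T * subst θ hθ0 (der A₀) * hδ
  obtain ⟨s, hs⟩ := hTA
  -- Elimination of the cofactor G₀: `r2` times A₁ minus `r3` times B₀, modulo t^(m+1).
  have hdvd : T ^ (m + 1) ∣ ε * subst θ hθ0 B₀ * g₁ * A₁ - subst θ hθ0 A₁ * g₁ * der θ * B₀ -
      T * ε * subst θ hθ0 B₀ * B₀ * der g₁ := by
    rw [← Ideal.mem_span_singleton, ← Ideal.Quotient.eq_zero_iff_mem]
    set q := Ideal.Quotient.mk (Ideal.span {T ^ (m + 1)})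
    have q0 : ∀ x y : O₁, x = T ^ (m + 1) * y → q x = 0 := fun x y hxy => by
      rw [Ideal.Quotient.eq_zero_iff_mem, Ideal.mem_span_singleton]; exact ⟨y, hxy⟩
    have q1 := q0 _ _ ha₀
    have q2 := q0 _ _ hg₀
    have q3 := q0 _ _ hTg
    have q4 := q0 _ _ hs
    have q5 : q (subst θ hθ0 A₀) = 0 := q0 _ (ε ^ (m + 1) * subst θ hθ0 a₀) (by rw [ha₀, hsubst])
    have q6 := congrArg q r2
    have q7 := congrArg q r3
    simp only [map_add, map_mul, map_sub, q1, q2, q5] at q3 q4 q6 q7 ⊢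
    linear_combination q A₁ * q6 - q B₀ * q7 + q B₀ * (q (der θ) * q υ * q4 + q k₂ * q3)
  obtain ⟨t, ht⟩ := hdvd
  obtain ⟨e', he'⟩ := he.exists_right_inv
  obtain ⟨w', hw'⟩ := hw.exists_right_inv
  obtain ⟨δ, hδ⟩ := hε.exists_right_inv
  have hse' := congrArg (subst θ hθ0) he'
  rw [map_mul, map_one] at hse'
  have hT1 : T ^ (m + 1) = T ^ N * (T ^ b * θ ^ b * (δ ^ b * T ^ (m + 1 - N - 2 * b))) := by
    have e1 : θ ^ b * δ ^ b = T ^ b := by rw [← mul_pow, hθ, mul_assoc, hδ, mul_one]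
    have e2 : T ^ (m + 1) = T ^ N * (T ^ b * T ^ b * T ^ (m + 1 - N - 2 * b)) := by
      rw [← pow_add, ← pow_add, ← pow_add]; congr 1; omega
    rw [e2, ← e1]; ring
  -- Here the flatness is used: dividing by t^N and by the two factors B₀ and B₀(θ) of order b ≤ K
  -- leaves an error without residue.
  obtain ⟨t', ht'⟩ : ∃ t', T ^ (m + 1 - N - 2 * b) = T * t' :=
    ⟨T ^ (m + 1 - N - 2 * b - 1), by rw [← pow_succ']; congr 1; omega⟩
  have hfin : ε * θ ^ b * (e' * A₁) - T ^ b * subst θ hθ0 (e' * A₁) * der θ =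
      ε * T ^ b * θ ^ b * (C (N : ℂ) + T * (w' * der w + δ * δ ^ b * t' * t * w' * e' *
        subst θ hθ0 e')) := by
    have hB : subst θ hθ0 B₀ = θ ^ b * subst θ hθ0 e := by rw [hbe, map_mul, map_pow, subst_T]
    have h1 : T ^ N * (ε * (θ ^ b * subst θ hθ0 e) * w * A₁ -
        subst θ hθ0 A₁ * w * der θ * (T ^ b * e) -
        ε * (θ ^ b * subst θ hθ0 e) * (T ^ b * e) * ((N : O₁) * w + T * der w) -
        T ^ b * θ ^ b * (δ ^ b * (T * t')) * t) = 0 := by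
      rw [hT1, ht', hB] at ht
      linear_combination ht - (ε * (θ ^ b * subst θ hθ0 e) * A₁ - subst θ hθ0 A₁ * der θ * B₀) * hg₁ +
        (-subst θ hθ0 A₁ * T ^ N * w * der θ) * (-1) * hbe +
        ε * (θ ^ b * subst θ hθ0 e) * B₀ * hTg₁ +
        ε * (θ ^ b * subst θ hθ0 e) * T ^ N * ((N : O₁) * w + T * der w) * hbe
    have h2 := (mul_eq_zero.1 h1).resolve_left (pow_ne_zero _ T_ne_zero)
    rw [map_mul, map_natCast]
    set σ := subst θ hθ0
    linear_combination w' * e' * σ e' * h2 - ε * θ ^ b * A₁ * e' * (σ e * σ e' * hw' + hse') +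
      σ A₁ * der θ * T ^ b * σ e' * (e * e' * hw' + he') +
      ε * θ ^ b * T ^ b * (N * (σ e * σ e' * (e * e') * hw' + e * e' * hse' + he') +
        T * w' * der w * (e * e' * hse' + he')) -
      T ^ b * θ ^ b * δ ^ b * T * t' * t * w' * e' * σ e' * hδ
  have hz := residue_eq_zero hθ0 hε hθ hfin
  have : N = 0 := by exact_mod_cast hz
  omega

end AnalyticGerm

namespace GermMap

/-- The germ `φ` fixes the line `x = 0`, contracting it to the origin, and preserves the
logarithmic form `A dx/x + B dy` with `A` vanishing at the origin. -/
structure IsLogInvariant (φ : GermMap (ℂ × ℂ)) (A B : O₂) (N K : ℕ) : Prop where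
  fst : ∃ u, IsUnit u ∧ φ.fst = X * u
  snd : X ∣ φ.snd
  jac : ∃ v, IsUnit v ∧ φ.jac = X ^ N * v
  preserves : φ.Preserves (A, X * B)
  isRelPrime : IsRelPrime A B
  mem_span : ∃ α β, X ^ K = α * A + β * B
  ev_eq_zero : ev A = 0

/-- On the axis, replacing A∘φ by its value at the projected image point costs a multiple of the
height of the image, negligible once the axis is flat. -/
theorem exists_resY_pull_eq (φ : GermMap (ℂ × ℂ)) (A : O₂) : ∃ k : O₁,
    resY (φ.pull A) = subst (resY φ.fst) (by simp) (resY A) + resY φ.snd * k := by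
  obtain ⟨b, hb⟩ := exists_eq_add_Y_mul A
  refine ⟨resY (φ.pull b), ?_⟩
  conv_lhs => rw [hb]
  rw [map_add, map_mul, pull_Y, map_add, map_mul, resY_pull_inclX]

theorem resY_dy_dx (g : O₂) : resY (dy (dx g)) = der (resY (dy g)) := by
  obtain ⟨h, hh⟩ := exists_eq_add_Y_mul g
  have h1 : dx g = inclX (der (resY g)) + Y * dx h := by
    conv_lhs => rw [hh]
    simp [Derivation.leibniz]
  have h2 : resY (dy g) = resY h := by
    conv_lhs => rw [hh]
    simp [Derivation.leibniz]
  rw [h1, h2]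
  simp [Derivation.leibniz, resY_dx]

/-- A change of coordinates `y ↦ y - c x^n` flattening the image of the axis `y = 0`. -/
theorem IsLogInvariant.exists_flatter {φ : GermMap (ℂ × ℂ)} {A B : O₂} {N K : ℕ}
    (h : φ.IsLogInvariant A B N K) {n : ℕ} (hn : 1 ≤ n) (hg : T ^ n ∣ resY φ.snd) :
    ∃ (φ' : GermMap (ℂ × ℂ)) (A' B' : O₂), φ'.IsLogInvariant A' B' N K ∧
      T ^ (n + 1) ∣ resY φ'.snd := by
  obtain ⟨⟨u, hu, hf⟩, ⟨g', hg'⟩, ⟨v, hv, hJ⟩, hpres, hrel, ⟨α, β, hK⟩, hA⟩ := h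
  obtain ⟨γ, hγ⟩ := hg
  have hu0 : ev u ≠ 0 := AnalyticGerm.isUnit_iff.1 hu
  -- This cancels the t^n coefficient of the image of the new axis. Since x divides the second
  -- component, moving the source axis by c x^n changes its height only in order n + 1.
  set c : ℂ := ev γ / ev u ^ n with hc
  obtain ⟨ψ, hψ1, hψ2⟩ : ∃ ψ : GermMap (ℂ × ℂ), ψ.fst = X ∧ ψ.snd = Y - AnalyticGerm.C c * X ^ n :=
    ⟨⟨X, Y - AnalyticGerm.C c * X ^ n, by simp, by simp [show n ≠ 0 by omega]⟩, rfl, rfl⟩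
  obtain ⟨M, hM1, hM2⟩ : ∃ M : GermMap (ℂ × ℂ), M.fst = X ∧ M.snd = Y + AnalyticGerm.C c * X ^ n :=
    ⟨⟨X, Y + AnalyticGerm.C c * X ^ n, by simp, by simp [show n ≠ 0 by omega]⟩, rfl, rfl⟩
  have hinv : IsInverse ψ M := by
    constructor
    · ext1
      · rw [comp_fst, hψ1, pull_X, hM1, id_fst]
      · rw [comp_snd, hψ2, map_sub, map_mul, map_pow, pull_C, pull_X, pull_Y, hM1, hM2, id_snd]; ring
    · ext1
      · rw [comp_fst, hM1, pull_X, hψ1, id_fst]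
      · rw [comp_snd, hM2, map_add, map_mul, map_pow, pull_C, pull_X, pull_Y, hψ1, hψ2, id_snd]; ring
  obtain ⟨v', hv', hJ'⟩ := hinv.exists_jac_eq hv hJ
  have hfst : (ψ.comp (φ.comp M)).fst = X * M.pull u := by
    rw [comp_fst, hψ1, pull_X, comp_fst, hf, map_mul, pull_X, hM1]
  have hsnd : (ψ.comp (φ.comp M)).snd = M.pull φ.snd - AnalyticGerm.C c * (X * M.pull u) ^ n := by
    rw [comp_snd, hψ2, map_sub, map_mul, map_pow, pull_C, pull_X, pull_Y, comp_fst, comp_snd, hf,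
      map_mul, pull_X, hM1]
  obtain ⟨n', rfl⟩ : ∃ n', n = n' + 1 := ⟨n - 1, by omega⟩
  have hdxM : dx M.snd = AnalyticGerm.C c * ((n' + 1 : ℕ) : O₂) * X ^ n' := by
    rw [hM2]
    simp [Derivation.leibniz, Derivation.leibniz_pow]; ring
  have hdyM : dy M.snd = 1 := by
    rw [hM2]
    simp [Derivation.leibniz, Derivation.leibniz_pow]
  have hform : M.pullForm (A, X * B) = (M.pull A + AnalyticGerm.C c * ((n' + 1 : ℕ) : O₂) *
      X ^ (n' + 1) * M.pull B, X * M.pull B) := by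
    simp only [pullForm, hM1, hdxM, hdyM, map_mul, pull_X, dx_X, dy_X]
    refine Prod.ext ?_ ?_ <;> simp only <;> ring
  have hrel' : IsRelPrime (M.pull A) (M.pull B) := by
    intro z h1 h2
    have h3 := map_dvd ψ.pull h1
    have h4 := map_dvd ψ.pull h2
    rw [hinv.symm.pull_pull] at h3 h4
    have h5 := (hrel h3 h4).map M.pull
    rwa [hinv.pull_pull] at h5
  refine ⟨ψ.comp (φ.comp M), M.pull A + AnalyticGerm.C c * ((n' + 1 : ℕ) : O₂) *
      X ^ (n' + 1) * M.pull B, M.pull B, ⟨⟨_, hu.map _, hfst⟩, ?_, ⟨v', hv', ?_⟩, ?_, ?_, ?_, ?_⟩, ?_⟩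
  · rw [hsnd, hg', map_mul, pull_X, hM1]
    exact ⟨M.pull g' - AnalyticGerm.C c * X ^ n' * M.pull u ^ (n' + 1), by ring⟩
  · rw [hJ', map_pow, pull_X, hM1]
  · rw [← hform]
    exact hpres.semiconj (hinv.semiconj φ)
  · intro z h1 h2
    refine hrel' ?_ h2
    have h3 : z ∣ AnalyticGerm.C c * ((n' + 1 : ℕ) : O₂) * X ^ (n' + 1) * M.pull B := h2.mul_left _
    exact (dvd_add_left h3).1 h1
  · refine ⟨M.pull α, M.pull β - M.pull α * (AnalyticGerm.C c * ((n' + 1 : ℕ) : O₂) * X ^ (n' + 1)), ?_⟩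
    have h3 := congrArg M.pull hK
    simp only [map_add, map_mul, map_pow, pull_X, hM1] at h3
    rw [h3]; ring
  · simp [hA]
  · obtain ⟨h, hh⟩ := exists_eq_add_Y_mul g'
    have h1 : φ.snd = inclX (resY φ.snd) + X * Y * h := by
      have : resY φ.snd = T * resY g' := by rw [hg', map_mul, resY_X]
      rw [this, map_mul, inclX_T, hg']
      linear_combination X * hh
    have h2 : resY (M.pull φ.snd) =
        T ^ (n' + 1) * γ + T ^ (n' + 1) * (T * (AnalyticGerm.C c * resY (M.pull h))) := by
      rw [h1]
      simp only [map_add, map_mul, pull_X, pull_Y, hM1, hM2, pull_inclX_of_fst_eq_X hM1, resY_inclX,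
        resY_X, resY_Y, map_pow, resY_C, hγ]
      ring
    have h3 : resY (ψ.comp (φ.comp M)).snd = T ^ (n' + 1) * (γ +
        T * (AnalyticGerm.C c * resY (M.pull h)) - AnalyticGerm.C c * resY (M.pull u) ^ (n' + 1)) := by
      rw [hsnd, map_sub, h2]
      simp only [map_mul, map_pow, resY_C, resY_X]; ring
    rw [h3, pow_succ]
    refine mul_dvd_mul_left _ (T_dvd_iff.2 ?_)
    simp only [map_add, map_sub, map_mul, map_pow, ev_T, zero_mul, add_zero, ev_C, ev_resY, ev_pull]
    rw [hc, div_mul_cancel₀ _ (pow_ne_zero _ hu0), sub_self]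

theorem IsLogInvariant.exists_flat {φ : GermMap (ℂ × ℂ)} {A B : O₂} {N K : ℕ}
    (h : φ.IsLogInvariant A B N K) (n : ℕ) :
    ∃ (φ' : GermMap (ℂ × ℂ)) (A' B' : O₂), φ'.IsLogInvariant A' B' N K ∧
      T ^ (n + 1) ∣ resY φ'.snd := by
  induction n with
  | zero => exact ⟨φ, A, B, h, by rw [zero_add, pow_one, T_dvd_iff]; simp⟩
  | succ n ih =>
    obtain ⟨φ', A', B', h', hn⟩ := ih
    exact h'.exists_flatter (by omega) hn

set_option maxHeartbeats 1000000 in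
theorem IsLogInvariant.false_of_flat {φ : GermMap (ℂ × ℂ)} {A B : O₂} {N K m : ℕ}
    (h : φ.IsLogInvariant A B N K) (hN : 1 ≤ N) (hm : 2 * K + N ≤ m)
    (hg : T ^ (m + 1) ∣ resY φ.snd) : False := by
  obtain ⟨⟨u, hu, hf⟩, ⟨g', hg'⟩, ⟨v, hv, hJ⟩, hpres, hrel, ⟨α, β, hK⟩, hA⟩ := h
  obtain ⟨γ, hγ⟩ := hg
  have hu0 : ev u ≠ 0 := AnalyticGerm.isUnit_iff.1 hu
  have hdxf : dx φ.fst = u + X * dx u := by rw [hf, Derivation.leibniz]; simp; ring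
  have hdyf : dy φ.fst = X * dy u := by rw [hf, Derivation.leibniz]; simp
  -- the cofactor
  have hinv : (φ.pull A * dx φ.fst + X * u * φ.pull B * dx φ.snd) * B =
      (φ.pull A * dy u + u * φ.pull B * dy φ.snd) * A := by
    have h1 := hpres
    simp only [Preserves, wedge, pullForm, map_mul, pull_X] at h1
    refine mul_left_cancel₀ X_ne_zero ?_
    rw [hdyf, hf] at h1
    rw [hf]
    linear_combination h1
  -- Invariance says that φ*ω and ω are proportional; as A and B are coprime, φ*ω is a multiple of ω
  -- with a holomorphic cofactor.
  obtain ⟨G, hG1, hG2⟩ : ∃ G, φ.pull A * dx φ.fst + X * u * φ.pull B * dx φ.snd = G * A ∧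
      φ.pull A * dy u + u * φ.pull B * dy φ.snd = G * B := by
    by_cases hA0 : A = 0
    · rw [hA0] at hrel hinv
      obtain ⟨e, he⟩ := (isRelPrime_zero_left.1 hrel).exists_left_inv
      rw [hA0]
      have hB0 := (isRelPrime_zero_left.1 hrel).ne_zero
      rw [mul_zero] at hinv
      refine ⟨(φ.pull 0 * dy u + u * φ.pull B * dy φ.snd) * e, ?_, ?_⟩
      · rw [(mul_eq_zero.1 hinv).resolve_right hB0, mul_zero]
      · linear_combination -(φ.pull 0 * dy u + u * φ.pull B * dy φ.snd) * he
    · obtain ⟨G, hG⟩ : A ∣ φ.pull A * dx φ.fst + X * u * φ.pull B * dx φ.snd :=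
        hrel.dvd_of_dvd_mul_right ⟨φ.pull A * dy u + u * φ.pull B * dy φ.snd, by rw [hinv]; ring⟩
      refine ⟨G, by rw [hG]; ring, ?_⟩
      refine mul_right_cancel₀ hA0 ?_
      rw [← hinv, hG]; ring
  -- As φ sends x = 0 to the origin, where A vanishes, x divides A∘φ and with it both G A and G B.
  obtain ⟨G', hG'⟩ : X ∣ G := by
    obtain ⟨b, c, hbc⟩ := exists_eq_X_mul_add_Y_mul hA
    have h1 : φ.pull A = X * (u * φ.pull b + g' * φ.pull c) := by
      rw [hbc]; simp only [map_add, map_mul, pull_X, pull_Y, hf, hg']; ring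
    have h2 : dy φ.snd = X * dy g' := by rw [hg', Derivation.leibniz]; simp
    by_contra hX
    have h3 : X ∣ G * A := ⟨(u * φ.pull b + g' * φ.pull c) * dx φ.fst + u * φ.pull B * dx φ.snd, by
      rw [← hG1, h1]; ring⟩
    have h4 : X ∣ G * B := ⟨(u * φ.pull b + g' * φ.pull c) * dy u + u * φ.pull B * dy g', by
      rw [← hG2, h1, h2]; ring⟩
    exact prime_X.not_isUnit (hrel ((prime_X.dvd_or_dvd h3).resolve_left hX)
      ((prime_X.dvd_or_dvd h4).resolve_left hX))
  -- restriction to the axis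
  have hθ0 : ev (resY φ.fst) = 0 := by simp
  obtain ⟨kA, hkA⟩ := φ.exists_resY_pull_eq A
  obtain ⟨kB, hkB⟩ := φ.exists_resY_pull_eq B
  obtain ⟨kAx, hkAx⟩ := φ.exists_resY_pull_eq (dx A)
  obtain ⟨kAy, hkAy⟩ := φ.exists_resY_pull_eq (dy A)
  have hθ : resY φ.fst = T * resY u := by rw [hf, map_mul, resY_X]
  have r1 := congrArg resY hG1
  have r2 := congrArg resY hG2
  have r3 := congrArg (fun z => resY (dy z)) hG1
  have rJ := congrArg resY hJ
  have rK := congrArg resY hK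
  simp only [map_add, map_mul, map_sub, map_pow, Derivation.leibniz, smul_eq_mul, dy_pull, resY_dx,
    resY_dy_dx, resY_X, dy_X, hdyf, GermMap.jac, hG', hkA, hkB, hkAx, hkAy, mul_zero, add_zero]
    at r1 r2 r3 rJ rK
  refine false_of_axis_relations hθ0 (hu.map _) hθ hγ (hv.map resY) hN hm r1 r2
    (A₁ := resY (dy A)) (kAx := kAx) (kAy := kAy) (k₁ := T * der (resY (dy u)) + resY (dy u) * der T)
    (k₂ := resY u * (resY (φ.pull (dx B)) * (T * resY (dy u)) +
      resY (φ.pull (dy B)) * resY (dy φ.snd)) +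
        (subst (resY φ.fst) hθ0 (resY B) + resY φ.snd * kB) * resY (dy u))
    (k₃ := T * resY (dy G')) ?_ rJ rK
  linear_combination r3

theorem IsLogInvariant.not {φ : GermMap (ℂ × ℂ)} {A B : O₂} {N K : ℕ} (hN : 1 ≤ N) :
    ¬ φ.IsLogInvariant A B N K := fun h => by
  obtain ⟨φ', A', B', h', hd⟩ := h.exists_flat (2 * K + N)
  exact h'.false_of_flat hN le_rfl hd

/-- An invariant foliation of a germ contracting a line to the origin, with nonzero multiplier
transversally to the line, is smooth and tangent to the line. -/
theorem isUnit_and_dvd_of_preserves {φ : GermMap (ℂ × ℂ)} {N : ℕ} (hN : 1 ≤ N) {u v : O₂}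
    (hu : IsUnit u) (hf : φ.fst = X * u) (hg : X ∣ φ.snd) (hv : IsUnit v) (hJ : φ.jac = X ^ N * v)
    {ω : O₂ × O₂} (hω : φ.Preserves ω) (hrel : IsRelPrime ω.1 ω.2) : IsUnit ω.1 ∧ X ∣ ω.2 := by
  -- If x = 0 is tangent, the logarithmic form is ω/x with A the first coefficient; otherwise it is
  -- ω itself, with A = x times that coefficient, which vanishes at the origin in any case.
  by_cases hX : X ∣ ω.2
  · refine ⟨?_, hX⟩
    obtain ⟨B, hB⟩ := hX
    by_contra hA
    have hAB : IsRelPrime ω.1 B := fun z h1 h2 => hrel h1 (by rw [hB]; exact h2.mul_left _)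
    obtain ⟨K, hK⟩ := exists_X_pow_eq hAB
    refine IsLogInvariant.not (A := ω.1) (B := B) (K := K) hN ⟨⟨u, hu, hf⟩, hg, ⟨v, hv, hJ⟩, ?_, hAB,
      hK, not_isUnit_iff.1 hA⟩
    rw [← hB]; exact hω
  · exfalso
    have hAB : IsRelPrime (X * ω.1) ω.2 := by
      refine IsRelPrime.mul_left ?_ hrel
      exact (prime_X.irreducible.isRelPrime_iff_not_dvd).2 hX
    obtain ⟨K, hK⟩ := exists_X_pow_eq hAB
    refine IsLogInvariant.not (A := X * ω.1) (B := ω.2) (K := K) hN ⟨⟨u, hu, hf⟩, hg, ⟨v, hv, hJ⟩, ?_,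
      hAB, hK, by simp⟩
    unfold Preserves wedge pullForm at *
    simp only [map_mul, pull_X]
    linear_combination φ.fst * X * hω

end GermMap

end

/-! ### Normal form of an invariant foliation. -/

noncomputable section

open Metric AnalyticGerm

namespace GermMap

/-- In suitable coordinates `(x, y)`, the form `ω` is either smooth, tangent to `x = 0`, which is
the critical set of `φ`, or it is of reduced logarithmic type, tangent to `xy = 0`, which
contains the critical set of `φ` and is the critical set of `φ ∘ φ`. -/
def IsNormalized (φ : GermMap (ℂ × ℂ)) (ω : O₂ × O₂) : Prop :=
  ∃ ψ M : GermMap (ℂ × ℂ), IsInverse ψ M ∧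
    ((IsUnit (M.pullForm ω).1 ∧ X ∣ (M.pullForm ω).2 ∧
        ∃ (i : ℕ) (v : O₂), IsUnit v ∧ φ.jac = ψ.fst ^ i * v) ∨
      (IsReducedLog (M.pullForm ω) ∧
        (∃ (i j : ℕ) (v : O₂), IsUnit v ∧ φ.jac = ψ.fst ^ i * ψ.snd ^ j * v) ∧
        ∃ (k l : ℕ) (w : O₂), 1 ≤ k ∧ 1 ≤ l ∧ IsUnit w ∧
          (φ.comp φ).jac = ψ.fst ^ k * ψ.snd ^ l * w))

theorem isInverse_comp {ψ M ψ' M' : GermMap (ℂ × ℂ)} (h : IsInverse ψ M) (h' : IsInverse ψ' M') :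
    IsInverse (ψ'.comp ψ) (M.comp M') := by
  constructor
  · rw [comp_assoc, ← comp_assoc ψ, h.left, id_comp, h'.left]
  · rw [comp_assoc, ← comp_assoc M', h'.right, id_comp, h.right]

theorem IsInverse.conj_conj {ψ M : GermMap (ℂ × ℂ)} (h : IsInverse ψ M) (φ : GermMap (ℂ × ℂ)) :
    M.comp ((ψ.comp (φ.comp M)).comp ψ) = φ := by
  rw [comp_assoc, comp_assoc, h.right, comp_id, ← comp_assoc, h.right, id_comp]

theorem IsNormalized.of_conj {φ ψ M : GermMap (ℂ × ℂ)} (h : IsInverse ψ M) {ω : O₂ × O₂}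
    (hn : (ψ.comp (φ.comp M)).IsNormalized (M.pullForm ω)) : φ.IsNormalized ω := by
  obtain ⟨ψ', M', h', hc⟩ := hn
  have hjac : ∀ {χ : GermMap (ℂ × ℂ)} {i j : ℕ} {v : O₂}, IsUnit v →
      (ψ.comp (χ.comp M)).jac = ψ'.fst ^ i * ψ'.snd ^ j * v → ∃ w, IsUnit w ∧
        χ.jac = (ψ'.comp ψ).fst ^ i * (ψ'.comp ψ).snd ^ j * w := by
    intro χ i j v hv hJ
    obtain ⟨w, hw, hJ'⟩ := h.symm.exists_jac_eq hv hJ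
    rw [h.conj_conj] at hJ'
    exact ⟨w, hw, by rw [hJ']; simp⟩
  refine ⟨ψ'.comp ψ, M.comp M', isInverse_comp h h', ?_⟩
  rw [pullForm_comp]
  rcases hc with ⟨h1, h2, i, v, hv, hJ⟩ | ⟨h1, ⟨i, j, v, hv, hJ⟩, k, l, w, hk, hl, hw, hJ'⟩
  · left
    obtain ⟨w, hw, hJ'⟩ := hjac (i := i) (j := 0) hv (by rw [hJ]; ring)
    exact ⟨h1, h2, i, w, hw, by rw [hJ']; ring⟩
  · right
    rw [comp_conj_comp_conj h] at hJ'
    obtain ⟨w', hw', h3⟩ := hjac hw hJ'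
    obtain ⟨v', hv', h4⟩ := hjac hv hJ
    exact ⟨h1, ⟨i, j, v', hv', h4⟩, k, l, w', hk, hl, hw', h3⟩

theorem isInverse_id : IsInverse id id := ⟨id_comp _, id_comp _⟩

theorem isInverse_flip_id : IsInverse (flip id) (flip id) := by
  constructor <;> ext1 <;> simp

theorem IsMonomial.flip_coord {φ ψ : GermMap (ℂ × ℂ)} {a b c d i j : ℕ}
    (h : IsMonomial φ ψ a b c d i j) : IsMonomial φ ψ.flip b a d c j i := by
  obtain ⟨h0, ⟨u, hu, h1⟩, ⟨w, hw, h2⟩, ⟨v, hv, h3⟩, h4, h5, h6⟩ := h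
  refine ⟨by simpa using h0, ⟨u, hu, ?_⟩, ⟨w, hw, ?_⟩, ⟨v, hv, ?_⟩, by omega, h6, h5⟩
  · rw [h1, flip_fst, flip_snd]; ring
  · rw [h2, flip_fst, flip_snd]; ring
  · rw [h3, flip_fst, flip_snd]; ring

theorem ne_zero_of_isRelPrime {ω : O₂ × O₂} (h : IsRelPrime ω.1 ω.2) : ω ≠ 0 := by
  rintro rfl
  exact not_isUnit_zero (isRelPrime_zero_left.1 h)

theorem isUnit_and_dvd_of_wedge_d {ω : O₂ × O₂} (hrel : IsRelPrime ω.1 ω.2) {e : O₂} (he : IsUnit e)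
    (h : wedge ω (d (X * e)) = 0) : IsUnit ω.1 ∧ X ∣ ω.2 := by
  simp only [wedge, d, Derivation.leibniz, dx_X, dy_X, smul_eq_mul] at h
  have hp : IsUnit (X * dx e + e * 1) := by
    rw [AnalyticGerm.isUnit_iff]; simpa using AnalyticGerm.isUnit_iff.1 he
  obtain ⟨q, hq⟩ := hp.exists_right_inv
  have h2 : ω.2 = ω.1 * (X * dy e * q) := by linear_combination -q * h - ω.2 * hq
  refine ⟨hrel dvd_rfl ⟨_, h2⟩, ⟨ω.1 * dy e * q, by rw [h2]; ring⟩⟩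

theorem GenInj.isNormalized_of_jac_eq_X_pow {φ : GermMap (ℂ × ℂ)} (hφ : φ.GenInj) {i : ℕ}
    (hi : 1 ≤ i) {v : O₂} (hv : IsUnit v) (hJ : φ.jac = X ^ i * v) {ω : O₂ × O₂}
    (hω : φ.Preserves ω) (hrel : IsRelPrime ω.1 ω.2) : φ.IsNormalized ω := by
  have hXJ : X ∣ φ.jac := by rw [hJ]; exact (dvd_pow_self X (by omega)).mul_right _
  obtain ⟨ψ, a, b, c, d, i', j', hm, hx, hi'⟩ : ∃ ψ a b c d i' j', IsMonomial φ ψ a b c d i' j' ∧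
      X ∣ ψ.fst ∧ 1 ≤ i' := by
    obtain ⟨ψ, a, b, c, d, i', j', hm⟩ := hφ.exists_isMonomial
    obtain ⟨v', hv', hJ'⟩ := hm.2.2.2.1
    rcases dvd_fst_or_dvd_snd prime_X hv' (hJ' ▸ hXJ) with ⟨h1, h2⟩ | ⟨h1, h2⟩
    · exact ⟨ψ, a, b, c, d, i', j', hm, h1, h2⟩
    · exact ⟨ψ.flip, b, a, d, c, j', i', hm.flip_coord, h1, h2⟩
  obtain ⟨hψ, ⟨u, hu, hf⟩, ⟨w, hw, hg⟩, ⟨v', hv', hJ'⟩, -, h5, -⟩ := hm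
  obtain ⟨ha, hc⟩ := h5 hi'
  obtain ⟨e, he⟩ := prime_X.irreducible.associated_of_dvd (prime_fst hψ).irreducible hx
  have heu : IsUnit (e : O₂) := e.isUnit
  have hj' : j' = 0 := by
    by_contra hne
    have h1 : ψ.snd ∣ φ.jac := by
      rw [hJ']; exact ((dvd_pow_self _ hne).mul_left _).mul_right _
    rw [hJ, hv.dvd_mul_right] at h1
    have h2 := (prime_snd hψ).dvd_of_dvd_pow h1
    have h3 := (prime_snd hψ).irreducible.associated_of_dvd prime_X.irreducible h2
    exact not_fst_dvd_snd hψ ((dvd_of_eq he.symm).trans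
      ((associated_mul_unit_left X (e : O₂) heu).trans h3.symm).dvd)
  subst hj'
  rw [pow_zero, mul_one] at hJ'
  -- If b = 0 the transverse local degree a decides: the residue argument for a = 1, Böttcher's for
  -- a ≥ 2. If b ≥ 1, a second curve is sent into the critical one, so both are critical for φ∘φ, to
  -- which the normal crossing case applies.
  rcases Nat.eq_zero_or_pos b with rfl | hb
  · refine ⟨id, id, isInverse_id, Or.inl ?_⟩
    rw [pullForm_id]
    rw [pow_zero, mul_one, ← he, mul_pow, mul_assoc] at hf
    have hXg : X ∣ φ.snd := by
      rw [hg, ← he]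
      exact ((((dvd_mul_right X (e : O₂)).trans (dvd_pow_self _ (by omega))).mul_right _).mul_right _)
    have key : IsUnit ω.1 ∧ X ∣ ω.2 := by
      rcases Nat.eq_or_lt_of_le ha with rfl | ha2
      · rw [pow_one] at hf
        exact isUnit_and_dvd_of_preserves hi ((heu.pow 1).mul hu) hf hXg hv hJ hω hrel
      · obtain ⟨n, rfl⟩ : ∃ n, a = n + 1 := ⟨a - 1, by omega⟩
        obtain ⟨e', he', h1⟩ := hφ.exists_wedge_d_eq_zero (n := n) (by omega) ((heu.pow _).mul hu) hf
          hXg hv hJ hω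
        exact isUnit_and_dvd_of_wedge_d hrel he' h1
    exact ⟨key.1, key.2, i, v, hv, hJ⟩
  · obtain ⟨M, hM⟩ := exists_isInverse hψ
    obtain ⟨v₁, hv₁, hJ₁⟩ := hM.exists_jac_eq hv' hJ'
    rw [map_pow, hM.pull_fst] at hJ₁
    have hf₁ : (ψ.comp (φ.comp M)).fst = X ^ a * Y ^ b * M.pull (u * φ.pull e) := by
      rw [comp_fst, pull_comp, ← he, map_mul, pull_X, hf]
      simp only [map_mul, map_pow, hM.pull_fst, hM.pull_snd]; ring
    have hJ₂ : ((ψ.comp (φ.comp M)).comp (ψ.comp (φ.comp M))).jac = X ^ (a * i' + i') * Y ^ (b * i') *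
        (M.pull (u * φ.pull e) ^ i' * (ψ.comp (φ.comp M)).pull v₁ * v₁) := by
      rw [jac_comp, hJ₁]
      simp only [map_mul, map_pow, pull_X, hf₁]; ring
    have hw₁ : IsUnit (M.pull (u * φ.pull e) ^ i' * (ψ.comp (φ.comp M)).pull v₁ * v₁) :=
      ((((hu.mul (heu.map _)).map _).pow _).mul (hv₁.map _)).mul hv₁
    refine IsNormalized.of_conj hM ⟨id, id, isInverse_id, Or.inr ⟨?_, ⟨i', 0, v₁, hv₁, ?_⟩, _, _, _, ?_,
      ?_, hw₁, hJ₂⟩⟩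
    · rw [pullForm_id]
      have hGI := hM.genInj hφ
      have hrel' := hM.isRelPrime_pullForm hrel
      refine (hGI.comp hGI).isReducedLog (i := a * i' + i') (j := b * i') (by nlinarith) (by nlinarith)
        hw₁ hJ₂ ?_ hrel'
      exact (hω.semiconj (hM.semiconj φ)).comp_self hGI.jac_ne_zero (ne_zero_of_isRelPrime hrel')
    · rw [hJ₁, id_fst]; ring
    · nlinarith
    · nlinarith

/-- Local normal form of a foliation invariant under a generically injective germ. -/
theorem GenInj.isNormalized {φ : GermMap (ℂ × ℂ)} (hφ : φ.GenInj) (hJ0 : ev φ.jac = 0)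
    {ω : O₂ × O₂} (hω : φ.Preserves ω) (hrel : IsRelPrime ω.1 ω.2) : φ.IsNormalized ω := by
  obtain ⟨ψ, a, b, c, d, i, j, hψ, -, -, ⟨v, hv, hJ⟩, -, -, -⟩ := hφ.exists_isMonomial
  obtain ⟨M, hM⟩ := exists_isInverse hψ
  obtain ⟨v₁, hv₁, hJ₁⟩ := hM.exists_jac_eq hv hJ
  rw [map_mul, map_pow, map_pow, hM.pull_fst, hM.pull_snd] at hJ₁
  refine IsNormalized.of_conj hM ?_
  have hGI := hM.genInj hφ
  have hrel' := hM.isRelPrime_pullForm hrel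
  have hω' := hω.semiconj (hM.semiconj φ)
  generalize ψ.comp (φ.comp M) = χ at *
  generalize M.pullForm ω = η at *
  rcases Nat.eq_zero_or_pos i with rfl | hi
  · rcases Nat.eq_zero_or_pos j with rfl | hj
    · rw [pow_zero, pow_zero, one_mul, one_mul] at hJ
      exact absurd hJ0 (AnalyticGerm.isUnit_iff.1 (hJ ▸ hv))
    · refine IsNormalized.of_conj isInverse_flip_id ?_
      obtain ⟨v₂, hv₂, hJ₂⟩ := isInverse_flip_id.exists_jac_eq hv₁ hJ₁
      refine (isInverse_flip_id.genInj hGI).isNormalized_of_jac_eq_X_pow hj hv₂ ?_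
        (hω'.semiconj (isInverse_flip_id.semiconj χ)) (isInverse_flip_id.isRelPrime_pullForm hrel')
      rw [hJ₂]; simp
  · rcases Nat.eq_zero_or_pos j with rfl | hj
    · refine hGI.isNormalized_of_jac_eq_X_pow hi hv₁ ?_ hω' hrel'
      rw [hJ₁]; ring
    · refine ⟨id, id, isInverse_id, Or.inr ⟨?_, ⟨i, j, v₁, hv₁, hJ₁⟩, ?_⟩⟩
      · rw [pullForm_id]
        exact hGI.isReducedLog hi hj hv₁ hJ₁ hω' hrel'
      · obtain ⟨a, b, c, d, u, w, ha, hb, hc, hd, hu, hw, hf, hg, -⟩ :=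
          hGI.exists_eq_monomial hi hj hJ₁
        refine ⟨a * i + c * j + i, b * i + d * j + j, u ^ i * w ^ j * χ.pull v₁ * v₁, by nlinarith,
          by nlinarith, ((((hu.pow _).mul (hw.pow _)).mul (hv₁.map _)).mul hv₁), ?_⟩
        rw [jac_comp, hJ₁]
        simp only [map_mul, map_pow, pull_X, pull_Y, hf, hg, id_fst, id_snd]; ring

end GermMap

end

/-! ### Critical sets and irreducible curves as germs of sets. -/

noncomputable section

open Metric AnalyticGerm

theorem charpoly_roots_eq {L : ℂ × ℂ →ₗ[ℂ] ℂ × ℂ} {l₁ l₂ : ℂ}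
    (htr : (L (1, 0)).1 + (L (0, 1)).2 = l₁ + l₂)
    (hdet : (L (1, 0)).1 * (L (0, 1)).2 - (L (0, 1)).1 * (L (1, 0)).2 = l₁ * l₂) :
    L.charpoly.roots = {l₁, l₂} := by
  have h : L.charpoly = (Polynomial.X - Polynomial.C l₁) * (Polynomial.X - Polynomial.C l₂) := by
    rw [← LinearMap.charpoly_toMatrix L (Module.Basis.finTwoProd ℂ), Matrix.charpoly_fin_two]
    have e1 : (LinearMap.toMatrix (Module.Basis.finTwoProd ℂ) (Module.Basis.finTwoProd ℂ) L).trace =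
        l₁ + l₂ := by
      rw [← htr, Matrix.trace_fin_two]; simp [LinearMap.toMatrix_apply]
    have e2 : (LinearMap.toMatrix (Module.Basis.finTwoProd ℂ) (Module.Basis.finTwoProd ℂ) L).det =
        l₁ * l₂ := by
      rw [← hdet, Matrix.det_fin_two]; simp [LinearMap.toMatrix_apply]
    rw [e1, e2, map_add, map_mul]; ring
  rw [h, Polynomial.roots_mul (mul_ne_zero (Polynomial.X_sub_C_ne_zero _) (Polynomial.X_sub_C_ne_zero _)),
    Polynomial.roots_X_sub_C, Polynomial.roots_X_sub_C]
  rfl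

theorem SameGerm.symm {S T : Set (ℂ × ℂ)} (h : SameGerm S T) : SameGerm T S := h.mono fun _ => Iff.symm

theorem SameGerm.trans {S T U : Set (ℂ × ℂ)} (h : SameGerm S T) (h' : SameGerm T U) : SameGerm S U := by
  filter_upwards [h, h'] with p h1 h2
  exact h1.trans h2

namespace GermMap

theorem mem_criticalSet_iff {χ : GermMap (ℂ × ℂ)} {f : ℂ × ℂ → ℂ × ℂ} (h : ∀ᶠ p in 𝓝 0, χ p = f p) :
    ∀ᶠ p in 𝓝 0, (p ∈ criticalSet f ↔ χ.jac p = 0) := by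
  filter_upwards [h.eventually_nhds, χ.det_fderiv] with p h1 h2
  rw [criticalSet, Set.mem_ofPred_eq, ← h2, (EventuallyEq.fderiv_eq (show χ =ᶠ[𝓝 p] f from h1))]

theorem genInj_ofAnalytic {φ : ℂ × ℂ → ℂ × ℂ} (hφ : IsBirationalGerm φ) :
    (ofAnalytic φ hφ.analyticAt hφ.map_zero).GenInj := by
  obtain ⟨h, hh, hne, U, hU, hinj⟩ := hφ.generically_injective
  refine ⟨AnalyticGerm.mk h hh, ?_, _, Filter.inter_mem hU
    (Filter.inter_mem (mk_apply h hh) (ofAnalytic_apply φ hφ.analyticAt hφ.map_zero)), ?_⟩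
  · intro h0
    refine hne ?_
    filter_upwards [AnalyticGerm.eq_zero_iff.1 h0, mk_apply h hh] with p h1 h2
    rw [← h2, h1]
  · rintro p ⟨⟨hp1, hp2, hp3⟩, hp4⟩ q ⟨⟨hq1, hq2, hq3⟩, hq4⟩ hpq
    simp only [Set.mem_ofPred_eq] at hp2 hp3 hq2 hq3
    rw [hp3, hq3] at hpq
    exact hinj ⟨hp1, by rwa [← hp2]⟩ ⟨hq1, by rwa [← hq2]⟩ hpq

theorem comp_self_ofAnalytic_apply {φ : ℂ × ℂ → ℂ × ℂ} (hφ : AnalyticAt ℂ φ 0) (h0 : φ 0 = 0) :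
    ∀ᶠ p in 𝓝 0, ((ofAnalytic φ hφ h0).comp (ofAnalytic φ hφ h0)) p = (φ ∘ φ) p := by
  have ht : Tendsto φ (𝓝 0) (𝓝 0) := by
    have := hφ.continuousAt.tendsto
    rwa [h0] at this
  filter_upwards [(ofAnalytic φ hφ h0).comp_apply (ofAnalytic φ hφ h0), ofAnalytic_apply φ hφ h0,
    ht.eventually (ofAnalytic_apply φ hφ h0)] with p h1 h2 h3
  rw [h1, h2, h3]; rfl

/-- The curve `x = 0`, for a local coordinate `x`, is irreducible. -/
theorem IsInverse.isIrreducibleCurveGerm {ψ M : GermMap (ℂ × ℂ)} (h : IsInverse ψ M) :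
    IsIrreducibleCurveGerm {p | ψ.fst p = 0} := by
  have hψM : ∀ᶠ t in 𝓝 (0 : ℂ), ψ (M (0, t)) = (0, t) :=
    tendsto_zero_right.eventually (comp_eq_id_apply h.left)
  refine ⟨fun t => M (0, t), ?_, M.map_zero, ?_, ?_⟩
  · exact AnalyticAt.fun_comp (g := M) (f := fun t : ℂ => ((0 : ℂ), t)) M.analyticAt
      (analyticAt_const.prod analyticAt_id)
  · intro h0
    have h1 : ∀ᶠ t in 𝓝 (0 : ℂ), t = 0 := by
      filter_upwards [h0, hψM] with t h1 h2
      rw [h1, ψ.map_zero] at h2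
      exact (congrArg Prod.snd h2).symm
    have h2 : ∃ᶠ t in 𝓝 (0 : ℂ), t ≠ 0 :=
      (eventually_mem_nhdsWithin (a := (0 : ℂ)) (s := {0}ᶜ)).frequently.filter_mono nhdsWithin_le_nhds
    exact h2 (h1.mono fun t ht => not_not.2 ht)
  · obtain ⟨ε, hε, hball⟩ := eventually_nhds_iff_ball.1 hψM
    filter_upwards [Ioo_mem_nhdsGT hε] with r hr
    have hy : ∀ᶠ p in 𝓝 (0 : ℂ × ℂ), ψ.snd p ∈ ball (0 : ℂ) r := by
      have h1 := ψ.snd.analyticAt.continuousAt.tendsto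
      rw [show ψ.snd 0 = 0 from ψ.ev_snd] at h1
      exact h1.eventually (ball_mem_nhds 0 hr.1)
    filter_upwards [comp_eq_id_apply h.right, hy] with p h1 h2
    constructor
    · rintro ⟨t, ht, rfl⟩
      exact congrArg Prod.fst (hball t (ball_subset_ball hr.2.le ht))
    · intro hp
      refine ⟨ψ.snd p, h2, ?_⟩
      have : ((0 : ℂ), ψ.snd p) = ψ p := Prod.ext (Eq.symm hp) rfl
      change M (0, ψ.snd p) = p
      rw [this, h1]

/-- An irreducible curve contained in the curve `x = 0` coincides with it. -/
theorem IsInverse.sameGerm_of_arc {ψ M : GermMap (ℂ × ℂ)} (h : IsInverse ψ M) {S : Set (ℂ × ℂ)}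
    {γ : ℂ → ℂ × ℂ} (hγ : AnalyticAt ℂ γ 0) (h0 : γ 0 = 0) (hne : ¬ ∀ᶠ t in 𝓝 0, γ t = 0)
    (hS : ∀ᶠ r in 𝓝[>] (0 : ℝ), SameGerm (γ '' ball 0 r) S)
    (hx : ∀ᶠ t in 𝓝 0, ψ.fst (γ t) = 0) : SameGerm S {p | ψ.fst p = 0} := by
  have hγt : Tendsto γ (𝓝 0) (𝓝 0) := by
    have := hγ.continuousAt.tendsto
    rwa [h0] at this
  have hy : AnalyticAt ℂ (fun t => ψ.snd (γ t)) 0 :=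
    AnalyticAt.fun_comp (g := ψ.snd) (f := γ) (by rw [h0]; exact ψ.snd.analyticAt) hγ
  have hMψ := comp_eq_id_apply h.right
  -- The remaining coordinate along the arc is not constant, hence open, so the arc fills the whole
  -- curve near the origin.
  have hopen := hy.eventually_constant_or_nhds_le_map_nhds
  have hy0 : ψ.snd (γ 0) = 0 := by rw [h0]; exact ψ.ev_snd
  rw [hy0] at hopen
  replace hopen := hopen.resolve_left fun hc => hne (by
    filter_upwards [hc, hx, hγt.eventually hMψ] with t h1 h2 h3
    have : ψ (γ t) = 0 := Prod.ext h2 h1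
    rw [← h3, this, M.map_zero])
  obtain ⟨ε, hε, hball⟩ := eventually_nhds_iff_ball.1 (hx.and (hγt.eventually hMψ))
  have hI : ∀ᶠ r in 𝓝[>] (0 : ℝ), r ∈ Set.Ioo 0 ε := Ioo_mem_nhdsGT hε
  obtain ⟨r, hr, hrS⟩ := (hI.and hS).exists
  refine hrS.symm.trans ?_
  have himg : ∀ᶠ z in 𝓝 (0 : ℂ), ∃ t ∈ ball (0 : ℂ) r, ψ.snd (γ t) = z :=
    hopen (Filter.mem_map.2 (Filter.mem_of_superset (ball_mem_nhds 0 hr.1)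
      fun t ht => ⟨t, ht, rfl⟩))
  have hyt : Tendsto ψ.snd (𝓝 0) (𝓝 0) := by
    have := ψ.snd.analyticAt.continuousAt.tendsto
    rwa [show ψ.snd 0 = 0 from ψ.ev_snd] at this
  filter_upwards [hMψ, hyt.eventually himg] with p h1 h2
  constructor
  · rintro ⟨t, ht, rfl⟩
    exact (hball t (ball_subset_ball hr.2.le ht)).1
  · intro hp
    obtain ⟨t, ht, hty⟩ := h2
    refine ⟨t, ht, ?_⟩
    obtain ⟨h3, h4⟩ := hball t (ball_subset_ball hr.2.le ht)
    have : ψ (γ t) = ψ p := Prod.ext (h3.trans (Eq.symm hp)) hty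
    rw [← h4, this, h1]

theorem flip_id_comp (ψ : GermMap (ℂ × ℂ)) : (flip id).comp ψ = ψ.flip := by
  ext1 <;> simp

theorem IsInverse.flip {ψ M : GermMap (ℂ × ℂ)} (h : IsInverse ψ M) :
    IsInverse ψ.flip (M.comp (GermMap.flip id)) := by
  have := isInverse_comp h isInverse_flip_id
  rwa [flip_id_comp] at this

theorem IsInverse.not_sameGerm {ψ M : GermMap (ℂ × ℂ)} (h : IsInverse ψ M) :
    ¬ SameGerm {p | ψ.fst p = 0} {p | ψ.snd p = 0} := by
  intro hS
  have h1 : ∀ᶠ t in 𝓝 (0 : ℂ), t = 0 := by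
    filter_upwards [tendsto_zero_right.eventually (comp_eq_id_apply h.left),
      tendsto_zero_right.eventually (M.tendsto.eventually hS)] with t h1 h2
    have h3 : ψ.snd (M (0, t)) = 0 := h2.1 (congrArg Prod.fst h1)
    exact (congrArg Prod.snd h1).symm.trans h3
  have h2 : ∃ᶠ t in 𝓝 (0 : ℂ), t ≠ 0 :=
    (eventually_mem_nhdsWithin (a := (0 : ℂ)) (s := {0}ᶜ)).frequently.filter_mono nhdsWithin_le_nhds
  exact h2 (h1.mono fun t ht => not_not.2 ht)

end GermMap

end

/-! ### From germs of forms back to foliations, eigenvalues and tangency. -/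

noncomputable section

open Metric AnalyticGerm

namespace AnalyticGerm

/-- Comparison of the orders of the coordinates of an arc tangent to a logarithmic form. -/
theorem exists_relation_of_arc {ξ υ α β : O₁} (hξ : ξ ≠ 0) (hυ : υ ≠ 0) (hξ0 : ev ξ = 0)
    (hυ0 : ev υ = 0) (h : υ * α * der ξ + ξ * β * der υ = 0) :
    ∃ m n : ℕ, 0 < m ∧ 0 < n ∧ (m : ℂ) * ev α + n * ev β = 0 := by
  obtain ⟨m, e, he, hm⟩ := exists_eq_T_pow_mul hξ
  obtain ⟨n, f, hf, hn⟩ := exists_eq_T_pow_mul hυ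
  have hm0 : 0 < m := Nat.pos_of_ne_zero fun h0 => by
    rw [hm, h0, pow_zero, one_mul] at hξ0
    exact isUnit_iff.1 he hξ0
  have hn0 : 0 < n := Nat.pos_of_ne_zero fun h0 => by
    rw [hn, h0, pow_zero, one_mul] at hυ0
    exact isUnit_iff.1 hf hυ0
  have h1 : T * der ξ = T ^ m * ((m : O₁) * e + T * der e) := by
    rw [hm, Derivation.leibniz]
    simp only [smul_eq_mul]
    linear_combination e * T_mul_der_pow m
  have h2 : T * der υ = T ^ n * ((n : O₁) * f + T * der f) := by
    rw [hn, Derivation.leibniz]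
    simp only [smul_eq_mul]
    linear_combination f * T_mul_der_pow n
  have h3 : T ^ m * T ^ n * (f * α * ((m : O₁) * e + T * der e) + e * β * ((n : O₁) * f + T * der f)) =
      0 := by
    linear_combination T * h - υ * α * h1 - ξ * β * h2 -
      α * T ^ m * ((m : O₁) * e + T * der e) * hn - β * T ^ n * ((n : O₁) * f + T * der f) * hm
  have h4 := (mul_eq_zero.1 h3).resolve_left
    (mul_ne_zero (pow_ne_zero _ T_ne_zero) (pow_ne_zero _ T_ne_zero))
  have h5 := congrArg ev h4
  simp only [map_add, map_mul, ev_T, zero_mul, add_zero, map_natCast, _root_.map_zero] at h5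
  refine ⟨m, n, hm0, hn0, ?_⟩
  have h6 : ev e * ev f ≠ 0 := mul_ne_zero (isUnit_iff.1 he) (isUnit_iff.1 hf)
  refine (mul_eq_zero.1 (?_ : ev e * ev f * ((m : ℂ) * ev α + n * ev β) = 0)).resolve_left h6
  linear_combination h5

end AnalyticGerm

namespace FoliationGerm

/-- The germs of the coefficients of the form defining the foliation. -/
def coeffs (F : FoliationGerm) : O₂ × O₂ :=
  (AnalyticGerm.mk F.a F.analyticAt_a, AnalyticGerm.mk F.b F.analyticAt_b)

theorem coeffs_fst_apply (F : FoliationGerm) : ∀ᶠ p in 𝓝 0, F.coeffs.1 p = F.a p :=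
  mk_apply _ F.analyticAt_a
theorem coeffs_snd_apply (F : FoliationGerm) : ∀ᶠ p in 𝓝 0, F.coeffs.2 p = F.b p :=
  mk_apply _ F.analyticAt_b

theorem isRelPrime_coeffs (F : FoliationGerm) : IsRelPrime F.coeffs.1 F.coeffs.2 := by
  rintro c ⟨a', ha'⟩ ⟨b', hb'⟩
  refine AnalyticGerm.isUnit_iff.2 (F.no_common_component c a' b' c.analyticAt a'.analyticAt
    b'.analyticAt ?_ ?_)
  · filter_upwards [F.coeffs_fst_apply, eventually_eq_of_eq ha', AnalyticGerm.mul_apply c a']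
      with p h1 h2 h3
    rw [← h1, h2, h3]
  · filter_upwards [F.coeffs_snd_apply, eventually_eq_of_eq hb', AnalyticGerm.mul_apply c b']
      with p h1 h2 h3
    rw [← h1, h2, h3]

theorem pullForm_apply (χ : GermMap (ℂ × ℂ)) (η : O₂ × O₂) : ∀ᶠ p in 𝓝 0, ∀ v : ℂ × ℂ,
    (χ.pullForm η).1 p * v.1 + (χ.pullForm η).2 p * v.2 =
      η.1 (χ p) * fderiv ℂ χ.fst p v + η.2 (χ p) * fderiv ℂ χ.snd p v := by
  filter_upwards [AnalyticGerm.add_apply (χ.pull η.1 * dx χ.fst) (χ.pull η.2 * dx χ.snd),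
    AnalyticGerm.add_apply (χ.pull η.1 * dy χ.fst) (χ.pull η.2 * dy χ.snd),
    AnalyticGerm.mul_apply (χ.pull η.1) (dx χ.fst), AnalyticGerm.mul_apply (χ.pull η.2) (dx χ.snd),
    AnalyticGerm.mul_apply (χ.pull η.1) (dy χ.fst), AnalyticGerm.mul_apply (χ.pull η.2) (dy χ.snd),
    χ.pull_apply η.1, χ.pull_apply η.2, fderiv_apply_eq χ.fst, fderiv_apply_eq χ.snd]
    with p h1 h2 h3 h4 h5 h6 h7 h8 h9 h10 v
  rw [GermMap.pullForm, h1, h2, h3, h4, h5, h6, h7, h8, h9, h10]; ring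

theorem preserves_coeffs {F : FoliationGerm} {φ : ℂ × ℂ → ℂ × ℂ} (hφ : AnalyticAt ℂ φ 0)
    (h0 : φ 0 = 0) (hF : F.IsInvariant φ) : (GermMap.ofAnalytic φ hφ h0).Preserves F.coeffs := by
  rw [GermMap.Preserves, AnalyticGerm.eq_zero_iff]
  set χ := GermMap.ofAnalytic φ hφ h0
  have ht : Tendsto φ (𝓝 0) (𝓝 0) := by
    have := hφ.continuousAt.tendsto
    rwa [h0] at this
  filter_upwards [hF, pullForm_apply χ F.coeffs, χ.hasFDerivAt,
    (GermMap.ofAnalytic_apply φ hφ h0).eventually_nhds, F.coeffs_fst_apply, F.coeffs_snd_apply,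
    ht.eventually F.coeffs_fst_apply, ht.eventually F.coeffs_snd_apply,
    AnalyticGerm.sub_apply ((χ.pullForm F.coeffs).1 * F.coeffs.2)
      ((χ.pullForm F.coeffs).2 * F.coeffs.1),
    AnalyticGerm.mul_apply (χ.pullForm F.coeffs).1 F.coeffs.2,
    AnalyticGerm.mul_apply (χ.pullForm F.coeffs).2 F.coeffs.1]
    with p h1 h2 h3 h4 h5 h6 h7 h8 h9 h10 h11
  have hfd : fderiv ℂ φ p = (fderiv ℂ χ.fst p).prod (fderiv ℂ χ.snd p) := by
    rw [← h3.fderiv]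
    exact (EventuallyEq.fderiv_eq (show χ =ᶠ[𝓝 p] φ from h4)).symm
  have hχp : χ p = φ p := h4.self_of_nhds
  rw [← hχp] at h7 h8
  have h12 := h1 (1, 0) (0, 1)
  have h13 := h2 (1, 0)
  have h14 := h2 (0, 1)
  simp only [form, hfd, ContinuousLinearMap.prod_apply, h7, h8, ← hχp, ← h5, ← h6, mul_one,
    mul_zero, add_zero, zero_add] at h12 h13 h14
  rw [wedge, h9, h10, h11, h13, h14]
  linear_combination h12

theorem form_apply (F : FoliationGerm) {ψ M : GermMap (ℂ × ℂ)} (h : GermMap.IsInverse ψ M) :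
    ∀ᶠ p in 𝓝 0, ∀ v, F.form p v = (M.pullForm F.coeffs).1 (ψ p) * fderiv ℂ ψ.fst p v +
      (M.pullForm F.coeffs).2 (ψ p) * fderiv ℂ ψ.snd p v := by
  have h1 := h.symm.pullForm_pullForm F.coeffs
  filter_upwards [pullForm_apply ψ (M.pullForm F.coeffs), F.coeffs_fst_apply, F.coeffs_snd_apply]
    with p h2 h3 h4 v
  rw [← h2, h1, h3, h4, form]

/-- The form `P dx + x Q dy` vanishes along arcs contained in `x = 0`. -/
theorem form_eq_zero_of_arc (F : FoliationGerm) {x y : O₂} {P Q : ℂ × ℂ → ℂ}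
    (h : ∀ᶠ p in 𝓝 0, ∀ v, F.form p v = P p * fderiv ℂ x p v + x p * Q p * fderiv ℂ y p v) :
    ∀ᶠ p in 𝓝 (0 : ℂ × ℂ), ∀ γ : ℂ → ℂ × ℂ, AnalyticAt ℂ γ 0 → γ 0 = p →
      (∀ᶠ t in 𝓝 0, x (γ t) = 0) → ∀ᶠ t in 𝓝 0, F.form (γ t) (deriv γ t) = 0 := by
  filter_upwards [h.eventually_nhds, x.analyticAt.eventually_analyticAt.eventually_nhds]
    with p h1 h2 γ hγ h0 hx
  have ht : Tendsto γ (𝓝 0) (𝓝 p) := h0 ▸ hγ.continuousAt.tendsto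
  filter_upwards [ht.eventually h1, ht.eventually h2, hx.eventually_nhds, hγ.eventually_analyticAt]
    with t h3 h4 h5 h6
  have h7 : fderiv ℂ x (γ t) (deriv γ t) = 0 := by
    have h8 := (h4.differentiableAt.hasFDerivAt.comp_hasDerivAt t h6.differentiableAt.hasDerivAt)
    rw [← h8.deriv]
    have h9 : (x.rep ∘ γ) =ᶠ[𝓝 t] fun _ => 0 := h5
    rw [h9.deriv_eq, deriv_const]
  rw [h3, h7, h5.self_of_nhds]; ring

/-- In local coordinates `x, y`, the foliation is given by `y α dx + x β dy`. -/
theorem form_apply_of_log (F : FoliationGerm) {ψ M : GermMap (ℂ × ℂ)} (h : GermMap.IsInverse ψ M)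
    {α β : O₂} (hα : (M.pullForm F.coeffs).1 = Y * α) (hβ : (M.pullForm F.coeffs).2 = X * β) :
    ∀ᶠ p in 𝓝 0, ∀ v, F.form p v = ψ.snd p * α (ψ p) * fderiv ℂ ψ.fst p v +
      ψ.fst p * β (ψ p) * fderiv ℂ ψ.snd p v := by
  filter_upwards [F.form_apply h, ψ.tendsto.eventually (eventually_eq_of_eq hα),
    ψ.tendsto.eventually (AnalyticGerm.mul_apply Y α), ψ.tendsto.eventually Y_apply,
    ψ.tendsto.eventually (eventually_eq_of_eq hβ), ψ.tendsto.eventually (AnalyticGerm.mul_apply X β),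
    ψ.tendsto.eventually X_apply] with p h1 h2 h3 h4 h5 h6 h7 v
  rw [h1, h2, h3, h4, h5, h6, h7]; rfl

/-- By the identity theorem an arc in xy = 0 lies entirely in one of the two curves, even when it
starts at their crossing. -/
theorem isTangent_of_forall {F : FoliationGerm} {S : Set (ℂ × ℂ)} {x y : O₂}
    (hS : ∀ᶠ p in 𝓝 0, p ∈ S → x p * y p = 0)
    (hx : ∀ᶠ p in 𝓝 (0 : ℂ × ℂ), ∀ γ : ℂ → ℂ × ℂ, AnalyticAt ℂ γ 0 → γ 0 = p →
      (∀ᶠ t in 𝓝 0, x (γ t) = 0) → ∀ᶠ t in 𝓝 0, F.form (γ t) (deriv γ t) = 0)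
    (hy : ∀ᶠ p in 𝓝 (0 : ℂ × ℂ), ∀ γ : ℂ → ℂ × ℂ, AnalyticAt ℂ γ 0 → γ 0 = p →
      (∀ᶠ t in 𝓝 0, y (γ t) = 0) → ∀ᶠ t in 𝓝 0, F.form (γ t) (deriv γ t) = 0) :
    F.IsTangent S := by
  filter_upwards [hS.eventually_nhds, hx, hy, x.analyticAt.eventually_analyticAt,
    y.analyticAt.eventually_analyticAt] with p h1 h2 h3 h4 h5 _ γ hγ h0 hγS
  have ht : Tendsto γ (𝓝 0) (𝓝 p) := h0 ▸ hγ.continuousAt.tendsto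
  have hxγ : AnalyticAt ℂ (fun t => x (γ t)) 0 :=
    AnalyticAt.fun_comp (g := x) (f := γ) (by rw [h0]; exact h4) hγ
  have hyγ : AnalyticAt ℂ (fun t => y (γ t)) 0 :=
    AnalyticAt.fun_comp (g := y) (f := γ) (by rw [h0]; exact h5) hγ
  have hmul : ∀ᶠ t in 𝓝 0, x (γ t) * y (γ t) = 0 := by
    filter_upwards [hγS, ht.eventually h1] with t h6 h7
    exact h7 h6
  rcases hxγ.eventually_eq_zero_or_eventually_ne_zero with h6 | h6
  · exact h2 γ hγ h0 h6
  · rcases hyγ.eventually_eq_zero_or_eventually_ne_zero with h7 | h7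
    · exact h3 γ hγ h0 h7
    · obtain ⟨t, h8, h9, h10⟩ := (h6.and (h7.and (hmul.filter_mono nhdsWithin_le_nhds))).exists
      exact absurd h10 (mul_ne_zero h8 h9)

/-- In the coordinates ψ the field is xβ ∂/∂x - yα ∂/∂y. Returning to the original ones multiplies
its linear part by det Dψ(0), up to conjugation. A positive rational ratio of eigenvalues would be a
relation mα(0) + nβ(0) = 0. -/
theorem isReducedNondegenerate_of_isReducedLog {F : FoliationGerm} {ψ M : GermMap (ℂ × ℂ)}
    (h : GermMap.IsInverse ψ M) (hr : IsReducedLog (M.pullForm F.coeffs)) :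
    F.IsReducedNondegenerate := by
  obtain ⟨α, β, hα, hβ, hαu, hβu, hαβ⟩ := hr
  have h1 := h.symm.pullForm_pullForm F.coeffs
  have ha : F.coeffs.1 = ψ.snd * ψ.pull α * dx ψ.fst + ψ.fst * ψ.pull β * dx ψ.snd := by
    conv_lhs => rw [← h1]
    simp only [GermMap.pullForm] at hα hβ ⊢
    simp only [hα, hβ, map_mul, GermMap.pull_X, GermMap.pull_Y]
  have hb : F.coeffs.2 = ψ.snd * ψ.pull α * dy ψ.fst + ψ.fst * ψ.pull β * dy ψ.snd := by
    conv_lhs => rw [← h1]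
    simp only [GermMap.pullForm] at hα hβ ⊢
    simp only [hα, hβ, map_mul, GermMap.pull_X, GermMap.pull_Y]
  have hα0 : ev α ≠ 0 := AnalyticGerm.isUnit_iff.1 hαu
  have hβ0 : ev β ≠ 0 := AnalyticGerm.isUnit_iff.1 hβu
  have hΔ : ev ψ.jac ≠ 0 := h.symm.ev_jac_ne_zero
  have hlin : ∀ v, F.linearPart v = (ev (dx F.coeffs.2) * v.1 + ev (dy F.coeffs.2) * v.2,
      -(ev (dx F.coeffs.1) * v.1 + ev (dy F.coeffs.1) * v.2)) := by
    intro v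
    have e1 : fderiv ℂ F.a 0 = fderiv ℂ F.coeffs.1 0 :=
      (EventuallyEq.fderiv_eq (show F.coeffs.1.rep =ᶠ[𝓝 0] F.a from F.coeffs_fst_apply)).symm
    have e2 : fderiv ℂ F.b 0 = fderiv ℂ F.coeffs.2 0 :=
      (EventuallyEq.fderiv_eq (show F.coeffs.2.rep =ᶠ[𝓝 0] F.b from F.coeffs_snd_apply)).symm
    have e3 := (F.analyticAt_b.differentiableAt.hasFDerivAt.prodMk
      F.analyticAt_a.differentiableAt.hasFDerivAt.neg).fderiv
    have e4 := (fderiv_apply_eq F.coeffs.1).self_of_nhds v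
    have e5 := (fderiv_apply_eq F.coeffs.2).self_of_nhds v
    change fderiv ℂ (fun p => (F.b p, -F.a p)) 0 v = _
    have e6 : fderiv ℂ (fun p => (F.b p, -F.a p)) 0 = (fderiv ℂ F.b 0).prod (-fderiv ℂ F.a 0) := e3
    rw [e6, e1, e2]
    exact Prod.ext e5 (congrArg Neg.neg e4)
  refine ⟨?_, ?_, ev β * ev ψ.jac, -(ev α * ev ψ.jac), charpoly_roots_eq ?_ ?_, mul_ne_zero hβ0 hΔ,
    neg_ne_zero.2 (mul_ne_zero hα0 hΔ), ?_⟩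
  · rw [← F.coeffs_fst_apply.self_of_nhds, ← ev_def, ha]; simp
  · rw [← F.coeffs_snd_apply.self_of_nhds, ← ev_def, hb]; simp
  · simp only [ContinuousLinearMap.coe_coe, hlin, ha, hb, GermMap.jac, map_add, map_sub, map_mul,
      Derivation.leibniz, smul_eq_mul, GermMap.ev_fst, GermMap.ev_snd, GermMap.ev_pull]
    ring
  · simp only [ContinuousLinearMap.coe_coe, hlin, ha, hb, GermMap.jac, map_add, map_sub, map_mul,
      Derivation.leibniz, smul_eq_mul, GermMap.ev_fst, GermMap.ev_snd, GermMap.ev_pull]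
    ring
  · intro q hq he
    rw [div_eq_iff (neg_ne_zero.2 (mul_ne_zero hα0 hΔ))] at he
    have h2 : ev β = -(q * ev α) := by
      refine mul_right_cancel₀ hΔ ?_
      linear_combination he
    have hnum : ((q.num.toNat : ℕ) : ℤ) = q.num := Int.toNat_of_nonneg (Rat.num_pos.2 hq).le
    refine hαβ q.num.toNat q.den (by have := Rat.num_pos.2 hq; omega) q.den_pos ?_
    have h3 : (q : ℂ) * q.den = (q.num.toNat : ℕ) := by
      have h4 : q * q.den = q.num := Rat.mul_den_eq_num q
      have h5 : (q : ℂ) * q.den = (q.num : ℂ) := by exact_mod_cast congrArg (Rat.cast (K := ℂ)) h4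
      rw [h5]
      exact_mod_cast congrArg (Int.cast (R := ℂ)) hnum.symm
    rw [h2]
    linear_combination -ev α * h3

/-- If neither coordinate vanishes along the arc, tangency compares logarithmic derivatives, and the
orders of the two coordinates give the excluded relation. -/
theorem fst_or_snd_eq_zero_of_arc {F : FoliationGerm} {ψ M : GermMap (ℂ × ℂ)}
    (h : GermMap.IsInverse ψ M) (hr : IsReducedLog (M.pullForm F.coeffs)) {γ : ℂ → ℂ × ℂ}
    (hγ : AnalyticAt ℂ γ 0) (h0 : γ 0 = 0) (hF : ∀ᶠ t in 𝓝 0, F.form (γ t) (deriv γ t) = 0) :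
    (∀ᶠ t in 𝓝 0, ψ.fst (γ t) = 0) ∨ ∀ᶠ t in 𝓝 0, ψ.snd (γ t) = 0 := by
  obtain ⟨α, β, hα, hβ, -, -, hαβ⟩ := hr
  have ht : Tendsto γ (𝓝 0) (𝓝 0) := by
    have := hγ.continuousAt.tendsto
    rwa [h0] at this
  have hΓ := GermMap.ofAnalytic_apply γ hγ h0
  set Γ := GermMap.ofAnalytic γ hγ h0
  have hpull : ∀ a : O₂, ∀ᶠ t in 𝓝 0, Γ.pull a t = a (γ t) := fun a => by
    filter_upwards [Γ.pull_apply a, hΓ] with t h1 h2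
    rw [h1, h2]
  have hder : ∀ a : O₂, ∀ᶠ t in 𝓝 0, fderiv ℂ a (γ t) (deriv γ t) = der (Γ.pull a) t := fun a => by
    filter_upwards [(hpull a).eventually_nhds, der_apply (Γ.pull a),
      ht.eventually a.analyticAt.eventually_analyticAt, hγ.eventually_analyticAt] with t h1 h2 h3 h4
    have h5 := h3.differentiableAt.hasFDerivAt.comp_hasDerivAt t h4.differentiableAt.hasDerivAt
    have h6 : (Γ.pull a).rep =ᶠ[𝓝 t] a.rep ∘ γ := h1
    rw [h2, h6.deriv_eq, h5.deriv]
  have hrel : Γ.pull ψ.snd * Γ.pull (ψ.pull α) * der (Γ.pull ψ.fst) +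
      Γ.pull ψ.fst * Γ.pull (ψ.pull β) * der (Γ.pull ψ.snd) = 0 := by
    rw [AnalyticGerm.eq_zero_iff]
    filter_upwards [hF, ht.eventually (F.form_apply_of_log h hα hβ), hder ψ.fst, hder ψ.snd,
      hpull ψ.fst, hpull ψ.snd, hpull (ψ.pull α), hpull (ψ.pull β), ht.eventually (ψ.pull_apply α),
      ht.eventually (ψ.pull_apply β),
      AnalyticGerm.add_apply (Γ.pull ψ.snd * Γ.pull (ψ.pull α) * der (Γ.pull ψ.fst))
        (Γ.pull ψ.fst * Γ.pull (ψ.pull β) * der (Γ.pull ψ.snd)),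
      AnalyticGerm.mul_apply (Γ.pull ψ.snd * Γ.pull (ψ.pull α)) (der (Γ.pull ψ.fst)),
      AnalyticGerm.mul_apply (Γ.pull ψ.fst * Γ.pull (ψ.pull β)) (der (Γ.pull ψ.snd)),
      AnalyticGerm.mul_apply (Γ.pull ψ.snd) (Γ.pull (ψ.pull α)),
      AnalyticGerm.mul_apply (Γ.pull ψ.fst) (Γ.pull (ψ.pull β))]
      with t h1 h2 h3 h4 h5 h6 h7 h8 h9 h10 h11 h12 h13 h14 h15
    rw [h11, h12, h13, h14, h15, ← h3, ← h4, h5, h6, h7, h8, h9, h10, ← h2, h1]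
  by_contra hne
  rw [not_or] at hne
  have hz : ∀ a : O₂, Γ.pull a = 0 → ∀ᶠ t in 𝓝 0, a (γ t) = 0 := fun a ha => by
    filter_upwards [AnalyticGerm.eq_zero_iff.1 ha, hpull a] with t h1 h2
    rw [← h2, h1]
  obtain ⟨m, n, hm, hn, hmn⟩ := exists_relation_of_arc (fun h1 => hne.1 (hz _ h1))
    (fun h1 => hne.2 (hz _ h1)) (by simp) (by simp) hrel
  refine hαβ m n hm hn ?_
  simpa using hmn

end FoliationGerm

end

/-! ### Conclusion: reading off the statement from the normal form. -/

theorem proposition4p2 (φ : ℂ × ℂ → ℂ × ℂ) (hφ : IsBirationalGerm φ)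
    (hcrit : (0 : ℂ × ℂ) ∈ criticalSet φ)
    (F : FoliationGerm) (hF : F.IsInvariant φ) :
    F.IsTangent (criticalSet φ) ∧
    (F.IsSmooth ∨ F.IsReducedNondegenerate) ∧
    (F.IsReducedNondegenerate →
      ∃ S₁ S₂ : Set (ℂ × ℂ), F.IsSeparatrix S₁ ∧ F.IsSeparatrix S₂ ∧ ¬ SameGerm S₁ S₂ ∧
        (∀ S : Set (ℂ × ℂ), F.IsSeparatrix S → SameGerm S S₁ ∨ SameGerm S S₂) ∧
        SameGerm (S₁ ∪ S₂) (criticalSet (φ ∘ φ)) ∧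
        (SameGerm (criticalSet (φ ∘ φ)) (criticalSet φ) →
          SameGerm (S₁ ∪ S₂) (criticalSet φ))) := by
  have hΦ := GermMap.ofAnalytic_apply φ hφ.analyticAt hφ.map_zero
  have hΦ2 := GermMap.comp_self_ofAnalytic_apply hφ.analyticAt hφ.map_zero
  have hGI := GermMap.genInj_ofAnalytic hφ
  have hpres := FoliationGerm.preserves_coeffs hφ.analyticAt hφ.map_zero hF
  set Φ := GermMap.ofAnalytic φ hφ.analyticAt hφ.map_zero
  have hC := GermMap.mem_criticalSet_iff hΦ
  have hC2 := GermMap.mem_criticalSet_iff hΦ2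
  obtain ⟨ψ, M, hM, hn⟩ := hGI.isNormalized (hC.self_of_nhds.1 hcrit) hpres F.isRelPrime_coeffs
  rcases hn with ⟨h1, ⟨B, hB⟩, i, v, hv, hJ⟩ | ⟨hr, ⟨i, j, v, hv, hJ⟩, k, l, w, hk, hl, hw, hJ2⟩
  · have hsm : F.IsSmooth := by
      by_contra hs
      simp only [FoliationGerm.IsSmooth, not_or, not_not] at hs
      have ha : AnalyticGerm.ev F.coeffs.1 = 0 := F.coeffs_fst_apply.self_of_nhds.trans hs.1
      have hb : AnalyticGerm.ev F.coeffs.2 = 0 := F.coeffs_snd_apply.self_of_nhds.trans hs.2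
      refine AnalyticGerm.isUnit_iff.1 h1 ?_
      simp [GermMap.pullForm, ha, hb]
    refine ⟨?_, Or.inl hsm, fun hr => absurd hsm ?_⟩
    · have hx := F.form_eq_zero_of_arc (x := ψ.fst) (y := ψ.snd)
        (P := fun p => (M.pullForm F.coeffs).1 (ψ p)) (Q := fun p => B (ψ p)) (by
          filter_upwards [F.form_apply hM, ψ.tendsto.eventually (AnalyticGerm.eventually_eq_of_eq hB),
            ψ.tendsto.eventually (AnalyticGerm.mul_apply AnalyticGerm.X B),
            ψ.tendsto.eventually AnalyticGerm.X_apply] with p h2 h3 h4 h5 v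
          rw [h2, h3, h4, h5]; rfl)
      refine FoliationGerm.isTangent_of_forall (x := ψ.fst) (y := ψ.fst) ?_ hx hx
      filter_upwards [hC, AnalyticGerm.eventually_eq_of_eq hJ, AnalyticGerm.mul_apply (ψ.fst ^ i) v,
        AnalyticGerm.pow_apply ψ.fst i, AnalyticGerm.eventually_ne_zero_of_isUnit hv]
        with p h2 h3 h4 h5 h6 hp
      rw [h2, h3, h4, h5, mul_eq_zero, or_iff_left h6] at hp
      rw [eq_zero_of_pow_eq_zero hp, mul_zero]
    · rintro (h | h)
      · exact h hr.1
      · exact h hr.2.1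
  · obtain ⟨α, β, hα, hβ, -⟩ := id hr
    have hform := F.form_apply_of_log hM hα hβ
    have hx := F.form_eq_zero_of_arc (x := ψ.fst) (y := ψ.snd) (P := fun p => ψ.snd p * α (ψ p))
      (Q := fun p => β (ψ p)) hform
    have hy := F.form_eq_zero_of_arc (x := ψ.snd) (y := ψ.fst) (P := fun p => ψ.fst p * β (ψ p))
      (Q := fun p => α (ψ p)) (hform.mono fun p h1 v => by rw [h1 v, add_comm])
    have hval : ∀ (J : O₂) (i j : ℕ) (v : O₂), J = ψ.fst ^ i * ψ.snd ^ j * v → IsUnit v →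
        ∀ᶠ p in 𝓝 0, (J p = 0 ↔ ψ.fst p ^ i * ψ.snd p ^ j = 0) := by
      intro J i j v hJ hv
      filter_upwards [AnalyticGerm.eventually_eq_of_eq hJ,
        AnalyticGerm.mul_apply (ψ.fst ^ i * ψ.snd ^ j) v,
        AnalyticGerm.mul_apply (ψ.fst ^ i) (ψ.snd ^ j), AnalyticGerm.pow_apply ψ.fst i,
        AnalyticGerm.pow_apply ψ.snd j, AnalyticGerm.eventually_ne_zero_of_isUnit hv]
        with p h2 h3 h4 h5 h6 h7
      rw [h2, h3, h4, h5, h6, mul_eq_zero, or_iff_left h7]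
    -- Both exponents of the Jacobian of φ∘φ are positive, so its zero set is the union of both
    -- axes; for φ itself one of them may be 0.
    have hS : SameGerm ({p | ψ.fst p = 0} ∪ {p | ψ.snd p = 0}) (criticalSet (φ ∘ φ)) := by
      filter_upwards [hC2, hval _ k l w hJ2 hw] with p h1 h2
      rw [h1, h2, mul_eq_zero, pow_eq_zero_iff (by omega), pow_eq_zero_iff (by omega)]
      rfl
    refine ⟨?_, Or.inr (FoliationGerm.isReducedNondegenerate_of_isReducedLog hM hr), fun _ =>
      ⟨{p | ψ.fst p = 0}, {p | ψ.snd p = 0}, ⟨hM.isIrreducibleCurveGerm, ?_⟩,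
        ⟨hM.flip.isIrreducibleCurveGerm, ?_⟩, hM.not_sameGerm, ?_, hS, fun h => hS.trans h⟩⟩
    · refine FoliationGerm.isTangent_of_forall (x := ψ.fst) (y := ψ.snd) ?_ hx hy
      filter_upwards [hC, hval _ i j v hJ hv] with p h1 h2 hp
      rw [h1, h2, mul_eq_zero] at hp
      exact mul_eq_zero.2 (hp.imp eq_zero_of_pow_eq_zero eq_zero_of_pow_eq_zero)
    · refine FoliationGerm.isTangent_of_forall (x := ψ.fst) (y := ψ.fst) ?_ hx hx
      exact Eventually.of_forall fun p hp => mul_eq_zero.2 (Or.inl hp)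
    · refine FoliationGerm.isTangent_of_forall (x := ψ.snd) (y := ψ.snd) ?_ hy hy
      exact Eventually.of_forall fun p hp => mul_eq_zero.2 (Or.inl hp)
    · rintro S ⟨⟨γ, hγ, h0, hne, hSγ⟩, htan⟩
      have hγt : Tendsto γ (𝓝 0) (𝓝 0) := by
        have := hγ.continuousAt.tendsto
        rwa [h0] at this
      have hpos : ∀ᶠ r in 𝓝[>] (0 : ℝ), 0 < r := eventually_mem_nhdsWithin
      obtain ⟨r, hr0, hrS⟩ := (hpos.and hSγ).exists
      have hγS : ∀ᶠ t in 𝓝 0, γ t ∈ S := by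
        filter_upwards [hγt.eventually hrS, Metric.ball_mem_nhds 0 hr0] with t h1 h2
        exact h1.1 ⟨t, h2, rfl⟩
      have h0S : (0 : ℂ × ℂ) ∈ S := h0 ▸ hγS.self_of_nhds
      rcases FoliationGerm.fst_or_snd_eq_zero_of_arc hM hr hγ h0
        (htan.self_of_nhds h0S γ hγ h0 hγS) with h1 | h1
      · exact Or.inl (hM.sameGerm_of_arc hγ h0 hne hSγ h1)
      · exact Or.inr (hM.flip.sameGerm_of_arc hγ h0 hne hSγ h1)
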